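/- Let $G\rightrightarrows M$ be a Lie groupoid (smooth Hausdorff manifolds without boundary) with compact unit space $M$, range and source maps $r,s$, inversion $\iota$, $s$-fibers $G_x=s^{-1}(x)$, $r$-fibers $G^x=r^{-1}(x)$ and Lie algebroid $AG=\ker ds|_M$. Let $\Gamma=T^*G\rightrightarrows A^*G$ be its cotangent groupoid, where $A^*G\subset T^*G$ is the conormal bundle of $M$, identified with the dual of $AG$ by restriction to $\ker ds$, and $$r_\Gamma(\gamma,\xi)=\big(r(\gamma),{}^t dR_\gamma(\xi|_{T_\gamma G_{s(\gamma)}})\big),\qquad s_\Gamma(\gamma,\xi)=\big(s(\gamma),-{}^t d(L_\gamma\circ\iota)(\xi|_{T_\gamma G^{r(\gamma)}})\big).$$ Let $\ker r_\Gamma,\ker s_\Gamma\subset T^*G$ be the sets on which $r_\Gamma$, resp. $s_\Gamma$, takes values in the zero section; put $T^*_{\bullet}G=T^*G\setminus\ker r_\Gamma$ and $\dot T^*G=T^*G\setminus(\ker r_\Gamma\cup\ker s_\Gamma)$. Let $p^0_0\in C^\infty(A^*G\setminus0)$ be the homogeneous principal symbol of an elliptic symmetric first order pseudodifferential $G$-operator,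 that is, any real-valued smooth function, positively homogeneous of degree one in the fibers and without zeros. Put $p^0=p^0_0\circ r_\Gamma$ on $T^*_{\bullet}G$. With $\omega=\sum_j dx_j\wedge d\xi_j$ the canonical symplectic form, let $H_{p^0}$ be the Hamiltonian vector field of $p^0$ on $T^*_\bullet G$, given by $\omega(H_{p^0},\cdot)=dp^0$. Then $A^*G\setminus 0\subset T^*_\bullet G$, and $H_{p^0}$ has a unique flow $\chi_t:T^*_\bullet G\to T^*_\bullet G$ defined for all $t\in\mathbb R$. Put $\Lambda_t=\chi_t(A^*G\setminus0)$ and $$\Lambda=\big\{(t,-p^0(\chi_t(x,\xi)),\chi_t(x,\xi))\;;\;t\in\mathbb R,\ (x,\xi)\in A^*G\setminus0\big\}\subset T^*\mathbb R\times T^*G=T^*(\mathbb R\times G).$$ The following hold. 1. $\Lambda$ is a conic (stable under positive fiber dilations) Lagrangian submanifold of $T^*(\mathbb R\times G)$, and $i_t^*\Lambda=\Lambda_t$ for all $t\in\mathbb R$, where $i_t:G\to\mathbb R\times G$, $i_t(\gamma)=(t,\gamma)$, and $i_t^*\Lambda=\{(\gamma,{}^t(di_t)_\gamma\eta)\;;\;(i_t(\gamma),\eta)\in\Lambda\}$.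 2. $\Lambda$ is contained in $(T^*\mathbb R\setminus0)\times\dot T^*G$ and is closed in $T^*\mathbb R\times T^*_\bullet G$. 3. $\Lambda$ is an invertible $\widetilde G$-relation and a family $G_+$-relation. Here $\widetilde G=\mathbb R\times G\rightrightarrows\mathbb R\times M$ is the constant family of groupoids, and $G_+=\mathbb R\times G\rightrightarrows M$ is the product of the additive group $\mathbb R$ with $G$. For a Lie groupoid $G'\rightrightarrows M'$ with cotangent groupoid $\Gamma'$, a $G'$-relation is a conic Lagrangian submanifold of $T^*G'\setminus0$ that is disjoint from $\ker r_{\Gamma'}\cup\ker s_{\Gamma'}$. It is invertible if $r_{\Gamma'}$ and $s_{\Gamma'}$ restrict to diffeomorphisms from it onto open subsets of $A^*G'$. It is a family relation if $(\gamma,\xi)\mapsto s(\gamma)$ restricts to a submersion from it to $M'$. 4. The support of $\Lambda$, i.e. its projection to $\mathbb R\times G$, is $\mathbb R$-proper: its intersection with $[a,b]\times G$ is compact for all $a,b\in\mathbb R$. -/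

import Mathlib

open Set Filter Topology
open scoped Manifold ContDiff

noncomputable section

namespace GroupoidRelation

section Cotangent

variable {E H : Type*} [NormedAddCommGroup E] [NormedSpace ℝ E] [TopologicalSpace H]
variable {E' H' : Type*} [NormedAddCommGroup E'] [NormedSpace ℝ E'] [TopologicalSpace H']

/-- `X` has a smooth slice chart along `S` at each point of `S`. -/
def IsEmbeddedSubmanifold (I : ModelWithCorners ℝ E H) {X : Type*} [TopologicalSpace X]
    [ChartedSpace H X] (S : Set X) : Prop :=
  ∀ x ∈ S, ∃ e ∈ IsManifold.maximalAtlas I ∞ X, x ∈ e.source ∧ ∃ W : Submodule ℝ E,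
    ∀ y ∈ e.source, y ∈ S ↔ e.extend I y - e.extend I x ∈ W

/-- The vectors at `x` tangent to `S`: the velocities at time `0` of curves in `S` through `x`. -/
def tangentVectors (I : ModelWithCorners ℝ E H) {X : Type*} [TopologicalSpace X]
    [ChartedSpace H X] (S : Set X) (x : X) : Set (TangentSpace I x) :=
  {v | ∃ c : ℝ → X, c 0 = x ∧ (∀ᶠ t in 𝓝 0, c t ∈ S) ∧
    HasMFDerivAt 𝓘(ℝ, ℝ) I c 0 (ContinuousLinearMap.toSpanSingleton ℝ (v : E) : ℝ →L[ℝ] E)}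

/-- The cotangent bundle `T*X`. -/
abbrev CotangentBundle (I : ModelWithCorners ℝ E H) (X : Type*) [TopologicalSpace X]
    [ChartedSpace H X] : Type _ :=
  Bundle.TotalSpace (E →L[ℝ] ℝ) (fun x : X => TangentSpace I x →L[ℝ] Bundle.Trivial X ℝ x)

/-- The model of the manifold `T*X`. -/
abbrev cotangentModel (I : ModelWithCorners ℝ E H) :
    ModelWithCorners ℝ (E × (E →L[ℝ] ℝ)) (ModelProd H (E →L[ℝ] ℝ)) :=
  I.prod 𝓘(ℝ, E →L[ℝ] ℝ)

variable (I : ModelWithCorners ℝ E H) (I' : ModelWithCorners ℝ E' H')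
variable {X : Type*} [TopologicalSpace X] [ChartedSpace H X] [IsManifold I ∞ X]
variable {Y : Type*} [TopologicalSpace Y] [ChartedSpace H' Y] [IsManifold I' ∞ Y]

/-- The canonical symplectic form `∑ dxⱼ ∧ dξⱼ` of `T*X`. The preferred chart of `T*X` at `l`, in
which tangent vectors at `l` are read as pairs `(δx, δξ)`, is the canonical chart `(x, ξ)` induced
by the preferred chart of `X` at the base point of `l`. -/
def symplecticForm (l : CotangentBundle I X) (v w : TangentSpace (cotangentModel I) l) : ℝ :=
  let v' : E × (E →L[ℝ] ℝ) := v
  let w' : E × (E →L[ℝ] ℝ) := w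
  w'.2 v'.1 - v'.2 w'.1

/-- Conic Lagrangian submanifolds of `T*X`: embedded submanifolds, stable under positive dilations
of the fibers, each of whose tangent spaces is its own symplectic orthogonal. -/
structure IsConicLagrangian (L : Set (CotangentBundle I X)) : Prop where
  submanifold : IsEmbeddedSubmanifold (cotangentModel I) L
  conic : ∀ l ∈ L, ∀ a : ℝ, 0 < a → (⟨l.1, a • l.2⟩ : CotangentBundle I X) ∈ L
  lagrangian : ∀ l ∈ L, ∀ v : TangentSpace (cotangentModel I) l,
    v ∈ tangentVectors (cotangentModel I) L l ↔
      ∀ w ∈ tangentVectors (cotangentModel I) L l, symplecticForm I l v w = 0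

/-- The pull-back `f^* L = {(x, ᵗdfₓ η) : (f x, η) ∈ L}` along `f : X → Y`. -/
def pullback (f : X → Y) (L : Set (CotangentBundle I' Y)) : Set (CotangentBundle I X) :=
  {l | ∃ η : TangentSpace I' (f l.1) →L[ℝ] ℝ,
    (⟨f l.1, η⟩ : CotangentBundle I' Y) ∈ L ∧ l.2 = η.comp (mfderiv I I' f l.1)}

/-- `χ` is the flow, defined for all times, of the Hamiltonian vector field `H_p` of `p` on the set
`U`, where `H_p` is given by `ω(H_p, w) = dp(w)` for all `w`. -/
structure IsHamiltonianFlow (p : CotangentBundle I X → ℝ) (U : Set (CotangentBundle I X))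
    (χ : ℝ → U → U) : Prop where
  zero : ∀ l, χ 0 l = l
  differentiable : ∀ l t,
    MDifferentiableAt 𝓘(ℝ, ℝ) (cotangentModel I) (fun t => (χ t l : CotangentBundle I X)) t
  velocity : ∀ (l : U) (t : ℝ) (w : TangentSpace (cotangentModel I) (χ t l).1),
    symplecticForm I (χ t l).1
      (mfderiv 𝓘(ℝ, ℝ) (cotangentModel I) (fun t => (χ t l : CotangentBundle I X)) t (1 : ℝ)) w
      = mfderiv (cotangentModel I) 𝓘(ℝ, ℝ) p (χ t l).1 w

/-- The covector `τ dt + ξ` at `(t, x)`, for `l = (x, ξ)`: the identification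
`T*ℝ × T*X = T*(ℝ × X)`. -/
def prodCovector (t τ : ℝ) (l : CotangentBundle I X) :
    CotangentBundle (𝓘(ℝ, ℝ).prod I) (ℝ × X) :=
  let ξ : E →L[ℝ] ℝ := l.2
  ⟨(t, l.1), (τ • ContinuousLinearMap.fst ℝ ℝ E + ξ.comp (ContinuousLinearMap.snd ℝ ℝ E) :
    ℝ × E →L[ℝ] ℝ)⟩

/-- The support in `X` of a subset of `T*X`: its projection. -/
def support (L : Set (CotangentBundle I X)) : Set X := Bundle.TotalSpace.proj '' L

/-- `f` restricts to a diffeomorphism from the submanifold `S` onto its range `f '' S`. -/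
def IsDiffeoOntoRange {Z Z' : Type*} [TopologicalSpace Z] [ChartedSpace H Z]
    [TopologicalSpace Z'] [ChartedSpace H' Z'] (f : Z → Z') (S : Set Z) : Prop :=
  ContMDiffOn I I' ∞ f S ∧
    ∃ g : Z' → Z, ContMDiffOn I' I ∞ g (f '' S) ∧ LeftInvOn g f S

end Cotangent

/-- A subset of `ℝ × X` is `ℝ`-proper if its part over each `[a, b]` is compact. -/
def IsRealProper {X : Type*} [TopologicalSpace X] (A : Set (ℝ × X)) : Prop :=
  ∀ a b : ℝ, IsCompact (A ∩ Icc a b ×ˢ univ)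

/-- Lie groupoids `G ⇉ M`. The product `mul a b` is meaningful only if `s a = r b`; the set of
composable pairs is an embedded submanifold of `G × G`. -/
structure LieGroupoid {E H F N : Type*} [NormedAddCommGroup E] [NormedSpace ℝ E]
    [TopologicalSpace H] [NormedAddCommGroup F] [NormedSpace ℝ F] [TopologicalSpace N]
    (I : ModelWithCorners ℝ E H) (G : Type*) [TopologicalSpace G] [ChartedSpace H G]
    (J : ModelWithCorners ℝ F N) (M : Type*) [TopologicalSpace M] [ChartedSpace N M] where
  /-- range -/
  r : G → M
  /-- source -/
  s : G → M
  /-- units -/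
  unit : M → G
  /-- inversion -/
  inv : G → G
  /-- multiplication -/
  mul : G → G → G
  smooth_r : ContMDiff I J ∞ r
  smooth_s : ContMDiff I J ∞ s
  submersion_r : ∀ a, Function.Surjective (mfderiv I J r a)
  submersion_s : ∀ a, Function.Surjective (mfderiv I J s a)
  smooth_unit : ContMDiff J I ∞ unit
  smooth_inv : ContMDiff I I ∞ inv
  smooth_mul : ContMDiffOn (I.prod I) I ∞ (fun q : G × G => mul q.1 q.2) {q | s q.1 = r q.2}
  r_unit : ∀ x, r (unit x) = x
  s_unit : ∀ x, s (unit x) = x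
  r_mul : ∀ a b, s a = r b → r (mul a b) = r a
  s_mul : ∀ a b, s a = r b → s (mul a b) = s b
  unit_mul : ∀ a, mul (unit (r a)) a = a
  mul_unit : ∀ a, mul a (unit (s a)) = a
  r_inv : ∀ a, r (inv a) = s a
  s_inv : ∀ a, s (inv a) = r a
  mul_inv : ∀ a, mul a (inv a) = unit (r a)
  inv_mul : ∀ a, mul (inv a) a = unit (s a)
  mul_assoc : ∀ a b c, s a = r b → s b = r c → mul (mul a b) c = mul a (mul b c)

namespace LieGroupoid

variable {E H F N : Type*} [NormedAddCommGroup E] [NormedSpace ℝ E] [TopologicalSpace H]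
  [NormedAddCommGroup F] [NormedSpace ℝ F] [TopologicalSpace N]
  {I : ModelWithCorners ℝ E H} {G : Type*} [TopologicalSpace G] [ChartedSpace H G]
  {J : ModelWithCorners ℝ F N} {M : Type*} [TopologicalSpace M] [ChartedSpace N M]

theorem surjective_mfderiv_idProd {f : G → M} (hf : ContMDiff I J ∞ f)
    (h : ∀ a, Function.Surjective (mfderiv I J f a)) (a : ℝ × G) :
    Function.Surjective (mfderiv (𝓘(ℝ, ℝ).prod I) (𝓘(ℝ, ℝ).prod J)
      (fun a : ℝ × G => (a.1, f a.2)) a) := by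
  have h1 : HasMFDerivAt (𝓘(ℝ, ℝ).prod I) (𝓘(ℝ, ℝ).prod J) (fun a : ℝ × G => (a.1, f a.2)) a
      ((mfderiv 𝓘(ℝ, ℝ) 𝓘(ℝ, ℝ) (fun t : ℝ => t) a.1).prodMap (mfderiv I J f a.2)) :=
    HasMFDerivAt.prodMap (hasMFDerivAt_id a.1).mdifferentiableAt.hasMFDerivAt
      ((hf.mdifferentiable (by simp) a.2).hasMFDerivAt)
  rw [h1.mfderiv]
  have h2 : mfderiv 𝓘(ℝ, ℝ) 𝓘(ℝ, ℝ) (fun t : ℝ => t) a.1 = ContinuousLinearMap.id ℝ ℝ :=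
    (hasMFDerivAt_id a.1).mfderiv
  rintro ⟨u, w⟩
  obtain ⟨v, hv⟩ := h a.2 w
  refine ⟨(u, v), Prod.ext ?_ hv⟩
  exact congrArg (fun L : ℝ →L[ℝ] ℝ => L u) h2

theorem surjective_mfderiv_comp_snd {f : G → M} (hf : ContMDiff I J ∞ f)
    (h : ∀ a, Function.Surjective (mfderiv I J f a)) (a : ℝ × G) :
    Function.Surjective (mfderiv (𝓘(ℝ, ℝ).prod I) J (fun a : ℝ × G => f a.2) a) := by
  have h1 : HasMFDerivAt (𝓘(ℝ, ℝ).prod I) J (fun a : ℝ × G => f a.2) a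
      ((mfderiv I J f a.2).comp (ContinuousLinearMap.snd ℝ ℝ E)) :=
    HasMFDerivAt.comp a ((hf.mdifferentiable (by simp) a.2).hasMFDerivAt) (hasMFDerivAt_snd a)
  rw [h1.mfderiv]
  intro w
  obtain ⟨v, hv⟩ := h a.2 w
  exact ⟨((0 : ℝ), v), hv⟩

/-- The constant family of groupoids `ℝ × G ⇉ ℝ × M`. -/
def constFamily (𝒢 : LieGroupoid I G J M) :
    LieGroupoid (𝓘(ℝ, ℝ).prod I) (ℝ × G) (𝓘(ℝ, ℝ).prod J) (ℝ × M) where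
  r a := (a.1, 𝒢.r a.2)
  s a := (a.1, 𝒢.s a.2)
  unit x := (x.1, 𝒢.unit x.2)
  inv a := (a.1, 𝒢.inv a.2)
  mul a b := (a.1, 𝒢.mul a.2 b.2)
  smooth_r := contMDiff_fst.prodMk (𝒢.smooth_r.comp contMDiff_snd)
  smooth_s := contMDiff_fst.prodMk (𝒢.smooth_s.comp contMDiff_snd)
  submersion_r a := surjective_mfderiv_idProd 𝒢.smooth_r 𝒢.submersion_r a
  submersion_s a := surjective_mfderiv_idProd 𝒢.smooth_s 𝒢.submersion_s a
  smooth_unit := contMDiff_fst.prodMk (𝒢.smooth_unit.comp contMDiff_snd)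
  smooth_inv := contMDiff_fst.prodMk (𝒢.smooth_inv.comp contMDiff_snd)
  smooth_mul := (contMDiff_fst.comp contMDiff_fst).contMDiffOn.prodMk
    (𝒢.smooth_mul.comp
      ((contMDiff_snd.comp contMDiff_fst).prodMk (contMDiff_snd.comp contMDiff_snd)).contMDiffOn
      (fun _ h => congrArg Prod.snd h))
  r_unit x := by simp [𝒢.r_unit]
  s_unit x := by simp [𝒢.s_unit]
  r_mul a b h := by simp [𝒢.r_mul a.2 b.2 (congrArg Prod.snd h)]
  s_mul a b h := Prod.ext (congrArg Prod.fst h :) (𝒢.s_mul a.2 b.2 (congrArg Prod.snd h))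
  unit_mul a := by simp [𝒢.unit_mul]
  mul_unit a := by simp [𝒢.mul_unit]
  r_inv a := by simp [𝒢.r_inv]
  s_inv a := by simp [𝒢.s_inv]
  mul_inv a := by simp [𝒢.mul_inv]
  inv_mul a := by simp [𝒢.inv_mul]
  mul_assoc a b c h h' := Prod.ext rfl
    (𝒢.mul_assoc a.2 b.2 c.2 (congrArg Prod.snd h) (congrArg Prod.snd h'))

/-- The cartesian product `ℝ × G ⇉ M` of `G` with the additive group `ℝ`. -/
def prodReal (𝒢 : LieGroupoid I G J M) : LieGroupoid (𝓘(ℝ, ℝ).prod I) (ℝ × G) J M where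
  r a := 𝒢.r a.2
  s a := 𝒢.s a.2
  unit x := (0, 𝒢.unit x)
  inv a := (-a.1, 𝒢.inv a.2)
  mul a b := (a.1 + b.1, 𝒢.mul a.2 b.2)
  smooth_r := 𝒢.smooth_r.comp contMDiff_snd
  smooth_s := 𝒢.smooth_s.comp contMDiff_snd
  submersion_r a := surjective_mfderiv_comp_snd 𝒢.smooth_r 𝒢.submersion_r a
  submersion_s a := surjective_mfderiv_comp_snd 𝒢.smooth_s 𝒢.submersion_s a
  smooth_unit := contMDiff_const.prodMk 𝒢.smooth_unit
  smooth_inv := contDiff_neg.contMDiff.comp contMDiff_fst |>.prodMk (𝒢.smooth_inv.comp contMDiff_snd)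
  smooth_mul := (contDiff_add.contMDiff.comp
      ((contMDiff_fst.comp contMDiff_fst).prodMk_space
        (contMDiff_fst.comp contMDiff_snd))).contMDiffOn.prodMk
    (𝒢.smooth_mul.comp
      ((contMDiff_snd.comp contMDiff_fst).prodMk (contMDiff_snd.comp contMDiff_snd)).contMDiffOn
      (fun _ h => h))
  r_unit x := 𝒢.r_unit x
  s_unit x := 𝒢.s_unit x
  r_mul a b h := 𝒢.r_mul a.2 b.2 h
  s_mul a b h := 𝒢.s_mul a.2 b.2 h
  unit_mul a := by simp [𝒢.unit_mul]
  mul_unit a := by simp [𝒢.mul_unit]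
  r_inv a := 𝒢.r_inv a.2
  s_inv a := 𝒢.s_inv a.2
  mul_inv a := by simp [𝒢.mul_inv]
  inv_mul a := by simp [𝒢.inv_mul]
  mul_assoc a b c h h' := Prod.ext (add_assoc _ _ _) (𝒢.mul_assoc a.2 b.2 c.2 h h')

variable [IsManifold I ∞ G] [IsManifold J ∞ M] (𝒢 : LieGroupoid I G J M)

/-- `A*G ⊆ T*G`, the units of the cotangent groupoid: covectors at units of `G` that vanish on
`TM`. As `T G = TM ⊕ ker ds` along the units, restriction to `ker ds` identifies it with the dual
of the Lie algebroid `AG = ker ds|_M`. -/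
def dualAlgebroid : Set (CotangentBundle I G) :=
  {l | ∃ x : M, ∃ ξ : TangentSpace I (𝒢.unit x) →L[ℝ] ℝ,
    l = ⟨𝒢.unit x, ξ⟩ ∧ ∀ u : TangentSpace J x, ξ (mfderiv J I 𝒢.unit x u) = 0}

/-- `Λ₀ = A*G \ 0`. -/
def dualAlgebroidNonzero : Set (CotangentBundle I G) := {l ∈ 𝒢.dualAlgebroid | l.2 ≠ 0}

/-- The projection `w ↦ w - dυ(ds w)` of `T_x G` onto `A_x G = ker ds` along `T_x M`, at `x ∈ M`. -/
def algebroidProj (x : M) : E →L[ℝ] E :=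
  let ds : E →L[ℝ] F := mfderiv I J 𝒢.s (𝒢.unit x)
  let du : F →L[ℝ] E := mfderiv J I 𝒢.unit x
  ContinuousLinearMap.id ℝ E - du.comp ds

/-- The range map `r_Γ` of the cotangent groupoid: `r_Γ(γ, ξ)` is the covector at the unit `r γ`
that vanishes on `TM` and equals `ξ ∘ dR_γ` on `ker ds`, where `R_γ : η ↦ η γ` is defined on the
`s`-fiber of `r γ` and maps the unit `r γ` to `γ`. -/
def rΓ (l : CotangentBundle I G) : CotangentBundle I G :=
  let dR : E →L[ℝ] E :=
    mfderivWithin I I (fun η => 𝒢.mul η l.1) {η | 𝒢.s η = 𝒢.r l.1} (𝒢.unit (𝒢.r l.1))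
  let ξ : E →L[ℝ] ℝ := l.2
  ⟨𝒢.unit (𝒢.r l.1), (ξ.comp (dR.comp (𝒢.algebroidProj (𝒢.r l.1))) : E →L[ℝ] ℝ)⟩

/-- The source map `s_Γ` of the cotangent groupoid: `s_Γ(γ, ξ)` is the covector at the unit `s γ`
that vanishes on `TM` and equals `-ξ ∘ d(L_γ ∘ ι)` on `ker ds`, where `L_γ ∘ ι : η ↦ γ η⁻¹` is
defined on the `s`-fiber of `s γ` and maps the unit `s γ` to `γ`. -/
def sΓ (l : CotangentBundle I G) : CotangentBundle I G :=
  let dL : E →L[ℝ] E :=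
    mfderivWithin I I (fun η => 𝒢.mul l.1 (𝒢.inv η)) {η | 𝒢.s η = 𝒢.s l.1} (𝒢.unit (𝒢.s l.1))
  let ξ : E →L[ℝ] ℝ := l.2
  ⟨𝒢.unit (𝒢.s l.1), (-(ξ.comp (dL.comp (𝒢.algebroidProj (𝒢.s l.1)))) : E →L[ℝ] ℝ)⟩

/-- `T*G \ ker r_Γ`. -/
def rRegular : Set (CotangentBundle I G) := {l | (𝒢.rΓ l).2 ≠ 0}

/-- `T*G \ (ker r_Γ ∪ ker s_Γ)`. -/
def biregular : Set (CotangentBundle I G) := {l | (𝒢.rΓ l).2 ≠ 0 ∧ (𝒢.sΓ l).2 ≠ 0}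

/-- `G`-relations: conic Lagrangian submanifolds of `T*G \ 0` that avoid `ker r_Γ` and
`ker s_Γ`. -/
structure IsRelation (L : Set (CotangentBundle I G)) : Prop where
  conicLagrangian : IsConicLagrangian I L
  nonzero : ∀ l ∈ L, l.2 ≠ 0
  subset_biregular : L ⊆ 𝒢.biregular

/-- Invertible `G`-relations: `r_Γ` and `s_Γ` restrict to diffeomorphisms onto open subsets of
`A*G`. -/
structure IsInvertibleRelation (L : Set (CotangentBundle I G)) : Prop where
  isRelation : 𝒢.IsRelation L
  diffeo_r : IsDiffeoOntoRange (cotangentModel I) (cotangentModel I) 𝒢.rΓ L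
  diffeo_s : IsDiffeoOntoRange (cotangentModel I) (cotangentModel I) 𝒢.sΓ L
  open_r : ∃ U, IsOpen U ∧ 𝒢.rΓ '' L = U ∩ 𝒢.dualAlgebroid
  open_s : ∃ U, IsOpen U ∧ 𝒢.sΓ '' L = U ∩ 𝒢.dualAlgebroid

/-- Family `G`-relations: `(γ, ξ) ↦ s(γ)` restricts to a submersion `L → M`, so that `L` is
transverse to each `T*G|_{G_x}`, `x ∈ M`, and gives a smooth family of Lagrangian submanifolds of
the cotangent spaces `T*G_x` of the `s`-fibers. -/
structure IsFamilyRelation (L : Set (CotangentBundle I G)) : Prop where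
  isRelation : 𝒢.IsRelation L
  submersion : ∀ l ∈ L, ∀ u : TangentSpace J (𝒢.s l.1),
    ∃ v ∈ tangentVectors (cotangentModel I) L l,
      mfderiv (cotangentModel I) J (fun l' : CotangentBundle I G => 𝒢.s l'.1) l v = u

/-- `p₀` is a real elliptic homogeneous principal symbol of order one: a smooth function on
`A*G \ 0`, positively homogeneous of degree one, without zeros. (Only the values of `p₀` on
`A*G \ 0` matter; for a function on a submanifold, smoothness along it is the intrinsic one.) -/
structure IsEllipticSymbol (p₀ : CotangentBundle I G → ℝ) : Prop where
  smooth : ContMDiffOn (cotangentModel I) 𝓘(ℝ, ℝ) ∞ p₀ 𝒢.dualAlgebroidNonzero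
  homogeneous : ∀ l ∈ 𝒢.dualAlgebroidNonzero, ∀ a : ℝ, 0 < a →
    p₀ ⟨l.1, a • l.2⟩ = a * p₀ l
  ne_zero : ∀ l ∈ 𝒢.dualAlgebroidNonzero, p₀ l ≠ 0

/-- `Λ_t = χ_t(A*G \ 0)`. -/
def flowOut (χ : ℝ → 𝒢.rRegular → 𝒢.rRegular) (t : ℝ) : Set (CotangentBundle I G) :=
  {l | ∃ l₀ : 𝒢.rRegular, l₀.1 ∈ 𝒢.dualAlgebroidNonzero ∧ l = χ t l₀}

/-- `Λ = {(t, -p(χ_t(x, ξ)), χ_t(x, ξ)) : t ∈ ℝ, (x, ξ) ∈ A*G \ 0}`. -/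
def gluedFlowOut (p : CotangentBundle I G → ℝ) (χ : ℝ → 𝒢.rRegular → 𝒢.rRegular) :
    Set (CotangentBundle (𝓘(ℝ, ℝ).prod I) (ℝ × G)) :=
  {l | ∃ (t : ℝ) (l₀ : 𝒢.rRegular), l₀.1 ∈ 𝒢.dualAlgebroidNonzero ∧
    l = prodCovector I t (-p (χ t l₀)) (χ t l₀)}

end LieGroupoid

end GroupoidRelation

end

open GroupoidRelation

/-! Write `α = ξ dx` for the canonical one-form, so that `ω = -dα`, and `p = p₀ ∘ r_Γ`. Three
properties of `p` carry the proof: it is invariant under right translations, it is homogeneous of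
degree one, and it is constant along its own flow.

Right invariance and completeness. `H_p` is tangent to the source fibers (`dS_hamilton`), so `s` is
constant along integral curves. Right multiplication by one arrow acts on a single source fiber
only. A local bisection through the arrow extends it to a local diffeomorphism of `G`, whose
cotangent lift, corrected by the differential of a function of `s`, preserves `ω` and `p`. It
therefore carries the integral curve from `r_Γ l` to the one from `l` (`exists_translate`). As `M`
is compact, the dilates of one compact set `K` fill `A*G \ 0` (`exists_compact_cosphere`). Integral
curves from `K` exist for a uniform time; dilations and translations spread this time over all of
`T*G \ ker r_Γ`, and a uniform existence time on an invariant set forces completeness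
(`exists_hamilton_curve`). Translation also shows that the base point of `χ_t l` is that of `χ_t
(r_Γ l)` multiplied by that of `l`, and that both have the same `r_Γ` (`flow_translate`).

Preservation of the one-form. Euler's identity gives `α(H_p) = p`, so the flow preserves `α` itself
(`liouville_eq`). The common tool is `symplecticForm_of_liouville`: if `Θ*α = aα + dh`, then `Θ*ω =
aω`. It is used with `a = 1` for the flow and the translations, with the dilation factor for
dilations, and with `a = 0` for `r_Γ`, which makes `A*G` isotropic. Invariance of `α`,
`flow_translate` and the Leibniz rule for the multiplication yield `s_Γ ∘ χ_t = id` on `A*G \ 0`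
(`sΓ_flow`), so the flow-out avoids `ker s_Γ`.

The geometry of `Λ`. Flowing back by `-t`, applying `r_Γ` and flowing out again is a smooth
retraction whose fixed points are exactly `Λ` (`gluedFlowOut_eq_fixedPoints`). Fixed point sets of
smooth retractions are submanifolds, and here they are relatively closed. In the product splitting,
tangent vectors of `Λ` are `(a, -dp(w), a H_p + dχ_t w)` with `w` tangent to `A*G`; the terms with
`a` cancel in the symplectic form, and the Lagrangian property reduces to that of `A*G`.

Relations and support. For the constant family, `s_Γ` sends the point of `Λ` with parameters `(t,
l)` to `(t, l)`, and `r_Γ` sends it to `(t, r_Γ χ_t l)`, which the flow at time `-t` inverts; both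
images are all nonzero covectors. Since `s` is conserved, submersivity onto `M` is inherited from
`A*G`. Since dilations do not move base points, the support over `[a, b]` is the image of the
compact set `[a, b] × K`.

Smoothness of the flow in its initial data comes from the inverse function theorem in a Banach space
of curves, applied to the integral equation rescaled to unit time. -/

noncomputable section

set_option linter.unusedSectionVars false

namespace GroupoidRelation

/-! ### Smooth dependence of ordinary differential equations on initial data -/

/-- The inverse function theorem, with smoothness on open sets. -/
theorem exists_openPartialHomeomorph_of_contDiffOn {E F : Type*} [NormedAddCommGroup E]
    [NormedSpace ℝ E] [CompleteSpace E] [NormedAddCommGroup F] [NormedSpace ℝ F] {f : E → F}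
    {O : Set E} (hO : IsOpen O) (hf : ContDiffOn ℝ ∞ f O) {a : E} (ha : a ∈ O) {f' : E ≃L[ℝ] F}
    (hf' : HasFDerivAt f (f' : E →L[ℝ] F) a) :
    ∃ P : OpenPartialHomeomorph E F, a ∈ P.source ∧ P.source ⊆ O ∧ (P : E → F) = f ∧
      ContDiffOn ℝ ∞ P.symm P.target := by
  have hfa : ∀ x ∈ O, ContDiffAt ℝ ∞ f x := fun x hx => hf.contDiffAt (hO.mem_nhds hx)
  let Q := (hfa a ha).toOpenPartialHomeomorph f hf' (by simp)
  -- The inverse is smooth at the image of any point where the derivative is invertible.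
  -- Invertibility is an open condition, so restricting the source to `S` gives smoothness on the
  -- whole target.
  let S := O ∩ fderiv ℝ f ⁻¹' range ((↑) : (E ≃L[ℝ] F) → E →L[ℝ] F)
  have hS : IsOpen S := (hf.continuousOn_fderiv_of_isOpen hO (by simp)).isOpen_inter_preimage hO
    ContinuousLinearEquiv.isOpen
  have haS : a ∈ S := ⟨ha, f', hf'.fderiv.symm⟩
  refine ⟨Q.restrOpen S hS, ⟨(hfa a ha).mem_toOpenPartialHomeomorph_source hf' (by simp), haS⟩,
    fun x hx => hx.2.1, rfl, fun y hy => ContDiffAt.contDiffWithinAt ?_⟩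
  have hx := (Q.restrOpen S hS).map_target hy
  obtain ⟨hxO, e, he⟩ := hx.2
  refine (Q.restrOpen S hS).contDiffAt_symm hy (f₀' := e) ?_ (hfa _ hxO)
  rw [he]
  exact ((hfa _ hxO).differentiableAt (by simp)).hasFDerivAt

/-! ### Composition operators on spaces of continuous functions -/

section Nemytskii

universe u

variable {K : Type*} [TopologicalSpace K] [CompactSpace K]
  {V : Type u} [NormedAddCommGroup V] [NormedSpace ℝ V]

variable {L W : Type u} [NormedAddCommGroup L] [NormedSpace ℝ L] [NormedAddCommGroup W]
  [NormedSpace ℝ W]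

/-- Pointwise application of a bounded bilinear map, on spaces of continuous functions. -/
def pointwiseApply (K : Type*) [TopologicalSpace K] [CompactSpace K] (B : L →L[ℝ] V →L[ℝ] W) :
    C(K, L) →L[ℝ] C(K, V) →L[ℝ] C(K, W) :=
  LinearMap.mkContinuous₂
    (LinearMap.mk₂ ℝ (fun (A : C(K, L)) (h : C(K, V)) =>
      (⟨fun t => B (A t) (h t), by fun_prop⟩ : C(K, W)))
      (by intros; ext; simp) (by intros; ext; simp) (by intros; ext; simp)
      (by intros; ext; simp)) ‖B‖ (by
    intro A h
    rw [ContinuousMap.norm_le _ (by positivity)]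
    intro t
    calc ‖B (A t) (h t)‖ ≤ ‖B‖ * ‖A t‖ * ‖h t‖ := B.le_opNorm₂ _ _
      _ ≤ ‖B‖ * ‖A‖ * ‖h‖ := by
        gcongr
        · exact A.norm_coe_le_norm t
        · exact h.norm_coe_le_norm t)

/-- The pointwise mean value inequality gives the remainder estimate, with a radius independent of
the point of `K` because `v ↦ f' ∘ v` is continuous in the sup norm. -/
theorem hasFDerivAt_postcomp (B : L →L[ℝ] V →L[ℝ] W) (hB : ∀ a, ‖B a‖ ≤ ‖a‖)
    (f : C(V, W)) (f' : C(V, L)) (hf : ∀ x, HasFDerivAt f (B (f' x)) x) (v : C(K, V)) :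
    HasFDerivAt (fun v : C(K, V) => f.comp v) (pointwiseApply K B (f'.comp v)) v := by
  rw [hasFDerivAt_iff_isLittleO_nhds_zero, Asymptotics.isLittleO_iff]
  intro ε hε
  have hc : ContinuousAt (fun v : C(K, V) => f'.comp v) v :=
    (ContinuousMap.continuous_postcomp f').continuousAt
  obtain ⟨δ, hδ, hd⟩ := Metric.continuousAt_iff.1 hc ε hε
  filter_upwards [Metric.ball_mem_nhds (0 : C(K, V)) hδ] with h hh
  rw [mem_ball_zero_iff] at hh
  rw [ContinuousMap.norm_le _ (by positivity)]
  intro t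
  have key : ∀ x ∈ Metric.ball (v t) δ, ‖B (f' x) - B (f' (v t))‖ ≤ ε := by
    intro x hx
    -- A constant perturbation of `v` moves its value at `t` to `x` at sup distance at most `‖x - v
    -- t‖`, so sup-norm continuity yields the pointwise estimate.
    have h1 : dist (v + ContinuousMap.const K (x - v t)) v < δ := by
      rw [dist_eq_norm, add_sub_cancel_left]
      refine lt_of_le_of_lt ((ContinuousMap.norm_le _ (norm_nonneg (x - v t))).2 ?_)
        (mem_ball_iff_norm.1 hx)
      intro s
      simp
    have h2 := hd h1
    rw [dist_eq_norm] at h2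
    have h3 := (ContinuousMap.norm_coe_le_norm
      (f'.comp (v + ContinuousMap.const K (x - v t)) - f'.comp v) t).trans h2.le
    rw [← map_sub]
    exact (hB _).trans (by simpa using h3)
  have hht : ‖h t‖ < δ := (h.norm_coe_le_norm t).trans_lt hh
  have := (convex_ball (v t) δ).norm_image_sub_le_of_norm_hasFDerivWithin_le'
    (fun x _ => (hf x).hasFDerivWithinAt) key (Metric.mem_ball_self hδ)
    (y := v t + h t) (by simpa [mem_ball_iff_norm] using hht)
  rw [add_sub_cancel_left] at this
  calc _ = ‖f (v t + h t) - f (v t) - B (f' (v t)) (h t)‖ := rfl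
    _ ≤ ε * ‖h t‖ := this
    _ ≤ ε * ‖h‖ := by gcongr; exact h.norm_coe_le_norm t

/-- The derivative of `v ↦ f ∘ v` is composition with `f'` followed by a bounded linear operation,
so one order of smoothness reduces to the previous one for `f'`. The induction runs over all targets
`W` in the universe of `V`, which contains `V →L[ℝ] W`. -/
theorem contDiff_succ_postcomp (B : L →L[ℝ] V →L[ℝ] W) (hB : ∀ a, ‖B a‖ ≤ ‖a‖) {n : ℕ}
    (f : C(V, W)) {f' : V → L} (hf' : ContDiff ℝ n f') (hf : ∀ x, HasFDerivAt f (B (f' x)) x)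
    (ih : ContDiff ℝ n (fun v : C(K, V) => (⟨f', hf'.continuous⟩ : C(V, L)).comp v)) :
    ContDiff ℝ (n + 1) (fun v : C(K, V) => f.comp v) :=
  contDiff_succ_iff_hasFDerivAt.2
    ⟨fun v => pointwiseApply K B ((⟨f', hf'.continuous⟩ : C(V, L)).comp v),
      (pointwiseApply K B).contDiff.comp ih, hasFDerivAt_postcomp B hB f ⟨f', hf'.continuous⟩ hf⟩

theorem contDiff_nat_postcomp (n : ℕ) : ∀ {W : Type u} [NormedAddCommGroup W] [NormedSpace ℝ W]
    (f : C(V, W)), ContDiff ℝ n f → ContDiff ℝ n (fun v : C(K, V) => f.comp v) := by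
  induction n with
  | zero =>
    intro W _ _ f _
    exact contDiff_zero.2 (ContinuousMap.continuous_postcomp f)
  | succ n ih =>
    intro W _ _ f hf
    push_cast at hf ⊢
    obtain ⟨f', hf', hd⟩ := contDiff_succ_iff_hasFDerivAt.1 hf
    exact contDiff_succ_postcomp (ContinuousLinearMap.id ℝ (V →L[ℝ] W)) (fun _ => le_rfl) f hf' hd
      (ih _ hf')

/-- Composition with a smooth map is smooth on spaces of continuous functions. -/
theorem contDiff_postcomp
    (f : C(V, W)) (hf : ContDiff ℝ ∞ f) : ContDiff ℝ ∞ (fun v : C(K, V) => f.comp v) :=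
  contDiff_infty.2 fun n => contDiff_nat_postcomp n f (contDiff_infty.1 hf n)

end Nemytskii

/-! ### Smooth local flows from the integral equation -/

section Flow

universe u
variable {V : Type u} [NormedAddCommGroup V] [NormedSpace ℝ V] [CompleteSpace V]

/-- The primitive `t ↦ ∫₀ᵗ u` as a continuous linear operator on `C([0, 1], V)`. -/
def primitiveCLM (V : Type u) [NormedAddCommGroup V] [NormedSpace ℝ V] [CompleteSpace V] :
    C(Icc (0 : ℝ) 1, V) →L[ℝ] C(Icc (0 : ℝ) 1, V) :=
  LinearMap.mkContinuous
    { toFun := fun v => ⟨fun t => ∫ s in (0 : ℝ)..t, v (projIcc 0 1 zero_le_one s), by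
        have : Continuous fun t : ℝ => ∫ s in (0 : ℝ)..t, v (projIcc 0 1 zero_le_one s) :=
          intervalIntegral.continuous_primitive (fun a b =>
            (v.continuous.comp continuous_projIcc).intervalIntegrable a b) 0
        fun_prop⟩
      map_add' := by
        intro v w
        ext t
        exact intervalIntegral.integral_add
          ((v.continuous.comp continuous_projIcc).intervalIntegrable _ _)
          ((w.continuous.comp continuous_projIcc).intervalIntegrable _ _)
      map_smul' := by
        intro a v
        ext t
        exact intervalIntegral.integral_smul a _ } 1 (by
    intro v
    rw [ContinuousMap.norm_le _ (by positivity)]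
    intro t
    refine (intervalIntegral.norm_integral_le_of_norm_le_const
      (C := ‖v‖) (fun s _ => v.norm_coe_le_norm _)).trans ?_
    have h1 := t.2.1
    have h2 := t.2.2
    rw [sub_zero, abs_of_nonneg h1, one_mul]
    exact mul_le_of_le_one_right (norm_nonneg v) h2)

/-- A smooth autonomous equation has a smooth local flow. -/
theorem exists_smooth_local_flow_of_contDiff {f : V → V} (hf : ContDiff ℝ ∞ f) (x₀ : V) :
    ∃ φ : ℝ × V → V, (∀ᶠ q in 𝓝 (0, x₀), ContDiffAt ℝ ∞ φ q) ∧
      ∀ᶠ q : ℝ × V in 𝓝 (0, x₀), φ (0, q.2) = q.2 ∧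
        HasDerivAt (fun t => φ (t, q.2)) (f (φ q)) q.1 := by
  -- a continuous local flow
  obtain ⟨ε, hε, a, r, L, K, hr, hpl⟩ :=
    IsPicardLindelof.of_contDiffAt_one (hf.contDiffAt.of_le (by simp) : ContDiffAt ℝ 1 f x₀)
  obtain ⟨y, hy, hyc⟩ :=
    (hpl 0).exists_forall_mem_closedBall_eq_hasDerivWithinAt_continuousOn
  simp only [zero_sub, zero_add] at hy hyc
  -- the integral equation
  let C := C(Icc (0 : ℝ) 1, V)
  let fc : C(V, V) := ⟨f, hf.continuous⟩
  let cst : V →L[ℝ] C := ContinuousLinearMap.const ℝ (Icc (0 : ℝ) 1)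
  -- For `q = ((t, x), v)` the second component is `v - x - t ∫ f(v)`. It vanishes exactly for the
  -- integral curve from `x` run at speed `t`, so every time lives on the fixed interval `[0, 1]`.
  let T : (ℝ × V) × C → (ℝ × V) × C := fun q =>
    (q.1, q.2 - cst q.1.2 - q.1.1 • primitiveCLM V (fc.comp q.2))
  have hN : ContDiff ℝ ∞ fun v : C => primitiveCLM V (fc.comp v) :=
    (primitiveCLM V).contDiff.comp (contDiff_postcomp fc hf)
  have hT : ContDiff ℝ ∞ T := by
    refine contDiff_fst.prodMk ((contDiff_snd.sub
      (cst.contDiff.comp (contDiff_snd.comp contDiff_fst))).sub ?_)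
    exact (contDiff_fst.comp contDiff_fst).smul (hN.comp contDiff_snd)
  -- its linearization at the constant solution is invertible
  let N₀ : C := primitiveCLM V (fc.comp (cst x₀))
  -- At `t = 0` the nonlinear term contributes to the derivative only in the direction of `t`. The
  -- linearization is therefore triangular with identity diagonal, and its inverse is explicit.
  let D : ((ℝ × V) × C) ≃L[ℝ] (ℝ × V) × C := ContinuousLinearEquiv.equivOfInverse
    ((ContinuousLinearMap.fst ℝ (ℝ × V) C).prod (ContinuousLinearMap.snd ℝ (ℝ × V) C -
      cst.comp ((ContinuousLinearMap.snd ℝ ℝ V).comp (ContinuousLinearMap.fst ℝ (ℝ × V) C)) -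
      ((ContinuousLinearMap.fst ℝ ℝ V).comp (ContinuousLinearMap.fst ℝ (ℝ × V) C)).smulRight N₀))
    ((ContinuousLinearMap.fst ℝ (ℝ × V) C).prod (ContinuousLinearMap.snd ℝ (ℝ × V) C +
      cst.comp ((ContinuousLinearMap.snd ℝ ℝ V).comp (ContinuousLinearMap.fst ℝ (ℝ × V) C)) +
      ((ContinuousLinearMap.fst ℝ ℝ V).comp (ContinuousLinearMap.fst ℝ (ℝ × V) C)).smulRight N₀))
    (fun q => Prod.ext rfl (by simp; abel)) (fun q => Prod.ext rfl (by simp; abel))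
  let q₀ : (ℝ × V) × C := ((0, x₀), cst x₀)
  have hD : HasFDerivAt T (D : ((ℝ × V) × C) →L[ℝ] (ℝ × V) × C) q₀ := by
    have h1 : HasFDerivAt (fun q : (ℝ × V) × C => q.1.1)
        ((ContinuousLinearMap.fst ℝ ℝ V).comp (ContinuousLinearMap.fst ℝ (ℝ × V) C)) q₀ :=
      ((ContinuousLinearMap.fst ℝ ℝ V).comp (ContinuousLinearMap.fst ℝ (ℝ × V) C)).hasFDerivAt
    have h2 : HasFDerivAt (fun q : (ℝ × V) × C => cst q.1.2)
        (cst.comp ((ContinuousLinearMap.snd ℝ ℝ V).comp (ContinuousLinearMap.fst ℝ (ℝ × V) C))) q₀ :=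
      (cst.comp ((ContinuousLinearMap.snd ℝ ℝ V).comp
        (ContinuousLinearMap.fst ℝ (ℝ × V) C))).hasFDerivAt
    have h3 := (((hN.comp contDiff_snd : ContDiff ℝ ∞ fun q : (ℝ × V) × C =>
      primitiveCLM V (fc.comp q.2)).differentiable (by simp)) q₀).hasFDerivAt
    have h4 := hasFDerivAt_fst.prodMk ((hasFDerivAt_snd.sub h2).sub (h1.smul h3))
    refine h4.congr_fderiv (ContinuousLinearMap.ext fun q => Prod.ext rfl ?_)
    simp [D, q₀, N₀]
  have hTq : T q₀ = ((0, x₀), 0) := by simp [T, q₀]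
  obtain ⟨P, hq₀, -, hPT', hS⟩ := exists_openPartialHomeomorph_of_contDiffOn isOpen_univ
    hT.contDiffOn (mem_univ q₀) hD
  have hPT : ∀ q, P q = T q := fun q => congrFun hPT' q
  -- The rescaled curve at time `1` is the original solution at time `t`.
  let φ : ℝ × V → V := fun q =>
    ContinuousMap.evalCLM ℝ (1 : Icc (0 : ℝ) 1) (P.symm (q, 0)).2
  have hφ : ∀ᶠ q in 𝓝 (0, x₀), ContDiffAt ℝ ∞ φ q := by
    have h1 : ∀ᶠ q : ℝ × V in 𝓝 (0, x₀), (q, (0 : C)) ∈ P.target :=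
      (by fun_prop : Continuous fun q : ℝ × V => (q, (0 : C))).continuousAt.eventually_mem
        (P.open_target.mem_nhds (by rw [← hTq, ← hPT]; exact P.map_source hq₀))
    filter_upwards [h1] with q hq
    exact (ContinuousMap.evalCLM ℝ (1 : Icc (0 : ℝ) 1)).contDiff.contDiffAt.comp _
      (contDiffAt_snd.comp _ ((hS.contDiffAt (P.open_target.mem_nhds hq)).comp q
        (contDiffAt_id.prodMk contDiffAt_const)))
  obtain ⟨δ, hδ, hball⟩ := Metric.mem_nhds_iff.1 (P.open_source.mem_nhds hq₀)
  have hx₀ : x₀ ∈ Metric.closedBall x₀ (r : ℝ) := Metric.mem_closedBall_self r.2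
  obtain ⟨ρ, hρ, hyρ⟩ := Metric.continuousWithinAt_iff.1
    (hyc (x₀, 0) ⟨hx₀, by constructor <;> simp [hε.le]⟩) (δ / 2) (by positivity)
  rw [(hy x₀ hx₀).1] at hyρ
  -- The rescaled Picard–Lindelöf solution solves the integral equation and is uniformly close to
  -- the constant curve, hence lies in the domain of the local inverse. Thus the smooth `φ`
  -- coincides with the known solution `y` and inherits its differential equation.
  have heq : ∀ᶠ q : ℝ × V in 𝓝 (0, x₀),
      φ q = y (q.2, q.1) ∧ q.1 ∈ Ioo (-ε) ε ∧ q.2 ∈ Metric.closedBall x₀ (r : ℝ) := by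
    have hb := Metric.ball_mem_nhds ((0 : ℝ), x₀)
      (lt_min (lt_min hδ hρ) (lt_min hε (NNReal.coe_pos.2 hr)))
    filter_upwards [hb] with q hq
    rw [Metric.mem_ball, Prod.dist_eq, max_lt_iff, Real.dist_eq, sub_zero] at hq
    simp only [lt_min_iff] at hq
    obtain ⟨⟨⟨hq1, hq2⟩, hq3, _⟩, ⟨hq5, hq6⟩, _, hq8⟩ := hq
    have hqr : q.2 ∈ Metric.closedBall x₀ (r : ℝ) := Metric.mem_closedBall.2 hq8.le
    have hqε : q.1 ∈ Ioo (-ε) ε := abs_lt.1 hq3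
    have hmul : ∀ t ∈ Icc (0 : ℝ) 1, |q.1 * t| ≤ |q.1| := fun t ht => by
      rw [abs_mul, abs_of_nonneg ht.1]
      exact mul_le_of_le_one_right (abs_nonneg _) ht.2
    have hder : ∀ t ∈ Icc (0 : ℝ) 1,
        HasDerivAt (fun t => y (q.2, q.1 * t)) (q.1 • f (y (q.2, q.1 * t))) t := by
      intro t ht
      have h1 : q.1 * t ∈ Ioo (-ε) ε := abs_lt.1 ((hmul t ht).trans_lt hq3)
      have h2 := ((hy q.2 hqr).2 (q.1 * t) (Ioo_subset_Icc_self h1)).hasDerivAt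
        (Icc_mem_nhds h1.1 h1.2)
      have h3 : HasDerivAt (fun t : ℝ => q.1 * t) q.1 t := by
        simpa using (hasDerivAt_id t).const_mul q.1
      exact h2.scomp t h3
    have hcont : ContinuousOn (fun t : ℝ => y (q.2, q.1 * t)) (Icc 0 1) :=
      fun t ht => (hder t ht).continuousAt.continuousWithinAt
    let v : C := ⟨fun t => y (q.2, q.1 * t), continuousOn_iff_continuous_domRestrict.1 hcont⟩
    have hvs : (q, v) ∈ P.source := by
      apply hball
      rw [Metric.mem_ball, Prod.dist_eq, max_lt_iff]
      refine ⟨?_, ?_⟩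
      · rw [Prod.dist_eq, max_lt_iff, Real.dist_eq, sub_zero]
        exact ⟨hq1, hq5⟩
      · refine lt_of_le_of_lt ((ContinuousMap.dist_le (half_pos hδ).le).2 ?_)
          (half_lt_self hδ)
        intro t
        refine (hyρ (x := (q.2, q.1 * t)) ⟨hqr, ?_⟩ ?_).le
        · exact abs_le.1 ((hmul t t.2).trans hq3.le)
        · rw [Prod.dist_eq, max_lt_iff, Real.dist_eq, sub_zero]
          exact ⟨hq6, (hmul t t.2).trans_lt hq2⟩
    have hTv : T (q, v) = (q, 0) := by
      refine Prod.ext rfl ?_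
      ext t
      have hsub : Icc (0 : ℝ) t ⊆ Icc 0 1 := Icc_subset_Icc_right t.2.2
      have h1 : ∫ s in (0 : ℝ)..t, q.1 • f (y (q.2, q.1 * s)) =
          y (q.2, q.1 * t) - y (q.2, q.1 * 0) := by
        refine intervalIntegral.integral_eq_sub_of_hasDerivAt
          (f := fun s => y (q.2, q.1 * s)) (fun s hs => hder s ?_) ?_
        · rw [uIcc_of_le t.2.1] at hs
          exact hsub hs
        · refine ContinuousOn.intervalIntegrable ?_
          rw [uIcc_of_le t.2.1]
          exact ((hf.continuous.comp_continuousOn hcont).mono hsub).const_smul q.1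
      have h2 : ∫ s in (0 : ℝ)..t, q.1 • f (y (q.2, q.1 * s)) =
          q.1 • ∫ s in (0 : ℝ)..t, f (v (projIcc 0 1 zero_le_one s)) := by
        rw [← intervalIntegral.integral_smul]
        refine intervalIntegral.integral_congr fun s hs => ?_
        rw [uIcc_of_le t.2.1] at hs
        simp only [projIcc_of_mem zero_le_one (hsub hs)]
        rfl
      rw [h2, mul_zero, (hy q.2 hqr).1] at h1
      calc _ = y (q.2, q.1 * t) - q.2 - q.1 • ∫ s in (0 : ℝ)..t,
            f (v (projIcc 0 1 zero_le_one s)) := rfl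
        _ = 0 := by rw [h1, sub_self]
    refine ⟨?_, hqε, hqr⟩
    have h1 : P.symm (q, 0) = (q, v) := by
      rw [← hTv, ← hPT, P.left_inv hvs]
    calc φ q = (P.symm (q, 0)).2 1 := rfl
      _ = y (q.2, q.1 * 1) := by rw [h1]; rfl
      _ = _ := by rw [mul_one]
  refine ⟨φ, hφ, ?_⟩
  have h0 : Tendsto (fun q : ℝ × V => ((0 : ℝ), q.2)) (𝓝 (0, x₀)) (𝓝 (0, x₀)) :=
    (by fun_prop : Continuous fun q : ℝ × V => ((0 : ℝ), q.2)).tendsto' _ _ rfl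
  filter_upwards [eventually_eventually_nhds.2 heq, h0.eventually heq] with q hq hq'
  obtain ⟨h1, h2, h3⟩ := hq.self_of_nhds
  refine ⟨by rw [hq'.1, (hy q.2 h3).1], ?_⟩
  have h4 : (fun t => φ (t, q.2)) =ᶠ[𝓝 q.1] fun t => y (q.2, t) := by
    have : Tendsto (fun t : ℝ => (t, q.2)) (𝓝 q.1) (𝓝 q) :=
      (by fun_prop : Continuous fun t : ℝ => (t, q.2)).tendsto' _ _ rfl
    filter_upwards [this.eventually hq] with t ht using ht.1
  rw [h1]
  exact (((hy q.2 h3).2 q.1 (Ioo_subset_Icc_self h2)).hasDerivAt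
    (Icc_mem_nhds h2.1 h2.2)).congr_of_eventuallyEq h4

/-- A vector field that is smooth on an open set has smooth local flows there. -/
theorem exists_smooth_local_flow {V : Type u} [NormedAddCommGroup V] [NormedSpace ℝ V]
    [FiniteDimensional ℝ V] {f : V → V} {x₀ : V} {O : Set V} (hO : IsOpen O) (hx₀ : x₀ ∈ O)
    (hf : ContDiffOn ℝ ∞ f O) :
    ∃ φ : ℝ × V → V, (∀ᶠ q in 𝓝 (0, x₀), ContDiffAt ℝ ∞ φ q) ∧
      ∀ᶠ q : ℝ × V in 𝓝 (0, x₀), φ q ∈ O ∧ φ (0, q.2) = q.2 ∧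
        HasDerivAt (fun t => φ (t, q.2)) (f (φ q)) q.1 := by
  have : CompleteSpace V := FiniteDimensional.complete ℝ V
  obtain ⟨R, hR, hball⟩ := Metric.isOpen_iff.1 hO x₀ hx₀
  -- The bump makes the field globally smooth and equals `1` on the ball of radius `R / 3`, where
  -- the flow stays for small times and therefore solves the original equation.
  let b : ContDiffBump x₀ := ⟨R / 3, R / 2, by positivity, by linarith⟩
  have hg : ContDiff ℝ ∞ fun x => b x • f x := by
    rw [contDiff_iff_contDiffAt]
    intro x
    by_cases hx : x ∈ Metric.ball x₀ R
    · exact b.contDiff.contDiffAt.smul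
        ((hf x (hball hx)).contDiffAt (hO.mem_nhds (hball hx)))
    · have h1 : x ∉ tsupport b := by
        rw [b.tsupport_eq, Metric.mem_closedBall, not_le]
        rw [Metric.mem_ball, not_lt] at hx
        exact lt_of_lt_of_le (show R / 2 < R by linarith) hx
      have h2 : (fun x => b x • f x) =ᶠ[𝓝 x] fun _ => 0 := by
        filter_upwards [notMem_tsupport_iff_eventuallyEq.1 h1] with y hy
        rw [hy, Pi.zero_apply, zero_smul]
      exact contDiffAt_const.congr_of_eventuallyEq h2
  obtain ⟨φ, hφ, h⟩ := exists_smooth_local_flow_of_contDiff hg x₀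
  refine ⟨φ, hφ, ?_⟩
  have h0 : φ (0, x₀) = x₀ := h.self_of_nhds.1
  have hc : ∀ᶠ q in 𝓝 ((0 : ℝ), x₀), φ q ∈ Metric.ball x₀ (R / 3) :=
    hφ.self_of_nhds.continuousAt.eventually_mem (by rw [h0]; exact Metric.ball_mem_nhds _ (by positivity))
  filter_upwards [h, hc] with q hq hqb
  refine ⟨hball (Metric.ball_subset_ball (by linarith) hqb), hq.1, ?_⟩
  have h1 : b (φ q) = 1 := b.one_of_mem_closedBall (Metric.ball_subset_closedBall hqb)
  simpa only [h1, one_smul] using hq.2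

end Flow

/-! ### Local coordinates on manifolds without boundary -/

section Coordinates

variable {E H : Type*} [NormedAddCommGroup E] [NormedSpace ℝ E] [TopologicalSpace H]
  {I : ModelWithCorners ℝ E H} [I.Boundaryless]
  {X : Type*} [TopologicalSpace X] [ChartedSpace H X]

/-- Smooth local coordinates: a homeomorphism between open subsets of `X` and `E`, smooth in both
directions. -/
structure IsCoord (I : ModelWithCorners ℝ E H) (κ : OpenPartialHomeomorph X E) : Prop where
  smooth : ContMDiffOn I 𝓘(ℝ, E) ∞ κ κ.source
  smooth_symm : ContMDiffOn 𝓘(ℝ, E) I ∞ κ.symm κ.target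

theorem IsCoord.contMDiffAt {κ : OpenPartialHomeomorph X E} (hκ : IsCoord I κ) {x : X}
    (hx : x ∈ κ.source) : ContMDiffAt I 𝓘(ℝ, E) ∞ κ x :=
  hκ.smooth.contMDiffAt (κ.open_source.mem_nhds hx)

theorem IsCoord.contMDiffAt_symm {κ : OpenPartialHomeomorph X E} (hκ : IsCoord I κ) {z : E}
    (hz : z ∈ κ.target) : ContMDiffAt 𝓘(ℝ, E) I ∞ κ.symm z :=
  hκ.smooth_symm.contMDiffAt (κ.open_target.mem_nhds hz)

theorem IsCoord.hasMFDerivAt {κ : OpenPartialHomeomorph X E} (hκ : IsCoord I κ) {x : X}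
    (hx : x ∈ κ.source) : HasMFDerivAt I 𝓘(ℝ, E) κ x (mfderiv I 𝓘(ℝ, E) κ x) :=
  ((hκ.contMDiffAt hx).mdifferentiableAt (by simp)).hasMFDerivAt

theorem IsCoord.hasMFDerivAt_symm {κ : OpenPartialHomeomorph X E} (hκ : IsCoord I κ) {z : E}
    (hz : z ∈ κ.target) : HasMFDerivAt 𝓘(ℝ, E) I κ.symm z (mfderiv 𝓘(ℝ, E) I κ.symm z) :=
  ((hκ.contMDiffAt_symm hz).mdifferentiableAt (by simp)).hasMFDerivAt

theorem IsCoord.mfderiv_symm_comp {κ : OpenPartialHomeomorph X E} (hκ : IsCoord I κ) {x : X}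
    (hx : x ∈ κ.source) :
    (mfderiv 𝓘(ℝ, E) I κ.symm (κ x)).comp (mfderiv I 𝓘(ℝ, E) κ x) =
      ContinuousLinearMap.id ℝ E := by
  have h := (hκ.hasMFDerivAt_symm (κ.map_source hx)).comp x (hκ.hasMFDerivAt hx)
  refine hasMFDerivAt_unique h ((hasMFDerivAt_id x).congr_of_eventuallyEq ?_)
  filter_upwards [κ.open_source.mem_nhds hx] with y hy using κ.left_inv hy

theorem IsCoord.mfderiv_comp_symm {κ : OpenPartialHomeomorph X E} (hκ : IsCoord I κ) {x : X}
    (hx : x ∈ κ.source) :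
    (mfderiv I 𝓘(ℝ, E) κ x).comp (mfderiv 𝓘(ℝ, E) I κ.symm (κ x)) =
      ContinuousLinearMap.id ℝ E := by
  have h := hκ.hasMFDerivAt hx
  rw [← κ.left_inv hx] at h
  have h2 := h.comp (κ x) (hκ.hasMFDerivAt_symm (κ.map_source hx))
  rw [κ.left_inv hx] at h2
  refine hasMFDerivAt_unique h2 ((hasMFDerivAt_id (κ x)).congr_of_eventuallyEq ?_)
  filter_upwards [κ.open_target.mem_nhds (κ.map_source hx)] with y hy using κ.right_inv hy

/-- Charts take values in `H` and coordinates in `E`; without boundary `I` is a homeomorphism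
between them. Compatibility then only involves the two transition maps `h3` and `h4`. -/
theorem IsCoord.mem_maximalAtlas [IsManifold I ∞ X] {κ : OpenPartialHomeomorph X E}
    (hκ : IsCoord I κ) :
    κ.trans I.toHomeomorph.symm.toOpenPartialHomeomorph ∈ IsManifold.maximalAtlas I ∞ X := by
  have hI : ∀ z : E, I (I.symm z) = z := fun z => I.right_inv (by simp [I.range_eq_univ])
  rw [IsManifold.mem_maximalAtlas_iff]
  intro e' he'
  have hm := IsManifold.subset_maximalAtlas (I := I) (n := ∞) he'
  have h1 := OpenPartialHomeomorph.contMDiffOn_extend hm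
  have h2 := contMDiffOn_extend_symm hm
  have h3 : ContDiffOn ℝ ∞ (e'.extend I ∘ κ.symm) (κ.target ∩ κ.symm ⁻¹' e'.source) :=
    (h1.comp (hκ.smooth_symm.mono inter_subset_left) inter_subset_right).contDiffOn
  have h4 : ContDiffOn ℝ ∞ (κ ∘ (e'.extend I).symm)
      (I '' e'.target ∩ (e'.extend I).symm ⁻¹' κ.source) :=
    (hκ.smooth.comp (h2.mono inter_subset_left) inter_subset_right).contDiffOn
  constructor <;> refine (mem_groupoid_of_pregroupoid ..).2 ⟨?_, ?_⟩
  · refine h3.congr_mono (fun z hz => ?_) (fun z hz => ?_)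
    · simp [ModelWithCorners.toHomeomorph, hI]
    · simpa [ModelWithCorners.toHomeomorph, hI] using hz.1
  · refine h4.congr_mono (fun z hz => ?_) (fun z hz => ?_)
    · simp [ModelWithCorners.toHomeomorph, hI]
    · have : z ∈ I '' e'.target ↔ I.symm z ∈ e'.target := by
        rw [I.image_eq]; simp [I.range_eq_univ]
      simpa [ModelWithCorners.toHomeomorph, hI, this] using hz.1
  · refine h4.congr_mono (fun z hz => ?_) (fun z hz => ?_)
    · simp [ModelWithCorners.toHomeomorph, hI]
    · have : z ∈ I '' e'.target ↔ I.symm z ∈ e'.target := by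
        rw [I.image_eq]; simp [I.range_eq_univ]
      simpa [ModelWithCorners.toHomeomorph, hI, this] using hz.1
  · refine h3.congr_mono (fun z hz => ?_) (fun z hz => ?_)
    · simp [ModelWithCorners.toHomeomorph, hI]
    · simpa [ModelWithCorners.toHomeomorph, hI] using hz.1

/-- The preferred chart of `X` at `x`, as coordinates with values in the model vector space. -/
def coordAt (I : ModelWithCorners ℝ E H) [I.Boundaryless] (x : X) : OpenPartialHomeomorph X E :=
  (chartAt H x).trans I.toHomeomorph.toOpenPartialHomeomorph

@[simp] theorem coordAt_apply (x y : X) : coordAt I x y = extChartAt I x y := rfl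

@[simp] theorem coordAt_symm_apply (x : X) (z : E) :
    (coordAt I x).symm z = (extChartAt I x).symm z := rfl

@[simp] theorem coordAt_source (x : X) : (coordAt I x).source = (chartAt H x).source := by
  simp [coordAt]

@[simp] theorem coordAt_target (x : X) : (coordAt I x).target = (extChartAt I x).target := by
  simp [coordAt, extChartAt, OpenPartialHomeomorph.extend, I.range_eq_univ]
  rfl

theorem isCoord_coordAt [IsManifold I ∞ X] (x : X) : IsCoord I (coordAt I x) where
  smooth := by
    rw [coordAt_source]
    exact contMDiffOn_extChartAt
  smooth_symm := by
    rw [coordAt_target]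
    exact contMDiffOn_extChartAt_symm x

theorem mem_coordAt_source (x : X) : x ∈ (coordAt I x).source := by
  rw [coordAt_source]; exact mem_chart_source H x

/-- Tangent vectors at `x` are by construction their readings in the preferred chart at `x`. This is
why velocities, elements of `E`, can be compared with chart derivatives at the center. -/
theorem mfderiv_coordAt_self [IsManifold I ∞ X] (x : X) :
    mfderiv I 𝓘(ℝ, E) (coordAt I x) x = ContinuousLinearMap.id ℝ E := by
  have : IsManifold I 1 X := IsManifold.of_le (n := ∞) (by simp)
  exact mfderiv_extChartAt_self

theorem hasMFDerivAt_coordAt_self [IsManifold I ∞ X] (x : X) :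
    HasMFDerivAt I 𝓘(ℝ, E) (coordAt I x) x (ContinuousLinearMap.id ℝ E) := by
  have h := (isCoord_coordAt (I := I) x).hasMFDerivAt (mem_coordAt_source x)
  rwa [mfderiv_coordAt_self x] at h

theorem hasMFDerivAt_coordAt_symm_self [IsManifold I ∞ X] (x : X) :
    HasMFDerivAt 𝓘(ℝ, E) I (coordAt I x).symm (coordAt I x x) (ContinuousLinearMap.id ℝ E) := by
  have hx := mem_coordAt_source (I := I) x
  have h := (isCoord_coordAt (I := I) x).hasMFDerivAt_symm ((coordAt I x).map_source hx)
  have h2 := (isCoord_coordAt (I := I) x).mfderiv_symm_comp hx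
  rw [mfderiv_coordAt_self x] at h2
  exact h2 ▸ h

/-- A smooth map to the model space with invertible derivative restricts to coordinates. -/
theorem exists_coord_of_bijective [CompleteSpace E] [IsManifold I ∞ X] {g : X → E} {O : Set X}
    (hO : IsOpen O) (hg : ContMDiffOn I 𝓘(ℝ, E) ∞ g O) {x : X} (hx : x ∈ O) {g' : E ≃L[ℝ] E}
    (hg' : HasMFDerivAt I 𝓘(ℝ, E) g x (g' : E →L[ℝ] E)) :
    ∃ κ : OpenPartialHomeomorph X E, IsCoord I κ ∧ x ∈ κ.source ∧ κ.source ⊆ O ∧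
      EqOn κ g κ.source := by
  set c := coordAt I x
  have hc := isCoord_coordAt (I := I) x
  have hxc : x ∈ c.source := mem_coordAt_source x
  have hO' : IsOpen (c.target ∩ c.symm ⁻¹' O) := c.isOpen_inter_preimage_symm hO
  have h1 : ContDiffOn ℝ ∞ (g ∘ c.symm) (c.target ∩ c.symm ⁻¹' O) :=
    (hg.comp (hc.smooth_symm.mono inter_subset_left) inter_subset_right).contDiffOn
  have hxO : c x ∈ c.target ∩ c.symm ⁻¹' O :=
    ⟨c.map_source hxc, by rw [mem_preimage, c.left_inv hxc]; exact hx⟩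
  have hg'' := hg'
  rw [← c.left_inv hxc] at hg''
  have h2 : HasFDerivAt (g ∘ c.symm) (g' : E →L[ℝ] E) (c x) :=
    (hg''.comp (c x) (hasMFDerivAt_coordAt_symm_self x)).hasFDerivAt
  obtain ⟨P, hxP, hPO, hP, hPs⟩ := exists_openPartialHomeomorph_of_contDiffOn hO' h1 hxO h2
  have hPg : EqOn (c.trans P) g (c.trans P).source := fun y hy => by
    rw [OpenPartialHomeomorph.trans_source] at hy
    rw [OpenPartialHomeomorph.coe_trans, hP]
    exact congrArg g (c.left_inv hy.1)
  have hsO : (c.trans P).source ⊆ O := fun y hy => by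
    rw [OpenPartialHomeomorph.trans_source] at hy
    have := (hPO hy.2).2
    rwa [mem_preimage, c.left_inv hy.1] at this
  refine ⟨c.trans P, ⟨(hg.mono hsO).congr hPg, ?_⟩, ?_, hsO, hPg⟩
  · rw [OpenPartialHomeomorph.trans_target]
    exact hc.smooth_symm.comp (hPs.contMDiffOn.mono inter_subset_left) inter_subset_right
  · rw [OpenPartialHomeomorph.trans_source]
    exact ⟨hxc, hxP⟩

theorem IsCoord.restrOpen {κ : OpenPartialHomeomorph X E} (hκ : IsCoord I κ) {S : Set X}
    (hS : IsOpen S) : IsCoord I (κ.restrOpen S hS) where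
  smooth := hκ.smooth.mono fun _ hx => hx.1
  smooth_symm := hκ.smooth_symm.mono fun _ hx => hx.1

end Coordinates

/-! ### Velocities of curves -/

section Velocity

variable {E H : Type*} [NormedAddCommGroup E] [NormedSpace ℝ E] [TopologicalSpace H]
  {I : ModelWithCorners ℝ E H} {X : Type*} [TopologicalSpace X] [ChartedSpace H X]
  {E' H' : Type*} [NormedAddCommGroup E'] [NormedSpace ℝ E'] [TopologicalSpace H']
  {I' : ModelWithCorners ℝ E' H'} {Y : Type*} [TopologicalSpace Y] [ChartedSpace H' Y]

/-- The curve `c` has velocity `v` at time `t`. -/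
def HasVelocity (I : ModelWithCorners ℝ E H) (c : ℝ → X) (t : ℝ) (v : E) : Prop :=
  HasMFDerivAt 𝓘(ℝ, ℝ) I c t (ContinuousLinearMap.toSpanSingleton ℝ v : ℝ →L[ℝ] E)

theorem HasVelocity.comp {c : ℝ → X} {t : ℝ} {v : E} (hc : HasVelocity I c t v) {f : X → Y}
    {f' : E →L[ℝ] E'} (hf : HasMFDerivAt I I' f (c t) f') :
    HasVelocity I' (fun u => f (c u)) t (f' v) := by
  have h := HasMFDerivAt.comp t hf hc
  have h2 : f'.comp (ContinuousLinearMap.toSpanSingleton ℝ v : ℝ →L[ℝ] E) =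
      ContinuousLinearMap.toSpanSingleton ℝ (f' v) := by ext; simp
  exact h.congr_mfderiv h2

theorem HasVelocity.comp_of_eq {c : ℝ → X} {t : ℝ} {v : E} (hc : HasVelocity I c t v) {f : X → Y}
    {f' : E →L[ℝ] E'} {x : X} (hf : HasMFDerivAt I I' f x f') (hx : c t = x) :
    HasVelocity I' (fun u => f (c u)) t (f' v) := by
  subst hx
  exact hc.comp hf

/-- Translations are differentiated only along source fibers; this chain rule reads such a
derivative off curves that stay in the fiber. -/
theorem HasVelocity.comp_within {c : ℝ → X} {t : ℝ} {v : E} (hc : HasVelocity I c t v) {f : X → Y}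
    {f' : E →L[ℝ] E'} {S : Set X} {x : X} (hf : HasMFDerivWithinAt I I' f S x f') (hx : c t = x)
    (hS : ∀ᶠ u in 𝓝 t, c u ∈ S) : HasVelocity I' (fun u => f (c u)) t (f' v) := by
  subst hx
  have h := HasMFDerivWithinAt.comp (s := c ⁻¹' S) t hf hc.hasMFDerivWithinAt subset_rfl
  have h2 : f'.comp (ContinuousLinearMap.toSpanSingleton ℝ v : ℝ →L[ℝ] E) =
      ContinuousLinearMap.toSpanSingleton ℝ (f' v) := by ext; simp
  exact (h.hasMFDerivAt hS).congr_mfderiv h2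

theorem HasVelocity.congr {c c' : ℝ → X} {t : ℝ} {v : E} (hc : HasVelocity I c t v)
    (h : c' =ᶠ[𝓝 t] c) : HasVelocity I c' t v :=
  HasMFDerivAt.congr_of_eventuallyEq hc h

theorem HasVelocity.unique {c : ℝ → X} {t : ℝ} {v w : E} (hv : HasVelocity I c t v)
    (hw : HasVelocity I c t w) : v = w := by
  have h := congrArg (fun L : ℝ →L[ℝ] E => L 1) (hasMFDerivAt_unique hv hw)
  simpa using h

theorem HasVelocity.of_mdifferentiableAt {c : ℝ → X} {t : ℝ}
    (hc : MDifferentiableAt 𝓘(ℝ, ℝ) I c t) :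
    HasVelocity I c t (mfderiv 𝓘(ℝ, ℝ) I c t (1 : ℝ)) := by
  have h2 : (ContinuousLinearMap.toSpanSingleton ℝ (mfderiv 𝓘(ℝ, ℝ) I c t (1 : ℝ)) : ℝ →L[ℝ] E) =
      mfderiv 𝓘(ℝ, ℝ) I c t := by
    exact ContinuousLinearMap.ext_ring (one_smul ℝ _)
  unfold HasVelocity
  rw [h2]
  exact hc.hasMFDerivAt

theorem HasVelocity.mdifferentiableAt {c : ℝ → X} {t : ℝ} {v : E} (hc : HasVelocity I c t v) :
    MDifferentiableAt 𝓘(ℝ, ℝ) I c t := HasMFDerivAt.mdifferentiableAt hc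

theorem HasVelocity.continuousAt {c : ℝ → X} {t : ℝ} {v : E} (hc : HasVelocity I c t v) :
    ContinuousAt c t := HasMFDerivAt.continuousAt hc

theorem HasVelocity.mfderiv_one {c : ℝ → X} {t : ℝ} {v : E} (hc : HasVelocity I c t v) :
    mfderiv 𝓘(ℝ, ℝ) I c t (1 : ℝ) = v :=
  (HasVelocity.of_mdifferentiableAt hc.mdifferentiableAt).unique hc

theorem hasVelocity_iff_hasDerivAt {c : ℝ → E} {t : ℝ} {v : E} :
    HasVelocity 𝓘(ℝ, E) c t v ↔ HasDerivAt c v t :=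
  hasMFDerivAt_iff_hasFDerivAt

theorem hasVelocity_const (x : X) (t : ℝ) : HasVelocity I (fun _ => x) t 0 := by
  have h : (ContinuousLinearMap.toSpanSingleton ℝ (0 : E) : ℝ →L[ℝ] E) = 0 := by ext; simp
  unfold HasVelocity
  rw [h]
  exact hasMFDerivAt_const x t

theorem hasVelocity_line (z v : E) : HasVelocity 𝓘(ℝ, E) (fun t : ℝ => z + t • v) 0 v := by
  rw [hasVelocity_iff_hasDerivAt]
  simpa using ((hasDerivAt_id (0 : ℝ)).smul_const v).const_add z

theorem HasVelocity.prodMk {c : ℝ → X} {d : ℝ → Y} {t : ℝ} {v : E} {w : E'}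
    (hc : HasVelocity I c t v) (hd : HasVelocity I' d t w) :
    HasVelocity (I.prod I') (fun u => (c u, d u)) t (v, w) := by
  have h := HasMFDerivAt.prodMk hc hd
  have h2 : (ContinuousLinearMap.toSpanSingleton ℝ v : ℝ →L[ℝ] E).prod
      (ContinuousLinearMap.toSpanSingleton ℝ w) = ContinuousLinearMap.toSpanSingleton ℝ (v, w) := by
    ext <;> simp
  exact h.congr_mfderiv h2

theorem IsCoord.exists_curve [I.Boundaryless] {κ : OpenPartialHomeomorph X E} (hκ : IsCoord I κ) {x : X}
    (hx : x ∈ κ.source) (v : E) :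
    κ.symm (κ x + (0 : ℝ) • v) = x ∧ HasVelocity I (fun t : ℝ => κ.symm (κ x + t • v)) 0
      (mfderiv 𝓘(ℝ, E) I κ.symm (κ x) v) := by
  have h0 : κ.symm (κ x + (0 : ℝ) • v) = x := by rw [zero_smul, add_zero, κ.left_inv hx]
  exact ⟨h0, (hasVelocity_line (κ x) v).comp_of_eq (hκ.hasMFDerivAt_symm (κ.map_source hx))
    (by simp)⟩

/-- Since every vector is a velocity, equalities between derivatives can be tested by following one
curve in two ways. -/
theorem exists_curve [I.Boundaryless] [IsManifold I ∞ X] (x : X) (v : E) :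
    ∃ c : ℝ → X, c 0 = x ∧ HasVelocity I c 0 v ∧ ContMDiffAt 𝓘(ℝ, ℝ) I ∞ c 0 := by
  have hκ := isCoord_coordAt (I := I) x
  have hx := mem_coordAt_source (I := I) x
  refine ⟨fun t => (coordAt I x).symm (coordAt I x x + t • v), (hκ.exists_curve hx v).1, ?_, ?_⟩
  · exact (hasVelocity_line _ v).comp_of_eq (hasMFDerivAt_coordAt_symm_self x) (by simp)
  · refine ContMDiffAt.comp 0 (f := fun t : ℝ => coordAt I x x + t • v)
      (hκ.contMDiffAt_symm ?_) ?_
    · rw [zero_smul, add_zero]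
      exact (coordAt I x).map_source hx
    · exact (by fun_prop : ContDiff ℝ ∞ fun t : ℝ => coordAt I x x + t • v).contMDiff.contMDiffAt

end Velocity

/-! ### Linearization of submersions -/

section Submersion

variable {E H : Type*} [NormedAddCommGroup E] [NormedSpace ℝ E] [FiniteDimensional ℝ E]
  [TopologicalSpace H] {I : ModelWithCorners ℝ E H} [I.Boundaryless]
  {X : Type*} [TopologicalSpace X] [ChartedSpace H X] [IsManifold I ∞ X]

/-- Around a point where its derivative is surjective, a smooth map is linear in suitable
coordinates, whose derivative at the point is the identity. -/
theorem exists_coord_of_surjective {V : Type*} [NormedAddCommGroup V] [NormedSpace ℝ V]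
    [FiniteDimensional ℝ V] {f : X → V} {O : Set X} (hO : IsOpen O) (hf : ContMDiffOn I 𝓘(ℝ, V) ∞ f O) {x : X}
    (hx : x ∈ O) {f' : E →L[ℝ] V} (hf' : HasMFDerivAt I 𝓘(ℝ, V) f x f')
    (hsurj : Function.Surjective f') :
    ∃ κ : OpenPartialHomeomorph X E, IsCoord I κ ∧ x ∈ κ.source ∧ κ.source ⊆ O ∧
      HasMFDerivAt I 𝓘(ℝ, E) κ x (ContinuousLinearMap.id ℝ E) ∧
      ∀ y ∈ κ.source, f' (κ y) = f y := by
  have : CompleteSpace E := FiniteDimensional.complete ℝ E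
  obtain ⟨T, hT⟩ := f'.exists_rightInverse_of_surjective (LinearMap.range_eq_top.2 hsurj)
  have hT' : ∀ v, f' (T v) = v := fun v => congrArg (fun L : V →L[ℝ] V => L v) hT
  set c := coordAt I x
  have hc := isCoord_coordAt (I := I) x
  have hxc : x ∈ c.source := mem_coordAt_source x
  -- With `T` a right inverse of `f'`, this map has derivative `T f' + (1 - T f') = 1` at `x`, and
  -- applying `f'` to it leaves `f`.
  have hg : ContMDiffOn I 𝓘(ℝ, E) ∞ (fun y => T (f y) + (c y - T (f' (c y)))) (O ∩ c.source) :=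
    (T.contMDiff.comp_contMDiffOn (hf.mono inter_subset_left)).add
      ((hc.smooth.mono inter_subset_right).sub ((T.comp f').contMDiff.comp_contMDiffOn
        (hc.smooth.mono inter_subset_right)))
  have hg' : HasMFDerivAt I 𝓘(ℝ, E) (fun y => T (f y) + (c y - T (f' (c y)))) x
      (ContinuousLinearMap.id ℝ E) := by
    have h0 := hasMFDerivAt_coordAt_self (I := I) x
    have h1 : HasMFDerivAt I 𝓘(ℝ, E) (fun y => T (f y)) x (T.comp f') :=
      T.hasMFDerivAt.comp x hf'
    have h2 : HasMFDerivAt I 𝓘(ℝ, E) (fun y => T (f' (c y))) x (T.comp f') :=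
      (T.comp f').hasMFDerivAt.comp x h0
    have h3 := h1.add (h0.sub h2)
    have h4 : T.comp f' + (ContinuousLinearMap.id ℝ E - T.comp f') =
      ContinuousLinearMap.id ℝ E := by abel
    exact h4 ▸ h3
  obtain ⟨κ, hκ, hxκ, hκO, hκg⟩ := exists_coord_of_bijective (hO.inter c.open_source) hg
    ⟨hx, hxc⟩ (g' := ContinuousLinearEquiv.refl ℝ E) hg'
  refine ⟨κ, hκ, hxκ, hκO.trans inter_subset_left, hg'.congr_of_eventuallyEq ?_, fun y hy => ?_⟩
  · filter_upwards [κ.open_source.mem_nhds hxκ] with y hy using hκg hy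
  · rw [hκg hy, map_add, map_sub, hT', hT', sub_self, add_zero]

end Submersion

/-! ### Fixed points of smooth retractions -/

section FixedPoints

variable {E H : Type*} [NormedAddCommGroup E] [NormedSpace ℝ E] [CompleteSpace E]
  [TopologicalSpace H] {I : ModelWithCorners ℝ E H} [I.Boundaryless]
  {X : Type*} [TopologicalSpace X] [ChartedSpace H X] [IsManifold I ∞ X]
  {ρ : X → X} {O : Set X}

/-- The derivative `D` of `ρ` at a fixed point is idempotent. Suitable coordinates split along `ker
D` and `range D`, with the fixed points cut out by the range directions. -/
theorem isEmbeddedSubmanifold_fixedPoints (hO : IsOpen O) (hρ : ContMDiffOn I I ∞ ρ O)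
    (hid : ∀ x ∈ O, ρ (ρ x) = ρ x) :
    IsEmbeddedSubmanifold I {x ∈ O | ρ x = x} := by
  rintro x ⟨hx, hfix⟩
  set c := coordAt I x
  have hc := isCoord_coordAt (I := I) x
  have hxc : x ∈ c.source := mem_coordAt_source x
  obtain ⟨D, hD⟩ : ∃ D : E →L[ℝ] E, HasMFDerivAt I I ρ x D :=
    ⟨_, ((hρ.contMDiffAt (hO.mem_nhds hx)).mdifferentiableAt (by simp)).hasMFDerivAt⟩
  have hDρ : HasMFDerivAt I I ρ (ρ x) D := by rw [hfix]; exact hD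
  have hDD : ∀ v, D (D v) = D v := by
    have h1 : HasMFDerivAt I I (ρ ∘ ρ) x (D.comp D) := hDρ.comp x hD
    have h2 : D.comp D = D := by
      refine hasMFDerivAt_unique h1 (hD.congr_of_eventuallyEq ?_)
      filter_upwards [hO.mem_nhds hx] with y hy using hid y hy
    exact fun v => congrArg (fun L : E →L[ℝ] E => L v) h2
  let P : E →L[ℝ] E := ContinuousLinearMap.id ℝ E - D
  -- The first term measures `y - ρ y` along `ker D`, the second records `ρ y` along `range D`. The
  -- derivative at `x` is `(1 - D)(1 - D) + D D = 1`.
  let g : X → E := fun y => P (c y - c (ρ y)) + D (c (ρ y))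
  have hO1 : IsOpen (O ∩ ρ ⁻¹' c.source) := hρ.continuousOn.isOpen_inter_preimage hO c.open_source
  have hcρ : ContMDiffOn I 𝓘(ℝ, E) ∞ (fun y => c (ρ y)) (O ∩ ρ ⁻¹' c.source ∩ c.source) :=
    hc.smooth.comp (hρ.mono fun y hy => hy.1.1) fun y hy => hy.1.2
  have hg : ContMDiffOn I 𝓘(ℝ, E) ∞ g (O ∩ ρ ⁻¹' c.source ∩ c.source) :=
    (P.contMDiff.comp_contMDiffOn ((hc.smooth.mono inter_subset_right).sub hcρ)).add
      (D.contMDiff.comp_contMDiffOn hcρ)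
  have hg' : HasMFDerivAt I 𝓘(ℝ, E) g x (ContinuousLinearMap.id ℝ E) := by
    have h0 := hasMFDerivAt_coordAt_self (I := I) x
    have h1 : HasMFDerivAt I 𝓘(ℝ, E) c (ρ x) (ContinuousLinearMap.id ℝ E) := by rw [hfix]; exact h0
    have h2 : HasMFDerivAt I 𝓘(ℝ, E) (fun y => c (ρ y)) x D := h1.comp x hD
    have h3 : HasMFDerivAt I 𝓘(ℝ, E) (fun y => P (c y - c (ρ y))) x
        (P.comp (ContinuousLinearMap.id ℝ E - D)) := P.hasMFDerivAt.comp x (h0.sub h2)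
    have h4 : HasMFDerivAt I 𝓘(ℝ, E) (fun y => D (c (ρ y))) x (D.comp D) :=
      D.hasMFDerivAt.comp x h2
    have h5 : P.comp (ContinuousLinearMap.id ℝ E - D) + D.comp D = ContinuousLinearMap.id ℝ E := by
      ext v
      simp [P, hDD]
    exact h5 ▸ h3.add h4
  have hxO : x ∈ O ∩ ρ ⁻¹' c.source ∩ c.source := ⟨⟨hx, by rwa [mem_preimage, hfix]⟩, hxc⟩
  obtain ⟨κ, hκ, hxκ, hκO, hκg⟩ := exists_coord_of_bijective (hO1.inter c.open_source) hg
    hxO (g' := ContinuousLinearEquiv.refl ℝ E) hg'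
  -- The point `ρ y` must also lie in the domain of `κ`: the converse inclusion shows `κ y = κ (ρ
  -- y)` and concludes by injectivity.
  have hS : IsOpen (O ∩ ρ ⁻¹' κ.source) := hρ.continuousOn.isOpen_inter_preimage hO κ.open_source
  refine ⟨_, (hκ.restrOpen hS).mem_maximalAtlas, ?_, LinearMap.range (D : E →ₗ[ℝ] E), ?_⟩
  · simp [hxκ, hx, hfix]
  intro y hy
  have hI : ∀ z : E, I (I.symm z) = z := fun z => I.right_inv (by simp [I.range_eq_univ])
  have hy' : y ∈ κ.source ∧ y ∈ O ∧ ρ y ∈ κ.source := by simpa using hy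
  obtain ⟨hyκ, hyO, hρy⟩ := hy'
  have he : ∀ w, ((κ.restrOpen _ hS).trans I.toHomeomorph.symm.toOpenPartialHomeomorph).extend I w =
      κ w := fun w => hI _
  rw [he, he, hκg hyκ, hκg hxκ, mem_ofPred_eq]
  have hgx : g x = D (c x) := by simp [g, hfix]
  have hgρ : g (ρ y) = D (c (ρ y)) := by simp [g, hid y hyO]
  constructor
  · rintro ⟨-, h⟩
    refine ⟨c y - c x, ?_⟩
    simp [g, h, hfix]
  · rintro ⟨v, hv⟩
    refine ⟨hyO, ?_⟩
    have h1 : P (g y - g x) = 0 := by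
      rw [← hv]
      simp [P, hDD]
    have h2 : P (c y - c (ρ y)) = 0 := by
      rw [← h1, hgx]
      simp [g, P, hDD]
    have h3 : g y = g (ρ y) := by
      rw [hgρ]
      simp only [g, h2, zero_add]
    rw [← hκg hyκ, ← hκg hρy] at h3
    exact (κ.injOn hyκ hρy h3).symm

end FixedPoints

/-! ### Canonical coordinates on cotangent bundles -/

section CotangentCoordinates

variable {E H : Type*} [NormedAddCommGroup E] [NormedSpace ℝ E] [TopologicalSpace H]
  {I : ModelWithCorners ℝ E H} [I.Boundaryless]
  {X : Type*} [TopologicalSpace X] [ChartedSpace H X] [IsManifold I ∞ X]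

/-- The canonical coordinates `(x, ξ)` on `T*X` induced by the preferred chart of `X` at `x₀`. -/
def cotCoord (I : ModelWithCorners ℝ E H) [I.Boundaryless] [IsManifold I ∞ X] (x₀ : X) :
    OpenPartialHomeomorph (CotangentBundle I X) (E × (E →L[ℝ] ℝ)) :=
  coordAt (cotangentModel I) (⟨x₀, 0⟩ : CotangentBundle I X)

theorem isCoord_cotCoord (x₀ : X) : IsCoord (cotangentModel I) (cotCoord I x₀) :=
  isCoord_coordAt _

theorem mem_cotCoord_source {x₀ : X} {l : CotangentBundle I X} :
    l ∈ (cotCoord I x₀).source ↔ l.1 ∈ (coordAt I x₀).source := by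
  simp only [cotCoord, coordAt_source, FiberBundle.chartedSpace_chartAt]
  simp only [mfld_simps]
  exact ⟨fun h => h.1.1, fun h => ⟨⟨h, mem_univ _⟩, h⟩⟩

theorem cotCoord_fst (x₀ : X) (l : CotangentBundle I X) :
    (cotCoord I x₀ l).1 = coordAt I x₀ l.1 := rfl

theorem isManifold_one : IsManifold I 1 X := IsManifold.of_le (n := ∞) (by simp)

theorem cotCoord_snd (x₀ : X) (l : CotangentBundle I X) :
    (cotCoord I x₀ l).2 = ContinuousLinearMap.inCoordinates E (TangentSpace I : X → Type _) ℝ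
      (Bundle.Trivial X ℝ) x₀ l.1 x₀ l.1 l.2 := by
  have h := hom_trivializationAt_apply (RingHom.id ℝ) (F₁ := E) (E₁ := (TangentSpace I : X → Type _))
    (F₂ := ℝ) (E₂ := Bundle.Trivial X ℝ) x₀ l
  exact congrArg Prod.snd h

theorem cotCoord_snd_apply_symmL (x₀ : X) (l : CotangentBundle I X) (w : E) :
    (cotCoord I x₀ l).2 w = l.2 ((trivializationAt E (TangentSpace I) x₀).symmL ℝ l.1 w) := by
  rw [cotCoord_snd, ContinuousLinearMap.inCoordinates]
  simp only [ContinuousLinearMap.comp_apply]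
  exact congrArg (fun L : ℝ →L[ℝ] ℝ => L _)
    (Bundle.Trivial.continuousLinearMapAt_trivialization ℝ X ℝ l.1)

/-- This relation characterizes the fiber coordinate as the covector transported by the chart, and
replaces the bundle trivialization in later arguments. -/
theorem cotCoord_snd_apply {x₀ : X} {l : CotangentBundle I X} (hl : l.1 ∈ (coordAt I x₀).source)
    (w : E) : (cotCoord I x₀ l).2 (mfderiv I 𝓘(ℝ, E) (coordAt I x₀) l.1 w) = l.2 w := by
  have := isManifold_one (I := I) (X := X)
  rw [coordAt_source] at hl
  have h1 := TangentBundle.continuousLinearMapAt_trivializationAt (I := I) hl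
  have h2 : (trivializationAt E (TangentSpace I) x₀).symmL ℝ l.1
      (mfderiv I 𝓘(ℝ, E) (extChartAt I x₀) l.1 w) = w := by
    rw [← h1]
    exact Bundle.Trivialization.symmL_continuousLinearMapAt
      (trivializationAt E (TangentSpace I) x₀) (b := l.1) (by simpa using hl) w
  exact (cotCoord_snd_apply_symmL x₀ l _).trans (congrArg l.2 h2)

theorem exists_mfderiv_coordAt_eq {x₀ x : X} (hx : x ∈ (coordAt I x₀).source) (w : E) :
    ∃ u : E, mfderiv I 𝓘(ℝ, E) (coordAt I x₀) x u = w :=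
  ⟨mfderiv 𝓘(ℝ, E) I (coordAt I x₀).symm (coordAt I x₀ x) w,
    congrArg (fun L : E →L[ℝ] E => L w) ((isCoord_coordAt (I := I) x₀).mfderiv_comp_symm hx)⟩

theorem cotCoord_snd_eq {x₀ : X} {l : CotangentBundle I X} (hl : l.1 ∈ (coordAt I x₀).source)
    {η : E →L[ℝ] ℝ} (h : ∀ w : E, η (mfderiv I 𝓘(ℝ, E) (coordAt I x₀) l.1 w) = l.2 w) :
    (cotCoord I x₀ l).2 = η := by
  ext w
  obtain ⟨u, rfl⟩ := exists_mfderiv_coordAt_eq hl w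
  exact (cotCoord_snd_apply hl u).trans (h u).symm

theorem cotCoord_symm_fst {x₀ : X} {z : E × (E →L[ℝ] ℝ)} (hz : z ∈ (cotCoord I x₀).target) :
    coordAt I x₀ ((cotCoord I x₀).symm z).1 = z.1 := by
  rw [← cotCoord_fst, (cotCoord I x₀).right_inv hz]

theorem cotCoord_self (l : CotangentBundle I X) :
    cotCoord I l.1 l = (coordAt I l.1 l.1, (l.2 : E →L[ℝ] ℝ)) := by
  refine Prod.ext rfl (cotCoord_snd_eq (mem_coordAt_source l.1) fun w => ?_)
  rw [mfderiv_coordAt_self]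
  rfl

theorem hasMFDerivAt_proj (l : CotangentBundle I X) :
    HasMFDerivAt (cotangentModel I) I (fun l : CotangentBundle I X => l.1) l
      (ContinuousLinearMap.fst ℝ E (E →L[ℝ] ℝ)) := by
  have h1 : HasMFDerivAt (cotangentModel I) 𝓘(ℝ, E) (fun l' => (coordAt (cotangentModel I) l l').1)
      l (ContinuousLinearMap.fst ℝ E (E →L[ℝ] ℝ)) :=
    (ContinuousLinearMap.fst ℝ E (E →L[ℝ] ℝ)).hasMFDerivAt.comp l (hasMFDerivAt_coordAt_self l)
  have h2 : HasMFDerivAt 𝓘(ℝ, E) I (coordAt I l.1).symm (coordAt (cotangentModel I) l l).1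
      (ContinuousLinearMap.id ℝ E) := hasMFDerivAt_coordAt_symm_self l.1
  refine (h2.comp l h1).congr_of_eventuallyEq ?_
  have h3 : ∀ᶠ l' : CotangentBundle I X in 𝓝 l, l' ∈ (cotCoord I l.1).source :=
    (cotCoord I l.1).open_source.mem_nhds (mem_cotCoord_source.2 (mem_coordAt_source l.1))
  filter_upwards [h3] with l' hl'
  exact ((coordAt I l.1).left_inv (mem_cotCoord_source.1 hl')).symm

theorem contMDiff_proj : ContMDiff (cotangentModel I) I ∞ (fun l : CotangentBundle I X => l.1) :=
  Bundle.contMDiff_proj _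

theorem continuous_proj : Continuous (fun l : CotangentBundle I X => l.1) :=
  contMDiff_proj.continuous

theorem HasVelocity.proj {c : ℝ → CotangentBundle I X} {t : ℝ} {v : E × (E →L[ℝ] ℝ)}
    (hc : HasVelocity (cotangentModel I) c t v) : HasVelocity I (fun u => (c u).1) t v.1 :=
  hc.comp (hasMFDerivAt_proj (c t))

theorem mfderiv_cotCoord_fst {x₀ : X} {l : CotangentBundle I X} (hl : l.1 ∈ (coordAt I x₀).source)
    (v : E × (E →L[ℝ] ℝ)) :
    (mfderiv (cotangentModel I) 𝓘(ℝ, E × (E →L[ℝ] ℝ)) (cotCoord I x₀) l v).1 =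
      mfderiv I 𝓘(ℝ, E) (coordAt I x₀) l.1 v.1 := by
  have h1 : HasMFDerivAt (cotangentModel I) 𝓘(ℝ, E) (fun l' => (cotCoord I x₀ l').1) l
      ((ContinuousLinearMap.fst ℝ E (E →L[ℝ] ℝ)).comp
        (mfderiv (cotangentModel I) 𝓘(ℝ, E × (E →L[ℝ] ℝ)) (cotCoord I x₀) l)) :=
    (ContinuousLinearMap.fst ℝ E (E →L[ℝ] ℝ)).hasMFDerivAt.comp l
      ((isCoord_cotCoord x₀).hasMFDerivAt (mem_cotCoord_source.2 hl))
  have h2 := ((isCoord_coordAt (I := I) x₀).hasMFDerivAt hl).comp l (hasMFDerivAt_proj l)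
  exact congrArg (fun L : E × (E →L[ℝ] ℝ) →L[ℝ] E => L v) (hasMFDerivAt_unique h1 h2)

/-- The form `ξ dx` has the same expression in every canonical chart, because fiber coordinates
transform inversely to base vectors. -/
theorem liouville_cotCoord {x₀ : X} {l : CotangentBundle I X} (hl : l.1 ∈ (coordAt I x₀).source)
    (v : E × (E →L[ℝ] ℝ)) :
    (cotCoord I x₀ l).2 (mfderiv (cotangentModel I) 𝓘(ℝ, E × (E →L[ℝ] ℝ)) (cotCoord I x₀) l v).1 =
      l.2 v.1 := by
  rw [mfderiv_cotCoord_fst hl]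
  exact cotCoord_snd_apply hl v.1

instance [T2Space X] : T2Space (CotangentBundle I X) := by
  refine ⟨fun l l' hne => ?_⟩
  by_cases h : l.1 = l'.1
  · have hl : l ∈ (cotCoord I l.1).source := mem_cotCoord_source.2 (mem_coordAt_source l.1)
    have hl' : l' ∈ (cotCoord I l.1).source :=
      mem_cotCoord_source.2 (h ▸ mem_coordAt_source l.1)
    have hne' : cotCoord I l.1 l ≠ cotCoord I l.1 l' := fun h => hne ((cotCoord I l.1).injOn hl hl' h)
    obtain ⟨u, v, hu, hv, hlu, hlv, huv⟩ := t2_separation hne'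
    refine ⟨_, _, (cotCoord I l.1).isOpen_inter_preimage hu,
      (cotCoord I l.1).isOpen_inter_preimage hv, ⟨hl, hlu⟩, ⟨hl', hlv⟩, ?_⟩
    exact Disjoint.mono inter_subset_right inter_subset_right (huv.preimage _)
  · obtain ⟨u, v, hu, hv, hlu, hlv, huv⟩ := t2_separation h
    exact ⟨_, _, hu.preimage continuous_proj, hv.preimage continuous_proj, hlu, hlv, huv.preimage _⟩

end CotangentCoordinates

/-! ### The canonical one-form and the symplectic form -/

section Symplectic

variable {E H : Type*} [NormedAddCommGroup E] [NormedSpace ℝ E] [TopologicalSpace H]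
  {I : ModelWithCorners ℝ E H} [I.Boundaryless]
  {X : Type*} [TopologicalSpace X] [ChartedSpace H X] [IsManifold I ∞ X]

/-- The symplectic form `∑ dxⱼ ∧ dξⱼ` of `E × E*`. -/
def stdSymplectic (v w : E × (E →L[ℝ] ℝ)) : ℝ := w.2 v.1 - v.2 w.1

theorem symplecticForm_eq (l : CotangentBundle I X) (v w : E × (E →L[ℝ] ℝ)) :
    symplecticForm I l v w = stdSymplectic v w := rfl

theorem stdSymplectic_nondegenerate [FiniteDimensional ℝ E] {v : E × (E →L[ℝ] ℝ)}
    (h : ∀ w, stdSymplectic v w = 0) : v = 0 := by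
  have h1 : v.1 = 0 := by
    by_contra hne
    obtain ⟨f, -, hf⟩ := exists_dual_vector ℝ v.1 (norm_ne_zero_iff.2 hne)
    have h2 := h (0, f)
    simp [stdSymplectic, hf] at h2
    exact hne h2
  have h2 : v.2 = 0 := by
    ext w
    have h3 := h (w, 0)
    simpa [stdSymplectic] using h3
  exact Prod.ext h1 h2

variable {Q : Type*} [NormedAddCommGroup Q] [NormedSpace ℝ Q]

/-- The symplectic form of `E × E*` is minus the exterior derivative of `ξ dx`. -/
theorem stdSymplectic_eq_fderiv {Ψ : Q → E × (E →L[ℝ] ℝ)} {q : Q} (hΨ : ContDiffAt ℝ ∞ Ψ q)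
    (δ ε : Q) :
    fderiv ℝ (fun q' => (Ψ q').2 (fderiv ℝ Ψ q' ε).1) q δ -
      fderiv ℝ (fun q' => (Ψ q').2 (fderiv ℝ Ψ q' δ).1) q ε =
      -stdSymplectic (fderiv ℝ Ψ q δ) (fderiv ℝ Ψ q ε) := by
  have h1 : DifferentiableAt ℝ Ψ q := hΨ.differentiableAt (by simp)
  have h2 : DifferentiableAt ℝ (fderiv ℝ Ψ) q :=
    (hΨ.fderiv_right (m := ∞) (by simp)).differentiableAt (by simp)
  have key : ∀ ε δ : Q, fderiv ℝ (fun q' => (Ψ q').2 (fderiv ℝ Ψ q' ε).1) q δ =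
      (fderiv ℝ Ψ q δ).2 (fderiv ℝ Ψ q ε).1 + (Ψ q).2 (fderiv ℝ (fderiv ℝ Ψ) q δ ε).1 := by
    intro ε δ
    have h3 : HasFDerivAt (fun q' => (Ψ q').2) ((ContinuousLinearMap.snd ℝ E _).comp (fderiv ℝ Ψ q)) q :=
      (ContinuousLinearMap.snd ℝ E (E →L[ℝ] ℝ)).hasFDerivAt.comp q h1.hasFDerivAt
    have h4 : HasFDerivAt (fun q' => (fderiv ℝ Ψ q' ε).1)
        ((ContinuousLinearMap.fst ℝ E (E →L[ℝ] ℝ)).comp ((fderiv ℝ (fderiv ℝ Ψ) q).flip ε)) q := by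
      refine (ContinuousLinearMap.fst ℝ E (E →L[ℝ] ℝ)).hasFDerivAt.comp q ?_
      have := h2.hasFDerivAt.clm_apply (hasFDerivAt_const ε q)
      simpa using this
    rw [(h3.clm_apply h4).fderiv]
    simp [add_comm]
  -- Antisymmetrization removes the second derivatives of `Ψ`, leaving only the symplectic form.
  have hsymm : IsSymmSndFDerivAt ℝ Ψ q := hΨ.isSymmSndFDerivAt
    (by simpa [minSmoothness_of_isRCLikeNormedField] using ENat.LEInfty.out)
  rw [key, key, hsymm.eq δ ε, stdSymplectic]
  ring

/-- The pull-back of the canonical one-form, in canonical coordinates. -/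
theorem exists_liouville_eq {Ψ : Q → CotangentBundle I X} {q : Q}
    (hΨ : ∀ᶠ q' in 𝓝 q, ContMDiffAt 𝓘(ℝ, Q) (cotangentModel I) ∞ Ψ q') {D : Q → Q →L[ℝ] E × (E →L[ℝ] ℝ)}
    (hD : ∀ᶠ q' in 𝓝 q, HasMFDerivAt 𝓘(ℝ, Q) (cotangentModel I) Ψ q' (D q')) :
    ∃ Ψ' : Q → E × (E →L[ℝ] ℝ), ContDiffAt ℝ ∞ Ψ' q ∧ fderiv ℝ Ψ' q = D q ∧
      ∀ v : Q, (fun q' => (Ψ q').2 (D q' v).1) =ᶠ[𝓝 q]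
        fun q' => (Ψ' q').2 (fderiv ℝ Ψ' q' v).1 := by
  set x₀ := (Ψ q).1
  let Ψ' : Q → E × (E →L[ℝ] ℝ) := fun q' => cotCoord I x₀ (Ψ q')
  have hs : ∀ᶠ q' in 𝓝 q, (Ψ q').1 ∈ (coordAt I x₀).source := by
    have : ∀ᶠ q' in 𝓝 q, Ψ q' ∈ (cotCoord I x₀).source :=
      hΨ.self_of_nhds.continuousAt.eventually_mem ((cotCoord I x₀).open_source.mem_nhds
        (mem_cotCoord_source.2 (mem_coordAt_source x₀)))
    filter_upwards [this] with q' hq' using mem_cotCoord_source.1 hq'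
  have hΨ' : ContDiffAt ℝ ∞ Ψ' q := by
    refine ContMDiffAt.contDiffAt ?_
    exact ((isCoord_cotCoord x₀).contMDiffAt (mem_cotCoord_source.2 hs.self_of_nhds)).comp q
      hΨ.self_of_nhds
  let K : CotangentBundle I X → (E × (E →L[ℝ] ℝ)) →L[ℝ] E × (E →L[ℝ] ℝ) := fun l =>
    mfderiv (cotangentModel I) 𝓘(ℝ, E × (E →L[ℝ] ℝ)) (cotCoord I x₀) l
  have hder : ∀ᶠ q' in 𝓝 q, fderiv ℝ Ψ' q' = (K (Ψ q')).comp (D q') := by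
    filter_upwards [hs, hD] with q' hs' hD'
    have h : HasMFDerivAt 𝓘(ℝ, Q) 𝓘(ℝ, E × (E →L[ℝ] ℝ)) Ψ' q' ((K (Ψ q')).comp (D q')) :=
      ((isCoord_cotCoord x₀).hasMFDerivAt (mem_cotCoord_source.2 hs')).comp q' hD'
    have h' : HasFDerivAt Ψ' ((K (Ψ q')).comp (D q')) q' := hasMFDerivAt_iff_hasFDerivAt.1 h
    exact h'.fderiv
  have hθ : ∀ v : Q, (fun q' => (Ψ q').2 (D q' v).1) =ᶠ[𝓝 q]
      fun q' => (Ψ' q').2 (fderiv ℝ Ψ' q' v).1 := by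
    intro v
    filter_upwards [hs, hder] with q' hs' hD'
    rw [hD']
    exact (liouville_cotCoord hs' (D q' v)).symm
  refine ⟨Ψ', hΨ', ?_, hθ⟩
  -- The chart is centered at `Ψ q`, so its derivative there is the identity: at `q` itself, though
  -- not nearby, the coordinate derivative is `D q`.
  rw [hder.self_of_nhds]
  exact congrArg (fun L : (E × (E →L[ℝ] ℝ)) →L[ℝ] E × (E →L[ℝ] ℝ) => L.comp (D q))
    (mfderiv_coordAt_self (I := cotangentModel I) (Ψ q))

/-- The symplectic form of `T*X` is minus the exterior derivative of the canonical one-form. -/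
theorem symplecticForm_eq_fderiv {Ψ : Q → CotangentBundle I X} {q : Q}
    (hΨ : ∀ᶠ q' in 𝓝 q, ContMDiffAt 𝓘(ℝ, Q) (cotangentModel I) ∞ Ψ q') {D : Q → Q →L[ℝ] E × (E →L[ℝ] ℝ)}
    (hD : ∀ᶠ q' in 𝓝 q, HasMFDerivAt 𝓘(ℝ, Q) (cotangentModel I) Ψ q' (D q')) (δ ε : Q) :
    fderiv ℝ (fun q' => (Ψ q').2 (D q' ε).1) q δ - fderiv ℝ (fun q' => (Ψ q').2 (D q' δ).1) q ε =
      -symplecticForm I (Ψ q) (D q δ) (D q ε) := by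
  obtain ⟨Ψ', hΨ', hq, hθ⟩ := exists_liouville_eq hΨ hD
  rw [(hθ ε).fderiv_eq, (hθ δ).fderiv_eq, symplecticForm_eq, ← hq]
  exact stdSymplectic_eq_fderiv hΨ' δ ε

theorem differentiableAt_liouville {Ψ : Q → CotangentBundle I X} {q : Q}
    (hΨ : ∀ᶠ q' in 𝓝 q, ContMDiffAt 𝓘(ℝ, Q) (cotangentModel I) ∞ Ψ q') {D : Q → Q →L[ℝ] E × (E →L[ℝ] ℝ)}
    (hD : ∀ᶠ q' in 𝓝 q, HasMFDerivAt 𝓘(ℝ, Q) (cotangentModel I) Ψ q' (D q')) (v : Q) :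
    DifferentiableAt ℝ (fun q' => (Ψ q').2 (D q' v).1) q := by
  obtain ⟨Ψ', hΨ', -, hθ⟩ := exists_liouville_eq hΨ hD
  refine DifferentiableAt.congr_of_eventuallyEq ?_ (hθ v)
  have h1 : DifferentiableAt ℝ (fderiv ℝ Ψ') q :=
    (hΨ'.fderiv_right (m := ∞) (by simp)).differentiableAt (by simp)
  exact (hΨ'.differentiableAt (by simp)).snd.clm_apply
    (h1.clm_apply (differentiableAt_const v)).fst

theorem liouville_cotCoord_symm {x₀ : X} {z : E × (E →L[ℝ] ℝ)} (hz : z ∈ (cotCoord I x₀).target)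
    {D : (E × (E →L[ℝ] ℝ)) →L[ℝ] E × (E →L[ℝ] ℝ)}
    (hD : HasMFDerivAt 𝓘(ℝ, E × (E →L[ℝ] ℝ)) (cotangentModel I) (cotCoord I x₀).symm z D)
    (u : E × (E →L[ℝ] ℝ)) : ((cotCoord I x₀).symm z).2 (D u).1 = z.2 u.1 := by
  set κ := cotCoord I x₀
  have hκ : IsCoord (cotangentModel I) κ := isCoord_cotCoord x₀
  have h1 : D = mfderiv 𝓘(ℝ, E × (E →L[ℝ] ℝ)) (cotangentModel I) κ.symm z :=
    hasMFDerivAt_unique hD (hκ.hasMFDerivAt_symm hz)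
  have h2 := liouville_cotCoord (x₀ := x₀) (l := κ.symm z)
    (mem_cotCoord_source.1 (κ.map_target hz)) (D u)
  have h3 := congrArg (fun L : (E × (E →L[ℝ] ℝ)) →L[ℝ] E × (E →L[ℝ] ℝ) => L u)
    (hκ.mfderiv_comp_symm (κ.map_target hz))
  rw [κ.right_inv hz] at h3
  rw [← h2]
  change (κ (κ.symm z)).2 _ = _
  rw [κ.right_inv hz, h1]
  exact congrArg (fun p : E × (E →L[ℝ] ℝ) => z.2 p.1) h3

/-- The symplectic form of `T*X` in any of the preferred canonical charts. -/
theorem stdSymplectic_cotCoord {x₀ : X} {l : CotangentBundle I X}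
    (hl : l.1 ∈ (coordAt I x₀).source) (v w : E × (E →L[ℝ] ℝ)) :
    stdSymplectic (mfderiv (cotangentModel I) 𝓘(ℝ, E × (E →L[ℝ] ℝ)) (cotCoord I x₀) l v)
      (mfderiv (cotangentModel I) 𝓘(ℝ, E × (E →L[ℝ] ℝ)) (cotCoord I x₀) l w) =
      symplecticForm I l v w := by
  set κ := cotCoord I x₀
  have hκ : IsCoord (cotangentModel I) κ := isCoord_cotCoord x₀
  have hl' : l ∈ κ.source := mem_cotCoord_source.2 hl
  let K : (E × (E →L[ℝ] ℝ)) →L[ℝ] E × (E →L[ℝ] ℝ) :=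
    mfderiv (cotangentModel I) 𝓘(ℝ, E × (E →L[ℝ] ℝ)) κ l
  let D : E × (E →L[ℝ] ℝ) → (E × (E →L[ℝ] ℝ)) →L[ℝ] E × (E →L[ℝ] ℝ) := fun z => mfderiv 𝓘(ℝ, E × (E →L[ℝ] ℝ)) (cotangentModel I) κ.symm z
  have hDK : ∀ v, D (κ l) (K v) = v := fun v =>
    congrArg (fun L : (E × (E →L[ℝ] ℝ)) →L[ℝ] E × (E →L[ℝ] ℝ) => L v) (hκ.mfderiv_symm_comp hl')
  have htgt : ∀ᶠ z in 𝓝 (κ l), z ∈ κ.target := κ.open_target.mem_nhds (κ.map_source hl')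
  -- The form is defined through a different chart at each point. The invariant formula `ω = -dα`
  -- compares them, since the inverse of any canonical chart pulls `α` back to `ξ dx`.
  have h1 := symplecticForm_eq_fderiv (I := I) (Ψ := κ.symm) (q := κ l) (D := D)
    (htgt.mono fun z hz => hκ.contMDiffAt_symm hz) (htgt.mono fun z hz => hκ.hasMFDerivAt_symm hz)
    (K v) (K w)
  have hθ : ∀ u, (fun z => (κ.symm z).2 (D z u).1) =ᶠ[𝓝 (κ l)] fun z => z.2 u.1 := by
    intro u
    filter_upwards [htgt] with z hz
    exact liouville_cotCoord_symm hz (hκ.hasMFDerivAt_symm hz) u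
  have hd : ∀ u v : E × (E →L[ℝ] ℝ), fderiv ℝ (fun z : E × (E →L[ℝ] ℝ) => z.2 u.1) (κ l) v =
      v.2 u.1 := by
    intro u v
    have : HasFDerivAt (fun z : E × (E →L[ℝ] ℝ) => z.2 u.1)
      ((ContinuousLinearMap.apply ℝ ℝ u.1).comp (ContinuousLinearMap.snd ℝ E (E →L[ℝ] ℝ))) (κ l) :=
      ((ContinuousLinearMap.apply ℝ ℝ u.1).comp
        (ContinuousLinearMap.snd ℝ E (E →L[ℝ] ℝ))).hasFDerivAt
    rw [this.fderiv]
    rfl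
  have hlast : symplecticForm I (κ.symm (κ l)) (D (κ l) (K v)) (D (κ l) (K w)) =
      symplecticForm I l v w := by
    rw [hDK, hDK]
    rfl
  rw [(hθ (K w)).fderiv_eq, (hθ (K v)).fderiv_eq, hd, hd, hlast] at h1
  change (K w).2 (K v).1 - (K v).2 (K w).1 = _
  linarith

end Symplectic

/-! ### Smooth maps into cotangent bundles -/

section Smoothness

variable {E H : Type*} [NormedAddCommGroup E] [NormedSpace ℝ E] [TopologicalSpace H]
  {I : ModelWithCorners ℝ E H} [I.Boundaryless]
  {X : Type*} [TopologicalSpace X] [ChartedSpace H X] [IsManifold I ∞ X]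
  {E' H' : Type*} [NormedAddCommGroup E'] [NormedSpace ℝ E'] [TopologicalSpace H']
  {I' : ModelWithCorners ℝ E' H'} [I'.Boundaryless]
  {Y : Type*} [TopologicalSpace Y] [ChartedSpace H' Y] [IsManifold I' ∞ Y]
  {E'' H'' : Type*} [NormedAddCommGroup E''] [NormedSpace ℝ E''] [TopologicalSpace H'']
  {I'' : ModelWithCorners ℝ E'' H''}
  {Q : Type*} [TopologicalSpace Q] [ChartedSpace H'' Q]

theorem eventually_mem_coordAt {f : Q → X} {q₀ : Q} (hf : ContMDiffAt I'' I ∞ f q₀) :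
    ∀ᶠ q in 𝓝 q₀, f q ∈ (coordAt I (f q₀)).source :=
  hf.continuousAt.eventually_mem ((coordAt I (f q₀)).open_source.mem_nhds (mem_coordAt_source _))

theorem contMDiffAt_cotangent_iff {f : Q → CotangentBundle I X} {q₀ : Q} :
    ContMDiffAt I'' (cotangentModel I) ∞ f q₀ ↔ ContMDiffAt I'' I ∞ (fun q => (f q).1) q₀ ∧
      ContMDiffAt I'' 𝓘(ℝ, E →L[ℝ] ℝ) ∞ (fun q => (cotCoord I (f q₀).1 (f q)).2) q₀ := by
  refine (contMDiffAt_hom_bundle f).trans (and_congr_right fun _ => ?_)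
  have h : (fun q => (cotCoord I (f q₀).1 (f q)).2) = fun q =>
    ContinuousLinearMap.inCoordinates E (TangentSpace I : X → Type _) ℝ
      (Bundle.Trivial X ℝ) (f q₀).1 (f q).1 (f q₀).1 (f q).1 (f q).2 :=
    funext fun q => cotCoord_snd _ _
  rw [h]

/-- Smoothness into `T*X` can be checked on the base point and on any smooth `η` that represents the
covectors in the fixed base chart. -/
theorem contMDiffAt_cotangent {f : Q → CotangentBundle I X} {q₀ : Q}
    (hf : ContMDiffAt I'' I ∞ (fun q => (f q).1) q₀) {η : Q → E →L[ℝ] ℝ}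
    (hη : ContMDiffAt I'' 𝓘(ℝ, E →L[ℝ] ℝ) ∞ η q₀)
    (h : ∀ᶠ q in 𝓝 q₀, ∀ w : E,
      η q (mfderiv I 𝓘(ℝ, E) (coordAt I (f q₀).1) (f q).1 w) = (f q).2 w) :
    ContMDiffAt I'' (cotangentModel I) ∞ f q₀ := by
  refine contMDiffAt_cotangent_iff.2 ⟨hf, hη.congr_of_eventuallyEq ?_⟩
  filter_upwards [h, eventually_mem_coordAt hf] with q hq hq' using cotCoord_snd_eq hq' hq

/-- Pull-back of covectors along a smooth family of maps is smooth. -/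
theorem ContMDiffAt.cotangent_pullback {q₀ : Q} {l : Q → CotangentBundle I' Y} {b : Q → X}
    {f : Q → X → Y} (hl : ContMDiffAt I'' (cotangentModel I') ∞ l q₀)
    (hb : ContMDiffAt I'' I ∞ b q₀)
    (hf : ContMDiffAt (I''.prod I) I' ∞ (Function.uncurry f) (q₀, b q₀))
    (hfe : ∀ᶠ p in 𝓝 (q₀, b q₀), ContMDiffAt (I''.prod I) I' ∞ (Function.uncurry f) p)
    (hfb : ∀ᶠ q in 𝓝 q₀, f q (b q) = (l q).1) [IsManifold I'' ∞ Q] :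
    ContMDiffAt I'' (cotangentModel I) ∞ (fun q => (⟨b q,
      ((l q).2 : E' →L[ℝ] ℝ).comp (mfderiv I I' (f q) (b q) : E →L[ℝ] E')⟩ :
        CotangentBundle I X)) q₀ := by
  obtain ⟨hl1, hl2⟩ := contMDiffAt_cotangent_iff.1 hl
  set y₀ := (l q₀).1
  set c := coordAt I (b q₀)
  set c' := coordAt I' y₀
  have hc : IsCoord I c := isCoord_coordAt _
  have hc' : IsCoord I' c' := isCoord_coordAt _
  have hbc : b q₀ ∈ c.source := mem_coordAt_source _
  have hf0 : f q₀ (b q₀) = y₀ := hfb.self_of_nhds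
  -- In base charts the family becomes a map between vector spaces with parameters, whose derivative
  -- depends smoothly on them. The fiber coordinate of the pull-back is then a composition of smooth
  -- linear maps.
  let g : Q → E → E' := fun q x => c' (f q (c.symm x))
  have hcb : ContMDiffAt I'' 𝓘(ℝ, E) ∞ (fun q => c (b q)) q₀ := (hc.contMDiffAt hbc).comp q₀ hb
  have hφ : ContMDiffAt (I''.prod 𝓘(ℝ, E)) (I''.prod I) ∞ (fun p : Q × E => (p.1, c.symm p.2))
      (q₀, c (b q₀)) :=
    contMDiffAt_fst.prodMk (ContMDiffAt.comp (q₀, c (b q₀)) (f := fun p : Q × E => p.2)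
      (hc.contMDiffAt_symm (c.map_source hbc)) contMDiffAt_snd)
  have hg : ContMDiffAt (I''.prod 𝓘(ℝ, E)) 𝓘(ℝ, E') ∞ (Function.uncurry g) (q₀, c (b q₀)) := by
    have h1 : ContMDiffAt I' 𝓘(ℝ, E') ∞ c' (f q₀ (c.symm (c (b q₀)))) := by
      rw [c.left_inv hbc, hf0]
      exact hc'.contMDiffAt (mem_coordAt_source _)
    have h2 : ContMDiffAt (I''.prod I) I' ∞ (Function.uncurry f) (q₀, c.symm (c (b q₀))) := by
      rw [c.left_inv hbc]
      exact hf
    have h3 : ContMDiffAt (I''.prod 𝓘(ℝ, E)) I' ∞ (fun p : Q × E => f p.1 (c.symm p.2))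
      (q₀, c (b q₀)) := h2.comp (q₀, c (b q₀)) hφ
    exact ContMDiffAt.comp (I' := I') (g := c') (q₀, c (b q₀)) h1 h3
  let φ : Q → E →L[ℝ] E' := fun q => mfderiv 𝓘(ℝ, E) 𝓘(ℝ, E') (g q) (c (b q))
  have hd : ContMDiffAt I'' 𝓘(ℝ, E →L[ℝ] E') ∞ φ q₀ := by
    have h := ContMDiffAt.mfderiv g (fun q => c (b q)) hg hcb (m := ∞) (by simp)
    have e := inTangentCoordinates_model_space (I := 𝓘(ℝ, E)) (I' := 𝓘(ℝ, E'))
      (fun q => c (b q)) (fun q => g q (c (b q))) φ q₀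
    exact h.congr_of_eventuallyEq (Eventually.of_forall fun q => (congrFun e q).symm)
  refine contMDiffAt_cotangent hb (hl2.clm_comp hd) ?_
  have hlim : Tendsto (fun q => (q, b q)) (𝓝 q₀) (𝓝 (q₀, b q₀)) :=
    (continuousAt_id.prodMk hb.continuousAt)
  filter_upwards [hfb, eventually_mem_coordAt hb, eventually_mem_coordAt hl1, hlim.eventually hfe]
    with q hq hq1 hq2 hq3 w
  have hfq : ContMDiffAt I I' ∞ (f q) (b q) := by
    have := ContMDiffAt.comp (b q) (f := fun x : X => (q, x)) hq3
      (contMDiffAt_const.prodMk contMDiffAt_id)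
    exact this
  have hD : HasMFDerivAt I I' (f q) (b q) (mfderiv I I' (f q) (b q)) :=
    (hfq.mdifferentiableAt (by simp)).hasMFDerivAt
  have h1 : HasMFDerivAt I' 𝓘(ℝ, E') c' (f q (b q)) (mfderiv I' 𝓘(ℝ, E') c' (l q).1) := by
    rw [hq]; exact hc'.hasMFDerivAt hq2
  obtain ⟨γ, hγ0, hγ, -⟩ := exists_curve (I := I) (b q) w
  have hgd : HasMFDerivAt 𝓘(ℝ, E) 𝓘(ℝ, E') (g q) (c (b q))
      (mfderiv 𝓘(ℝ, E) 𝓘(ℝ, E') (g q) (c (b q))) := by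
    refine MDifferentiableAt.hasMFDerivAt ?_
    have h2 : MDifferentiableAt I I' (f q) (c.symm (c (b q))) := by
      rw [c.left_inv hq1]; exact hD.mdifferentiableAt
    have h3 : MDifferentiableAt I' 𝓘(ℝ, E') c' (f q (c.symm (c (b q)))) := by
      rw [c.left_inv hq1]; exact h1.mdifferentiableAt
    exact h3.comp (c (b q)) (h2.comp (c (b q))
      (hc.hasMFDerivAt_symm (c.map_source hq1)).mdifferentiableAt)
  have e1 := (hγ.comp_of_eq hD hγ0).comp_of_eq h1 (congrArg (f q) hγ0)
  have e2 := (hγ.comp_of_eq (hc.hasMFDerivAt hq1) hγ0).comp_of_eq hgd (congrArg c hγ0)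
  have hγs : ∀ᶠ t in 𝓝 (0 : ℝ), γ t ∈ c.source :=
    hγ.continuousAt.eventually_mem (c.open_source.mem_nhds (by rw [hγ0]; exact hq1))
  -- Chain rule: both sides are the velocity of the image of `γ`, followed either through the charts
  -- first or through `f q` first.
  have e3 : mfderiv 𝓘(ℝ, E) 𝓘(ℝ, E') (g q) (c (b q)) (mfderiv I 𝓘(ℝ, E) c (b q) w) =
      mfderiv I' 𝓘(ℝ, E') c' (l q).1 (mfderiv I I' (f q) (b q) w) := by
    refine e2.unique (e1.congr ?_)
    filter_upwards [hγs] with t ht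
    change c' (f q (c.symm (c (γ t)))) = _
    rw [c.left_inv ht]
  exact (congrArg (cotCoord I' y₀ (l q)).2 e3).trans (cotCoord_snd_apply hq2 _)

theorem ContMDiffAt.cotangent_add_smul {q₀ : Q} {b : Q → X} {ξ ξ' : Q → E →L[ℝ] ℝ} {a a' : Q → ℝ}
    (ha : ContMDiffAt I'' 𝓘(ℝ, ℝ) ∞ a q₀) (ha' : ContMDiffAt I'' 𝓘(ℝ, ℝ) ∞ a' q₀)
    (h : ContMDiffAt I'' (cotangentModel I) ∞ (fun q => (⟨b q, ξ q⟩ : CotangentBundle I X)) q₀)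
    (h' : ContMDiffAt I'' (cotangentModel I) ∞ (fun q => (⟨b q, ξ' q⟩ : CotangentBundle I X)) q₀) :
    ContMDiffAt I'' (cotangentModel I) ∞
      (fun q => (⟨b q, (a q • ξ q + a' q • ξ' q : E →L[ℝ] ℝ)⟩ : CotangentBundle I X)) q₀ := by
  obtain ⟨h1, h2⟩ := contMDiffAt_cotangent_iff.1 h
  obtain ⟨-, h3⟩ := contMDiffAt_cotangent_iff.1 h'
  refine contMDiffAt_cotangent h1 ((ha.smul h2).add (ha'.smul h3)) ?_
  filter_upwards [eventually_mem_coordAt h1] with q hq w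
  have e1 := cotCoord_snd_apply (l := (⟨b q, ξ q⟩ : CotangentBundle I X)) hq w
  have e2 := cotCoord_snd_apply (l := (⟨b q, ξ' q⟩ : CotangentBundle I X)) hq w
  exact congrArg₂ (fun x y : ℝ => a q * x + a' q * y) e1 e2

theorem contMDiff_fiber_smul : ContMDiff (𝓘(ℝ, ℝ).prod (cotangentModel I)) (cotangentModel I) ∞
    (fun q : ℝ × CotangentBundle I X => (⟨q.2.1, q.1 • q.2.2⟩ : CotangentBundle I X)) := by
  intro q₀
  have h := ContMDiffAt.cotangent_add_smul (I := I) (I'' := 𝓘(ℝ, ℝ).prod (cotangentModel I))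
    (q₀ := q₀) (b := fun q : ℝ × CotangentBundle I X => q.2.1)
    (ξ := fun q => q.2.2) (ξ' := fun q => q.2.2) (a := fun q => q.1) (a' := fun _ => 0)
    contMDiffAt_fst contMDiffAt_const contMDiffAt_snd contMDiffAt_snd
  refine h.congr_of_eventuallyEq (Eventually.of_forall fun q => ?_)
  have : (q.1 • q.2.2 : E →L[ℝ] ℝ) = (q.1 • q.2.2 + (0 : ℝ) • q.2.2 : E →L[ℝ] ℝ) := by simp
  exact congrArg (fun ξ : E →L[ℝ] ℝ => (⟨q.2.1, ξ⟩ : CotangentBundle I X)) this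

theorem cotCoord_snd_eq_zero_iff {x₀ : X} {l : CotangentBundle I X}
    (hl : l.1 ∈ (coordAt I x₀).source) : (cotCoord I x₀ l).2 = 0 ↔ l.2 = 0 := by
  constructor
  · intro h
    ext w
    have := cotCoord_snd_apply hl w
    rw [h] at this
    exact this.symm
  · intro h
    refine cotCoord_snd_eq hl fun w => ?_
    exact (congrArg (fun L : E →L[ℝ] ℝ => L w) h).symm

theorem isOpen_ne_zero : IsOpen {l : CotangentBundle I X | l.2 ≠ 0} := by
  rw [isOpen_iff_mem_nhds]
  intro l hl
  have h1 : ∀ᶠ l' in 𝓝 l, l' ∈ (cotCoord I l.1).source :=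
    (cotCoord I l.1).open_source.mem_nhds (mem_cotCoord_source.2 (mem_coordAt_source _))
  have h2 : ContinuousAt (fun l' => (cotCoord I l.1 l').2) l :=
    continuous_snd.continuousAt.comp
      ((isCoord_cotCoord l.1).contMDiffAt (mem_cotCoord_source.2 (mem_coordAt_source _))).continuousAt
  have h3 := h2.eventually_ne ((cotCoord_snd_eq_zero_iff (mem_coordAt_source _)).not.2 hl)
  filter_upwards [h1, h3] with l' h4 h5
  exact (cotCoord_snd_eq_zero_iff (mem_cotCoord_source.1 h4)).not.1 h5

end Smoothness

/-! ### Integral curves of Hamiltonian vector fields -/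

section Velocity

variable {E H : Type*} [NormedAddCommGroup E] [NormedSpace ℝ E] [TopologicalSpace H]
  {I : ModelWithCorners ℝ E H} {X : Type*} [TopologicalSpace X] [ChartedSpace H X]

theorem HasVelocity.comp_hasDerivAt {c : ℝ → X} {f : ℝ → ℝ} {t a : ℝ} {v : E}
    (hc : HasVelocity I c (f t) v) (hf : HasDerivAt f a t) :
    HasVelocity I (fun u => c (f u)) t (a • v) := by
  have h := HasVelocity.comp (I := 𝓘(ℝ, ℝ)) (hasVelocity_iff_hasDerivAt.2 hf) hc
  simpa using h

theorem HasVelocity.comp_add_const {c : ℝ → X} {t a : ℝ} {v : E} (hc : HasVelocity I c (t + a) v) :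
    HasVelocity I (fun u => c (u + a)) t v := by
  have h := HasVelocity.comp_hasDerivAt (f := fun u => u + a) hc ((hasDerivAt_id t).add_const a)
  simpa using h

theorem ContMDiffOn.hasMFDerivAt_of_isOpen {E' H' : Type*} [NormedAddCommGroup E'] [NormedSpace ℝ E']
    [TopologicalSpace H'] {I' : ModelWithCorners ℝ E' H'} {Y : Type*} [TopologicalSpace Y]
    [ChartedSpace H' Y] {f : X → Y} {O : Set X} (hf : ContMDiffOn I I' ∞ f O) (hO : IsOpen O)
    {x : X} (hx : x ∈ O) : HasMFDerivAt I I' f x (mfderiv I I' f x) :=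
  ((hf.contMDiffAt (hO.mem_nhds hx)).mdifferentiableAt (by simp)).hasMFDerivAt

end Velocity

section Hamiltonian

variable {E H : Type*} [NormedAddCommGroup E] [NormedSpace ℝ E] [FiniteDimensional ℝ E]
  [TopologicalSpace H]
  {I : ModelWithCorners ℝ E H} [I.Boundaryless]
  {X : Type*} [TopologicalSpace X] [ChartedSpace H X] [IsManifold I ∞ X]

/-- The symplectic form of `E × E*`, as an isomorphism with the dual. -/
def flatEquiv (E : Type*) [NormedAddCommGroup E] [NormedSpace ℝ E] [FiniteDimensional ℝ E] :
    (E × (E →L[ℝ] ℝ)) ≃ₗ[ℝ] ((E × (E →L[ℝ] ℝ)) →L[ℝ] ℝ) :=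
  LinearEquiv.ofInjectiveOfFinrankEq
    { toFun := fun v => (ContinuousLinearMap.apply ℝ ℝ v.1).comp
          (ContinuousLinearMap.snd ℝ E (E →L[ℝ] ℝ)) -
          v.2.comp (ContinuousLinearMap.fst ℝ E (E →L[ℝ] ℝ))
      map_add' := fun v w => by
        ext
        · simp
          ring
        · simp
      map_smul' := fun a v => by ext <;> simp }
    ((injective_iff_map_eq_zero _).2 fun v hv => stdSymplectic_nondegenerate fun w =>
      congrArg (fun L : (E × (E →L[ℝ] ℝ)) →L[ℝ] ℝ => L w) hv)
    (by
      rw [← (LinearMap.toContinuousLinearMap (𝕜 := ℝ) (E := E × (E →L[ℝ] ℝ)) (F' := ℝ)).finrank_eq]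
      exact (Subspace.dual_finrank_eq (K := ℝ) (V := E × (E →L[ℝ] ℝ))).symm)

/-- The Hamiltonian vector of a linear form. -/
def sharp (E : Type*) [NormedAddCommGroup E] [NormedSpace ℝ E] [FiniteDimensional ℝ E] :
    ((E × (E →L[ℝ] ℝ)) →L[ℝ] ℝ) →L[ℝ] (E × (E →L[ℝ] ℝ)) :=
  ⟨(flatEquiv E).symm.toLinearMap, LinearMap.continuous_of_finiteDimensional (𝕜 := ℝ)
    (E := (E × (E →L[ℝ] ℝ)) →L[ℝ] ℝ) (F' := E × (E →L[ℝ] ℝ)) _⟩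

theorem stdSymplectic_sharp (L : (E × (E →L[ℝ] ℝ)) →L[ℝ] ℝ) (w : E × (E →L[ℝ] ℝ)) :
    stdSymplectic (sharp E L) w = L w := by
  have h : flatEquiv E (sharp E L) = L := (flatEquiv E).apply_symm_apply L
  conv_rhs => rw [← h]
  rfl

theorem eq_sharp {v : E × (E →L[ℝ] ℝ)} {L : (E × (E →L[ℝ] ℝ)) →L[ℝ] ℝ}
    (h : ∀ w, stdSymplectic v w = L w) : v = sharp E L := by
  refine sub_eq_zero.1 (stdSymplectic_nondegenerate fun w => ?_)
  have h1 := h w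
  have h2 := stdSymplectic_sharp L w
  simp only [stdSymplectic, Prod.fst_sub, Prod.snd_sub, map_sub,
    sub_apply] at *
  linarith

/-- `c` satisfies Hamilton's equation for `p` at time `t`. -/
def IsHamiltonAt (p : CotangentBundle I X → ℝ) (c : ℝ → CotangentBundle I X) (t : ℝ) : Prop :=
  ∃ v : E × (E →L[ℝ] ℝ), HasVelocity (cotangentModel I) c t v ∧
    ∀ w : E × (E →L[ℝ] ℝ), symplecticForm I (c t) v w =
      mfderiv (cotangentModel I) 𝓘(ℝ, ℝ) p (c t) w

variable {p : CotangentBundle I X → ℝ} {c c' : ℝ → CotangentBundle I X} {t : ℝ}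

theorem IsHamiltonAt.continuousAt (h : IsHamiltonAt p c t) : ContinuousAt c t :=
  let ⟨_, h1, _⟩ := h
  h1.continuousAt

theorem IsHamiltonAt.congr (h : IsHamiltonAt p c t) (hc : c' =ᶠ[𝓝 t] c) : IsHamiltonAt p c' t := by
  obtain ⟨v, h1, h2⟩ := h
  refine ⟨v, h1.congr hc, fun w => ?_⟩
  rw [hc.self_of_nhds]
  exact h2 w

theorem IsHamiltonAt.comp_add_const {a : ℝ} (h : IsHamiltonAt p c (t + a)) :
    IsHamiltonAt p (fun u => c (u + a)) t := by
  obtain ⟨v, h1, h2⟩ := h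
  exact ⟨v, h1.comp_add_const, h2⟩

variable {U : Set (CotangentBundle I X)}

/-- The Hamiltonian is constant along integral curves, infinitesimally. -/
theorem IsHamiltonAt.hasDerivAt_zero (hU : IsOpen U) (hp : ContMDiffOn (cotangentModel I) 𝓘(ℝ, ℝ) ∞ p U)
    (h : IsHamiltonAt p c t) (hc : c t ∈ U) : HasDerivAt (fun u => p (c u)) 0 t := by
  obtain ⟨v, h1, h2⟩ := h
  have h3 := h1.comp (ContMDiffOn.hasMFDerivAt_of_isOpen hp hU hc)
  have h4 : mfderiv (cotangentModel I) 𝓘(ℝ, ℝ) p (c t) v = (0 : ℝ) := by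
    rw [← h2 v, symplecticForm_eq, stdSymplectic, sub_self]
  rw [hasVelocity_iff_hasDerivAt] at h3
  exact h4 ▸ h3

/-- The Hamiltonian vector field of `p` in canonical coordinates. -/
def hamField (x₀ : X) (p : CotangentBundle I X → ℝ) (z : E × (E →L[ℝ] ℝ)) : E × (E →L[ℝ] ℝ) :=
  sharp E (fderiv ℝ (p ∘ (cotCoord I x₀).symm) z)

theorem contDiffOn_hamField (x₀ : X) (hU : IsOpen U)
    (hp : ContMDiffOn (cotangentModel I) 𝓘(ℝ, ℝ) ∞ p U) :
    ContDiffOn ℝ ∞ (hamField x₀ p) ((cotCoord I x₀).target ∩ (cotCoord I x₀).symm ⁻¹' U) := by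
  have h1 : ContDiffOn ℝ ∞ (p ∘ (cotCoord I x₀).symm)
      ((cotCoord I x₀).target ∩ (cotCoord I x₀).symm ⁻¹' U) :=
    (hp.comp ((isCoord_cotCoord x₀).smooth_symm.mono inter_subset_left)
      inter_subset_right).contDiffOn
  exact (sharp E).contDiff.comp_contDiffOn (h1.fderiv_of_isOpen
    ((cotCoord I x₀).isOpen_inter_preimage_symm hU) (m := ∞) (by simp))

/-- Canonical charts preserve the symplectic form, so Hamilton's equation becomes an ordinary
differential equation for the smooth field `hamField` on a vector space. -/
theorem isHamiltonAt_iff {x₀ : X} (hU : IsOpen U)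
    (hp : ContMDiffOn (cotangentModel I) 𝓘(ℝ, ℝ) ∞ p U) (hcU : c t ∈ U)
    (hc : c t ∈ (cotCoord I x₀).source) (hcc : ContinuousAt c t) :
    IsHamiltonAt p c t ↔ HasDerivAt (fun u => cotCoord I x₀ (c u))
      (hamField x₀ p (cotCoord I x₀ (c t))) t := by
  set κ := cotCoord I x₀
  have hκ : IsCoord (cotangentModel I) κ := isCoord_cotCoord x₀
  have hD := hκ.hasMFDerivAt hc
  have hS := hκ.hasMFDerivAt_symm (κ.map_source hc)
  let K : (E × (E →L[ℝ] ℝ)) →L[ℝ] E × (E →L[ℝ] ℝ) :=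
    mfderiv (cotangentModel I) 𝓘(ℝ, E × (E →L[ℝ] ℝ)) κ (c t)
  let D : (E × (E →L[ℝ] ℝ)) →L[ℝ] E × (E →L[ℝ] ℝ) :=
    mfderiv 𝓘(ℝ, E × (E →L[ℝ] ℝ)) (cotangentModel I) κ.symm (κ (c t))
  let P : (E × (E →L[ℝ] ℝ)) →L[ℝ] ℝ := mfderiv (cotangentModel I) 𝓘(ℝ, ℝ) p (c t)
  have hKD : ∀ v, K (D v) = v := fun v =>
    congrArg (fun L : (E × (E →L[ℝ] ℝ)) →L[ℝ] E × (E →L[ℝ] ℝ) => L v) (hκ.mfderiv_comp_symm hc)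
  have hDK : ∀ v, D (K v) = v := fun v =>
    congrArg (fun L : (E × (E →L[ℝ] ℝ)) →L[ℝ] E × (E →L[ℝ] ℝ) => L v) (hκ.mfderiv_symm_comp hc)
  have hP : fderiv ℝ (p ∘ κ.symm) (κ (c t)) = P.comp D := by
    have h1 : HasMFDerivAt (cotangentModel I) 𝓘(ℝ, ℝ) p (κ.symm (κ (c t))) P := by
      rw [κ.left_inv hc]; exact ContMDiffOn.hasMFDerivAt_of_isOpen hp hU hcU
    have h2 : HasFDerivAt (p ∘ κ.symm) (P.comp D) (κ (c t)) :=
      hasMFDerivAt_iff_hasFDerivAt.1 (h1.comp (κ (c t)) hS)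
    exact h2.fderiv
  have hω : ∀ v w, stdSymplectic (K v) (K w) = symplecticForm I (c t) v w :=
    stdSymplectic_cotCoord (mem_cotCoord_source.1 hc)
  have hsrc : ∀ᶠ u in 𝓝 t, c u ∈ κ.source := hcc.eventually_mem (κ.open_source.mem_nhds hc)
  rw [← hasVelocity_iff_hasDerivAt, hamField]
  change _ ↔ HasVelocity _ _ _ (sharp E (fderiv ℝ (p ∘ κ.symm) (κ (c t))))
  rw [hP]
  constructor
  · rintro ⟨v, h1, h2⟩
    have h3 : K v = sharp E (P.comp D) := by
      refine eq_sharp fun w => ?_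
      have h4 := hω v (D w)
      rw [hKD] at h4
      exact h4.trans (h2 (D w))
    exact h3 ▸ h1.comp hD
  · intro h1
    refine ⟨D (sharp E (P.comp D)), (h1.comp hS).congr ?_, fun w => ?_⟩
    · filter_upwards [hsrc] with u hu using (κ.left_inv hu).symm
    · have h4 := hω (D (sharp E (P.comp D))) w
      rw [hKD, stdSymplectic_sharp] at h4
      refine h4.symm.trans ?_
      change P (D (K w)) = P w
      rw [hDK]

/-- The local flow of a Hamiltonian vector field. -/
theorem exists_hamilton_local_flow (hU : IsOpen U)
    (hp : ContMDiffOn (cotangentModel I) 𝓘(ℝ, ℝ) ∞ p U) {l₀ : CotangentBundle I X} (hl₀ : l₀ ∈ U) :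
    ∃ φ : ℝ × CotangentBundle I X → CotangentBundle I X,
      (∀ᶠ q in 𝓝 (0, l₀), ContMDiffAt (𝓘(ℝ, ℝ).prod (cotangentModel I)) (cotangentModel I) ∞ φ q) ∧
      ∀ᶠ q : ℝ × CotangentBundle I X in 𝓝 (0, l₀), φ q ∈ U ∧ φ (0, q.2) = q.2 ∧
        IsHamiltonAt p (fun t => φ (t, q.2)) q.1 := by
  set κ := cotCoord I l₀.1
  have hκ : IsCoord (cotangentModel I) κ := isCoord_cotCoord _
  have hl : l₀ ∈ κ.source := mem_cotCoord_source.2 (mem_coordAt_source _)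
  have hO : IsOpen (κ.target ∩ κ.symm ⁻¹' U) := κ.isOpen_inter_preimage_symm hU
  obtain ⟨φ, h1, h2⟩ := exists_smooth_local_flow hO
    ⟨κ.map_source hl, by rw [mem_preimage, κ.left_inv hl]; exact hl₀⟩
    (contDiffOn_hamField l₀.1 hU hp)
  have hlim : Tendsto (fun q : ℝ × CotangentBundle I X => (q.1, κ q.2)) (𝓝 (0, l₀))
      (𝓝 ((0 : ℝ), κ l₀)) :=
    (continuousAt_fst.prodMk (ContinuousAt.comp (g := κ) (f := fun q : ℝ × CotangentBundle I X => q.2)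
      (κ.continuousAt hl) continuousAt_snd))
  have hs : ∀ᶠ q : ℝ × CotangentBundle I X in 𝓝 (0, l₀), q.2 ∈ κ.source :=
    continuousAt_snd.eventually_mem (κ.open_source.mem_nhds hl)
  have h1' := hlim.eventually h1
  have h2' := hlim.eventually h2
  refine ⟨fun q => κ.symm (φ (q.1, κ q.2)), ?_, ?_⟩
  · filter_upwards [hs, h1', h2'] with q hq h3 h4
    refine ContMDiffAt.comp q (g := κ.symm) (I' := 𝓘(ℝ, E × (E →L[ℝ] ℝ)))
      (f := fun q : ℝ × CotangentBundle I X => φ (q.1, κ q.2))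
      (hκ.contMDiffAt_symm h4.1.1) ?_
    exact ContMDiffAt.comp q (f := fun q : ℝ × CotangentBundle I X => (q.1, κ q.2)) h3.contMDiffAt
      (contMDiffAt_fst.prodMk_space (ContMDiffAt.comp q (f := fun q : ℝ × CotangentBundle I X => q.2)
        (hκ.contMDiffAt hq) contMDiffAt_snd))
  · filter_upwards [hs, h2', h2'.eventually_nhds] with q hq h4 h5
    refine ⟨h4.1.2, ?_, ?_⟩
    · rw [h4.2.1]
      exact κ.left_inv hq
    · have h6 : ∀ᶠ t in 𝓝 q.1, φ (t, κ q.2) ∈ κ.target ∩ κ.symm ⁻¹' U := by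
        have h7 : Tendsto (fun t : ℝ => (t, q.2)) (𝓝 q.1) (𝓝 q) := by
          have : ContinuousAt (fun t : ℝ => (t, q.2)) q.1 := by fun_prop
          exact this
        filter_upwards [h7.eventually h5] with t ht using ht.1
      have h8 : ContinuousAt (fun t => κ.symm (φ (t, κ q.2))) q.1 :=
        ContinuousAt.comp (g := κ.symm) (f := fun t => φ (t, κ q.2))
          (κ.symm.continuousAt h4.1.1) h4.2.2.continuousAt
      rw [isHamiltonAt_iff hU hp h4.1.2 (κ.map_target h4.1.1) h8]
      change HasDerivAt (fun u => κ (κ.symm (φ (u, κ q.2))))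
        (hamField l₀.1 p (κ (κ.symm (φ (q.1, κ q.2))))) q.1
      rw [κ.right_inv h4.1.1]
      refine h4.2.2.congr_of_eventuallyEq ?_
      filter_upwards [h6] with t ht using κ.right_inv ht.1

/-- In a canonical chart both curves solve the equation of a locally Lipschitz field, where local
uniqueness applies. -/
theorem IsHamiltonAt.eventuallyEq (hU : IsOpen U)
    (hp : ContMDiffOn (cotangentModel I) 𝓘(ℝ, ℝ) ∞ p U)
    (hc : ∀ᶠ u in 𝓝 t, c u ∈ U ∧ IsHamiltonAt p c u)
    (hc' : ∀ᶠ u in 𝓝 t, c' u ∈ U ∧ IsHamiltonAt p c' u) (h : c t = c' t) : c =ᶠ[𝓝 t] c' := by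
  set κ := cotCoord I (c t).1
  have hl : c t ∈ κ.source := mem_cotCoord_source.2 (mem_coordAt_source _)
  have hz : κ (c t) ∈ κ.target ∩ κ.symm ⁻¹' U :=
    ⟨κ.map_source hl, by rw [mem_preimage, κ.left_inv hl]; exact hc.self_of_nhds.1⟩
  have hX := (contDiffOn_hamField (c t).1 hU hp).contDiffAt
    ((κ.isOpen_inter_preimage_symm hU).mem_nhds hz)
  obtain ⟨K, s, hs, hL⟩ := (hX.of_le (m := 1) (by simp)).exists_lipschitzOnWith
  have main : ∀ d : ℝ → CotangentBundle I X, (∀ᶠ u in 𝓝 t, d u ∈ U ∧ IsHamiltonAt p d u) →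
      d t = c t → (∀ᶠ u in 𝓝 t, d u ∈ κ.source) ∧ ∀ᶠ u in 𝓝 t,
      HasDerivAt (fun u => κ (d u)) (hamField (c t).1 p (κ (d u))) u ∧ κ (d u) ∈ s := by
    intro d hd hdt
    have h1 : ContinuousAt d t := hd.self_of_nhds.2.continuousAt
    have h2 : ∀ᶠ u in 𝓝 t, d u ∈ κ.source := h1.eventually_mem
      (κ.open_source.mem_nhds (by rw [hdt]; exact hl))
    have h3 : ∀ᶠ u in 𝓝 t, κ (d u) ∈ s := by
      have : ContinuousAt (fun u => κ (d u)) t :=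
        ContinuousAt.comp (g := κ) (κ.continuousAt (by rw [hdt]; exact hl)) h1
      exact this.eventually_mem (by rw [hdt]; exact hs)
    refine ⟨h2, ?_⟩
    filter_upwards [hd, h2, h3] with u h4 h5 h6
    exact ⟨(isHamiltonAt_iff hU hp h4.1 h5 h4.2.continuousAt).1 h4.2, h6⟩
  obtain ⟨a1, a2⟩ := main c hc rfl
  obtain ⟨b1, b2⟩ := main c' hc' h.symm
  have := ODE_solution_unique_of_eventually (v := fun _ => hamField (c t).1 p) (s := fun _ => s)
    (K := K) (t₀ := t) (Eventually.of_forall fun _ => hL) a2 b2 (congrArg κ h)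
  filter_upwards [this, a1, b1] with u h1 h2 h3 using κ.injOn h2 h3 h1

/-- Integral curves of a Hamiltonian vector field are determined by their value at one time. -/
theorem IsHamiltonAt.eqOn [T2Space X] (hU : IsOpen U)
    (hp : ContMDiffOn (cotangentModel I) 𝓘(ℝ, ℝ) ∞ p U) {s : Set ℝ} (hs : IsOpen s)
    (hs' : IsPreconnected s) (hc : ∀ t ∈ s, c t ∈ U ∧ IsHamiltonAt p c t)
    (hc' : ∀ t ∈ s, c' t ∈ U ∧ IsHamiltonAt p c' t) {t₀ : ℝ} (ht₀ : t₀ ∈ s) (h : c t₀ = c' t₀) :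
    EqOn c c' s := by
  let A : Set ℝ := {t | t ∈ s ∧ c =ᶠ[𝓝 t] c'}
  have hloc : ∀ t ∈ s, c t = c' t → c =ᶠ[𝓝 t] c' := fun t ht h =>
    IsHamiltonAt.eventuallyEq hU hp (eventually_of_mem (hs.mem_nhds ht) hc)
      (eventually_of_mem (hs.mem_nhds ht) hc') h
  have hA : IsOpen A := by
    rw [isOpen_iff_mem_nhds]
    rintro t ⟨h1, h2⟩
    filter_upwards [hs.mem_nhds h1, h2.eventuallyEq_nhds] with u h3 h4 using ⟨h3, h4⟩
  -- The times near which the curves agree form an open set; limits of such times are again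
  -- coincidences because `T*X` is Hausdorff, and local uniqueness makes the set closed in `s`.
  have : s ⊆ A := by
    refine hs'.subset_of_closure_inter_subset hA ⟨t₀, ht₀, ht₀, hloc t₀ ht₀ h⟩ ?_
    rintro t ⟨h1, h2⟩
    refine ⟨h2, hloc t h2 ?_⟩
    have h3 : (𝓝[A] t).NeBot := mem_closure_iff_nhdsWithin_neBot.1 h1
    have h4 : Tendsto c (𝓝[A] t) (𝓝 (c t)) := ((hc t h2).2.continuousAt).mono_left nhdsWithin_le_nhds
    have h5 : Tendsto c' (𝓝[A] t) (𝓝 (c' t)) :=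
      ((hc' t h2).2.continuousAt).mono_left nhdsWithin_le_nhds
    refine tendsto_nhds_unique h4 (h5.congr' ?_)
    filter_upwards [self_mem_nhdsWithin] with u hu using hu.2.self_of_nhds.symm
  exact fun t ht => (this ht).2.self_of_nhds

end Hamiltonian

/-! ### Complete Hamiltonian flows -/

section Flow

variable {E H : Type*} [NormedAddCommGroup E] [NormedSpace ℝ E] [FiniteDimensional ℝ E]
  [TopologicalSpace H]
  {I : ModelWithCorners ℝ E H} [I.Boundaryless]
  {X : Type*} [TopologicalSpace X] [ChartedSpace H X] [IsManifold I ∞ X] [T2Space X]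
  {p : CotangentBundle I X → ℝ} {U S : Set (CotangentBundle I X)}

/-- Integral curves defined on `(-a, a)` for every starting point in an invariant set extend to
`(-3a/2, 3a/2)`. -/
theorem exists_hamilton_curve_three_halves (hU : IsOpen U)
    (hp : ContMDiffOn (cotangentModel I) 𝓘(ℝ, ℝ) ∞ p U) (hS : S ⊆ U) {a : ℝ} (ha : 0 < a)
    (h : ∀ l ∈ S, ∃ c, c 0 = l ∧ ∀ t ∈ Ioo (-a) a, c t ∈ S ∧ IsHamiltonAt p c t) :
    ∀ l ∈ S, ∃ c, c 0 = l ∧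
      ∀ t ∈ Ioo (-(3 / 2 * a)) (3 / 2 * a), c t ∈ S ∧ IsHamiltonAt p c t := by
  intro l hl
  obtain ⟨c, hc0, hc⟩ := h l hl
  obtain ⟨c₁, hc₁0, hc₁⟩ := h (c (a / 2)) (hc _ ⟨by linarith, by linarith⟩).1
  obtain ⟨c₂, hc₂0, hc₂⟩ := h (c (-(a / 2))) (hc _ ⟨by linarith, by linarith⟩).1
  have e1 : EqOn c (fun t => c₁ (t + -(a / 2))) (Ioo (-(a / 2)) a) :=
    IsHamiltonAt.eqOn hU hp isOpen_Ioo isPreconnected_Ioo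
      (fun t ht => (hc t ⟨by linarith [ht.1], ht.2⟩).imp_left (@hS _))
      (fun t ht => (hc₁ (t + -(a / 2)) ⟨by linarith [ht.1], by linarith [ht.2]⟩).imp (@hS _)
        IsHamiltonAt.comp_add_const)
      (t₀ := a / 2) ⟨by linarith, by linarith⟩ (by simp [hc₁0])
  have e2 : EqOn c (fun t => c₂ (t + a / 2)) (Ioo (-a) (a / 2)) :=
    IsHamiltonAt.eqOn hU hp isOpen_Ioo isPreconnected_Ioo
      (fun t ht => (hc t ⟨ht.1, by linarith [ht.2]⟩).imp_left (@hS _))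
      (fun t ht => (hc₂ (t + a / 2) ⟨by linarith [ht.1], by linarith [ht.2]⟩).imp (@hS _)
        IsHamiltonAt.comp_add_const)
      (t₀ := -(a / 2)) ⟨by linarith, by linarith⟩ (by simp [hc₂0])
  -- Restarting at times `a / 2` and `-a / 2` gains `a / 2` on each side. Both restarted curves
  -- agree with `c` near `0`, so changing from one to the other there does no harm.
  let d : ℝ → CotangentBundle I X := fun t => if 0 ≤ t then c₁ (t + -(a / 2)) else c₂ (t + a / 2)
  have hd : d =ᶠ[𝓝 0] c := by
    filter_upwards [Ioo_mem_nhds (show -(a / 2) < 0 by linarith) (show 0 < a / 2 by linarith)]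
      with t ht
    by_cases h0 : 0 ≤ t
    · exact (if_pos h0).trans (e1 ⟨ht.1, by linarith [ht.2]⟩).symm
    · exact (if_neg h0).trans (e2 ⟨by linarith [ht.1], ht.2⟩).symm
  refine ⟨d, hd.self_of_nhds.trans hc0, fun t ht => ?_⟩
  rcases lt_trichotomy t 0 with h0 | h0 | h0
  · have h1 : d =ᶠ[𝓝 t] fun t => c₂ (t + a / 2) := by
      filter_upwards [Iio_mem_nhds h0] with u hu using if_neg (not_le.2 hu)
    have h2 := hc₂ (t + a / 2) ⟨by linarith [ht.1], by linarith⟩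
    exact ⟨by rw [h1.self_of_nhds]; exact h2.1, h2.2.comp_add_const.congr h1⟩
  · subst h0
    have h2 := hc 0 ⟨by linarith, by linarith⟩
    exact ⟨by rw [hd.self_of_nhds]; exact h2.1, h2.2.congr hd⟩
  · have h1 : d =ᶠ[𝓝 t] fun t => c₁ (t + -(a / 2)) := by
      filter_upwards [Ioi_mem_nhds h0] with u hu using if_pos (le_of_lt hu)
    have h2 := hc₁ (t + -(a / 2)) ⟨by linarith, by linarith [ht.2]⟩
    exact ⟨by rw [h1.self_of_nhds]; exact h2.1, h2.2.comp_add_const.congr h1⟩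

/-- Integral curves that exist for a uniform time in an invariant set exist for all times. -/
theorem exists_hamilton_curve (hU : IsOpen U)
    (hp : ContMDiffOn (cotangentModel I) 𝓘(ℝ, ℝ) ∞ p U) (hS : S ⊆ U) {a : ℝ} (ha : 0 < a)
    (h : ∀ l ∈ S, ∃ c, c 0 = l ∧ ∀ t ∈ Ioo (-a) a, c t ∈ S ∧ IsHamiltonAt p c t) :
    ∀ l ∈ S, ∃ c, c 0 = l ∧ ∀ t, c t ∈ S ∧ IsHamiltonAt p c t := by
  intro l hl
  have h1 : ∀ n : ℕ, ∀ l ∈ S, ∃ c, c 0 = l ∧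
      ∀ t ∈ Ioo (-((3 / 2) ^ n * a)) ((3 / 2) ^ n * a), c t ∈ S ∧ IsHamiltonAt p c t := by
    intro n
    induction n with
    | zero => simpa using h
    | succ n ih =>
      rw [pow_succ', mul_assoc]
      exact exists_hamilton_curve_three_halves hU hp hS (by positivity) ih
  choose c hc0 hc using fun n => h1 n l hl
  have hlim : Tendsto (fun n : ℕ => ((3 : ℝ) / 2) ^ n * a) atTop atTop :=
    (tendsto_pow_atTop_atTop_of_one_lt (by norm_num)).atTop_mul_const ha
  have hex : ∀ t : ℝ, ∃ n : ℕ, |t| < (3 / 2) ^ n * a := fun t =>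
    (hlim.eventually_gt_atTop |t|).exists
  choose N hN using hex
  have hagree : ∀ m n t, |t| < (3 / 2) ^ m * a → |t| < (3 / 2) ^ n * a → c m t = c n t := by
    intro m n t hm hn
    let b := min (((3 : ℝ) / 2) ^ m * a) ((3 / 2) ^ n * a)
    have hb : |t| < b := lt_min hm hn
    have hbm : b ≤ (3 / 2) ^ m * a := min_le_left _ _
    have hbn : b ≤ (3 / 2) ^ n * a := min_le_right _ _
    have hb0 : 0 < b := (abs_nonneg t).trans_lt hb
    refine IsHamiltonAt.eqOn hU hp (isOpen_Ioo (a := -b) (b := b)) isPreconnected_Ioo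
      (fun u hu => (hc m u ⟨by linarith [hu.1], by linarith [hu.2]⟩).imp_left (@hS _))
      (fun u hu => (hc n u ⟨by linarith [hu.1], by linarith [hu.2]⟩).imp_left (@hS _))
      (t₀ := 0) ⟨by linarith, hb0⟩ (by rw [hc0, hc0]) (abs_lt.1 hb)
  -- The curves agree on common intervals, so near any fixed time the choice of index is immaterial
  -- and the glued curve is locally `c (N t)`.
  refine ⟨fun t => c (N t) t, hc0 _, fun t => ?_⟩
  have h2 : (fun u => c (N u) u) =ᶠ[𝓝 t] c (N t) := by
    filter_upwards [(continuous_abs.tendsto t).eventually (gt_mem_nhds (hN t))] with u hu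
    exact hagree _ _ u (hN u) hu
  exact ⟨(hc _ t (abs_lt.1 (hN t))).1, (hc _ t (abs_lt.1 (hN t))).2.congr h2⟩

/-- The flow exists if all integral curves exist for all times. -/
theorem existsUnique_isHamiltonianFlow (hU : IsOpen U)
    (hp : ContMDiffOn (cotangentModel I) 𝓘(ℝ, ℝ) ∞ p U)
    (h : ∀ l ∈ U, ∃ c, c 0 = l ∧ ∀ t, c t ∈ U ∧ IsHamiltonAt p c t) :
    ∃! χ : ℝ → U → U, IsHamiltonianFlow I p U χ := by
  choose c hc0 hc using fun l : U => h l.1 l.2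
  have hham : ∀ χ : ℝ → U → U, IsHamiltonianFlow I p U χ → ∀ l t,
      IsHamiltonAt p (fun t => (χ t l).1) t := fun χ hχ l t =>
    ⟨_, HasVelocity.of_mdifferentiableAt (hχ.differentiable l t), hχ.velocity l t⟩
  refine ⟨fun t l => ⟨c l t, (hc l t).1⟩, ⟨fun l => Subtype.ext (hc0 l), fun l t => ?_,
    fun l t w => ?_⟩, fun χ hχ => ?_⟩
  · obtain ⟨v, hv, -⟩ := (hc l t).2
    exact hv.mdifferentiableAt
  · obtain ⟨v, hv, hw⟩ := (hc l t).2
    have := hv.mfderiv_one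
    exact (congrArg (fun v => symplecticForm I (c l t) v w) this).trans (hw w)
  · funext t l
    refine Subtype.ext (IsHamiltonAt.eqOn hU hp isOpen_univ isPreconnected_univ
      (fun t _ => ⟨(χ t l).2, hham χ hχ l t⟩) (fun t _ => hc l t) (mem_univ 0) ?_ (mem_univ t))
    rw [hχ.zero, hc0]

variable {χ : ℝ → U → U}

theorem IsHamiltonianFlow.isHamiltonAt (hχ : IsHamiltonianFlow I p U χ) (l : U) (t : ℝ) :
    IsHamiltonAt p (fun t => (χ t l).1) t :=
  ⟨_, HasVelocity.of_mdifferentiableAt (hχ.differentiable l t), hχ.velocity l t⟩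

theorem IsHamiltonianFlow.eq_of_isHamiltonAt (hχ : IsHamiltonianFlow I p U χ) (hU : IsOpen U)
    (hp : ContMDiffOn (cotangentModel I) 𝓘(ℝ, ℝ) ∞ p U) {s : Set ℝ} (hs : IsOpen s)
    (hs' : IsPreconnected s) (h0 : (0 : ℝ) ∈ s) {c : ℝ → CotangentBundle I X}
    (hc : ∀ t ∈ s, c t ∈ U ∧ IsHamiltonAt p c t) {l : U} (hl : c 0 = l) {t : ℝ} (ht : t ∈ s) :
    c t = χ t l :=
  IsHamiltonAt.eqOn hU hp hs hs' hc (fun t _ => ⟨(χ t l).2, hχ.isHamiltonAt l t⟩) h0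
    (by rw [hl, hχ.zero]) ht

theorem IsHamiltonianFlow.add (hχ : IsHamiltonianFlow I p U χ) (hU : IsOpen U)
    (hp : ContMDiffOn (cotangentModel I) 𝓘(ℝ, ℝ) ∞ p U) (s t : ℝ) (l : U) :
    χ (s + t) l = χ s (χ t l) :=
  Subtype.ext (hχ.eq_of_isHamiltonAt hU hp isOpen_univ isPreconnected_univ (mem_univ 0)
    (c := fun s => (χ (s + t) l).1)
    (fun s _ => ⟨(χ (s + t) l).2, (hχ.isHamiltonAt l (s + t)).comp_add_const⟩)
    (by simp) (mem_univ s))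

theorem IsHamiltonianFlow.hamiltonian_eq (hχ : IsHamiltonianFlow I p U χ) (hU : IsOpen U)
    (hp : ContMDiffOn (cotangentModel I) 𝓘(ℝ, ℝ) ∞ p U) (t : ℝ) (l : U) :
    p (χ t l) = p l := by
  have h : ∀ t, HasDerivAt (fun t => p (χ t l).1) 0 t := fun t =>
    (hχ.isHamiltonAt l t).hasDerivAt_zero hU hp (χ t l).2
  have h2 := is_const_of_deriv_eq_zero (fun t => (h t).differentiableAt) (fun t => (h t).deriv) t 0
  rwa [hχ.zero] at h2

open Classical in
/-- The flow, extended by the identity outside `U`. -/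
def flowMap (χ : ℝ → U → U) (q : ℝ × CotangentBundle I X) : CotangentBundle I X :=
  if h : q.2 ∈ U then χ q.1 ⟨q.2, h⟩ else q.2

theorem flowMap_of_mem (χ : ℝ → U → U) {t : ℝ} {l : CotangentBundle I X} (h : l ∈ U) :
    flowMap χ (t, l) = χ t ⟨l, h⟩ := dif_pos h

theorem flowMap_mem (χ : ℝ → U → U) {t : ℝ} {l : CotangentBundle I X} (h : l ∈ U) :
    flowMap χ (t, l) ∈ U := by
  rw [flowMap_of_mem χ h]
  exact (χ t _).2

/-- A global flow is only known to be differentiable in time. By uniqueness it coincides near time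
zero with the smooth local flow, on a box with a connected time interval. -/
theorem IsHamiltonianFlow.eventually_contMDiffAt_zero (hχ : IsHamiltonianFlow I p U χ)
    (hU : IsOpen U) (hp : ContMDiffOn (cotangentModel I) 𝓘(ℝ, ℝ) ∞ p U)
    {l₀ : CotangentBundle I X} (hl₀ : l₀ ∈ U) :
    ∀ᶠ q in 𝓝 ((0 : ℝ), l₀),
      ContMDiffAt (𝓘(ℝ, ℝ).prod (cotangentModel I)) (cotangentModel I) ∞ (flowMap χ) q := by
  obtain ⟨φ, h1, h2⟩ := exists_hamilton_local_flow hU hp hl₀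
  rw [nhds_prod_eq] at h2
  obtain ⟨P, hP, Q, hQ, hPQ⟩ := eventually_prod_iff.1 h2
  obtain ⟨δ, hδ, hball⟩ := Metric.eventually_nhds_iff_ball.1 hP
  have heq : flowMap χ =ᶠ[𝓝 ((0 : ℝ), l₀)] φ := by
    rw [nhds_prod_eq]
    filter_upwards [prod_mem_prod (Metric.ball_mem_nhds (0 : ℝ) hδ)
      (inter_mem hQ (hU.mem_nhds hl₀))] with ⟨t, l⟩ ⟨ht, hl, hlU⟩
    rw [flowMap_of_mem χ hlU]
    refine (hχ.eq_of_isHamiltonAt hU hp Metric.isOpen_ball (convex_ball (0 : ℝ) δ).isPreconnected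
      (Metric.mem_ball_self hδ) (c := fun t => φ (t, l))
      (fun u hu => ?_) ?_ ht).symm
    · have := hPQ (hball u hu) hl
      exact ⟨this.1, this.2.2⟩
    · exact (hPQ (hball 0 (Metric.mem_ball_self hδ)) hl).2.1
  filter_upwards [h1, heq.eventuallyEq_nhds] with q hq hq' using hq.congr_of_eventuallyEq hq'

/-- The flow of a Hamiltonian vector field is smooth. -/
theorem IsHamiltonianFlow.contMDiffAt (hχ : IsHamiltonianFlow I p U χ)
    (hU : IsOpen U) (hp : ContMDiffOn (cotangentModel I) 𝓘(ℝ, ℝ) ∞ p U)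
    {q : ℝ × CotangentBundle I X} (hq : q.2 ∈ U) :
    ContMDiffAt (𝓘(ℝ, ℝ).prod (cotangentModel I)) (cotangentModel I) ∞ (flowMap χ) q := by
  obtain ⟨t₀, l₀⟩ := q
  -- Continuation along the orbit: these are the times near which the flow is jointly smooth. The
  -- set contains `0`, is open by definition, and is shown to be closed.
  let A : Set ℝ := {t | ∀ᶠ q in 𝓝 (t, l₀),
    ContMDiffAt (𝓘(ℝ, ℝ).prod (cotangentModel I)) (cotangentModel I) ∞ (flowMap χ) q}
  have hcurve : Continuous fun t => flowMap χ (t, l₀) := by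
    rw [continuous_iff_continuousAt]
    intro t
    have h1 : (fun t => flowMap χ (t, l₀)) = fun t => (χ t ⟨l₀, hq⟩).1 :=
      funext fun t => flowMap_of_mem χ hq
    rw [h1]
    exact (hχ.isHamiltonAt ⟨l₀, hq⟩ t).continuousAt
  have hA : IsOpen A := by
    rw [isOpen_iff_mem_nhds]
    intro t ht
    have h1 : ContinuousAt (fun t : ℝ => (t, l₀)) t := by fun_prop
    exact h1.eventually ht.eventually_nhds
  suffices h : univ ⊆ A from (h (mem_univ t₀)).self_of_nhds
  refine isPreconnected_univ.subset_of_closure_inter_subset hA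
    ⟨0, mem_univ _, hχ.eventually_contMDiffAt_zero hU hp hq⟩ ?_
  rintro t ⟨ht, -⟩
  have h0 := hχ.eventually_contMDiffAt_zero hU hp (flowMap_mem χ (t := t) hq)
  have h1 : Tendsto (fun s => (t - s, flowMap χ (s, l₀))) (𝓝 t) (𝓝 (0, flowMap χ (t, l₀))) := by
    have : Continuous fun s => (t - s, flowMap χ (s, l₀)) :=
      (continuous_const.sub continuous_id).prodMk hcurve
    simpa using this.tendsto t
  -- Choose `s ∈ A` close to `t`. The flow near time `t` is the flow for time `s` followed by the
  -- flow for a time near `t - s`, and both are smooth at the relevant points.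
  obtain ⟨s, hs, hsA⟩ := mem_closure_iff_nhds.1 ht _ (h1.eventually h0.eventually_nhds)
  have h2 : ContinuousAt (fun q : ℝ × CotangentBundle I X => (s, q.2)) (t, l₀) := by fun_prop
  have h3 : Tendsto (fun q : ℝ × CotangentBundle I X => (s, q.2)) (𝓝 (t, l₀)) (𝓝 (s, l₀)) := h2
  have h4 : Tendsto (fun q : ℝ × CotangentBundle I X => (q.1 - s, flowMap χ (s, q.2)))
      (𝓝 (t, l₀)) (𝓝 (t - s, flowMap χ (s, l₀))) := by
    have h5 : ContinuousAt (flowMap χ) (s, l₀) := hsA.self_of_nhds.continuousAt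
    have h6 : ContinuousAt (fun q : ℝ × CotangentBundle I X => flowMap χ (s, q.2)) (t, l₀) :=
      ContinuousAt.comp (g := flowMap χ) (f := fun q : ℝ × CotangentBundle I X => (s, q.2)) h5 h2
    exact (continuousAt_fst.sub continuousAt_const).prodMk h6
  have h7 : ∀ᶠ q : ℝ × CotangentBundle I X in 𝓝 (t, l₀), q.2 ∈ U :=
    continuousAt_snd.eventually_mem (hU.mem_nhds hq)
  filter_upwards [h3.eventually hsA, h4.eventually hs, h7.eventually_nhds] with q hq1 hq2 hq3
  have h8 : ContMDiffAt (𝓘(ℝ, ℝ).prod (cotangentModel I)) (cotangentModel I) ∞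
      (fun q : ℝ × CotangentBundle I X => flowMap χ (q.1 - s, flowMap χ (s, q.2))) q := by
    refine ContMDiffAt.comp q (g := flowMap χ)
      (f := fun q : ℝ × CotangentBundle I X => (q.1 - s, flowMap χ (s, q.2))) hq2 ?_
    refine ContMDiffAt.prodMk ?_ ?_
    · exact contMDiffAt_fst.sub contMDiffAt_const
    · exact ContMDiffAt.comp q (f := fun q : ℝ × CotangentBundle I X => (s, q.2)) hq1
        (contMDiffAt_const.prodMk contMDiffAt_snd)
  refine h8.congr_of_eventuallyEq ?_
  filter_upwards [hq3] with q' hq'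
  obtain ⟨t', l'⟩ := q'
  have hq'' : l' ∈ U := hq'
  simp only [flowMap_of_mem χ hq'', flowMap_of_mem χ (χ s _).2]
  rw [Subtype.coe_eta, ← hχ.add hU hp, sub_add_cancel]

end Flow

/-! ### Canonical transformations -/

section Canonical

variable {E H : Type*} [NormedAddCommGroup E] [NormedSpace ℝ E]
  [TopologicalSpace H]
  {I : ModelWithCorners ℝ E H} [I.Boundaryless]
  {X : Type*} [TopologicalSpace X] [ChartedSpace H X] [IsManifold I ∞ X]

/-- A map that multiplies the canonical one-form by `a`, up to an exact form, multiplies the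
symplectic form by `a`. -/
theorem symplecticForm_of_liouville {Θ : CotangentBundle I X → CotangentBundle I X}
    {h : CotangentBundle I X → ℝ} {l : CotangentBundle I X} {a : ℝ}
    {D : CotangentBundle I X → (E × (E →L[ℝ] ℝ)) →L[ℝ] E × (E →L[ℝ] ℝ)}
    (hΘ : ∀ᶠ l' in 𝓝 l, ContMDiffAt (cotangentModel I) (cotangentModel I) ∞ Θ l')
    (hD : ∀ᶠ l' in 𝓝 l, HasMFDerivAt (cotangentModel I) (cotangentModel I) Θ l' (D l'))
    (hh : ContMDiffAt (cotangentModel I) 𝓘(ℝ, ℝ) ∞ h l)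
    {d : CotangentBundle I X → (E × (E →L[ℝ] ℝ)) →L[ℝ] ℝ}
    (hd : ∀ᶠ l' in 𝓝 l, HasMFDerivAt (cotangentModel I) 𝓘(ℝ, ℝ) h l' (d l'))
    (hα : ∀ᶠ l' in 𝓝 l, ∀ v : E × (E →L[ℝ] ℝ), (Θ l').2 (D l' v).1 = a * l'.2 v.1 + d l' v) (v w : E × (E →L[ℝ] ℝ)) :
    symplecticForm I (Θ l) (D l v) (D l w) = a * symplecticForm I l v w := by
  set κ := cotCoord I l.1
  have hκ : IsCoord (cotangentModel I) κ := isCoord_cotCoord l.1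
  have hl : l ∈ κ.source := mem_cotCoord_source.2 (mem_coordAt_source _)
  let K : E × (E →L[ℝ] ℝ) → (E × (E →L[ℝ] ℝ)) →L[ℝ] E × (E →L[ℝ] ℝ) := fun z =>
    mfderiv 𝓘(ℝ, E × (E →L[ℝ] ℝ)) (cotangentModel I) κ.symm z
  have htgt : ∀ᶠ z in 𝓝 (κ l), z ∈ κ.target := κ.open_target.mem_nhds (κ.map_source hl)
  have hK : ∀ z ∈ κ.target,
      HasMFDerivAt 𝓘(ℝ, E × (E →L[ℝ] ℝ)) (cotangentModel I) κ.symm z (K z) := fun z hz =>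
    hκ.hasMFDerivAt_symm hz
  have hK0 : K (κ l) = ContinuousLinearMap.id ℝ _ :=
    hasMFDerivAt_unique (hK _ (κ.map_source hl)) (hasMFDerivAt_coordAt_symm_self l)
  have hlim : Tendsto κ.symm (𝓝 (κ l)) (𝓝 l) := by
    have := κ.symm.continuousAt (κ.map_source hl)
    rwa [ContinuousAt, κ.left_inv hl] at this
  let g : E × (E →L[ℝ] ℝ) → ℝ := fun z => h (κ.symm z)
  have hg : ContDiffAt ℝ ∞ g (κ l) := by
    have h1 : ContMDiffAt (cotangentModel I) 𝓘(ℝ, ℝ) ∞ h (κ.symm (κ l)) := by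
      rw [κ.left_inv hl]; exact hh
    exact (h1.comp (κ l) (hκ.contMDiffAt_symm (κ.map_source hl))).contDiffAt
  have hgd : ∀ᶠ z in 𝓝 (κ l), ∀ u, d (κ.symm z) (K z u) = fderiv ℝ g z u := by
    filter_upwards [hlim.eventually hd, htgt] with z hz hzt u
    have h1 : HasMFDerivAt 𝓘(ℝ, E × (E →L[ℝ] ℝ)) 𝓘(ℝ, ℝ) g z ((d (κ.symm z)).comp (K z)) :=
      hz.comp z (hK z hzt)
    have h2 : HasFDerivAt g ((d (κ.symm z)).comp (K z)) z := hasMFDerivAt_iff_hasFDerivAt.1 h1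
    exact (congrArg (fun L : (E × (E →L[ℝ] ℝ)) →L[ℝ] ℝ => L u) h2.fderiv).symm
  have hS := symplecticForm_eq_fderiv (I := I) (Ψ := fun z => Θ (κ.symm z)) (q := κ l)
    (D := fun z => (D (κ.symm z)).comp (K z))
    (by
      filter_upwards [hlim.eventually hΘ, htgt] with z hz hzt
      exact hz.comp z (hκ.contMDiffAt_symm hzt))
    (by
      filter_upwards [hlim.eventually hD, htgt] with z hz hzt
      exact hz.comp z (hK z hzt)) v w
  have hθ : ∀ u, (fun z => (Θ (κ.symm z)).2 (((D (κ.symm z)).comp (K z)) u).1) =ᶠ[𝓝 (κ l)]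
      fun z => a * z.2 u.1 + fderiv ℝ g z u := by
    intro u
    filter_upwards [hlim.eventually hα, htgt, hgd] with z h1 h2 h3
    rw [← h3 u, ← liouville_cotCoord_symm h2 (hK z h2) u]
    exact h1 (K z u)
  have hdd : ∀ u v : E × (E →L[ℝ] ℝ),
      fderiv ℝ (fun z : E × (E →L[ℝ] ℝ) => a * z.2 u.1 + fderiv ℝ g z u) (κ l) v =
      a * v.2 u.1 + fderiv ℝ (fderiv ℝ g) (κ l) v u := by
    intro u v
    have h1 : HasFDerivAt (fun z : E × (E →L[ℝ] ℝ) => z.2 u.1)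
      ((ContinuousLinearMap.apply ℝ ℝ u.1).comp (ContinuousLinearMap.snd ℝ E (E →L[ℝ] ℝ))) (κ l) :=
      ((ContinuousLinearMap.apply ℝ ℝ u.1).comp
        (ContinuousLinearMap.snd ℝ E (E →L[ℝ] ℝ))).hasFDerivAt
    have h2 : DifferentiableAt ℝ (fderiv ℝ g) (κ l) :=
      (hg.fderiv_right (m := ∞) (by simp)).differentiableAt (by simp)
    have h3 := h2.hasFDerivAt.clm_apply (hasFDerivAt_const u (κ l))
    have h4 : HasFDerivAt (fun z : E × (E →L[ℝ] ℝ) => a * z.2 u.1 + fderiv ℝ g z u) _ (κ l) :=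
      (h1.const_mul a).add h3
    rw [h4.fderiv]
    simp
  have hsymm : IsSymmSndFDerivAt ℝ g (κ l) := hg.isSymmSndFDerivAt
    (by simpa [minSmoothness_of_isRCLikeNormedField] using ENat.LEInfty.out)
  -- The exact part contributes second derivatives of `g`, which cancel by symmetry; the rest is `a`
  -- times the canonical computation.
  rw [(hθ v).fderiv_eq, (hθ w).fderiv_eq, hdd, hdd, hsymm.eq v w, hK0, κ.left_inv hl] at hS
  have h4 : symplecticForm I (Θ l) (D l v) (D l w) = -(a * v.2 w.1 - a * w.2 v.1) := by
    change _ = -symplecticForm I (Θ l) (D l v) (D l w) at hS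
    linarith
  rw [h4, symplecticForm_eq, stdSymplectic]
  ring

/-- Such maps send integral curves of a Hamiltonian vector field to integral curves. -/
theorem IsHamiltonAt.map_of_liouville [FiniteDimensional ℝ E]
    {Θ : CotangentBundle I X → CotangentBundle I X}
    {h p : CotangentBundle I X → ℝ} {a : ℝ} (ha : a ≠ 0)
    {c : ℝ → CotangentBundle I X} {t : ℝ} (hc : IsHamiltonAt p c t)
    (hΘ : ∀ᶠ l' in 𝓝 (c t), ContMDiffAt (cotangentModel I) (cotangentModel I) ∞ Θ l')
    (hh : ContMDiffAt (cotangentModel I) 𝓘(ℝ, ℝ) ∞ h (c t))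
    {d : CotangentBundle I X → (E × (E →L[ℝ] ℝ)) →L[ℝ] ℝ}
    (hd : ∀ᶠ l' in 𝓝 (c t), HasMFDerivAt (cotangentModel I) 𝓘(ℝ, ℝ) h l' (d l'))
    (hα : ∀ᶠ l' in 𝓝 (c t), ∀ (D : (E × (E →L[ℝ] ℝ)) →L[ℝ] E × (E →L[ℝ] ℝ)),
      HasMFDerivAt (cotangentModel I) (cotangentModel I) Θ l' D → ∀ v : E × (E →L[ℝ] ℝ),
      (Θ l').2 (D v).1 = a * l'.2 v.1 + d l' v)
    (hp : MDifferentiableAt (cotangentModel I) 𝓘(ℝ, ℝ) p (c t))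
    (hp' : MDifferentiableAt (cotangentModel I) 𝓘(ℝ, ℝ) p (Θ (c t)))
    (hpΘ : ∀ᶠ l' in 𝓝 (c t), p (Θ l') = a * p l') :
    IsHamiltonAt p (fun u => Θ (c u)) t := by
  obtain ⟨v, hv, hvw⟩ := hc
  let D : CotangentBundle I X → (E × (E →L[ℝ] ℝ)) →L[ℝ] E × (E →L[ℝ] ℝ) := fun l =>
    mfderiv (cotangentModel I) (cotangentModel I) Θ l
  have hD : ∀ᶠ l' in 𝓝 (c t), HasMFDerivAt (cotangentModel I) (cotangentModel I) Θ l' (D l') := by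
    filter_upwards [hΘ] with l' hl' using (hl'.mdifferentiableAt (by simp)).hasMFDerivAt
  have hω : ∀ v w, symplecticForm I (Θ (c t)) (D (c t) v) (D (c t) w) =
      a * symplecticForm I (c t) v w :=
    symplecticForm_of_liouville hΘ hD hh hd
      (by filter_upwards [hD, hα] with l' h1 h2 v using h2 _ h1 v)
  -- As `a ≠ 0` and the form is nondegenerate, `D` is injective, hence bijective by dimension. It
  -- suffices to test Hamilton's equation on vectors `D w`.
  have hinj : Function.Injective (D (c t)) := by
    refine (injective_iff_map_eq_zero _).2 fun v hv => stdSymplectic_nondegenerate fun w => ?_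
    have h1 := hω v w
    rw [hv, symplecticForm_eq, symplecticForm_eq, stdSymplectic] at h1
    simpa [ha] using h1.symm
  have hsurj : Function.Surjective (D (c t)) :=
    LinearMap.surjective_of_injective (f := (D (c t) : (E × (E →L[ℝ] ℝ)) →ₗ[ℝ] _)) hinj
  refine ⟨D (c t) v, hv.comp hD.self_of_nhds, fun w => ?_⟩
  obtain ⟨w, rfl⟩ := hsurj w
  rw [hω, hvw]
  have h1 : HasMFDerivAt (cotangentModel I) 𝓘(ℝ, ℝ) (fun l => p (Θ l)) (c t)
    ((mfderiv (cotangentModel I) 𝓘(ℝ, ℝ) p (Θ (c t))).comp (D (c t))) :=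
    hp'.hasMFDerivAt.comp (c t) hD.self_of_nhds
  have h2 : HasMFDerivAt (cotangentModel I) 𝓘(ℝ, ℝ) (fun l => a * p l) (c t)
      (a • (mfderiv (cotangentModel I) 𝓘(ℝ, ℝ) p (c t) : (E × (E →L[ℝ] ℝ)) →L[ℝ] ℝ)) :=
    hp.hasMFDerivAt.const_smul a
  have h3 := hasMFDerivAt_unique (h1.congr_of_eventuallyEq
    (by filter_upwards [hpΘ] with l' hl' using hl'.symm)) h2
  exact (congrArg (fun L : (E × (E →L[ℝ] ℝ)) →L[ℝ] ℝ => L w) h3).symm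

/-- Over a fixed base point, canonical coordinates centered there are affine in the covector, so a
line in the fiber remains a line. -/
theorem hasVelocity_vertical (x : X) (ξ ζ : E →L[ℝ] ℝ) :
    HasVelocity (cotangentModel I)
      (fun t : ℝ => (⟨x, (ξ + t • ζ : E →L[ℝ] ℝ)⟩ : CotangentBundle I X)) 0
      ((0 : E), ζ) := by
  set l : CotangentBundle I X := ⟨x, ξ⟩
  have hl : l ∈ (cotCoord I x).source := mem_cotCoord_source.2 (mem_coordAt_source _)
  have h1 := (hasVelocity_line (cotCoord I x l) ((0 : E), ζ)).comp_of_eq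
    (hasMFDerivAt_coordAt_symm_self (I := cotangentModel I) l) (by simp; rfl)
  refine h1.congr (Eventually.of_forall fun t => ?_)
  have h2 : cotCoord I x ⟨x, (ξ + t • ζ : E →L[ℝ] ℝ)⟩ = cotCoord I x l + t • ((0 : E), ζ) := by
    have h3 : ∀ ζ : E →L[ℝ] ℝ,
        cotCoord I x (⟨x, ζ⟩ : CotangentBundle I X) = (coordAt I x x, ζ) := fun ζ =>
      cotCoord_self (⟨x, ζ⟩ : CotangentBundle I X)
    refine (h3 _).trans ?_
    rw [show cotCoord I x l = (coordAt I x x, ξ) from h3 ξ]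
    simp
  have h3 := (cotCoord I x).left_inv
    (mem_cotCoord_source.2 (mem_coordAt_source x) :
      (⟨x, (ξ + t • ζ : E →L[ℝ] ℝ)⟩ : CotangentBundle I X) ∈ _)
  exact h3.symm.trans (congrArg (cotCoord I x).symm h2)

end Canonical

/-! ### Homogeneous Hamiltonians -/

section Homogeneous

variable {E H : Type*} [NormedAddCommGroup E] [NormedSpace ℝ E]
  [TopologicalSpace H]
  {I : ModelWithCorners ℝ E H} [I.Boundaryless]
  {X : Type*} [TopologicalSpace X] [ChartedSpace H X] [IsManifold I ∞ X]
  {p : CotangentBundle I X → ℝ} {U : Set (CotangentBundle I X)}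

/-- Dilation in the fibers of `T*X`. -/
def dilate (a : ℝ) (l : CotangentBundle I X) : CotangentBundle I X := ⟨l.1, a • l.2⟩

theorem contMDiff_dilate (a : ℝ) : ContMDiff (cotangentModel I) (cotangentModel I) ∞
    (dilate (I := I) (X := X) a) :=
  (contMDiff_fiber_smul (I := I) (X := X)).comp (contMDiff_const.prodMk contMDiff_id)

theorem dilate_dilate (a b : ℝ) (l : CotangentBundle I X) :
    dilate a (dilate b l) = dilate (a * b) l :=
  congrArg (fun ξ : E →L[ℝ] ℝ => (⟨l.1, ξ⟩ : CotangentBundle I X)) (smul_smul a b (l.2 : E →L[ℝ] ℝ))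

theorem dilate_one (l : CotangentBundle I X) : dilate 1 l = l :=
  congrArg (fun ξ : E →L[ℝ] ℝ => (⟨l.1, ξ⟩ : CotangentBundle I X)) (one_smul ℝ (l.2 : E →L[ℝ] ℝ))

/-- `p` is positively homogeneous of degree one on the conic set `U`. -/
structure IsHomogeneousOn (p : CotangentBundle I X → ℝ) (U : Set (CotangentBundle I X)) :
    Prop where
  conic : ∀ l ∈ U, ∀ a : ℝ, 0 < a → dilate a l ∈ U
  eq : ∀ l ∈ U, ∀ a : ℝ, 0 < a → p (dilate a l) = a * p l

/-- Dilation by `a` multiplies both `α` and `p` by `a`; the factors cancel in Hamilton's equation.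
-/
theorem IsHamiltonAt.dilate [FiniteDimensional ℝ E] (hU : IsOpen U)
    (hp : ContMDiffOn (cotangentModel I) 𝓘(ℝ, ℝ) ∞ p U) (hom : IsHomogeneousOn p U) {a : ℝ}
    (ha : 0 < a) {c : ℝ → CotangentBundle I X} {t : ℝ} (hcU : c t ∈ U) (hc : IsHamiltonAt p c t) :
    IsHamiltonAt p (fun u => dilate a (c u)) t := by
  refine hc.map_of_liouville (Θ := GroupoidRelation.dilate a) (h := fun _ => 0) (d := 0) ha.ne'
    (Eventually.of_forall fun l => contMDiff_dilate a l) contMDiffAt_const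
    (Eventually.of_forall fun l => hasMFDerivAt_const _ _)
    (Eventually.of_forall fun l D hD v => ?_)
    ((hp.contMDiffAt (hU.mem_nhds hcU)).mdifferentiableAt (by simp))
    ((hp.contMDiffAt (hU.mem_nhds (hom.conic _ hcU a ha))).mdifferentiableAt (by simp))
    (by filter_upwards [hU.mem_nhds hcU] with l hl using hom.eq l hl a ha)
  have h1 : HasMFDerivAt (cotangentModel I) I (fun l : CotangentBundle I X => l.1) l
    ((ContinuousLinearMap.fst ℝ E (E →L[ℝ] ℝ)).comp D) :=
    (hasMFDerivAt_proj (GroupoidRelation.dilate a l)).comp l hD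
  have h2 : (D v).1 = v.1 := congrArg (fun L : (E × (E →L[ℝ] ℝ)) →L[ℝ] E => L v)
    (hasMFDerivAt_unique h1 (hasMFDerivAt_proj l))
  rw [h2]
  exact (add_zero (a * (l.2 : E →L[ℝ] ℝ) v.1)).symm

/-- Euler's identity. -/
theorem mfderiv_vertical_eq (hU : IsOpen U)
    (hp : ContMDiffOn (cotangentModel I) 𝓘(ℝ, ℝ) ∞ p U) (hom : IsHomogeneousOn p U)
    {l : CotangentBundle I X} (hl : l ∈ U) :
    mfderiv (cotangentModel I) 𝓘(ℝ, ℝ) p l ((0 : E), (l.2 : E →L[ℝ] ℝ)) = p l := by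
  have h1 := (hasVelocity_vertical (I := I) l.1 l.2 l.2).comp_of_eq
    (ContMDiffOn.hasMFDerivAt_of_isOpen hp hU hl)
    (congrArg (fun ξ : E →L[ℝ] ℝ => (⟨l.1, ξ⟩ : CotangentBundle I X))
      (by rw [zero_smul, add_zero] : ((l.2 : E →L[ℝ] ℝ) + (0 : ℝ) • (l.2 : E →L[ℝ] ℝ)) = l.2))
  have h2 : HasVelocity 𝓘(ℝ, ℝ) (fun t : ℝ => (1 + t) * p l) 0 (p l) := by
    rw [hasVelocity_iff_hasDerivAt]
    simpa using ((hasDerivAt_id (0 : ℝ)).const_add 1).mul_const (p l)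
  refine h1.unique (h2.congr ?_)
  filter_upwards [Ioi_mem_nhds (show (-1 : ℝ) < 0 by norm_num)] with t ht
  have h3 : (⟨l.1, ((l.2 : E →L[ℝ] ℝ) + t • (l.2 : E →L[ℝ] ℝ) : E →L[ℝ] ℝ)⟩ :
      CotangentBundle I X) = dilate (1 + t) l :=
    congrArg (fun ξ : E →L[ℝ] ℝ => (⟨l.1, ξ⟩ : CotangentBundle I X)) (by rw [add_smul, one_smul])
  exact (congrArg p h3).trans (hom.eq l hl (1 + t) (by linarith [mem_Ioi.1 ht]))

/-- Pairing `H_p` with the vertical vector `(0, ξ)` gives `ξ dx (H_p)` on one side and, by Euler's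
identity, `p` on the other. -/
theorem liouville_hamilton (hU : IsOpen U)
    (hp : ContMDiffOn (cotangentModel I) 𝓘(ℝ, ℝ) ∞ p U) (hom : IsHomogeneousOn p U)
    {l : CotangentBundle I X} (hl : l ∈ U) {v : E × (E →L[ℝ] ℝ)}
    (hv : ∀ w : E × (E →L[ℝ] ℝ), symplecticForm I l v w =
      mfderiv (cotangentModel I) 𝓘(ℝ, ℝ) p l w) : l.2 v.1 = p l := by
  have h1 := (hv ((0 : E), (l.2 : E →L[ℝ] ℝ))).trans (mfderiv_vertical_eq hU hp hom hl)
  have h2 : ∀ ξ : E →L[ℝ] ℝ, stdSymplectic v ((0 : E), ξ) = ξ v.1 := fun ξ => by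
    simp [stdSymplectic]
  exact (h2 l.2).symm.trans h1

variable [FiniteDimensional ℝ E] [T2Space X] {χ : ℝ → U → U}

theorem IsHamiltonianFlow.contMDiffAt_time (hχ : IsHamiltonianFlow I p U χ)
    (hU : IsOpen U) (hp : ContMDiffOn (cotangentModel I) 𝓘(ℝ, ℝ) ∞ p U) (t : ℝ)
    {l : CotangentBundle I X} (hl : l ∈ U) :
    ContMDiffAt (cotangentModel I) (cotangentModel I) ∞ (fun l => flowMap χ (t, l)) l :=
  ContMDiffAt.comp l (f := fun l : CotangentBundle I X => (t, l))
    (hχ.contMDiffAt hU hp (q := (t, l)) hl) (contMDiffAt_const.prodMk contMDiffAt_id)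

theorem IsHamiltonianFlow.isHamiltonAt_flowMap (hχ : IsHamiltonianFlow I p U χ) (t : ℝ)
    {l : CotangentBundle I X} (hl : l ∈ U) : IsHamiltonAt p (fun u => flowMap χ (u, l)) t :=
  (hχ.isHamiltonAt ⟨l, hl⟩ t).congr (Eventually.of_forall fun _ => flowMap_of_mem χ hl)

theorem IsHamiltonianFlow.hamiltonian_flowMap (hχ : IsHamiltonianFlow I p U χ) (hU : IsOpen U)
    (hp : ContMDiffOn (cotangentModel I) 𝓘(ℝ, ℝ) ∞ p U) (t : ℝ)
    {l : CotangentBundle I X} (hl : l ∈ U) : p (flowMap χ (t, l)) = p l := by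
  rw [flowMap_of_mem χ hl]
  exact hχ.hamiltonian_eq hU hp t ⟨l, hl⟩

theorem IsHamiltonianFlow.flowMap_zero (hχ : IsHamiltonianFlow I p U χ)
    {l : CotangentBundle I X} (hl : l ∈ U) : flowMap χ (0, l) = l := by
  rw [flowMap_of_mem χ hl, hχ.zero]

theorem IsHamiltonianFlow.flowMap_add (hχ : IsHamiltonianFlow I p U χ) (hU : IsOpen U)
    (hp : ContMDiffOn (cotangentModel I) 𝓘(ℝ, ℝ) ∞ p U) (s t : ℝ)
    {l : CotangentBundle I X} (hl : l ∈ U) :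
    flowMap χ (s, flowMap χ (t, l)) = flowMap χ (s + t, l) := by
  have : (⟨flowMap χ (t, l), flowMap_mem χ hl⟩ : U) = χ t ⟨l, hl⟩ :=
    Subtype.ext (flowMap_of_mem χ hl)
  rw [flowMap_of_mem χ (flowMap_mem χ hl), this, flowMap_of_mem χ hl, hχ.add hU hp]

theorem IsHamiltonianFlow.flowMap_neg (hχ : IsHamiltonianFlow I p U χ) (hU : IsOpen U)
    (hp : ContMDiffOn (cotangentModel I) 𝓘(ℝ, ℝ) ∞ p U) (t : ℝ)
    {l : CotangentBundle I X} (hl : l ∈ U) :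
    flowMap χ (t, flowMap χ (-t, l)) = l := by
  rw [hχ.flowMap_add hU hp _ _ hl, _root_.add_neg_cancel, hχ.flowMap_zero hl]

theorem IsHamiltonianFlow.flowMap_neg' (hχ : IsHamiltonianFlow I p U χ) (hU : IsOpen U)
    (hp : ContMDiffOn (cotangentModel I) 𝓘(ℝ, ℝ) ∞ p U) (t : ℝ)
    {l : CotangentBundle I X} (hl : l ∈ U) :
    flowMap χ (-t, flowMap χ (t, l)) = l := by
  rw [hχ.flowMap_add hU hp _ _ hl, _root_.neg_add_cancel, hχ.flowMap_zero hl]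

theorem IsHamiltonianFlow.flowMap_eq (hχ : IsHamiltonianFlow I p U χ) (hU : IsOpen U)
    (hp : ContMDiffOn (cotangentModel I) 𝓘(ℝ, ℝ) ∞ p U)
    {c : ℝ → CotangentBundle I X}
    (hc : ∀ t, c t ∈ U ∧ IsHamiltonAt p c t) {l : CotangentBundle I X} (hl : c 0 = l) (t : ℝ) :
    flowMap χ (t, l) = c t := by
  have hl' : l ∈ U := hl ▸ (hc 0).1
  rw [flowMap_of_mem χ hl']
  exact (hχ.eq_of_isHamiltonAt hU hp isOpen_univ isPreconnected_univ (mem_univ 0)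
    (fun t _ => hc t) (l := ⟨l, hl'⟩) hl (mem_univ t)).symm

theorem IsHamiltonianFlow.flowMap_dilate (hχ : IsHamiltonianFlow I p U χ) (hU : IsOpen U)
    (hp : ContMDiffOn (cotangentModel I) 𝓘(ℝ, ℝ) ∞ p U) (hom : IsHomogeneousOn p U) (t : ℝ)
    {l : CotangentBundle I X} (hl : l ∈ U) {a : ℝ} (ha : 0 < a) :
    flowMap χ (t, dilate a l) = dilate a (flowMap χ (t, l)) :=
  hχ.flowMap_eq hU hp (c := fun t => dilate a (flowMap χ (t, l)))
    (fun t => ⟨hom.conic _ (flowMap_mem χ hl) a ha,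
      (hχ.isHamiltonAt_flowMap t hl).dilate hU hp hom ha (flowMap_mem χ hl)⟩)
    (by rw [hχ.flowMap_zero hl]) t

/-- The flow of a homogeneous Hamiltonian preserves the canonical one-form. -/
theorem IsHamiltonianFlow.liouville_eq (hχ : IsHamiltonianFlow I p U χ) (hU : IsOpen U)
    (hp : ContMDiffOn (cotangentModel I) 𝓘(ℝ, ℝ) ∞ p U) (hom : IsHomogeneousOn p U) (t : ℝ)
    {l : CotangentBundle I X} (hl : l ∈ U) {D : (E × (E →L[ℝ] ℝ)) →L[ℝ] E × (E →L[ℝ] ℝ)}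
    (hD : HasMFDerivAt (cotangentModel I) (cotangentModel I) (fun l => flowMap χ (t, l)) l D)
    (w : E × (E →L[ℝ] ℝ)) : (flowMap χ (t, l)).2 (D w).1 = l.2 w.1 := by
  set κ := cotCoord I l.1
  have hκ : IsCoord (cotangentModel I) κ := isCoord_cotCoord l.1
  have hlκ : l ∈ κ.source := mem_cotCoord_source.2 (mem_coordAt_source _)
  have hO : IsOpen (κ.target ∩ κ.symm ⁻¹' U) := κ.isOpen_inter_preimage_symm hU
  let V := E × (E →L[ℝ] ℝ)
  -- Time and initial point are varied together, so that `ω = -dα` can be applied to the pair formed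
  -- by the time direction and `w`.
  let Ψ : ℝ × V → CotangentBundle I X := fun q => flowMap χ (q.1, κ.symm q.2)
  let O : Set (ℝ × V) := {q | q.2 ∈ κ.target ∩ κ.symm ⁻¹' U}
  have hO' : IsOpen O := hO.preimage continuous_snd
  have hΨ : ∀ q ∈ O, ContMDiffAt 𝓘(ℝ, ℝ × V) (cotangentModel I) ∞ Ψ q := fun q hq => by
    refine ContMDiffAt.comp q (g := flowMap χ) (f := fun q : ℝ × V => (q.1, κ.symm q.2))
      (hχ.contMDiffAt hU hp (q := (q.1, κ.symm q.2)) hq.2) ?_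
    exact contDiff_fst.contMDiff.contMDiffAt.prodMk (ContMDiffAt.comp q (f := fun q : ℝ × V => q.2)
      (hκ.contMDiffAt_symm hq.1) contDiff_snd.contMDiff.contMDiffAt)
  let D' : ℝ × V → (ℝ × V) →L[ℝ] V := fun q => mfderiv 𝓘(ℝ, ℝ × V) (cotangentModel I) Ψ q
  have hD' : ∀ q ∈ O, HasMFDerivAt 𝓘(ℝ, ℝ × V) (cotangentModel I) Ψ q (D' q) := fun q hq =>
    ((hΨ q hq).mdifferentiableAt (by simp)).hasMFDerivAt
  have hmem : ∀ t : ℝ, (t, κ l) ∈ O := fun t =>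
    ⟨κ.map_source hlκ, by rw [mem_preimage, κ.left_inv hlκ]; exact hl⟩
  have htime : ∀ q ∈ O, HasVelocity (cotangentModel I) (fun t => flowMap χ (t, κ.symm q.2)) q.1
      (D' q (1, 0)) := by
    intro q hq
    have h1 : HasVelocity 𝓘(ℝ, ℝ × V) (fun t : ℝ => (t, q.2)) q.1 ((1 : ℝ), (0 : V)) := by
      rw [hasVelocity_iff_hasDerivAt]
      exact (hasDerivAt_id q.1).prodMk (hasDerivAt_const q.1 q.2)
    exact h1.comp_of_eq (hD' q hq) rfl
  have hsymp : ∀ q ∈ O, ∀ w, symplecticForm I (Ψ q) (D' q (1, 0)) w =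
      mfderiv (cotangentModel I) 𝓘(ℝ, ℝ) p (Ψ q) w := by
    intro q hq w
    obtain ⟨v, h1, h2⟩ := hχ.isHamiltonAt_flowMap q.1 hq.2
    rw [(htime q hq).unique h1]
    exact h2 w
  have hθ1 : ∀ q ∈ O, (Ψ q).2 (D' q (1, 0)).1 = p (κ.symm q.2) := fun q hq =>
    (liouville_hamilton hU hp hom (flowMap_mem χ hq.2) (hsymp q hq)).trans
      (hχ.hamiltonian_flowMap hU hp q.1 hq.2)
  let θ : ℝ × V → ℝ := fun q => (Ψ q).2 (D' q (0, w)).1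
  have hθd : ∀ t, DifferentiableAt ℝ θ (t, κ l) := fun t =>
    differentiableAt_liouville (eventually_of_mem (hO'.mem_nhds (hmem t)) hΨ)
      (eventually_of_mem (hO'.mem_nhds (hmem t)) hD') (0, w)
  -- The formula for `dα` gives `∂_t θ - dp(Ψ_w) = -ω(H_p, Ψ_w)`, where `α(H_p) = p` is constant in
  -- time. By Hamilton's equation the right side is `-dp(Ψ_w)`, hence `∂_t θ = 0`.
  have hθ0 : ∀ t, fderiv ℝ θ (t, κ l) (1, 0) = 0 := by
    intro t
    have h1 := symplecticForm_eq_fderiv (eventually_of_mem (hO'.mem_nhds (hmem t)) hΨ)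
      (eventually_of_mem (hO'.mem_nhds (hmem t)) hD') (1, 0) (0, w)
    have h2 : (fun q' => (Ψ q').2 (D' q' (1, 0)).1) =ᶠ[𝓝 (t, κ l)] fun q => p (κ.symm q.2) :=
      eventually_of_mem (hO'.mem_nhds (hmem t)) hθ1
    have h3 : (fun q => p (Ψ q)) =ᶠ[𝓝 (t, κ l)] fun q => p (κ.symm q.2) :=
      eventually_of_mem (hO'.mem_nhds (hmem t)) fun q hq => hχ.hamiltonian_flowMap hU hp q.1 hq.2
    let P : V →L[ℝ] ℝ := mfderiv (cotangentModel I) 𝓘(ℝ, ℝ) p (Ψ (t, κ l))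
    have h4 : HasMFDerivAt 𝓘(ℝ, ℝ × V) 𝓘(ℝ, ℝ) (fun q => p (Ψ q)) (t, κ l)
        (P.comp (D' (t, κ l))) :=
      HasMFDerivAt.comp (t, κ l)
        (ContMDiffOn.hasMFDerivAt_of_isOpen hp hU (flowMap_mem χ (hmem t).2)) (hD' _ (hmem t))
    have h5 : HasFDerivAt (fun q : ℝ × V => p (κ.symm q.2)) (P.comp (D' (t, κ l))) (t, κ l) :=
      hasMFDerivAt_iff_hasFDerivAt.1 (h4.congr_of_eventuallyEq h3.symm)
    have h6 : symplecticForm I (Ψ (t, κ l)) (D' (t, κ l) (1, 0)) (D' (t, κ l) (0, w)) =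
      P (D' (t, κ l) (0, w)) := hsymp _ (hmem t) _
    rw [h2.fderiv_eq, h5.fderiv, h6, ContinuousLinearMap.comp_apply] at h1
    have h7 : fderiv ℝ θ (t, κ l) (1, 0) - P (D' (t, κ l) (0, w)) = -P (D' (t, κ l) (0, w)) := h1
    linarith
  have hconst : ∀ t, HasDerivAt (fun t : ℝ => θ (t, κ l)) 0 t := by
    intro t
    have h1 : HasDerivAt (fun t : ℝ => (t, κ l)) ((1 : ℝ), (0 : V)) t :=
      (hasDerivAt_id t).prodMk (hasDerivAt_const t (κ l))
    have h2 := (hθd t).hasFDerivAt.comp_hasDerivAt t h1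
    rw [hθ0 t] at h2
    exact h2
  have h0 := is_const_of_deriv_eq_zero (fun t => (hconst t).differentiableAt)
    (fun t => (hconst t).deriv) t 0
  have hspace : ∀ (t : ℝ) (D : V →L[ℝ] V),
      HasMFDerivAt (cotangentModel I) (cotangentModel I) (fun l => flowMap χ (t, l)) l D →
      D' (t, κ l) (0, w) = D w := by
    intro t D hD
    have h1 : HasVelocity 𝓘(ℝ, ℝ × V) (fun u : ℝ => (t, κ l + u • w)) 0 ((0 : ℝ), w) := by
      rw [hasVelocity_iff_hasDerivAt]
      exact (hasDerivAt_const 0 t).prodMk (hasVelocity_iff_hasDerivAt.1 (hasVelocity_line (κ l) w))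
    have h2 := h1.comp_of_eq (hD' _ (hmem t)) (by simp)
    have h3 := (hasVelocity_line (κ l) w).comp_of_eq
      (hasMFDerivAt_coordAt_symm_self (I := cotangentModel I) l) (by simp; rfl)
    have h4 := h3.comp_of_eq hD (by
      rw [zero_smul, add_zero]
      exact κ.left_inv hlκ)
    exact h2.unique h4
  have h1 : θ (t, κ l) = (flowMap χ (t, l)).2 (D w).1 := by
    change (flowMap χ (t, κ.symm (κ l))).2 (D' (t, κ l) (0, w)).1 = _
    rw [hspace t D hD, κ.left_inv hlκ]
  have h2 : θ (0, κ l) = l.2 w.1 := by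
    have h3 : HasMFDerivAt (cotangentModel I) (cotangentModel I) (fun l => flowMap χ (0, l)) l
        (ContinuousLinearMap.id ℝ V) := by
      refine (hasMFDerivAt_id l).congr_of_eventuallyEq ?_
      filter_upwards [hU.mem_nhds hl] with l' hl' using hχ.flowMap_zero hl'
    change (flowMap χ (0, κ.symm (κ l))).2 (D' (0, κ l) (0, w)).1 = _
    rw [hspace 0 _ h3, κ.left_inv hlκ, hχ.flowMap_zero hl]
    rfl
  exact h1.symm.trans (h0.trans h2)

/-- The flow of a homogeneous Hamiltonian preserves the symplectic form. -/
theorem IsHamiltonianFlow.symplecticForm_eq (hχ : IsHamiltonianFlow I p U χ) (hU : IsOpen U)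
    (hp : ContMDiffOn (cotangentModel I) 𝓘(ℝ, ℝ) ∞ p U) (hom : IsHomogeneousOn p U) (t : ℝ)
    {l : CotangentBundle I X} (hl : l ∈ U) {D : (E × (E →L[ℝ] ℝ)) →L[ℝ] E × (E →L[ℝ] ℝ)}
    (hD : HasMFDerivAt (cotangentModel I) (cotangentModel I) (fun l => flowMap χ (t, l)) l D)
    (v w : E × (E →L[ℝ] ℝ)) :
    symplecticForm I (flowMap χ (t, l)) (D v) (D w) = symplecticForm I l v w := by
  let D' : CotangentBundle I X → (E × (E →L[ℝ] ℝ)) →L[ℝ] E × (E →L[ℝ] ℝ) := fun l =>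
    mfderiv (cotangentModel I) (cotangentModel I) (fun l => flowMap χ (t, l)) l
  have hD' : ∀ l ∈ U, HasMFDerivAt (cotangentModel I) (cotangentModel I)
      (fun l => flowMap χ (t, l)) l (D' l) := fun l hl =>
    ((hχ.contMDiffAt_time hU hp t hl).mdifferentiableAt (by simp)).hasMFDerivAt
  have h := symplecticForm_of_liouville (I := I) (Θ := fun l => flowMap χ (t, l)) (l := l)
    (h := fun _ => 0) (d := 0) (a := 1) (D := D')
    (eventually_of_mem (hU.mem_nhds hl) fun l hl => hχ.contMDiffAt_time hU hp t hl)
    (eventually_of_mem (hU.mem_nhds hl) hD') contMDiffAt_const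
    (Eventually.of_forall fun l => hasMFDerivAt_const _ _)
    (eventually_of_mem (hU.mem_nhds hl) fun l hl v => by
      rw [hχ.liouville_eq hU hp hom t hl (hD' l hl)]
      simp) v w
  rw [one_mul] at h
  have h2 : D' l = D := hasMFDerivAt_unique (hD' l hl) hD
  rwa [h2] at h

end Homogeneous

/-! ### The structure maps of the cotangent groupoid -/

namespace LieGroupoid

variable {E H F N : Type*} [NormedAddCommGroup E] [NormedSpace ℝ E] [FiniteDimensional ℝ E]
  [TopologicalSpace H] [NormedAddCommGroup F] [NormedSpace ℝ F] [FiniteDimensional ℝ F]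
  [TopologicalSpace N]
  {I : ModelWithCorners ℝ E H} [I.Boundaryless] {G : Type*} [TopologicalSpace G] [ChartedSpace H G]
  {J : ModelWithCorners ℝ F N} [J.Boundaryless] {M : Type*} [TopologicalSpace M] [ChartedSpace N M]
  [IsManifold I ∞ G] [IsManifold J ∞ M] (𝒢 : LieGroupoid I G J M)
  {E'' H'' : Type*} [NormedAddCommGroup E''] [NormedSpace ℝ E''] [TopologicalSpace H'']
  {I'' : ModelWithCorners ℝ E'' H''}
  {Q : Type*} [TopologicalSpace Q] [ChartedSpace H'' Q]

theorem contMDiffAt_mul {f g : Q → G} {q₀ : Q} (hf : ContMDiffAt I'' I ∞ f q₀)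
    (hg : ContMDiffAt I'' I ∞ g q₀) (h : ∀ᶠ q in 𝓝 q₀, 𝒢.s (f q) = 𝒢.r (g q)) :
    ContMDiffAt I'' I ∞ (fun q => 𝒢.mul (f q) (g q)) q₀ :=
  ((𝒢.smooth_mul (f q₀, g q₀) h.self_of_nhds).comp (t := {q : G × G | 𝒢.s q.1 = 𝒢.r q.2})
    (s := {q | 𝒢.s (f q) = 𝒢.r (g q)}) q₀
    (hf.prodMk hg).contMDiffWithinAt fun _ hq => hq).contMDiffAt h

/-- The derivative of the source map. -/
def dS (y : G) : E →L[ℝ] F := mfderiv I J 𝒢.s y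

/-- The derivative of the range map. -/
def dR (y : G) : E →L[ℝ] F := mfderiv I J 𝒢.r y

/-- The derivative of the unit map. -/
def dU (x : M) : F →L[ℝ] E := mfderiv J I 𝒢.unit x

theorem hasMFDerivAt_s (y : G) : HasMFDerivAt I J 𝒢.s y (𝒢.dS y) :=
  (𝒢.smooth_s.mdifferentiable (by simp) y).hasMFDerivAt

theorem hasMFDerivAt_r (y : G) : HasMFDerivAt I J 𝒢.r y (𝒢.dR y) :=
  (𝒢.smooth_r.mdifferentiable (by simp) y).hasMFDerivAt

theorem hasMFDerivAt_unit (x : M) : HasMFDerivAt J I 𝒢.unit x (𝒢.dU x) :=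
  (𝒢.smooth_unit.mdifferentiable (by simp) x).hasMFDerivAt

theorem dS_dU (x : M) (w : F) : 𝒢.dS (𝒢.unit x) (𝒢.dU x w) = w := by
  have h : HasMFDerivAt J J (fun x => 𝒢.s (𝒢.unit x)) x ((𝒢.dS (𝒢.unit x)).comp (𝒢.dU x)) :=
    (𝒢.hasMFDerivAt_s (𝒢.unit x)).comp x (𝒢.hasMFDerivAt_unit x)
  have h2 := hasMFDerivAt_unique h ((hasMFDerivAt_id x).congr_of_eventuallyEq
    (Eventually.of_forall fun x => 𝒢.s_unit x))
  exact congrArg (fun L : F →L[ℝ] F => L w) h2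

theorem algebroidProj_apply (x : M) (w : E) :
    𝒢.algebroidProj x w = w - 𝒢.dU x (𝒢.dS (𝒢.unit x) w) := rfl

theorem dS_algebroidProj (x : M) (w : E) : 𝒢.dS (𝒢.unit x) (𝒢.algebroidProj x w) = 0 := by
  rw [algebroidProj_apply, map_sub, dS_dU, sub_self]

theorem algebroidProj_of_dS_eq_zero {x : M} {w : E} (hw : 𝒢.dS (𝒢.unit x) w = 0) :
    𝒢.algebroidProj x w = w := by
  rw [algebroidProj_apply, hw, map_zero, sub_zero]

theorem algebroidProj_dU (x : M) (w : F) : 𝒢.algebroidProj x (𝒢.dU x w) = 0 := by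
  rw [algebroidProj_apply, dS_dU, sub_self]

/-- Coordinates in which the source map is linear. -/
theorem exists_source_coord (y : G) : ∃ κ : OpenPartialHomeomorph G E, IsCoord I κ ∧ y ∈ κ.source ∧
    HasMFDerivAt I 𝓘(ℝ, E) κ y (ContinuousLinearMap.id ℝ E) ∧
    ∀ z ∈ κ.source, 𝒢.s z ∈ (coordAt J (𝒢.s y)).source ∧
      𝒢.dS y (κ z) = coordAt J (𝒢.s y) (𝒢.s z) := by
  have hO : IsOpen (𝒢.s ⁻¹' (coordAt J (𝒢.s y)).source) :=
    (coordAt J (𝒢.s y)).open_source.preimage 𝒢.smooth_s.continuous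
  obtain ⟨κ, h1, h2, h3, h4, h5⟩ := exists_coord_of_surjective (f' := 𝒢.dS y) hO
    (f := fun z => coordAt J (𝒢.s y) (𝒢.s z))
    ((isCoord_coordAt (I := J) (𝒢.s y)).smooth.comp 𝒢.smooth_s.contMDiffOn fun z hz => hz)
    (x := y) (mem_coordAt_source _)
    ((hasMFDerivAt_coordAt_self (𝒢.s y)).comp y (𝒢.hasMFDerivAt_s y)) (𝒢.submersion_s y)
  exact ⟨κ, h1, h2, h4, fun z hz => ⟨h3 hz, h5 z hz⟩⟩

/-- In coordinates where `s` is linear, a line in a direction of `ker ds` stays in the source fiber.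
-/
theorem exists_fiber_curve {y : G} {v : E} (hv : 𝒢.dS y v = 0) :
    ∃ c : ℝ → G, c 0 = y ∧ (∀ᶠ t in 𝓝 0, 𝒢.s (c t) = 𝒢.s y) ∧ HasVelocity I c 0 v ∧
      ContMDiffAt 𝓘(ℝ, ℝ) I ∞ c 0 := by
  obtain ⟨κ, hκ, hy, hκy, hs⟩ := 𝒢.exists_source_coord y
  have hl : Continuous fun t : ℝ => κ y + t • v := by fun_prop
  have hev : ∀ᶠ t : ℝ in 𝓝 0, κ y + t • v ∈ κ.target :=
    hl.continuousAt.eventually_mem (κ.open_target.mem_nhds (by simpa using κ.map_source hy))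
  have hid : mfderiv 𝓘(ℝ, E) I κ.symm (κ y) v = v := by
    have h1 := congrArg (fun L : E →L[ℝ] E => L v) (hκ.mfderiv_symm_comp hy)
    rw [hκy.mfderiv] at h1
    exact h1
  have hc := hκ.exists_curve hy v
  refine ⟨fun t => κ.symm (κ y + t • v), hc.1, ?_, ?_, ?_⟩
  rotate_left
  · have h1 := hc.2
    rw [hid] at h1
    exact h1
  rotate_right
  · filter_upwards [hev] with t ht
    have h1 := hs _ (κ.map_target ht)
    have h2 := hs _ hy
    refine (coordAt J (𝒢.s y)).injOn h1.1 h2.1 ?_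
    rw [← h1.2, ← h2.2, κ.right_inv ht, map_add, map_smul, hv, smul_zero, add_zero]
  · refine ContMDiffAt.comp 0 (f := fun t : ℝ => κ y + t • v) (hκ.contMDiffAt_symm ?_) ?_
    · simpa using κ.map_source hy
    · exact (by fun_prop : ContDiff ℝ ∞ fun t : ℝ => κ y + t • v).contMDiff.contMDiffAt

/-- Smooth local retractions onto the source fibers. -/
theorem exists_fiber_retraction (y : G) : ∃ ρ : M × G → G, ∀ᶠ p in 𝓝 (𝒢.s y, y),
    ContMDiffAt (J.prod I) I ∞ ρ p ∧ 𝒢.s (ρ p) = p.1 ∧ (𝒢.s p.2 = p.1 → ρ p = p.2) := by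
  obtain ⟨κ, hκ, hy, hκy, hs⟩ := 𝒢.exists_source_coord y
  obtain ⟨T, hT⟩ := (𝒢.dS y).exists_rightInverse_of_surjective
    (LinearMap.range_eq_top.2 (𝒢.submersion_s y))
  have hT' : ∀ v, 𝒢.dS y (T v) = v := fun v => congrArg (fun L : F →L[ℝ] F => L v) hT
  set k := coordAt J (𝒢.s y)
  have hk : IsCoord J k := isCoord_coordAt _
  let m : M × G → E := fun p => κ p.2 + T (k p.1 - k (𝒢.s p.2))
  have hm : ∀ p : M × G, p.1 ∈ k.source → p.2 ∈ κ.source →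
      ContMDiffAt (J.prod I) 𝓘(ℝ, E) ∞ m p := by
    intro p h1 h2
    have e1 : ContMDiffAt (J.prod I) 𝓘(ℝ, E) ∞ (fun p : M × G => κ p.2) p :=
      ContMDiffAt.comp p (f := fun p : M × G => p.2) (hκ.contMDiffAt h2) contMDiffAt_snd
    have e2 : ContMDiffAt (J.prod I) 𝓘(ℝ, F) ∞ (fun p : M × G => k p.1) p :=
      ContMDiffAt.comp p (f := fun p : M × G => p.1) (hk.contMDiffAt h1) contMDiffAt_fst
    have e3 : ContMDiffAt (J.prod I) 𝓘(ℝ, F) ∞ (fun p : M × G => k (𝒢.s p.2)) p :=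
      ContMDiffAt.comp p (f := fun p : M × G => 𝒢.s p.2) (hk.contMDiffAt (hs _ h2).1)
        ((𝒢.smooth_s.comp contMDiff_snd).contMDiffAt)
    exact e1.add (T.contMDiff.contMDiffAt.comp p (e2.sub e3))
  have h1 : ∀ᶠ p : M × G in 𝓝 (𝒢.s y, y), p.1 ∈ k.source :=
    continuousAt_fst.eventually_mem (k.open_source.mem_nhds (mem_coordAt_source _))
  have h2 : ∀ᶠ p : M × G in 𝓝 (𝒢.s y, y), p.2 ∈ κ.source :=
    continuousAt_snd.eventually_mem (κ.open_source.mem_nhds hy)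
  have h3 : ∀ᶠ p : M × G in 𝓝 (𝒢.s y, y), m p ∈ κ.target :=
    (hm (𝒢.s y, y) (mem_coordAt_source _) hy).continuousAt.eventually_mem
      (κ.open_target.mem_nhds (by simpa [m] using κ.map_source hy))
  refine ⟨fun p => κ.symm (m p), ?_⟩
  filter_upwards [h1, h2, h3] with p e1 e2 e3
  refine ⟨ContMDiffAt.comp p (hκ.contMDiffAt_symm e3) (hm p e1 e2), ?_, fun h => ?_⟩
  · refine k.injOn (hs _ (κ.map_target e3)).1 e1 ?_
    rw [← (hs _ (κ.map_target e3)).2, κ.right_inv e3, map_add, hT', (hs _ e2).2]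
    abel
  · have : m p = κ p.2 := by simp [m, h]
    rw [this, κ.left_inv e2]

/-- A smooth family of maps `g γ` from the source fibers of `b γ` to `G`, sending the unit to
`γ`. -/
structure IsFiberMap (g : G → G → G) (b : G → M) : Prop where
  smooth_base : ContMDiff I J ∞ b
  smooth : ContMDiffOn (I.prod I) I ∞ (Function.uncurry g) {q | 𝒢.s q.2 = b q.1}
  unit : ∀ γ, g γ (𝒢.unit (b γ)) = γ

/-- The derivative of `g γ` at the unit, along the source fiber. -/
def fiberDeriv (g : G → G → G) (b : G → M) (γ : G) : E →L[ℝ] E :=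
  mfderivWithin I I (g γ) {η | 𝒢.s η = b γ} (𝒢.unit (b γ))

/-- The pull-back of covectors by `fiberDeriv`. -/
def fiberCovector (g : G → G → G) (b : G → M) (l : CotangentBundle I G) : CotangentBundle I G :=
  let ξ : E →L[ℝ] ℝ := l.2
  ⟨𝒢.unit (b l.1), (ξ.comp ((𝒢.fiberDeriv g b l.1).comp (𝒢.algebroidProj (b l.1))) : E →L[ℝ] ℝ)⟩

theorem isFiberMap_right : 𝒢.IsFiberMap (fun γ η => 𝒢.mul η γ) 𝒢.r where
  smooth_base := 𝒢.smooth_r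
  smooth := 𝒢.smooth_mul.comp (contMDiff_snd.prodMk contMDiff_fst).contMDiffOn fun _ h => h
  unit γ := 𝒢.unit_mul γ

theorem r_inv_unit (x : M) : 𝒢.inv (𝒢.unit x) = 𝒢.unit x := by
  have h := 𝒢.unit_mul (𝒢.inv (𝒢.unit x))
  rw [𝒢.r_inv, 𝒢.s_unit] at h
  have h2 := 𝒢.mul_inv (𝒢.unit x)
  rw [𝒢.r_unit] at h2
  exact h.symm.trans h2

theorem isFiberMap_left : 𝒢.IsFiberMap (fun γ η => 𝒢.mul γ (𝒢.inv η)) 𝒢.s where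
  smooth_base := 𝒢.smooth_s
  smooth := 𝒢.smooth_mul.comp
    (contMDiff_fst.prodMk (𝒢.smooth_inv.comp contMDiff_snd)).contMDiffOn fun q h => by
      have h' : 𝒢.s q.2 = 𝒢.s q.1 := h
      change 𝒢.s q.1 = 𝒢.r (𝒢.inv q.2)
      rw [𝒢.r_inv, h']
  unit γ := by rw [𝒢.r_inv_unit, 𝒢.mul_unit]

theorem sΓ_eq (l : CotangentBundle I G) :
    𝒢.sΓ l = dilate (-1) (𝒢.fiberCovector (fun γ η => 𝒢.mul γ (𝒢.inv η)) 𝒢.s l) :=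
  congrArg (fun ξ : E →L[ℝ] ℝ => (⟨𝒢.unit (𝒢.s l.1), ξ⟩ : CotangentBundle I G))
    (neg_one_smul ℝ _).symm

variable {𝒢} {g : G → G → G} {b : G → M}

theorem IsFiberMap.hasVelocity (hg : 𝒢.IsFiberMap g b) {γ : G} {c : ℝ → G} {t : ℝ} {v : E}
    (hc : HasVelocity I c t v) (hct : c t = 𝒢.unit (b γ)) (hcs : ∀ᶠ u in 𝓝 t, 𝒢.s (c u) = b γ) :
    HasVelocity I (fun u => g γ (c u)) t (𝒢.fiberDeriv g b γ v) := by
  have h1 : ContMDiffWithinAt I I ∞ (g γ) {η | 𝒢.s η = b γ} (𝒢.unit (b γ)) :=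
    (hg.smooth (γ, 𝒢.unit (b γ)) (𝒢.s_unit (b γ))).comp (f := fun η => (γ, η))
      (t := {q : G × G | 𝒢.s q.2 = b q.1}) (𝒢.unit (b γ))
      (contMDiffAt_const.prodMk contMDiffAt_id).contMDiffWithinAt fun _ h => h
  exact hc.comp_within (h1.mdifferentiableWithinAt (by simp)).hasMFDerivWithinAt hct hcs

/-- The derivative is taken within source fibers that move with the base point, so it is first
replaced by a full derivative. The projection onto `ker ds` is `1 - d(unit ∘ s)`, which makes the
covector a difference of two pull-backs. -/
theorem IsFiberMap.contMDiff (hg : 𝒢.IsFiberMap g b) :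
    ContMDiff (cotangentModel I) (cotangentModel I) ∞ (𝒢.fiberCovector g b) := by
  intro l₀
  obtain ⟨ρ, hρ⟩ := 𝒢.exists_fiber_retraction (𝒢.unit (b l₀.1))
  rw [𝒢.s_unit] at hρ
  have hb : ContMDiff (cotangentModel I) J ∞ fun l : CotangentBundle I G => b l.1 :=
    hg.smooth_base.comp contMDiff_proj
  have hub : ContMDiff (cotangentModel I) I ∞ fun l : CotangentBundle I G => 𝒢.unit (b l.1) :=
    𝒢.smooth_unit.comp hb
  -- Composition with the fiber retraction extends `g γ` from the source fiber to a neighborhood of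
  -- the unit without changing it on the fiber.
  let m : CotangentBundle I G → G → G := fun l z => g l.1 (ρ (b l.1, z))
  have hbp : ContMDiff ((cotangentModel I).prod I) (J.prod I) ∞
      fun p : CotangentBundle I G × G => (b p.1.1, p.2) :=
    (hb.comp contMDiff_fst).prodMk contMDiff_snd
  have hρ' : ∀ᶠ p : CotangentBundle I G × G in 𝓝 (l₀, 𝒢.unit (b l₀.1)),
      ContMDiffAt (J.prod I) I ∞ ρ (b p.1.1, p.2) ∧ 𝒢.s (ρ (b p.1.1, p.2)) = b p.1.1 ∧
        (𝒢.s p.2 = b p.1.1 → ρ (b p.1.1, p.2) = p.2) :=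
    (hbp.continuous.tendsto (l₀, 𝒢.unit (b l₀.1))).eventually hρ
  have hm : ∀ᶠ p in 𝓝 (l₀, 𝒢.unit (b l₀.1)),
      ContMDiffAt ((cotangentModel I).prod I) I ∞ (Function.uncurry m) p := by
    filter_upwards [hρ'.eventually_nhds] with p hp
    have e1 : ContMDiffAt ((cotangentModel I).prod I) I ∞
        (fun p : CotangentBundle I G × G => ρ (b p.1.1, p.2)) p :=
      ContMDiffAt.comp p (f := fun p : CotangentBundle I G × G => (b p.1.1, p.2))
        hp.self_of_nhds.1 hbp.contMDiffAt
    have e2 : ContMDiffAt ((cotangentModel I).prod I) (I.prod I) ∞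
        (fun p : CotangentBundle I G × G => (p.1.1, ρ (b p.1.1, p.2))) p :=
      ((contMDiff_proj.comp contMDiff_fst).contMDiffAt).prodMk e1
    exact ((hg.smooth (p.1.1, ρ (b p.1.1, p.2)) hp.self_of_nhds.2.1).comp
      (t := {q : G × G | 𝒢.s q.2 = b q.1})
      (s := {p : CotangentBundle I G × G | 𝒢.s (ρ (b p.1.1, p.2)) = b p.1.1}) p
      e2.contMDiffWithinAt fun _ hq => hq).contMDiffAt (hp.mono fun _ h => h.2.1)
  have hlim : Tendsto (fun l : CotangentBundle I G => (l, 𝒢.unit (b l.1))) (𝓝 l₀)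
      (𝓝 (l₀, 𝒢.unit (b l₀.1))) := (continuous_id.prodMk hub.continuous).tendsto l₀
  have hmb : ∀ᶠ l in 𝓝 l₀, m l (𝒢.unit (b l.1)) = l.1 := by
    filter_upwards [hlim.eventually hρ'] with l hl
    change g l.1 (ρ (b l.1, 𝒢.unit (b l.1))) = l.1
    rw [hl.2.2 (𝒢.s_unit _), hg.unit]
  let D : CotangentBundle I G → E →L[ℝ] E := fun l => mfderiv I I (m l) (𝒢.unit (b l.1))
  let us : G → G := fun z => 𝒢.unit (𝒢.s z)
  have hus : ContMDiff I I ∞ us := 𝒢.smooth_unit.comp 𝒢.smooth_s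
  let P : CotangentBundle I G → E →L[ℝ] E := fun l => mfderiv I I us (𝒢.unit (b l.1))
  have h1 : ContMDiffAt (cotangentModel I) (cotangentModel I) ∞ (fun l =>
      (⟨𝒢.unit (b l.1), (l.2 : E →L[ℝ] ℝ).comp (D l)⟩ : CotangentBundle I G)) l₀ :=
    ContMDiffAt.cotangent_pullback (l := fun l => l) (b := fun l => 𝒢.unit (b l.1)) contMDiffAt_id
      hub.contMDiffAt hm.self_of_nhds hm hmb
  have h2 : ContMDiffAt (cotangentModel I) (cotangentModel I) ∞ (fun l =>
      (⟨𝒢.unit (b l.1), ((l.2 : E →L[ℝ] ℝ).comp (D l)).comp (P l)⟩ : CotangentBundle I G)) l₀ := by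
    have hus' : ContMDiff ((cotangentModel I).prod I) I ∞
        (Function.uncurry fun (_ : CotangentBundle I G) z => us z) := hus.comp contMDiff_snd
    exact ContMDiffAt.cotangent_pullback (f := fun _ z => us z) (b := fun l => 𝒢.unit (b l.1)) h1
      hub.contMDiffAt hus'.contMDiffAt (Eventually.of_forall fun _ => hus'.contMDiffAt)
      (Eventually.of_forall fun l => congrArg 𝒢.unit (𝒢.s_unit _))
  -- The coefficients `1` and `-1` express `ξ ∘ D ∘ (1 - P)` with `P = d(unit ∘ s)`.
  have h3 := ContMDiffAt.cotangent_add_smul (a := fun _ => 1) (a' := fun _ => -1) contMDiffAt_const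
    contMDiffAt_const h1 h2
  refine h3.congr_of_eventuallyEq ?_
  filter_upwards [hlim.eventually hm, hlim.eventually hρ'.eventually_nhds] with l hl hl2
  have hP : ∀ w, P l w = 𝒢.dU (b l.1) (𝒢.dS (𝒢.unit (b l.1)) w) := by
    intro w
    have e1 : HasMFDerivAt J I 𝒢.unit (𝒢.s (𝒢.unit (b l.1))) (𝒢.dU (b l.1)) := by
      rw [𝒢.s_unit]; exact 𝒢.hasMFDerivAt_unit _
    have e2 := HasMFDerivAt.comp (𝒢.unit (b l.1)) e1 (𝒢.hasMFDerivAt_s _)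
    exact congrArg (fun L : E →L[ℝ] E => L w) e2.mfderiv
  have hD : ∀ v, 𝒢.dS (𝒢.unit (b l.1)) v = 0 → D l v = 𝒢.fiberDeriv g b l.1 v := by
    intro v hv
    obtain ⟨c, hc0, hcs, hc, -⟩ := 𝒢.exists_fiber_curve hv
    rw [𝒢.s_unit] at hcs
    have e1 : ContMDiffAt I I ∞ (m l) (𝒢.unit (b l.1)) :=
      ContMDiffAt.comp (𝒢.unit (b l.1)) (f := fun z : G => (l, z)) hl
        (contMDiffAt_const.prodMk contMDiffAt_id)
    have e2 := hc.comp_of_eq (e1.mdifferentiableAt (by simp)).hasMFDerivAt hc0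
    refine e2.unique ((hg.hasVelocity hc hc0 hcs).congr ?_)
    have e3 : Tendsto (fun t => (l, c t)) (𝓝 0) (𝓝 (l, 𝒢.unit (b l.1))) := by
      have := (continuousAt_const (y := l)).prodMk hc.continuousAt
      rwa [ContinuousAt, hc0] at this
    filter_upwards [hcs, e3.eventually hl2] with t ht ht2
    change g l.1 (ρ (b l.1, c t)) = _
    rw [ht2.2.2 ht]
  refine congrArg (fun ξ : E →L[ℝ] ℝ => (⟨𝒢.unit (b l.1), ξ⟩ : CotangentBundle I G)) ?_
  ext w
  have e1 := hD (𝒢.algebroidProj (b l.1) w) (𝒢.dS_algebroidProj _ w)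
  change l.2 (𝒢.fiberDeriv g b l.1 (𝒢.algebroidProj (b l.1) w)) =
    (1 : ℝ) * (l.2 : E →L[ℝ] ℝ) (D l w) + (-1) * (l.2 : E →L[ℝ] ℝ) (D l (P l w))
  rw [← e1, hP, algebroidProj_apply, map_sub]
  refine (map_sub (l.2 : E →L[ℝ] ℝ) _ _).trans ?_
  ring

variable (𝒢)

theorem contMDiff_rΓ : ContMDiff (cotangentModel I) (cotangentModel I) ∞ 𝒢.rΓ :=
  𝒢.isFiberMap_right.contMDiff

theorem contMDiff_sΓ : ContMDiff (cotangentModel I) (cotangentModel I) ∞ 𝒢.sΓ := by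
  have h : 𝒢.sΓ = fun l => dilate (-1)
    (𝒢.fiberCovector (fun γ η => 𝒢.mul γ (𝒢.inv η)) 𝒢.s l) := funext 𝒢.sΓ_eq
  rw [h]
  exact (contMDiff_dilate (-1)).comp 𝒢.isFiberMap_left.contMDiff

end LieGroupoid

/-! ### Local bisections -/

/-- Two surjections have a common section up to an isomorphism. -/
theorem exists_section_of_surjective {K E F : Type*} [Field K] [AddCommGroup E] [Module K E]
    [AddCommGroup F] [Module K F] [FiniteDimensional K F] {A B : E →ₗ[K] F}
    (hA : Function.Surjective A) (hB : Function.Surjective B) :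
    ∃ D : F →ₗ[K] E, (∀ x, A (D x) = x) ∧ Function.Bijective (B ∘ₗ D) := by
  obtain ⟨D₀, hD₀⟩ := A.exists_rightInverse_of_surjective (LinearMap.range_eq_top.2 hA)
  have hAD : ∀ x, A (D₀ x) = x := fun x => congrArg (fun L : F →ₗ[K] F => L x) hD₀
  let T := B ∘ₗ D₀
  -- Adding maps into `ker A` keeps `D₀` a section of `A` and changes `B ∘ D₀` by maps into `V`.
  -- Surjectivity of `B` makes `V` large enough to repair the cokernel of `T`.
  let V := (LinearMap.ker A).map B
  have hsum : LinearMap.range T ⊔ V = ⊤ := by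
    rw [eq_top_iff]
    intro y _
    obtain ⟨e, rfl⟩ := hB y
    have h1 : B e = T (A e) + B (e - D₀ (A e)) := by simp [T]
    rw [h1]
    exact Submodule.add_mem_sup (LinearMap.mem_range_self T _)
      (Submodule.mem_map_of_mem (by simp [hAD]))
  -- A complement of `range T ∩ V` within `V` is also a complement of `range T` in `F`.
  obtain ⟨C, hC1, hC2⟩ := IsModularLattice.exists_disjoint_and_sup_eq (inf_le_right : LinearMap.range T ⊓ V ≤ V)
  have hCV : C ≤ V := hC2 ▸ le_sup_right
  have hdisj : Disjoint (LinearMap.range T) C := by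
    rw [disjoint_iff_inf_le] at hC1 ⊢
    exact fun x hx => hC1 ⟨⟨hx.1, hCV hx.2⟩, hx.2⟩
  have htop : LinearMap.range T ⊔ C = ⊤ := by
    rw [eq_top_iff, ← hsum]
    refine sup_le le_sup_left ?_
    rw [← hC2]
    exact sup_le (inf_le_left.trans le_sup_left) le_sup_right
  have hdim : Module.finrank K (LinearMap.ker T) = Module.finrank K C := by
    have h1 := Submodule.finrank_add_eq_of_isCompl ⟨hdisj, codisjoint_iff.2 htop⟩
    have h2 := T.finrank_range_add_finrank_ker
    omega
  let φ := LinearEquiv.ofFinrankEq (LinearMap.ker T) C hdim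
  obtain ⟨π, hπ⟩ := (LinearMap.ker T).subtype.exists_leftInverse_of_injective
    (by simp)
  have hlift : ∀ c : C, ∃ e : E, A e = 0 ∧ B e = c := fun c => by
    obtain ⟨e, he, hec⟩ := hCV c.2
    exact ⟨e, he, hec⟩
  obtain ⟨ψ, hψ⟩ : ∃ ψ : C →ₗ[K] E, ∀ c, A (ψ c) = 0 ∧ B (ψ c) = c := by
    let b := Module.Free.chooseBasis K C
    choose f hf using fun i => hlift (b i)
    refine ⟨b.constr K f, fun c => ⟨?_, ?_⟩⟩
    · have : A ∘ₗ b.constr K f = 0 := b.ext fun i => by simp [hf]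
      exact congrArg (fun L : C →ₗ[K] F => L c) this
    · have : B ∘ₗ b.constr K f = C.subtype := b.ext fun i => by simp [hf]
      exact congrArg (fun L : C →ₗ[K] F => L c) this
  -- The correction sends `ker T` isomorphically onto `C`, through lifts `ψ` into `ker A`; the
  -- retraction `π` extends it to all of `F`.
  refine ⟨D₀ + ψ ∘ₗ φ.toLinearMap ∘ₗ π, fun x => by simp [hAD, hψ], ?_⟩
  have hinj : Function.Injective (B ∘ₗ (D₀ + ψ ∘ₗ φ.toLinearMap ∘ₗ π)) := by
    refine (injective_iff_map_eq_zero _).2 fun x hx => ?_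
    have h1 : T x + (φ (π x) : F) = 0 := by simpa [T, hψ] using hx
    have h2 : T x = 0 := by
      have h3 : T x = -(φ (π x) : F) := eq_neg_of_add_eq_zero_left h1
      have h4 : T x ∈ C := h3 ▸ C.neg_mem (φ (π x)).2
      exact (Submodule.mem_bot K).1 (hdisj.le_bot ⟨LinearMap.mem_range_self T x, h4⟩)
    have h5 : π x = 0 := by
      rw [h2, zero_add] at h1
      exact φ.map_eq_zero_iff.1 (Subtype.ext h1)
    have h6 : π x = ⟨x, h2⟩ :=
      congrArg (fun L : LinearMap.ker T →ₗ[K] LinearMap.ker T => L ⟨x, h2⟩) hπ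
    rw [h5] at h6
    exact (congrArg Subtype.val h6).symm
  exact ⟨hinj, LinearMap.surjective_of_injective hinj⟩

namespace LieGroupoid

variable {E H F N : Type*} [NormedAddCommGroup E] [NormedSpace ℝ E] [FiniteDimensional ℝ E]
  [TopologicalSpace H] [NormedAddCommGroup F] [NormedSpace ℝ F] [FiniteDimensional ℝ F]
  [TopologicalSpace N]
  {I : ModelWithCorners ℝ E H} [I.Boundaryless] {G : Type*} [TopologicalSpace G] [ChartedSpace H G]
  {J : ModelWithCorners ℝ F N} [J.Boundaryless] {M : Type*} [TopologicalSpace M] [ChartedSpace N M]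
  [IsManifold I ∞ G] [IsManifold J ∞ M] (𝒢 : LieGroupoid I G J M)

/-- Through every `γ` there is a local bisection: a local section `σ` of the range map for which
`s ∘ σ` is a local diffeomorphism, with inverse `τ`. -/
theorem exists_bisection (γ : G) : ∃ (σ : M → G) (τ : M → M) (W : Set M), IsOpen W ∧
    𝒢.r γ ∈ W ∧ σ (𝒢.r γ) = γ ∧
    (∀ x ∈ W, 𝒢.r (σ x) = x ∧ ContMDiffAt J I ∞ σ x ∧ τ (𝒢.s (σ x)) = x) ∧
    ∀ x ∈ W, ∀ᶠ y in 𝓝 (𝒢.s (σ x)), ContMDiffAt J J ∞ τ y ∧ τ y ∈ W ∧ 𝒢.s (σ (τ y)) = y := by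
  have : CompleteSpace F := FiniteDimensional.complete ℝ F
  set k := coordAt J (𝒢.r γ)
  set k' := coordAt J (𝒢.s γ)
  have hk : IsCoord J k := isCoord_coordAt _
  have hk' : IsCoord J k' := isCoord_coordAt _
  have hkr : 𝒢.r γ ∈ k.source := mem_coordAt_source _
  have hO : IsOpen (𝒢.r ⁻¹' k.source) := k.open_source.preimage 𝒢.smooth_r.continuous
  obtain ⟨κ, hκ, hγκ, hκO, hκid, hκr⟩ := exists_coord_of_surjective (f' := 𝒢.dR γ) hO
    (f := fun z => k (𝒢.r z)) (hk.smooth.comp 𝒢.smooth_r.contMDiffOn fun z hz => hz)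
    (x := γ) hkr ((hasMFDerivAt_coordAt_self (𝒢.r γ)).comp γ (𝒢.hasMFDerivAt_r γ))
    (𝒢.submersion_r γ)
  obtain ⟨D, hD, hDbij⟩ := exists_section_of_surjective (A := (𝒢.dR γ : E →ₗ[ℝ] F))
    (B := (𝒢.dS γ : E →ₗ[ℝ] F)) (𝒢.submersion_r γ) (𝒢.submersion_s γ)
  let D' : F →L[ℝ] E := LinearMap.toContinuousLinearMap D
  let e : F ≃L[ℝ] F := (LinearEquiv.ofBijective _ hDbij).toContinuousLinearEquiv
  have hκsymm : HasMFDerivAt 𝓘(ℝ, E) I κ.symm (κ γ) (ContinuousLinearMap.id ℝ E) := by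
    have h1 := hκ.hasMFDerivAt_symm (κ.map_source hγκ)
    have h2 := hκ.mfderiv_symm_comp hγκ
    rw [hκid.mfderiv] at h2
    exact h2 ▸ h1
  -- the bisection in the coordinates of `M`
  let m : F → E := fun z => κ γ + D' (z - k (𝒢.r γ))
  have hm : ContDiff ℝ ∞ m := contDiff_const.add (D'.contDiff.comp (contDiff_id.sub contDiff_const))
  have hm0 : m (k (𝒢.r γ)) = κ γ := by simp [m]
  have hmd : HasFDerivAt m D' (k (𝒢.r γ)) := by
    have := (D'.hasFDerivAt.comp (k (𝒢.r γ)) ((hasFDerivAt_id _).sub_const (k (𝒢.r γ)))).const_add (κ γ)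
    exact this
  let σ' : F → G := fun z => κ.symm (m z)
  let Z : Set F := k.target ∩ m ⁻¹' (κ.target ∩ κ.symm ⁻¹' (𝒢.s ⁻¹' k'.source))
  have hZ : IsOpen Z := k.open_target.inter ((κ.isOpen_inter_preimage_symm
    (k'.open_source.preimage 𝒢.smooth_s.continuous)).preimage hm.continuous)
  have hz0 : k (𝒢.r γ) ∈ Z := by
    refine ⟨k.map_source hkr, ?_, ?_⟩
    · rw [hm0]; exact κ.map_source hγκ
    · rw [hm0, mem_preimage, κ.left_inv hγκ]; exact mem_coordAt_source _
  have hσ'0 : σ' (k (𝒢.r γ)) = γ := by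
    change κ.symm (m (k (𝒢.r γ))) = γ
    rw [hm0, κ.left_inv hγκ]
  have hσ' : ContMDiffOn 𝓘(ℝ, F) I ∞ σ' Z :=
    hκ.smooth_symm.comp hm.contMDiff.contMDiffOn fun z hz => hz.2.1
  have hrσ' : ∀ z ∈ Z, k (𝒢.r (σ' z)) = z := by
    intro z hz
    rw [← hκr _ (κ.map_target hz.2.1), κ.right_inv hz.2.1]
    have h1 : 𝒢.dR γ (κ γ) = k (𝒢.r γ) := hκr γ hγκ
    have h2 : 𝒢.dR γ (D' (z - k (𝒢.r γ))) = z - k (𝒢.r γ) := hD _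
    change 𝒢.dR γ (κ γ + D' (z - k (𝒢.r γ))) = z
    rw [map_add, h1, h2]
    abel
  have hg : ContDiffOn ℝ ∞ (fun z => k' (𝒢.s (σ' z))) Z :=
    (hk'.smooth.comp (𝒢.smooth_s.comp_contMDiffOn hσ') fun z hz => hz.2.2).contDiffOn
  have hσ'd : HasMFDerivAt 𝓘(ℝ, F) I σ' (k (𝒢.r γ)) D' := by
    have h1 : HasMFDerivAt 𝓘(ℝ, E) I κ.symm (m (k (𝒢.r γ))) (ContinuousLinearMap.id ℝ E) := by
      rw [hm0]; exact hκsymm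
    exact h1.comp (k (𝒢.r γ)) hmd.hasMFDerivAt
  -- The derivative of `s ∘ σ` at the base point is `ds ∘ D`, bijective by the choice of `D`. The
  -- inverse function theorem then provides `τ`.
  have hgd : HasFDerivAt (fun z => k' (𝒢.s (σ' z))) (e : F →L[ℝ] F) (k (𝒢.r γ)) := by
    have h1 : HasMFDerivAt I J 𝒢.s (σ' (k (𝒢.r γ))) (𝒢.dS γ) := by
      rw [hσ'0]; exact 𝒢.hasMFDerivAt_s γ
    have h2 : HasMFDerivAt J 𝓘(ℝ, F) k' (𝒢.s (σ' (k (𝒢.r γ)))) (ContinuousLinearMap.id ℝ F) := by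
      rw [hσ'0]; exact hasMFDerivAt_coordAt_self _
    have h3 : HasMFDerivAt 𝓘(ℝ, F) 𝓘(ℝ, F) (fun z => k' (𝒢.s (σ' z))) (k (𝒢.r γ))
        ((ContinuousLinearMap.id ℝ F).comp ((𝒢.dS γ).comp D')) :=
      h2.comp (k (𝒢.r γ)) (h1.comp (k (𝒢.r γ)) hσ'd)
    exact hasMFDerivAt_iff_hasFDerivAt.1 h3
  obtain ⟨P, hP0, hPZ, hPg, hPs⟩ := exists_openPartialHomeomorph_of_contDiffOn hZ hg hz0 hgd
  have hW : IsOpen (k.source ∩ k ⁻¹' P.source) := k.isOpen_inter_preimage P.open_source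
  have hsrc : ∀ x ∈ k.source ∩ k ⁻¹' P.source, 𝒢.s (σ' (k x)) ∈ k'.source := fun x hx =>
    (hPZ hx.2).2.2
  have hPk : ∀ x, P (k x) = k' (𝒢.s (σ' (k x))) := fun x => congrFun hPg (k x)
  refine ⟨fun x => σ' (k x), fun y => k.symm (P.symm (k' y)), _, hW, ⟨hkr, hP0⟩, hσ'0,
    fun x hx => ⟨?_, ?_, ?_⟩, fun x hx => ?_⟩
  · exact k.injOn (hκO (κ.map_target (hPZ hx.2).2.1)) hx.1 (hrσ' _ (hPZ hx.2))
  · exact (hσ'.contMDiffAt (hZ.mem_nhds (hPZ hx.2))).comp x (hk.contMDiffAt hx.1)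
  · change k.symm (P.symm (k' (𝒢.s (σ' (k x))))) = x
    rw [← hPk, P.left_inv hx.2, k.left_inv hx.1]
  · have h1 : ∀ᶠ y in 𝓝 (𝒢.s (σ' (k x))), y ∈ k'.source ∩ k' ⁻¹' P.target :=
      (k'.isOpen_inter_preimage P.open_target).mem_nhds
        ⟨hsrc x hx, by rw [mem_preimage, ← hPk]; exact P.map_source hx.2⟩
    filter_upwards [h1] with y hy
    have h2 : P.symm (k' y) ∈ P.source := P.map_target hy.2
    have h3 : P.symm (k' y) ∈ k.target := (hPZ h2).1
    refine ⟨?_, ⟨k.map_target h3, ?_⟩, ?_⟩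
    · have h4 : ContMDiffAt 𝓘(ℝ, F) 𝓘(ℝ, F) ∞ P.symm (k' y) :=
        (hPs.contDiffAt (P.open_target.mem_nhds hy.2)).contMDiffAt
      exact ContMDiffAt.comp y (g := k.symm) (f := fun y => P.symm (k' y)) (hk.contMDiffAt_symm h3)
        (h4.comp y (hk'.contMDiffAt hy.1))
    · rw [mem_preimage, k.right_inv h3]; exact h2
    · have h5 : k (k.symm (P.symm (k' y))) ∈ P.source := by rw [k.right_inv h3]; exact h2
      refine k'.injOn (hsrc _ ⟨k.map_target h3, h5⟩) hy.1 ?_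
      rw [← hPk, k.right_inv h3, P.right_inv hy.2]

end LieGroupoid

/-! ### Right translations in the cotangent groupoid -/

/-- The covector of a point of the cotangent bundle, as a linear form on the model space. -/
abbrev fib {E H : Type*} [NormedAddCommGroup E] [NormedSpace ℝ E] [TopologicalSpace H]
    {I : ModelWithCorners ℝ E H} {X : Type*} [TopologicalSpace X] [ChartedSpace H X]
    (l : CotangentBundle I X) : E →L[ℝ] ℝ := l.2

theorem covector_ext {E H : Type*} [NormedAddCommGroup E] [NormedSpace ℝ E] [TopologicalSpace H]
    {I : ModelWithCorners ℝ E H} {X : Type*} [TopologicalSpace X] [ChartedSpace H X]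
    {l l' : CotangentBundle I X} (h1 : l.1 = l'.1)
    (h2 : ∀ w : E, (l.2 : E →L[ℝ] ℝ) w = (l'.2 : E →L[ℝ] ℝ) w) : l = l' := by
  obtain ⟨x, ξ⟩ := l
  obtain ⟨x', ξ'⟩ := l'
  obtain rfl : x = x' := h1
  have : ξ = ξ' := ContinuousLinearMap.ext h2
  rw [this]

namespace LieGroupoid

variable {E H F N : Type*} [NormedAddCommGroup E] [NormedSpace ℝ E] [FiniteDimensional ℝ E]
  [TopologicalSpace H] [NormedAddCommGroup F] [NormedSpace ℝ F] [FiniteDimensional ℝ F]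
  [TopologicalSpace N]
  {I : ModelWithCorners ℝ E H} [I.Boundaryless] {G : Type*} [TopologicalSpace G] [ChartedSpace H G]
  {J : ModelWithCorners ℝ F N} [J.Boundaryless] {M : Type*} [TopologicalSpace M] [ChartedSpace N M]
  [IsManifold I ∞ G] [IsManifold J ∞ M] (𝒢 : LieGroupoid I G J M)

theorem rΓ_fst (l : CotangentBundle I G) : (𝒢.rΓ l).1 = 𝒢.unit (𝒢.r l.1) := rfl

theorem rΓ_apply (l : CotangentBundle I G) (w : E) :
    (𝒢.rΓ l).2 w = l.2 (𝒢.fiberDeriv (fun γ η => 𝒢.mul η γ) 𝒢.r l.1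
      (𝒢.algebroidProj (𝒢.r l.1) w)) := rfl

theorem rΓ_dilate (a : ℝ) (l : CotangentBundle I G) : 𝒢.rΓ (dilate a l) = dilate a (𝒢.rΓ l) := rfl

theorem rΓ_dU (l : CotangentBundle I G) (w : F) : (𝒢.rΓ l).2 (𝒢.dU (𝒢.r l.1) w) = (0 : ℝ) := by
  rw [rΓ_apply, algebroidProj_dU, map_zero]
  exact map_zero (l.2 : E →L[ℝ] ℝ)

theorem rΓ_algebroidProj (l : CotangentBundle I G) (w : E) :
    (𝒢.rΓ l).2 (𝒢.algebroidProj (𝒢.r l.1) w) = (𝒢.rΓ l).2 w := by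
  rw [rΓ_apply, rΓ_apply, 𝒢.algebroidProj_of_dS_eq_zero (𝒢.dS_algebroidProj _ w)]

/-- The derivative of a curve in a source fiber. -/
theorem dS_eq_zero_of_hasVelocity {c : ℝ → G} {t : ℝ} {v : E} {y : G} {x : M}
    (hc : HasVelocity I c t v) (hct : c t = y)
    (hcs : ∀ᶠ u in 𝓝 t, 𝒢.s (c u) = x) : 𝒢.dS y v = 0 :=
  (hc.comp_of_eq (𝒢.hasMFDerivAt_s y) hct).unique ((hasVelocity_const x t).congr hcs)

/-- The working description of `r_Γ`: a vector of `ker ds` is the velocity of a curve in a source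
fiber, and one evaluates the covector on the velocity of the translated curve. -/
theorem rΓ_hasVelocity {l : CotangentBundle I G} {c : ℝ → G} {v v' : E}
    (hc : HasVelocity I c 0 v) (hc0 : c 0 = 𝒢.unit (𝒢.r l.1))
    (hcs : ∀ᶠ u in 𝓝 0, 𝒢.s (c u) = 𝒢.r l.1)
    (hv' : HasVelocity I (fun u => 𝒢.mul (c u) l.1) 0 v') : (𝒢.rΓ l).2 v = l.2 v' := by
  have h1 := 𝒢.dS_eq_zero_of_hasVelocity hc hc0 hcs
  rw [rΓ_apply, 𝒢.algebroidProj_of_dS_eq_zero h1]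
  have h2 := 𝒢.isFiberMap_right.hasVelocity hc hc0 hcs
  rw [hv'.unique h2]

theorem exists_velocity_mul_right {γ : G} {c : ℝ → G} {v : E}
    (hc : HasVelocity I c 0 v) (hc0 : c 0 = 𝒢.unit (𝒢.r γ))
    (hcs : ∀ᶠ u in 𝓝 0, 𝒢.s (c u) = 𝒢.r γ) :
    ∃ v' : E, HasVelocity I (fun u => 𝒢.mul (c u) γ) 0 v' ∧ 𝒢.dS γ v' = 0 := by
  have h1 := 𝒢.isFiberMap_right.hasVelocity hc hc0 hcs
  refine ⟨_, h1, 𝒢.dS_eq_zero_of_hasVelocity (x := 𝒢.s γ) h1 ?_ ?_⟩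
  · rw [hc0, 𝒢.unit_mul]
  · filter_upwards [hcs] with u hu using 𝒢.s_mul _ _ hu

/-- `r_Γ` only depends on the right translates of covectors along the source fibers. -/
theorem rΓ_congr {l l' : CotangentBundle I G} (hr : 𝒢.r l.1 = 𝒢.r l'.1)
    (h : ∀ (c : ℝ → G) (v v' : E), c 0 = 𝒢.unit (𝒢.r l.1) → (∀ᶠ u in 𝓝 0, 𝒢.s (c u) = 𝒢.r l.1) →
      HasVelocity I (fun u => 𝒢.mul (c u) l.1) 0 v → HasVelocity I (fun u => 𝒢.mul (c u) l'.1) 0 v' →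
      𝒢.dS l.1 v = 0 → (l.2 : E →L[ℝ] ℝ) v = (l'.2 : E →L[ℝ] ℝ) v') : 𝒢.rΓ l = 𝒢.rΓ l' := by
  refine covector_ext (congrArg 𝒢.unit hr) fun w => ?_
  have e1 := 𝒢.rΓ_algebroidProj l w
  have e2 := 𝒢.rΓ_algebroidProj l' w
  rw [← hr] at e2
  obtain ⟨c, hc0, hcs, hc, -⟩ := 𝒢.exists_fiber_curve (𝒢.dS_algebroidProj (𝒢.r l.1) w)
  rw [𝒢.s_unit] at hcs
  obtain ⟨v, hv, hv0⟩ := 𝒢.exists_velocity_mul_right hc hc0 hcs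
  have hc0' : c 0 = 𝒢.unit (𝒢.r l'.1) := by rw [← hr, hc0]
  have hcs' : ∀ᶠ u in 𝓝 0, 𝒢.s (c u) = 𝒢.r l'.1 := by rw [← hr]; exact hcs
  obtain ⟨v', hv', -⟩ := 𝒢.exists_velocity_mul_right hc hc0' hcs'
  have e3 : (l.2 : E →L[ℝ] ℝ) v = (l'.2 : E →L[ℝ] ℝ) v' := h c v v' hc0 hcs hv hv' hv0
  exact (e1.symm.trans (𝒢.rΓ_hasVelocity hc hc0 hcs hv)).trans
    (e3.trans ((𝒢.rΓ_hasVelocity hc hc0' hcs' hv').symm.trans e2))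

theorem rΓ_mem_dualAlgebroid (l : CotangentBundle I G) : 𝒢.rΓ l ∈ 𝒢.dualAlgebroid :=
  ⟨𝒢.r l.1, (𝒢.rΓ l).2, rfl, fun u => 𝒢.rΓ_dU l u⟩

/-- Right multiplication by a unit is the identity on the source fiber, and the covector already
vanishes on `TM`, so projecting onto `ker ds` loses nothing. -/
theorem rΓ_of_mem {l : CotangentBundle I G} (hl : l ∈ 𝒢.dualAlgebroid) : 𝒢.rΓ l = l := by
  obtain ⟨x, ξ, rfl, hξ⟩ := hl
  have hx : 𝒢.r (𝒢.unit x) = x := 𝒢.r_unit x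
  refine covector_ext (congrArg 𝒢.unit hx) fun w => ?_
  have h1 := 𝒢.rΓ_algebroidProj ⟨𝒢.unit x, ξ⟩ w
  refine h1.symm.trans ?_
  have hx' : 𝒢.r (⟨𝒢.unit x, ξ⟩ : CotangentBundle I G).1 = x := hx
  rw [hx']
  obtain ⟨c, hc0, hcs, hc, -⟩ := 𝒢.exists_fiber_curve (𝒢.dS_algebroidProj x w)
  rw [𝒢.s_unit] at hcs
  have h2 : HasVelocity I (fun u => 𝒢.mul (c u) (𝒢.unit x)) 0 (𝒢.algebroidProj x w) := by
    refine hc.congr ?_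
    filter_upwards [hcs] with u hu
    rw [← hu, 𝒢.mul_unit]
  refine (𝒢.rΓ_hasVelocity (l := ⟨𝒢.unit x, ξ⟩) hc (by rw [hx', hc0]) (by rw [hx']; exact hcs)
    h2).trans ?_
  rw [algebroidProj_apply]
  refine (map_sub (ξ : E →L[ℝ] ℝ) _ _).trans ?_
  have h3 : (ξ : E →L[ℝ] ℝ) (𝒢.dU x (𝒢.dS (𝒢.unit x) w)) = 0 := hξ _
  rw [h3, sub_zero]

/-- `A*G` is the fixed point set of the smooth retraction `r_Γ`. This gives its closedness, and
suggests describing its tangent vectors as the vectors fixed by the derivative. -/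
theorem mem_dualAlgebroid_iff {l : CotangentBundle I G} : l ∈ 𝒢.dualAlgebroid ↔ 𝒢.rΓ l = l :=
  ⟨𝒢.rΓ_of_mem, fun h => h ▸ 𝒢.rΓ_mem_dualAlgebroid l⟩

theorem rΓ_rΓ (l : CotangentBundle I G) : 𝒢.rΓ (𝒢.rΓ l) = 𝒢.rΓ l :=
  𝒢.rΓ_of_mem (𝒢.rΓ_mem_dualAlgebroid l)

theorem dualAlgebroidNonzero_subset : 𝒢.dualAlgebroidNonzero ⊆ 𝒢.rRegular := fun l hl => by
  change (𝒢.rΓ l).2 ≠ 0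
  rw [𝒢.rΓ_of_mem hl.1]
  exact hl.2

theorem rΓ_mem_dualAlgebroidNonzero {l : CotangentBundle I G} (hl : l ∈ 𝒢.rRegular) :
    𝒢.rΓ l ∈ 𝒢.dualAlgebroidNonzero := ⟨𝒢.rΓ_mem_dualAlgebroid l, hl⟩

theorem isOpen_rRegular : IsOpen 𝒢.rRegular :=
  isOpen_ne_zero.preimage 𝒢.contMDiff_rΓ.continuous

theorem mem_rRegular_rΓ {l : CotangentBundle I G} (hl : l ∈ 𝒢.rRegular) : 𝒢.rΓ l ∈ 𝒢.rRegular :=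
  𝒢.dualAlgebroidNonzero_subset (𝒢.rΓ_mem_dualAlgebroidNonzero hl)

variable {𝒢} {p₀ : CotangentBundle I G → ℝ}

theorem IsEllipticSymbol.contMDiffOn (hp₀ : 𝒢.IsEllipticSymbol p₀) :
    ContMDiffOn (cotangentModel I) 𝓘(ℝ, ℝ) ∞ (p₀ ∘ 𝒢.rΓ) 𝒢.rRegular :=
  hp₀.smooth.comp 𝒢.contMDiff_rΓ.contMDiffOn fun _ hl => 𝒢.rΓ_mem_dualAlgebroidNonzero hl

theorem IsEllipticSymbol.isHomogeneousOn (hp₀ : 𝒢.IsEllipticSymbol p₀) :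
    IsHomogeneousOn (p₀ ∘ 𝒢.rΓ) 𝒢.rRegular where
  conic l hl a ha := by
    change (𝒢.rΓ (dilate a l)).2 ≠ 0
    rw [𝒢.rΓ_dilate]
    exact smul_ne_zero ha.ne' hl
  eq l hl a ha := by
    change p₀ (𝒢.rΓ (dilate a l)) = _
    rw [𝒢.rΓ_dilate]
    exact hp₀.homogeneous _ (𝒢.rΓ_mem_dualAlgebroidNonzero hl) a ha

/-- Hamiltonian vector fields of right invariant functions are tangent to the source fibers. -/
theorem IsEllipticSymbol.dS_hamilton (hp₀ : 𝒢.IsEllipticSymbol p₀) {l : CotangentBundle I G}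
    (hl : l ∈ 𝒢.rRegular) {v : E × (E →L[ℝ] ℝ)}
    (hv : ∀ w : E × (E →L[ℝ] ℝ), symplecticForm I l v w =
      mfderiv (cotangentModel I) 𝓘(ℝ, ℝ) (p₀ ∘ 𝒢.rΓ) l w) : 𝒢.dS l.1 v.1 = 0 := by
  refine SeparatingDual.eq_zero_of_forall_dual_eq_zero (R := ℝ) fun β => ?_
  -- Covectors `β ∘ ds` vanish along the source fiber, so adding multiples of `ζ` does not change
  -- `r_Γ`, hence not `p`. Pairing `H_p` with the vertical vector `ζ` gives `β (ds H_p) = 0`.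
  let ζ : E →L[ℝ] ℝ := β.comp (𝒢.dS l.1)
  let e : ℝ → CotangentBundle I G := fun t => ⟨l.1, (fib l + t • ζ : E →L[ℝ] ℝ)⟩
  have he0 : e 0 = l := congrArg (fun ξ : E →L[ℝ] ℝ => (⟨l.1, ξ⟩ : CotangentBundle I G))
    (by rw [zero_smul, add_zero] : (fib l + (0 : ℝ) • ζ) = fib l)
  have h1 := (hasVelocity_vertical (I := I) l.1 l.2 ζ).comp_of_eq
    (ContMDiffOn.hasMFDerivAt_of_isOpen hp₀.contMDiffOn 𝒢.isOpen_rRegular hl) he0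
  have h2 : ∀ t, 𝒢.rΓ (e t) = 𝒢.rΓ l := by
    intro t
    refine 𝒢.rΓ_congr rfl fun c v v' _ _ hv hv' hv0 => ?_
    have h3 : v = v' := hv.unique hv'
    subst h3
    have h4 : 𝒢.dS l.1 v = 0 := hv0
    change (fib l + t • ζ) v = fib l v
    simp [ζ, h4]
  have h3 := h1.unique ((hasVelocity_const (p₀ (𝒢.rΓ l)) (0 : ℝ)).congr
    (Eventually.of_forall fun t => congrArg p₀ (h2 t)))
  have h4 := (hv ((0 : E), ζ)).trans h3
  rw [symplecticForm_eq, stdSymplectic] at h4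
  simpa [ζ] using h4

end LieGroupoid

/-! ### Curves with zero velocity -/

section LocallyConstant

variable {F N : Type*} [NormedAddCommGroup F] [NormedSpace ℝ F] [TopologicalSpace N]
  {J : ModelWithCorners ℝ F N} [J.Boundaryless] {M : Type*} [TopologicalSpace M] [ChartedSpace N M]
  [IsManifold J ∞ M]

/-- In a chart the derivative vanishes, so the curve is locally constant, and connectedness
finishes. It serves to show that `s` is conserved. -/
theorem eqOn_of_hasVelocity_zero {f : ℝ → M} {s : Set ℝ} (hs : IsOpen s) (hs' : IsPreconnected s)
    (h : ∀ t ∈ s, HasVelocity J f t 0) {t₀ t : ℝ} (ht₀ : t₀ ∈ s) (ht : t ∈ s) : f t = f t₀ := by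
  have hloc : ∀ t ∈ s, ∀ᶠ u in 𝓝 t, f u = f t := by
    intro t ht
    set k := coordAt J (f t)
    have hk : IsCoord J k := isCoord_coordAt _
    have h1 : ∀ᶠ u in 𝓝 t, u ∈ s ∧ f u ∈ k.source :=
      Eventually.and (show ∀ᶠ u in 𝓝 t, u ∈ s from hs.mem_nhds ht) ((h t ht).continuousAt.eventually_mem
        (k.open_source.mem_nhds (mem_coordAt_source _)))
    obtain ⟨δ, hδ, hball⟩ := Metric.eventually_nhds_iff_ball.1 h1
    have h2 : ∀ u ∈ Metric.ball t δ, HasDerivAt (fun u => k (f u)) 0 u := by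
      intro u hu
      have := (h u (hball u hu).1).comp (hk.hasMFDerivAt (hball u hu).2)
      rw [hasVelocity_iff_hasDerivAt] at this
      have h3 : (mfderiv J 𝓘(ℝ, F) k (f u) : F →L[ℝ] F) 0 = 0 := map_zero _
      exact h3 ▸ this
    filter_upwards [Metric.ball_mem_nhds t hδ] with u hu
    have h4 : k (f u) = k (f t) := Metric.isOpen_ball.is_const_of_deriv_eq_zero
      (convex_ball t δ).isPreconnected
      (fun u hu => (h2 u hu).differentiableAt.differentiableWithinAt)
      (fun u hu => (h2 u hu).deriv) hu (Metric.mem_ball_self hδ)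
    exact k.injOn (hball u hu).2 (mem_coordAt_source _) h4
  let A : Set ℝ := {t ∈ s | f t = f t₀}
  let B : Set ℝ := {t ∈ s | f t ≠ f t₀}
  have hA : IsOpen A := by
    rw [isOpen_iff_mem_nhds]
    rintro t ⟨h1, h2⟩
    filter_upwards [hs.mem_nhds h1, hloc t h1] with u h3 h4 using ⟨h3, h4.trans h2⟩
  have hB : IsOpen B := by
    rw [isOpen_iff_mem_nhds]
    rintro t ⟨h1, h2⟩
    filter_upwards [hs.mem_nhds h1, hloc t h1] with u h3 h4 using ⟨h3, by rw [h4]; exact h2⟩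
  have : s ⊆ A := hs'.subset_left_of_subset_union hA hB
    (disjoint_left.2 fun t h1 h2 => h2.2 h1.2)
    (fun t ht => (em (f t = f t₀)).imp (fun h => ⟨ht, h⟩) fun h => ⟨ht, h⟩) ⟨t₀, ht₀, ht₀, rfl⟩
  exact (this ht).2

end LocallyConstant

/-! ### Translation of integral curves along local bisections -/

namespace LieGroupoid

variable {E H F N : Type*} [NormedAddCommGroup E] [NormedSpace ℝ E] [FiniteDimensional ℝ E]
  [TopologicalSpace H] [NormedAddCommGroup F] [NormedSpace ℝ F] [FiniteDimensional ℝ F]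
  [TopologicalSpace N]
  {I : ModelWithCorners ℝ E H} [I.Boundaryless] {G : Type*} [TopologicalSpace G] [ChartedSpace H G]
  {J : ModelWithCorners ℝ F N} [J.Boundaryless] {M : Type*} [TopologicalSpace M] [ChartedSpace N M]
  [IsManifold I ∞ G] [IsManifold J ∞ M] {𝒢 : LieGroupoid I G J M}
  {p₀ : CotangentBundle I G → ℝ}

theorem IsEllipticSymbol.s_eq (hp₀ : 𝒢.IsEllipticSymbol p₀) {c : ℝ → CotangentBundle I G}
    {T : Set ℝ} (hT : IsOpen T) (hT' : IsPreconnected T)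
    (hc : ∀ t ∈ T, c t ∈ 𝒢.rRegular ∧ IsHamiltonAt (p₀ ∘ 𝒢.rΓ) c t) {t₀ t : ℝ} (ht₀ : t₀ ∈ T)
    (ht : t ∈ T) : 𝒢.s (c t).1 = 𝒢.s (c t₀).1 := by
  refine eqOn_of_hasVelocity_zero (J := J) (f := fun t => 𝒢.s (c t).1) hT hT' (fun t ht => ?_) ht₀ ht
  obtain ⟨hU, v, hv, hvw⟩ := hc t ht
  have h1 := hv.proj.comp (𝒢.hasMFDerivAt_s (c t).1)
  rw [hp₀.dS_hamilton hU hvw] at h1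
  exact h1

/-- Integral curves starting at `r_Γ l`, translated to `l`. -/
theorem IsEllipticSymbol.exists_translate (hp₀ : 𝒢.IsEllipticSymbol p₀) (l : CotangentBundle I G)
    {c : ℝ → CotangentBundle I G} {T : Set ℝ} (hT : IsOpen T) (hT' : IsPreconnected T)
    (h0 : (0 : ℝ) ∈ T) (hc : ∀ t ∈ T, c t ∈ 𝒢.rRegular ∧ IsHamiltonAt (p₀ ∘ 𝒢.rΓ) c t)
    (hc0 : c 0 = 𝒢.rΓ l) : ∃ c' : ℝ → CotangentBundle I G, c' 0 = l ∧ ∀ t ∈ T,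
      c' t ∈ 𝒢.rRegular ∧ IsHamiltonAt (p₀ ∘ 𝒢.rΓ) c' t ∧ (c' t).1 = 𝒢.mul (c t).1 l.1 ∧
      𝒢.rΓ (c' t) = 𝒢.rΓ (c t) := by
  set x₀ := 𝒢.r l.1
  obtain ⟨σ, τ, W, hW, hx₀, hσ0, hσ, hτ⟩ := 𝒢.exists_bisection l.1
  -- Right translation by the bisection; on the source fiber of `x₀` it is right multiplication by
  -- the base point of `l`.
  let Φ : G → G := fun η => 𝒢.mul η (σ (𝒢.s η))
  let Φ' : G → G := fun ζ => 𝒢.mul ζ (𝒢.inv (σ (τ (𝒢.s ζ))))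
  let O : Set G := 𝒢.s ⁻¹' W
  have hO : IsOpen O := hW.preimage 𝒢.smooth_s.continuous
  have hcomp : ∀ η ∈ O, 𝒢.s η = 𝒢.r (σ (𝒢.s η)) := fun η hη => (hσ _ hη).1.symm
  have hsΦ : ∀ η ∈ O, 𝒢.s (Φ η) = 𝒢.s (σ (𝒢.s η)) := fun η hη => 𝒢.s_mul _ _ (hcomp η hη)
  have hΦ : ∀ η ∈ O, ContMDiffAt I I ∞ Φ η := fun η hη =>
    𝒢.contMDiffAt_mul contMDiffAt_id
      (ContMDiffAt.comp η (g := σ) (f := 𝒢.s) (hσ _ hη).2.1 𝒢.smooth_s.contMDiffAt)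
      (eventually_of_mem (hO.mem_nhds hη) hcomp)
  have hΦ' : ∀ η ∈ O, ∀ᶠ ζ in 𝓝 (Φ η), ContMDiffAt I I ∞ Φ' ζ := by
    intro η hη
    have h1 := hτ _ hη
    rw [← hsΦ η hη] at h1
    have h2 := (𝒢.smooth_s.continuous.tendsto (Φ η)).eventually h1
    filter_upwards [h2, h2.eventually_nhds] with ζ h3 h4
    refine 𝒢.contMDiffAt_mul contMDiffAt_id (𝒢.smooth_inv.contMDiffAt.comp ζ
      (ContMDiffAt.comp ζ (g := σ) (f := fun ζ => τ (𝒢.s ζ)) (hσ _ h3.2.1).2.1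
        (ContMDiffAt.comp ζ (g := τ) (f := 𝒢.s) h3.1 𝒢.smooth_s.contMDiffAt))) ?_
    filter_upwards [h4] with ζ' h5
    rw [𝒢.r_inv, h5.2.2]
  have hΦΦ : ∀ η ∈ O, Φ' (Φ η) = η := by
    intro η hη
    change 𝒢.mul (Φ η) (𝒢.inv (σ (τ (𝒢.s (Φ η))))) = η
    rw [hsΦ η hη, (hσ _ hη).2.2, 𝒢.mul_assoc _ _ _ (hcomp η hη) (𝒢.r_inv _).symm, 𝒢.mul_inv,
      ← hcomp η hη, 𝒢.mul_unit]
  let dΦ : G → E →L[ℝ] E := fun η => mfderiv I I Φ η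
  let dΦ' : G → E →L[ℝ] E := fun η => mfderiv I I Φ' η
  have hdΦ : ∀ η ∈ O, HasMFDerivAt I I Φ η (dΦ η) := fun η hη =>
    ((hΦ η hη).mdifferentiableAt (by simp)).hasMFDerivAt
  have hdd : ∀ η ∈ O, ∀ u, dΦ' (Φ η) (dΦ η u) = u := by
    intro η hη u
    have h1 : HasMFDerivAt I I Φ' (Φ η) (dΦ' (Φ η)) :=
      ((hΦ' η hη).self_of_nhds.mdifferentiableAt (by simp)).hasMFDerivAt
    have h2 := hasMFDerivAt_unique (h1.comp η (hdΦ η hη)) ((hasMFDerivAt_id η).congr_of_eventuallyEq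
      (eventually_of_mem (hO.mem_nhds hη) hΦΦ))
    exact congrArg (fun L : E →L[ℝ] E => L u) h2
  -- the function `h` that corrects the values along the units
  set k := coordAt J x₀
  have hk : IsCoord J k := isCoord_coordAt _
  -- The covector `r_Γ l` and the pull-back of `l` by `dΦ` at the unit agree on `ker ds`, but the
  -- former vanishes on `TM`. Their difference is `β ∘ ds`, which is `dh` at the unit.
  let β : F →L[ℝ] ℝ := (l.2 : E →L[ℝ] ℝ).comp ((dΦ (𝒢.unit x₀)).comp (𝒢.dU x₀))
  let O' : Set G := O ∩ 𝒢.s ⁻¹' k.source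
  have hO' : IsOpen O' := hO.inter (k.open_source.preimage 𝒢.smooth_s.continuous)
  let h : G → ℝ := fun η => β (k (𝒢.s η))
  have hh : ∀ η ∈ O', ContMDiffAt I 𝓘(ℝ, ℝ) ∞ h η := fun η hη =>
    β.contMDiff.contMDiffAt.comp η ((hk.contMDiffAt hη.2).comp η 𝒢.smooth_s.contMDiffAt)
  let dh : G → E →L[ℝ] ℝ := fun η => mfderiv I 𝓘(ℝ, ℝ) h η
  have hdh : ∀ η ∈ O', HasMFDerivAt I 𝓘(ℝ, ℝ) h η (dh η) := fun η hη =>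
    ((hh η hη).mdifferentiableAt (by simp)).hasMFDerivAt
  -- The cotangent lift of `Φ` after the fiberwise shift by `dh`. It satisfies `Θ*α = α + dh`, so it
  -- preserves the symplectic form.
  let Θ : CotangentBundle I G → CotangentBundle I G := fun l =>
    ⟨Φ l.1, (fib l + dh l.1 : E →L[ℝ] ℝ).comp (dΦ' (Φ l.1))⟩
  have hΘ : ∀ l : CotangentBundle I G, l.1 ∈ O' →
      ContMDiffAt (cotangentModel I) (cotangentModel I) ∞ Θ l := by
    intro l hl
    have hev : ∀ᶠ l' : CotangentBundle I G in 𝓝 l, l'.1 ∈ O' :=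
      (continuous_proj.tendsto l).eventually (hO'.mem_nhds hl)
    have e1 : ContMDiffAt (cotangentModel I) (cotangentModel I) ∞
        (fun l : CotangentBundle I G => (⟨l.1, dh l.1⟩ : CotangentBundle I G)) l := by
      have e2 : ContMDiff (cotangentModel I) (cotangentModel 𝓘(ℝ, ℝ)) ∞
          (fun _ : CotangentBundle I G =>
            (⟨(0 : ℝ), ContinuousLinearMap.id ℝ ℝ⟩ : CotangentBundle 𝓘(ℝ, ℝ) ℝ)) :=
        contMDiff_const
      -- The differential of `h` is the pull-back of the covector `1` at `0 ∈ ℝ` along `η ↦ h η - h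
      -- l`; subtracting the value keeps the target base point fixed.
      have e3 : ContMDiffAt (cotangentModel I) (cotangentModel I) ∞
          (fun l : CotangentBundle I G => (⟨l.1, (ContinuousLinearMap.id ℝ ℝ).comp
            (mfderiv I 𝓘(ℝ, ℝ) (fun η => h η - h l.1) l.1 : E →L[ℝ] ℝ)⟩ :
            CotangentBundle I G)) l := by
        have e4 : ∀ p : CotangentBundle I G × G, p.1.1 ∈ O' → p.2 ∈ O' →
            ContMDiffAt ((cotangentModel I).prod I) 𝓘(ℝ, ℝ) ∞
              (Function.uncurry fun (l : CotangentBundle I G) η => h η - h l.1) p := by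
          intro p hp1 hp2
          exact (ContMDiffAt.comp p (f := fun p : CotangentBundle I G × G => p.2) (hh _ hp2)
            contMDiffAt_snd).sub (ContMDiffAt.comp p
              (f := fun p : CotangentBundle I G × G => p.1.1) (hh _ hp1)
              (contMDiff_proj.comp contMDiff_fst).contMDiffAt)
        have e5 : IsOpen {p : CotangentBundle I G × G | p.1.1 ∈ O' ∧ p.2 ∈ O'} :=
          (hO'.preimage (continuous_proj.comp continuous_fst)).inter (hO'.preimage continuous_snd)
        exact ContMDiffAt.cotangent_pullback (b := fun l : CotangentBundle I G => l.1)
          (f := fun (l : CotangentBundle I G) η => h η - h l.1) e2.contMDiffAt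
          contMDiff_proj.contMDiffAt (e4 (l, l.1) hl hl)
          (eventually_of_mem (e5.mem_nhds (show _ ∧ _ from ⟨hl, hl⟩)) fun p hp => e4 p hp.1 hp.2)
          (Eventually.of_forall fun l => sub_self _)
      refine e3.congr_of_eventuallyEq ?_
      filter_upwards [hev] with l' hl'
      refine congrArg (fun ξ : E →L[ℝ] ℝ => (⟨l'.1, ξ⟩ : CotangentBundle I G)) ?_
      have e6 : HasMFDerivAt I 𝓘(ℝ, ℝ) (fun η => h η - h l'.1) l'.1 (dh l'.1) := by
        let Z : E →L[ℝ] ℝ := 0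
        have e0 : HasMFDerivAt I 𝓘(ℝ, ℝ) (fun _ : G => h l'.1) l'.1 Z :=
          hasMFDerivAt_const (h l'.1) l'.1
        exact ((hdh _ hl').sub e0).congr_mfderiv (sub_zero (dh l'.1))
      exact e6.mfderiv.symm
    have e7 := ContMDiffAt.cotangent_add_smul (I := I) (b := fun l : CotangentBundle I G => l.1)
      (ξ := fun l => l.2) (ξ' := fun l => dh l.1) (a := fun _ => 1) (a' := fun _ => 1)
      contMDiffAt_const contMDiffAt_const contMDiffAt_id e1
    have e8 : ContMDiffAt (cotangentModel I) I ∞ (fun l : CotangentBundle I G => Φ l.1) l :=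
      (hΦ _ hl.1).comp l contMDiff_proj.contMDiffAt
    have e9 : ∀ᶠ p : CotangentBundle I G × G in 𝓝 (l, Φ l.1),
        ContMDiffAt ((cotangentModel I).prod I) I ∞
          (Function.uncurry fun (_ : CotangentBundle I G) ζ => Φ' ζ) p := by
      filter_upwards [(continuous_snd.tendsto (l, Φ l.1)).eventually (hΦ' _ hl.1)] with p hp
      exact ContMDiffAt.comp p (f := fun p : CotangentBundle I G × G => p.2) hp contMDiffAt_snd
    have e10 := ContMDiffAt.cotangent_pullback (b := fun l : CotangentBundle I G => Φ l.1)
      (f := fun _ ζ => Φ' ζ) e7 e8 e9.self_of_nhds e9 (by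
        filter_upwards [hev] with l' hl' using hΦΦ _ hl'.1)
    refine e10.congr_of_eventuallyEq (Eventually.of_forall fun l' => ?_)
    refine congrArg (fun ξ : E →L[ℝ] ℝ =>
      (⟨Φ l'.1, ξ.comp (dΦ' (Φ l'.1))⟩ : CotangentBundle I G)) ?_
    ext w
    exact (congrArg₂ (· + ·) (one_mul ((l'.2 : E →L[ℝ] ℝ) w)) (one_mul (dh l'.1 w))).symm
  have hΘd : ∀ l : CotangentBundle I G, l.1 ∈ O' → ∀ u : E,
      (Θ l).2 (dΦ l.1 u) = (l.2 : E →L[ℝ] ℝ) u + dh l.1 u := by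
    intro l hl u
    change (fib l + dh l.1 : E →L[ℝ] ℝ) (dΦ' (Φ l.1) (dΦ l.1 u)) = _
    rw [hdd _ hl.1]
    rfl
  -- Left multiplication by arrows commutes with `Φ`, and `dh` vanishes along source fibers because
  -- `h` is a function of `s`. Hence `r_Γ`, and with it `p`, is invariant under `Θ`.
  have hΘr : ∀ l : CotangentBundle I G, l.1 ∈ O' → 𝒢.rΓ (Θ l) = 𝒢.rΓ l := by
    intro l hl
    refine (𝒢.rΓ_congr (l := l) (l' := Θ l) (𝒢.r_mul _ _ (hcomp _ hl.1)).symm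
      fun c v v' hc0 hcs hv hv' hv0 => ?_).symm
    have e1 := hv.comp_of_eq (hdΦ l.1 hl.1) (by rw [hc0, 𝒢.unit_mul])
    have e2 : HasVelocity I (fun u => 𝒢.mul (c u) (Φ l.1)) 0 (dΦ l.1 v) := by
      refine e1.congr ?_
      filter_upwards [hcs] with u hu
      change 𝒢.mul (c u) (𝒢.mul l.1 _) = 𝒢.mul (𝒢.mul (c u) l.1) (σ (𝒢.s (𝒢.mul (c u) l.1)))
      rw [𝒢.s_mul _ _ hu, 𝒢.mul_assoc _ _ _ hu (hcomp _ hl.1)]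
    have e3 : v' = dΦ l.1 v := hv'.unique e2
    have e4 : dh l.1 v = 0 := by
      let K : F →L[ℝ] F := mfderiv J 𝓘(ℝ, F) k (𝒢.s l.1)
      have e5 : HasMFDerivAt I 𝓘(ℝ, ℝ) h l.1 (β.comp (K.comp (𝒢.dS l.1))) :=
        β.hasMFDerivAt.comp l.1 ((hk.hasMFDerivAt hl.2).comp l.1 (𝒢.hasMFDerivAt_s l.1))
      rw [hasMFDerivAt_unique (hdh _ hl) e5]
      change β (K (𝒢.dS l.1 v)) = 0
      rw [hv0, map_zero, map_zero]
    rw [e3]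
    refine Eq.trans ?_ (hΘd l hl v).symm
    rw [e4, add_zero]
  have hs : ∀ t ∈ T, 𝒢.s (c t).1 = x₀ := fun t ht => by
    rw [hp₀.s_eq hT hT' hc h0 ht, hc0]
    exact 𝒢.s_unit _
  have hcO : ∀ t ∈ T, (c t).1 ∈ O' := fun t ht => by
    refine ⟨?_, ?_⟩
    · change 𝒢.s (c t).1 ∈ W
      rw [hs t ht]; exact hx₀
    · change 𝒢.s (c t).1 ∈ k.source
      rw [hs t ht]; exact mem_coordAt_source _
  -- The integral curve stays over the source `x₀`, where the bisection takes the value of the given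
  -- arrow.
  have hΦc : ∀ t ∈ T, Φ (c t).1 = 𝒢.mul (c t).1 l.1 := fun t ht => by
    change 𝒢.mul (c t).1 (σ (𝒢.s (c t).1)) = _
    rw [hs t ht, hσ0]
  have hUΘ : ∀ t ∈ T, Θ (c t) ∈ 𝒢.rRegular := fun t ht => by
    change (𝒢.rΓ (Θ (c t))).2 ≠ 0
    rw [hΘr _ (hcO t ht)]
    exact (hc t ht).1
  refine ⟨fun t => Θ (c t), ?_, fun t ht => ⟨hUΘ t ht, ?_, hΦc t ht, hΘr _ (hcO t ht)⟩⟩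
  · have hb : (c 0).1 = 𝒢.unit x₀ := by rw [hc0]; rfl
    have hΦ0 : Φ (c 0).1 = l.1 := by rw [hΦc 0 h0, hb, 𝒢.unit_mul]
    refine covector_ext hΦ0 fun w => ?_
    have e0 : (Θ (c 0)).1 = l.1 := hΦ0
    -- `dΦ` is surjective at `c 0`
    have hinj : Function.Injective (dΦ (c 0).1) := fun u u' huu => by
      rw [← hdd _ (hcO 0 h0).1 u, huu, hdd _ (hcO 0 h0).1]
    obtain ⟨u, rfl⟩ := LinearMap.surjective_of_injective
      (f := (dΦ (c 0).1 : E →ₗ[ℝ] E)) hinj w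
    refine (hΘd _ (hcO 0 h0) u).trans ?_
    have hdh' : ∀ u, dh (c 0).1 u = β (𝒢.dS (𝒢.unit x₀) u) := by
      intro u
      have e5 : HasMFDerivAt I 𝓘(ℝ, ℝ) h (𝒢.unit x₀)
          (β.comp ((ContinuousLinearMap.id ℝ F).comp (𝒢.dS (𝒢.unit x₀)))) := by
        refine β.hasMFDerivAt.comp (𝒢.unit x₀) (HasMFDerivAt.comp (𝒢.unit x₀) ?_
          (𝒢.hasMFDerivAt_s (𝒢.unit x₀)))
        rw [𝒢.s_unit]
        exact hasMFDerivAt_coordAt_self x₀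
      rw [hb]
      rw [← hb] at e5
      have e6 := hasMFDerivAt_unique (hdh _ (hcO 0 h0)) e5
      rw [hb] at e6
      rw [e6]
      rfl
    have hfib : ∀ v, 𝒢.dS (𝒢.unit x₀) v = 0 → (𝒢.rΓ l).2 v = (l.2 : E →L[ℝ] ℝ) (dΦ (𝒢.unit x₀) v) := by
      intro v hv
      obtain ⟨d, hd0, hds, hd, -⟩ := 𝒢.exists_fiber_curve hv
      rw [𝒢.s_unit] at hds
      have hux : 𝒢.unit x₀ ∈ O := hb ▸ (hcO 0 h0).1
      have e1 := hd.comp_of_eq (hdΦ _ hux) hd0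
      refine 𝒢.rΓ_hasVelocity hd hd0 hds (e1.congr ?_)
      filter_upwards [hds] with u hu
      change _ = 𝒢.mul (d u) (σ (𝒢.s (d u)))
      rw [hu, hσ0]
    have hsplit : u = 𝒢.algebroidProj x₀ u + 𝒢.dU x₀ (𝒢.dS (𝒢.unit x₀) u) := by
      rw [algebroidProj_apply]
      abel
    have e7 : (c 0).2 u = (𝒢.rΓ l).2 u := by rw [hc0]
    have e8 : (𝒢.rΓ l).2 u = (l.2 : E →L[ℝ] ℝ) (dΦ (𝒢.unit x₀) (𝒢.algebroidProj x₀ u)) :=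
      (𝒢.rΓ_algebroidProj l u).symm.trans (hfib _ (𝒢.dS_algebroidProj x₀ u))
    have e9 : (l.2 : E →L[ℝ] ℝ) (dΦ (c 0).1 u) =
        (l.2 : E →L[ℝ] ℝ) (dΦ (𝒢.unit x₀) (𝒢.algebroidProj x₀ u)) + dh (c 0).1 u := by
      rw [hdh', hb]
      conv_lhs => rw [hsplit, map_add]
      exact map_add (fib l) _ _
    exact (congrArg (· + dh (c 0).1 u) (e7.trans e8)).trans e9.symm
  · have hev : ∀ᶠ l' : CotangentBundle I G in 𝓝 (c t), l'.1 ∈ O' :=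
      (continuous_proj.tendsto (c t)).eventually (hO'.mem_nhds (hcO t ht))
    have hp := hp₀.contMDiffOn
    refine (hc t ht).2.map_of_liouville (Θ := Θ) (h := fun l => h l.1)
      (d := fun l => (dh l.1).comp (ContinuousLinearMap.fst ℝ E (E →L[ℝ] ℝ))) one_ne_zero
      (hev.mono fun l' hl' => hΘ l' hl')
      (ContMDiffAt.comp (c t) (g := h) (f := fun l : CotangentBundle I G => l.1)
        (hh _ (hcO t ht)) contMDiff_proj.contMDiffAt)
      (hev.mono fun l' hl' => (hdh _ hl').comp l' (hasMFDerivAt_proj l'))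
      (hev.mono fun l' hl' D hD v => ?_)
      ((hp.contMDiffAt (𝒢.isOpen_rRegular.mem_nhds (hc t ht).1)).mdifferentiableAt (by simp))
      ((hp.contMDiffAt (𝒢.isOpen_rRegular.mem_nhds (hUΘ t ht))).mdifferentiableAt (by simp))
      (hev.mono fun l' hl' => by
        rw [one_mul]
        exact congrArg p₀ (hΘr l' hl'))
    have e1 : HasMFDerivAt (cotangentModel I) I (fun l => Φ l.1) l'
        ((ContinuousLinearMap.fst ℝ E (E →L[ℝ] ℝ)).comp D) :=
      (hasMFDerivAt_proj (Θ l')).comp l' hD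
    have e2 : HasMFDerivAt (cotangentModel I) I (fun l => Φ l.1) l'
        ((dΦ l'.1).comp (ContinuousLinearMap.fst ℝ E (E →L[ℝ] ℝ))) :=
      (hdΦ _ hl'.1).comp l' (hasMFDerivAt_proj l')
    have e3 : (D v).1 = dΦ l'.1 v.1 :=
      congrArg (fun L : (E × (E →L[ℝ] ℝ)) →L[ℝ] E => L v) (hasMFDerivAt_unique e1 e2)
    rw [e3, one_mul]
    exact hΘd l' hl' v.1

end LieGroupoid

/-! ### Completeness of the flow -/

section Complete

variable {E H : Type*} [NormedAddCommGroup E] [NormedSpace ℝ E] [TopologicalSpace H]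
  {I : ModelWithCorners ℝ E H} [I.Boundaryless]
  {X : Type*} [TopologicalSpace X] [ChartedSpace H X] [IsManifold I ∞ X]

theorem mem_cotCoord_target {x₀ : X} {z : E × (E →L[ℝ] ℝ)} (hz : z.1 ∈ (coordAt I x₀).target) :
    z ∈ (cotCoord I x₀).target := by
  let x : X := (coordAt I x₀).symm z.1
  have hx : x ∈ (coordAt I x₀).source := (coordAt I x₀).map_target hz
  let D : E →L[ℝ] E := mfderiv I 𝓘(ℝ, E) (coordAt I x₀) x
  let l : CotangentBundle I X := ⟨x, (z.2.comp D : E →L[ℝ] ℝ)⟩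
  have h1 : cotCoord I x₀ l = z := by
    refine Prod.ext ?_ (cotCoord_snd_eq (l := l) hx fun w => rfl)
    rw [cotCoord_fst]
    exact (coordAt I x₀).right_inv hz
  rw [← h1]
  exact (cotCoord I x₀).map_source (mem_cotCoord_source.2 hx)

theorem cotCoord_dilate {x₀ : X} {l : CotangentBundle I X} (hl : l.1 ∈ (coordAt I x₀).source)
    (a : ℝ) : (cotCoord I x₀ (dilate a l)).2 = a • (cotCoord I x₀ l).2 := by
  refine cotCoord_snd_eq (l := dilate a l) hl fun w => ?_
  exact congrArg (a * ·) (cotCoord_snd_apply hl w)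

variable [FiniteDimensional ℝ E] {p : CotangentBundle I X → ℝ} {U : Set (CotangentBundle I X)}

/-- Near each point the local flow exists for a common time; compactness leaves a minimum of
finitely many such times. -/
theorem exists_uniform_hamilton_curve (hU : IsOpen U)
    (hp : ContMDiffOn (cotangentModel I) 𝓘(ℝ, ℝ) ∞ p U) {K : Set (CotangentBundle I X)}
    (hK : IsCompact K) (hKU : K ⊆ U) :
    ∃ a > 0, ∀ l ∈ K, ∃ c, c 0 = l ∧ ∀ t ∈ Ioo (-a) a, c t ∈ U ∧ IsHamiltonAt p c t := by
  refine hK.induction_on (p := fun S => ∃ a > 0, ∀ l ∈ S, ∃ c, c 0 = l ∧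
    ∀ t ∈ Ioo (-a) a, c t ∈ U ∧ IsHamiltonAt p c t) ⟨1, one_pos, fun l hl => hl.elim⟩ ?_ ?_ ?_
  · rintro S S' hS ⟨a, ha, h⟩
    exact ⟨a, ha, fun l hl => h l (hS hl)⟩
  · rintro S S' ⟨a, ha, h⟩ ⟨a', ha', h'⟩
    refine ⟨min a a', lt_min ha ha', ?_⟩
    rintro l (hl | hl)
    · obtain ⟨c, hc0, hc⟩ := h l hl
      exact ⟨c, hc0, fun t ht => hc t ⟨by linarith [ht.1, min_le_left a a'],
        by linarith [ht.2, min_le_left a a']⟩⟩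
    · obtain ⟨c, hc0, hc⟩ := h' l hl
      exact ⟨c, hc0, fun t ht => hc t ⟨by linarith [ht.1, min_le_right a a'],
        by linarith [ht.2, min_le_right a a']⟩⟩
  · intro l hl
    obtain ⟨φ, -, h⟩ := exists_hamilton_local_flow hU hp (hKU hl)
    rw [nhds_prod_eq] at h
    obtain ⟨P, hP, Q, hQ, hPQ⟩ := eventually_prod_iff.1 h
    obtain ⟨δ, hδ, hball⟩ := Metric.eventually_nhds_iff_ball.1 hP
    refine ⟨{l | Q l}, mem_nhdsWithin_of_mem_nhds hQ, δ, hδ, fun l' hl' =>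
      ⟨fun t => φ (t, l'), (hPQ (hball 0 (Metric.mem_ball_self hδ)) hl').2.1, fun t ht => ?_⟩⟩
    have ht' : t ∈ Metric.ball (0 : ℝ) δ := by
      rw [Real.ball_eq_Ioo]
      simpa using ht
    have := hPQ (hball t ht') hl'
    exact ⟨this.1, this.2.2⟩

end Complete

namespace LieGroupoid

variable {E H F N : Type*} [NormedAddCommGroup E] [NormedSpace ℝ E] [FiniteDimensional ℝ E]
  [TopologicalSpace H] [NormedAddCommGroup F] [NormedSpace ℝ F] [FiniteDimensional ℝ F]
  [TopologicalSpace N]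
  {I : ModelWithCorners ℝ E H} [I.Boundaryless] {G : Type*} [TopologicalSpace G] [ChartedSpace H G]
  {J : ModelWithCorners ℝ F N} [J.Boundaryless] {M : Type*} [TopologicalSpace M] [ChartedSpace N M]
  [IsManifold I ∞ G] [IsManifold J ∞ M] [T2Space G] (𝒢 : LieGroupoid I G J M)

theorem isClosed_dualAlgebroid : IsClosed 𝒢.dualAlgebroid := by
  have h : 𝒢.dualAlgebroid = {l | 𝒢.rΓ l = l} := Set.ext fun l => 𝒢.mem_dualAlgebroid_iff
  rw [h]
  exact isClosed_eq 𝒢.contMDiff_rΓ.continuous continuous_id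

variable {𝒢} in
theorem dilate_mem_dualAlgebroidNonzero {l : CotangentBundle I G}
    (hl : l ∈ 𝒢.dualAlgebroidNonzero) {a : ℝ} (ha : a ≠ 0) :
    dilate a l ∈ 𝒢.dualAlgebroidNonzero := by
  refine ⟨𝒢.mem_dualAlgebroid_iff.2 ?_, smul_ne_zero ha hl.2⟩
  rw [𝒢.rΓ_dilate, 𝒢.rΓ_of_mem hl.1]

/-- In a chart, the unit sphere bundle over a compact neighborhood is compact. Its intersection with
the closed set `A*G` stays compact, and normalizing the fiber coordinate gives the required
dilation. -/
theorem exists_compact_cosphere_local (x : M) : ∃ V ∈ 𝓝 x, ∃ K : Set (CotangentBundle I G),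
    IsCompact K ∧ K ⊆ 𝒢.dualAlgebroidNonzero ∧ ∀ l ∈ 𝒢.dualAlgebroidNonzero,
      𝒢.r l.1 ∈ V → ∃ a > 0, dilate a l ∈ K := by
  set k := coordAt I (𝒢.unit x)
  have hk : IsCoord I k := isCoord_coordAt _
  have hx : 𝒢.unit x ∈ k.source := mem_coordAt_source _
  obtain ⟨C, hC, hCt, hCc⟩ := local_compact_nhds (k.open_target.mem_nhds (k.map_source hx))
  set κ := cotCoord I (𝒢.unit x)
  have hCκ : C ×ˢ Metric.sphere (0 : E →L[ℝ] ℝ) 1 ⊆ κ.target := fun z hz =>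
    mem_cotCoord_target (hCt hz.1)
  let S : Set (CotangentBundle I G) := κ.symm '' (C ×ˢ Metric.sphere (0 : E →L[ℝ] ℝ) 1)
  have hS : IsCompact S := (hCc.prod (isCompact_sphere _ _)).image_of_continuousOn
    (κ.continuousOn_symm.mono hCκ)
  have hunit : ContinuousAt (fun y => k (𝒢.unit y)) x :=
    (hk.contMDiffAt hx).continuousAt.comp 𝒢.smooth_unit.continuous.continuousAt
  refine ⟨{y | 𝒢.unit y ∈ k.source ∧ k (𝒢.unit y) ∈ C}, ?_, S ∩ 𝒢.dualAlgebroid,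
    hS.inter_right 𝒢.isClosed_dualAlgebroid, ?_, ?_⟩
  · exact inter_mem (𝒢.smooth_unit.continuous.continuousAt.preimage_mem_nhds
      (k.open_source.mem_nhds hx)) (hunit.preimage_mem_nhds hC)
  · rintro l ⟨⟨z, hz, rfl⟩, hl⟩
    refine ⟨hl, ?_⟩
    have h1 := κ.map_target (hCκ hz)
    refine (cotCoord_snd_eq_zero_iff (mem_cotCoord_source.1 h1)).not.1 ?_
    rw [κ.right_inv (hCκ hz)]
    intro h2
    have h3 : ‖z.2‖ = 1 := by simpa using hz.2
    rw [h2, norm_zero] at h3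
    exact zero_ne_one h3
  · rintro l hl ⟨h1, h2⟩
    have h3 : 𝒢.unit (𝒢.r l.1) = l.1 := congrArg Bundle.TotalSpace.proj (𝒢.rΓ_of_mem hl.1)
    rw [h3] at h1 h2
    have h4 : (κ l).2 ≠ 0 := (cotCoord_snd_eq_zero_iff h1).not.2 hl.2
    have h5 : 0 < ‖(κ l).2‖⁻¹ := inv_pos.2 (norm_pos_iff.2 h4)
    refine ⟨_, h5, ⟨κ (dilate ‖(κ l).2‖⁻¹ l), ⟨h2, ?_⟩,
      κ.left_inv (mem_cotCoord_source.2 h1)⟩, (dilate_mem_dualAlgebroidNonzero hl h5.ne').1⟩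
    rw [cotCoord_dilate h1, mem_sphere_zero_iff_norm, norm_smul, norm_inv, norm_norm,
      inv_mul_cancel₀ (norm_ne_zero_iff.2 h4)]

/-- Every nonzero covector in the dual algebroid is a dilate of one in a fixed compact set. -/
theorem exists_compact_cosphere [CompactSpace M] : ∃ K : Set (CotangentBundle I G),
    IsCompact K ∧ K ⊆ 𝒢.dualAlgebroidNonzero ∧
      ∀ l ∈ 𝒢.dualAlgebroidNonzero, ∃ a > 0, dilate a l ∈ K := by
  choose V hV K hK hK' h using 𝒢.exists_compact_cosphere_local
  obtain ⟨T, hT⟩ := CompactSpace.elim_nhds_subcover V hV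
  refine ⟨⋃ x ∈ T, K x, T.isCompact_biUnion fun x _ => hK x, iUnion₂_subset fun x _ => hK' x,
    fun l hl => ?_⟩
  have h1 : 𝒢.r l.1 ∈ ⋃ x ∈ T, V x := hT ▸ mem_univ _
  obtain ⟨x, hx, h2⟩ := mem_iUnion₂.1 h1
  obtain ⟨a, ha, h3⟩ := h x l hl h2
  exact ⟨a, ha, mem_iUnion₂.2 ⟨x, hx, h3⟩⟩

variable {𝒢} {p₀ : CotangentBundle I G → ℝ}

/-- The uniform time on the compact set is transported by dilation to `r_Γ l` and by right
translation to `l`. Dilation does not change the time because the Hamiltonian has degree one. -/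
theorem IsEllipticSymbol.existsUnique_flow [CompactSpace M] (hp₀ : 𝒢.IsEllipticSymbol p₀) :
    ∃! χ : ℝ → 𝒢.rRegular → 𝒢.rRegular, IsHamiltonianFlow I (p₀ ∘ 𝒢.rΓ) 𝒢.rRegular χ := by
  obtain ⟨K, hK, hKA, hcone⟩ := 𝒢.exists_compact_cosphere
  have hU := 𝒢.isOpen_rRegular
  have hp := hp₀.contMDiffOn
  have hom := hp₀.isHomogeneousOn
  obtain ⟨ε, hε, h⟩ := exists_uniform_hamilton_curve hU hp hK
    (hKA.trans 𝒢.dualAlgebroidNonzero_subset)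
  refine existsUnique_isHamiltonianFlow hU hp
    (exists_hamilton_curve hU hp Subset.rfl hε fun l hl => ?_)
  obtain ⟨a, ha, hal⟩ := hcone _ (𝒢.rΓ_mem_dualAlgebroidNonzero hl)
  obtain ⟨c, hc0, hc⟩ := h _ hal
  obtain ⟨c', hc0', hc'⟩ := hp₀.exists_translate l (c := fun t => dilate a⁻¹ (c t)) isOpen_Ioo
    isPreconnected_Ioo (show (0 : ℝ) ∈ Ioo (-ε) ε from ⟨by linarith, hε⟩)
    (fun t ht => ⟨hom.conic _ (hc t ht).1 _ (inv_pos.2 ha),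
      (hc t ht).2.dilate hU hp hom (inv_pos.2 ha) (hc t ht).1⟩)
    (by rw [hc0, dilate_dilate, inv_mul_cancel₀ ha.ne', dilate_one])
  exact ⟨c', hc0', fun t ht => ⟨(hc' t ht).1, (hc' t ht).2.1⟩⟩

variable {χ : ℝ → 𝒢.rRegular → 𝒢.rRegular}

/-- Right invariance, integrated: the translated integral curve starts at `l` and is therefore the
flow line of `l`. -/
theorem IsEllipticSymbol.flow_translate (hp₀ : 𝒢.IsEllipticSymbol p₀)
    (hχ : IsHamiltonianFlow I (p₀ ∘ 𝒢.rΓ) 𝒢.rRegular χ) (t : ℝ) {l : CotangentBundle I G}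
    (hl : l ∈ 𝒢.rRegular) :
    (flowMap χ (t, l)).1 = 𝒢.mul (flowMap χ (t, 𝒢.rΓ l)).1 l.1 ∧
      𝒢.rΓ (flowMap χ (t, l)) = 𝒢.rΓ (flowMap χ (t, 𝒢.rΓ l)) := by
  have hU := 𝒢.isOpen_rRegular
  have hp := hp₀.contMDiffOn
  have hl' := 𝒢.mem_rRegular_rΓ hl
  obtain ⟨c, hc0, hc⟩ := hp₀.exists_translate l (c := fun t => flowMap χ (t, 𝒢.rΓ l)) isOpen_univ
    isPreconnected_univ (mem_univ 0)
    (fun t _ => ⟨flowMap_mem χ hl', hχ.isHamiltonAt_flowMap t hl'⟩) (hχ.flowMap_zero hl')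
  rw [hχ.flowMap_eq hU hp (fun t => ⟨(hc t (mem_univ t)).1, (hc t (mem_univ t)).2.1⟩) hc0 t]
  exact (hc t (mem_univ t)).2.2

theorem IsEllipticSymbol.s_flow (hp₀ : 𝒢.IsEllipticSymbol p₀)
    (hχ : IsHamiltonianFlow I (p₀ ∘ 𝒢.rΓ) 𝒢.rRegular χ) (t : ℝ) {l : CotangentBundle I G}
    (hl : l ∈ 𝒢.rRegular) : 𝒢.s (flowMap χ (t, l)).1 = 𝒢.s l.1 := by
  have h := hp₀.s_eq (c := fun t => flowMap χ (t, l)) isOpen_univ isPreconnected_univ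
    (fun t _ => ⟨flowMap_mem χ hl, hχ.isHamiltonAt_flowMap t hl⟩) (mem_univ 0) (mem_univ t)
  rwa [hχ.flowMap_zero hl] at h

end LieGroupoid

/-! ### The source map along the flow, and the tangent spaces of the dual algebroid -/

section Curves

variable {E H : Type*} [NormedAddCommGroup E] [NormedSpace ℝ E] [TopologicalSpace H]
  {I : ModelWithCorners ℝ E H}
  {X : Type*} [TopologicalSpace X] [ChartedSpace H X]

theorem exists_velocity {c : ℝ → X} {t : ℝ} (hc : ContMDiffAt 𝓘(ℝ, ℝ) I ∞ c t) :
    ∃ v : E, HasVelocity I c t v :=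
  ⟨_, HasVelocity.of_mdifferentiableAt (hc.mdifferentiableAt (by simp))⟩

variable [I.Boundaryless] [IsManifold I ∞ X]

/-- Lift the base curve by freezing the fiber coordinate in a canonical chart. -/
theorem exists_covector_curve {β : ℝ → X} (hβ : ContMDiffAt 𝓘(ℝ, ℝ) I ∞ β 0)
    {l : CotangentBundle I X} (hl : β 0 = l.1) :
    ∃ c : ℝ → CotangentBundle I X, c 0 = l ∧ (∀ᶠ u in 𝓝 0, (c u).1 = β u) ∧
      ContMDiffAt 𝓘(ℝ, ℝ) (cotangentModel I) ∞ c 0 := by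
  set k := coordAt I l.1
  have hk : IsCoord I k := isCoord_coordAt _
  set κ := cotCoord I l.1
  have hκ : IsCoord (cotangentModel I) κ := isCoord_cotCoord _
  have hl₀ : l ∈ κ.source := mem_cotCoord_source.2 (mem_coordAt_source _)
  let ξ : E →L[ℝ] ℝ := (κ l).2
  have h0 : (k (β 0), ξ) = κ l := Prod.ext (congrArg k hl) rfl
  have hβ0 : β 0 ∈ k.source := by rw [hl]; exact mem_coordAt_source _
  refine ⟨fun u => κ.symm (k (β u), ξ), ?_, ?_, ?_⟩
  · change κ.symm (k (β 0), ξ) = l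
    rw [h0, κ.left_inv hl₀]
  · filter_upwards [hβ.continuousAt.eventually_mem (k.open_source.mem_nhds hβ0)] with u hu
    have h1 : (k (β u), ξ) ∈ κ.target := mem_cotCoord_target (k.map_source hu)
    exact k.injOn (mem_cotCoord_source.1 (κ.map_target h1)) hu (cotCoord_symm_fst h1)
  · have h1 : ContMDiffAt 𝓘(ℝ, ℝ) 𝓘(ℝ, E) ∞ (fun u => k (β u)) 0 :=
      ContMDiffAt.comp (0 : ℝ) (hk.contMDiffAt hβ0) hβ
    have h2 : ContMDiffAt 𝓘(ℝ, ℝ) 𝓘(ℝ, E × (E →L[ℝ] ℝ)) ∞ (fun u => (k (β u), ξ)) 0 :=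
      h1.prodMk_space contMDiffAt_const
    refine ContMDiffAt.comp (0 : ℝ) (g := κ.symm) (hκ.contMDiffAt_symm ?_) h2
    exact mem_cotCoord_target (k.map_source hβ0)

end Curves

namespace LieGroupoid

variable {E H F N : Type*} [NormedAddCommGroup E] [NormedSpace ℝ E] [FiniteDimensional ℝ E]
  [TopologicalSpace H] [NormedAddCommGroup F] [NormedSpace ℝ F] [FiniteDimensional ℝ F]
  [TopologicalSpace N]
  {I : ModelWithCorners ℝ E H} [I.Boundaryless] {G : Type*} [TopologicalSpace G] [ChartedSpace H G]
  {J : ModelWithCorners ℝ F N} [J.Boundaryless] {M : Type*} [TopologicalSpace M] [ChartedSpace N M]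
  [IsManifold I ∞ G] [IsManifold J ∞ M] (𝒢 : LieGroupoid I G J M)

/-- Leibniz rule: all arrows involved compose over the same `x`, so `(u, u') ↦ c(u) d(u')` is smooth
in two variables, and its derivative along the diagonal is the sum of the partial derivatives. -/
theorem hasVelocity_mul {c d : ℝ → G} {x : M} (hc : ContMDiffAt 𝓘(ℝ, ℝ) I ∞ c 0)
    (hd : ContMDiffAt 𝓘(ℝ, ℝ) I ∞ d 0) (hcs : ∀ᶠ u in 𝓝 0, 𝒢.s (c u) = x)
    (hdr : ∀ᶠ u in 𝓝 0, 𝒢.r (d u) = x) {v w : E}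
    (hv : HasVelocity I (fun u => 𝒢.mul (c u) (d 0)) 0 v)
    (hw : HasVelocity I (fun u => 𝒢.mul (c 0) (d u)) 0 w) :
    HasVelocity I (fun u => 𝒢.mul (c u) (d u)) 0 (v + w) := by
  let f : ℝ × ℝ → G := fun q => 𝒢.mul (c q.1) (d q.2)
  have hf : ContMDiffAt 𝓘(ℝ, ℝ × ℝ) I ∞ f (0, 0) := by
    refine 𝒢.contMDiffAt_mul
      (ContMDiffAt.comp ((0 : ℝ), (0 : ℝ)) (f := Prod.fst) hc contDiff_fst.contMDiff.contMDiffAt)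
      (ContMDiffAt.comp ((0 : ℝ), (0 : ℝ)) (f := Prod.snd) hd contDiff_snd.contMDiff.contMDiffAt) ?_
    filter_upwards [(continuous_fst.tendsto ((0 : ℝ), (0 : ℝ))).eventually hcs,
      (continuous_snd.tendsto ((0 : ℝ), (0 : ℝ))).eventually hdr] with q h1 h2
    exact h1.trans h2.symm
  let D : ℝ × ℝ →L[ℝ] E := mfderiv 𝓘(ℝ, ℝ × ℝ) I f (0, 0)
  have hD : HasMFDerivAt 𝓘(ℝ, ℝ × ℝ) I f (0, 0) D := (hf.mdifferentiableAt (by simp)).hasMFDerivAt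
  have h1 : HasVelocity 𝓘(ℝ, ℝ × ℝ) (fun u : ℝ => (u, (0 : ℝ))) 0 ((1 : ℝ), (0 : ℝ)) := by
    rw [hasVelocity_iff_hasDerivAt]
    exact (hasDerivAt_id 0).prodMk (hasDerivAt_const 0 0)
  have h2 : HasVelocity 𝓘(ℝ, ℝ × ℝ) (fun u : ℝ => ((0 : ℝ), u)) 0 ((0 : ℝ), (1 : ℝ)) := by
    rw [hasVelocity_iff_hasDerivAt]
    exact (hasDerivAt_const 0 0).prodMk (hasDerivAt_id 0)
  have h3 : HasVelocity 𝓘(ℝ, ℝ × ℝ) (fun u : ℝ => (u, u)) 0 ((1 : ℝ), (1 : ℝ)) := by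
    rw [hasVelocity_iff_hasDerivAt]
    exact (hasDerivAt_id 0).prodMk (hasDerivAt_id 0)
  rw [hv.unique (h1.comp_of_eq hD rfl), hw.unique (h2.comp_of_eq hD rfl), ← map_add, Prod.mk_add_mk,
    add_zero, zero_add]
  exact h3.comp_of_eq hD rfl

theorem sΓ_apply (l : CotangentBundle I G) (w : E) :
    (𝒢.sΓ l).2 w = (-(l.2 (𝒢.fiberDeriv (fun γ η => 𝒢.mul γ (𝒢.inv η)) 𝒢.s l.1
      (𝒢.algebroidProj (𝒢.s l.1) w)) : ℝ) : ℝ) := rfl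

theorem sΓ_dU (l : CotangentBundle I G) (w : F) : (𝒢.sΓ l).2 (𝒢.dU (𝒢.s l.1) w) = (0 : ℝ) := by
  rw [sΓ_apply, algebroidProj_dU, map_zero]
  exact (congrArg Neg.neg (map_zero (fib l))).trans neg_zero

theorem sΓ_mem_dualAlgebroid (l : CotangentBundle I G) : 𝒢.sΓ l ∈ 𝒢.dualAlgebroid :=
  ⟨𝒢.s l.1, (𝒢.sΓ l).2, rfl, fun u => 𝒢.sΓ_dU l u⟩

theorem sΓ_algebroidProj (l : CotangentBundle I G) (w : E) :
    (𝒢.sΓ l).2 (𝒢.algebroidProj (𝒢.s l.1) w) = (𝒢.sΓ l).2 w := by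
  rw [sΓ_apply, sΓ_apply, 𝒢.algebroidProj_of_dS_eq_zero (𝒢.dS_algebroidProj _ w)]

theorem sΓ_hasVelocity {l : CotangentBundle I G} {c : ℝ → G} {v v' : E}
    (hc : HasVelocity I c 0 v) (hc0 : c 0 = 𝒢.unit (𝒢.s l.1))
    (hcs : ∀ᶠ u in 𝓝 0, 𝒢.s (c u) = 𝒢.s l.1)
    (hv' : HasVelocity I (fun u => 𝒢.mul l.1 (𝒢.inv (c u))) 0 v') :
    (𝒢.sΓ l).2 v = -(fib l v') := by
  have h1 := 𝒢.dS_eq_zero_of_hasVelocity hc hc0 hcs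
  rw [sΓ_apply, 𝒢.algebroidProj_of_dS_eq_zero h1]
  have h2 := 𝒢.isFiberMap_left.hasVelocity hc hc0 hcs
  rw [hv'.unique h2]
  rfl

/-- The inversion acts on the Lie algebroid as `-1`, modulo vectors tangent to the units. -/
theorem exists_velocity_inv {b : ℝ → G} {x : M} {v : E} (hb : ContMDiffAt 𝓘(ℝ, ℝ) I ∞ b 0)
    (hv : HasVelocity I b 0 v) (hb0 : b 0 = 𝒢.unit x) (hbs : ∀ᶠ u in 𝓝 0, 𝒢.s (b u) = x) :
    ∃ y : F, HasVelocity I (fun u => 𝒢.inv (b u)) 0 (𝒢.dU x y - v) := by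
  have hi : ContMDiffAt 𝓘(ℝ, ℝ) I ∞ (fun u => 𝒢.inv (b u)) 0 :=
    𝒢.smooth_inv.contMDiffAt.comp (0 : ℝ) hb
  obtain ⟨w, hw⟩ := exists_velocity hi
  have h1 : HasVelocity I (fun u => 𝒢.mul (b u) (𝒢.inv (b 0))) 0 v := by
    refine hv.congr ?_
    filter_upwards [hbs] with u hu
    rw [hb0, 𝒢.r_inv_unit, ← hu, 𝒢.mul_unit]
  have h2 : HasVelocity I (fun u => 𝒢.mul (b 0) (𝒢.inv (b u))) 0 w := by
    refine hw.congr ?_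
    filter_upwards [hbs] with u hu
    have h3 := 𝒢.unit_mul (𝒢.inv (b u))
    rwa [𝒢.r_inv, hu, ← hb0] at h3
  -- Differentiate `b · b⁻¹ = unit (r b)`: the left side has velocity `v + w`, the right side is
  -- tangent to the units.
  have h3 := 𝒢.hasVelocity_mul (x := x) hb hi hbs (hbs.mono fun u hu => (𝒢.r_inv _).trans hu) h1 h2
  have h4 := (hv.comp_of_eq (𝒢.hasMFDerivAt_r _) hb0).comp_of_eq (𝒢.hasMFDerivAt_unit x)
    (by rw [hb0, 𝒢.r_unit])
  have h5 := h3.unique (h4.congr (Eventually.of_forall fun u => 𝒢.mul_inv (b u)))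
  refine ⟨𝒢.dR (𝒢.unit x) v, ?_⟩
  rw [← h5, add_sub_cancel_left]
  exact hw

variable {𝒢}

theorem eq_of_mem_dualAlgebroid {l : CotangentBundle I G} (hl : l ∈ 𝒢.dualAlgebroid) :
    𝒢.unit (𝒢.r l.1) = l.1 ∧ 𝒢.s l.1 = 𝒢.r l.1 ∧
      ∀ y, fib l (𝒢.dU (𝒢.r l.1) y) = 0 := by
  have h := 𝒢.rΓ_of_mem hl
  have h1 : 𝒢.unit (𝒢.r l.1) = l.1 := congrArg Bundle.TotalSpace.proj h
  refine ⟨h1, (congrArg 𝒢.s h1).symm.trans (𝒢.s_unit _), fun y => ?_⟩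
  obtain ⟨x, ξ, rfl, hξ⟩ := hl
  have h2 : 𝒢.r (⟨𝒢.unit x, ξ⟩ : CotangentBundle I G).1 = x := 𝒢.r_unit x
  rw [h2]
  exact hξ y

theorem fib_algebroidProj {l : CotangentBundle I G} (hl : l ∈ 𝒢.dualAlgebroid) (w : E) :
    fib l (𝒢.algebroidProj (𝒢.r l.1) w) = fib l w := by
  rw [algebroidProj_apply, map_sub, (eq_of_mem_dualAlgebroid hl).2.2, sub_zero]

variable [T2Space G] {p₀ : CotangentBundle I G → ℝ} {χ : ℝ → 𝒢.rRegular → 𝒢.rRegular}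

/-- The source of a point of the flow out of the dual algebroid. -/
theorem IsEllipticSymbol.sΓ_flow (hp₀ : 𝒢.IsEllipticSymbol p₀)
    (hχ : IsHamiltonianFlow I (p₀ ∘ 𝒢.rΓ) 𝒢.rRegular χ) (t : ℝ) {l : CotangentBundle I G}
    (hl : l ∈ 𝒢.dualAlgebroidNonzero) : 𝒢.sΓ (flowMap χ (t, l)) = l := by
  have hU := 𝒢.isOpen_rRegular
  have hp := hp₀.contMDiffOn
  have hom := hp₀.isHomogeneousOn
  have hlU := 𝒢.dualAlgebroidNonzero_subset hl
  obtain ⟨hx, hsr, hl0⟩ := eq_of_mem_dualAlgebroid hl.1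
  set x := 𝒢.r l.1
  set μ := flowMap χ (t, l)
  have hsμ : 𝒢.s μ.1 = x := (hp₀.s_flow hχ t hlU).trans hsr
  have hlr : 𝒢.rΓ l = l := 𝒢.rΓ_of_mem hl.1
  refine covector_ext ((congrArg 𝒢.unit hsμ).trans hx) fun w => ?_
  have e1 := 𝒢.sΓ_algebroidProj μ w
  rw [hsμ] at e1
  refine e1.symm.trans (Eq.trans ?_ (fib_algebroidProj hl.1 w))
  change _ = fib l (𝒢.algebroidProj x w)
  obtain ⟨b, hb0, hbs, hv, hb⟩ := 𝒢.exists_fiber_curve (𝒢.dS_algebroidProj x w)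
  rw [𝒢.s_unit] at hbs
  obtain ⟨y, hβv⟩ := 𝒢.exists_velocity_inv hb hv hb0 hbs
  -- The test curve `b` in the source fiber is inverted, so that it runs in the range fiber of `x`
  -- and can serve as the right factor. It is lifted to covectors starting at `l`.
  let β : ℝ → G := fun u => 𝒢.inv (b u)
  have hβ : ContMDiffAt 𝓘(ℝ, ℝ) I ∞ β 0 := 𝒢.smooth_inv.contMDiffAt.comp (0 : ℝ) hb
  have hβ0 : β 0 = 𝒢.unit x := by
    change 𝒢.inv (b 0) = _
    rw [hb0, 𝒢.r_inv_unit]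
  have hβr : ∀ᶠ u in 𝓝 0, 𝒢.r (β u) = x := hbs.mono fun u hu => (𝒢.r_inv _).trans hu
  obtain ⟨c, hc0, hcβ, hc⟩ := exists_covector_curve hβ (hβ0.trans hx)
  -- the curve, and its image under `rΓ`
  let c' : ℝ → CotangentBundle I G := fun u => 𝒢.rΓ (c u)
  have hc' : ContMDiffAt 𝓘(ℝ, ℝ) (cotangentModel I) ∞ c' 0 :=
    𝒢.contMDiff_rΓ.contMDiffAt.comp (0 : ℝ) hc
  have hc'0 : c' 0 = l := by
    change 𝒢.rΓ (c 0) = l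
    rw [hc0, hlr]
  have hc'b : ∀ᶠ u in 𝓝 0, (c' u).1 = 𝒢.unit x := by
    filter_upwards [hcβ, hβr] with u h1 h2
    change 𝒢.unit (𝒢.r (c u).1) = _
    rw [h1, h2]
  have hcU : ∀ᶠ u in 𝓝 0, c u ∈ 𝒢.rRegular :=
    hc.continuousAt.eventually_mem (hU.mem_nhds (by rw [hc0]; exact hlU))
  obtain ⟨w₁, hw₁⟩ := exists_velocity hc
  obtain ⟨w₂, hw₂⟩ := exists_velocity hc'
  let D : (E × (E →L[ℝ] ℝ)) →L[ℝ] E × (E →L[ℝ] ℝ) :=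
    mfderiv (cotangentModel I) (cotangentModel I) (fun l => flowMap χ (t, l)) l
  have hD : HasMFDerivAt (cotangentModel I) (cotangentModel I) (fun l => flowMap χ (t, l)) l D :=
    ((hχ.contMDiffAt_time hU hp t hlU).mdifferentiableAt (by simp)).hasMFDerivAt
  have h1 := hχ.liouville_eq hU hp hom t hlU hD w₁
  have h2 := hχ.liouville_eq hU hp hom t hlU hD w₂
  have hv₁ := (hw₁.comp_of_eq hD hc0).proj
  have hv₂ := (hw₂.comp_of_eq hD hc'0).proj
  have e2 : w₁.1 = 𝒢.dU x y - 𝒢.algebroidProj x w :=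
    (hw₁.proj.congr (hcβ.mono fun u hu => hu.symm)).unique hβv
  have e3 : w₂.1 = 0 := (hw₂.proj.congr (hc'b.mono fun u hu => hu.symm)).unique
    (hasVelocity_const (𝒢.unit x) 0)
  let g : ℝ → G := fun u => (flowMap χ (t, c' u)).1
  have hg : ContMDiffAt 𝓘(ℝ, ℝ) I ∞ g 0 :=
    contMDiff_proj.contMDiffAt.comp (0 : ℝ) (ContMDiffAt.comp (0 : ℝ)
      (g := fun l => flowMap χ (t, l)) (hχ.contMDiffAt_time hU hp t (by rw [hc'0]; exact hlU)) hc')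
  have hg0 : g 0 = μ.1 := by
    change (flowMap χ (t, c' 0)).1 = _
    rw [hc'0]
  have hgs : ∀ᶠ u in 𝓝 0, 𝒢.s (g u) = x := by
    filter_upwards [hcU, hc'b] with u h3 h4
    change 𝒢.s (flowMap χ (t, c' u)).1 = x
    rw [hp₀.s_flow hχ t (𝒢.mem_rRegular_rΓ h3), h4, 𝒢.s_unit]
  obtain ⟨v', hv'⟩ := exists_velocity (𝒢.contMDiffAt_mul (f := fun _ : ℝ => μ.1) contMDiffAt_const hβ
    (hβr.mono fun u hu => hsμ.trans hu.symm))
  have h3 := 𝒢.hasVelocity_mul hg hβ hgs hβr (v := (D w₂).1) (w := v')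
    (hv₂.congr (by
      filter_upwards [hgs] with u hu
      rw [hβ0, ← hu, 𝒢.mul_unit]))
    (by rw [hg0]; exact hv')
  -- By `flow_translate` the base point of `χ_t (c u)` is the product of `g u` and `β u`. The
  -- Leibniz rule isolates `v'`, the vector on which `s_Γ` evaluates the covector of `μ`.
  have h4 : (D w₁).1 = (D w₂).1 + v' := by
    refine hv₁.unique (h3.congr ?_)
    filter_upwards [hcU, hcβ] with u h5 h6
    rw [(hp₀.flow_translate hχ t h5).1, h6]
  have h5 := 𝒢.sΓ_hasVelocity (l := μ) hv (by rw [hsμ, hb0]) (by rw [hsμ]; exact hbs) hv'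
  refine h5.trans ?_
  -- Invariance of `α` computes both other terms at time zero. The one for `w₂` vanishes since `c'`
  -- stays over `unit x`; the one for `w₁` is minus `l` on the test vector, as `l` kills `TM`. The
  -- sign cancels the one in `s_Γ`.
  have h6 : fib μ (D w₁).1 = fib l w₁.1 := h1
  have h7 : fib μ (D w₂).1 = fib l w₂.1 := h2
  rw [e3, map_zero] at h7
  rw [h4, map_add, h7, zero_add, e2, map_sub, hl0, zero_sub] at h6
  rw [h6, neg_neg]

/-- Every direction in `TM` lifts to a vector tangent to `A*G`: lift a curve of units to covectors
and project it by `r_Γ`. -/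
theorem exists_velocity_rΓ_over {l : CotangentBundle I G} (hl : l ∈ 𝒢.dualAlgebroid)
    {D : (E × (E →L[ℝ] ℝ)) →L[ℝ] E × (E →L[ℝ] ℝ)}
    (hD : HasMFDerivAt (cotangentModel I) (cotangentModel I) 𝒢.rΓ l D) (y : F) :
    ∃ w, D w = w ∧ w.1 = 𝒢.dU (𝒢.r l.1) y := by
  obtain ⟨hx, -, -⟩ := eq_of_mem_dualAlgebroid hl
  obtain ⟨d, hd0, hdv, hd⟩ := exists_curve (I := J) (𝒢.r l.1) y
  have hβ : ContMDiffAt 𝓘(ℝ, ℝ) I ∞ (fun u => 𝒢.unit (d u)) 0 :=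
    𝒢.smooth_unit.contMDiffAt.comp (0 : ℝ) hd
  obtain ⟨c, hc0, hcβ, hc⟩ := exists_covector_curve hβ ((congrArg 𝒢.unit hd0).trans hx)
  obtain ⟨w, hw⟩ := exists_velocity hc
  have h1 := hw.comp_of_eq hD hc0
  have h2 := h1.comp_of_eq hD (by rw [hc0, 𝒢.rΓ_of_mem hl])
  refine ⟨D w, (h2.congr (Eventually.of_forall fun u => (𝒢.rΓ_rΓ (c u)).symm)).unique h1, ?_⟩
  refine (h1.proj.congr ?_).unique (hdv.comp_of_eq (𝒢.hasMFDerivAt_unit _) hd0)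
  filter_upwards [hcβ] with u hu
  rw [rΓ_fst, hu, 𝒢.r_unit]

/-- The tangent spaces of the dual algebroid are their own symplectic orthogonals. -/
theorem lagrangian_dualAlgebroid {l : CotangentBundle I G} (hl : l ∈ 𝒢.dualAlgebroid)
    {D : (E × (E →L[ℝ] ℝ)) →L[ℝ] E × (E →L[ℝ] ℝ)}
    (hD : HasMFDerivAt (cotangentModel I) (cotangentModel I) 𝒢.rΓ l D) (v : E × (E →L[ℝ] ℝ)) :
    D v = v ↔ ∀ w, D w = w → stdSymplectic v w = 0 := by
  obtain ⟨hx, -, hl0⟩ := eq_of_mem_dualAlgebroid hl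
  have hlr : 𝒢.rΓ l = l := 𝒢.rΓ_of_mem hl
  set x := 𝒢.r l.1
  -- Points of `A*G` vanish on `TM`, where `r_Γ` sends base vectors, so `r_Γ*α = 0`. The case `a =
  -- 0` of `symplecticForm_of_liouville` then gives isotropy.
  have hiso : ∀ v w, D v = v → D w = w → stdSymplectic v w = 0 := by
    intro v w hv hw
    let D' : CotangentBundle I G → (E × (E →L[ℝ] ℝ)) →L[ℝ] E × (E →L[ℝ] ℝ) := fun l =>
      mfderiv (cotangentModel I) (cotangentModel I) 𝒢.rΓ l
    have hD' : ∀ l, HasMFDerivAt (cotangentModel I) (cotangentModel I) 𝒢.rΓ l (D' l) := fun l =>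
      (𝒢.contMDiff_rΓ.mdifferentiable (by simp) l).hasMFDerivAt
    have h := symplecticForm_of_liouville (I := I) (Θ := 𝒢.rΓ) (l := l)
      (h := fun _ => 0) (d := 0) (a := 0) (D := D')
      (Eventually.of_forall fun l => 𝒢.contMDiff_rΓ l) (Eventually.of_forall hD') contMDiffAt_const
      (Eventually.of_forall fun l => hasMFDerivAt_const _ _)
      (Eventually.of_forall fun l' v => by
        have h1 : HasMFDerivAt (cotangentModel I) I (fun l => 𝒢.unit (𝒢.r l.1)) l'
            ((ContinuousLinearMap.fst ℝ E (E →L[ℝ] ℝ)).comp (D' l')) :=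
          (hasMFDerivAt_proj (𝒢.rΓ l')).comp l' (hD' l')
        have h2 : HasMFDerivAt (cotangentModel I) I (fun l => 𝒢.unit (𝒢.r l.1)) l'
            ((𝒢.dU (𝒢.r l'.1)).comp ((𝒢.dR l'.1).comp (ContinuousLinearMap.fst ℝ E (E →L[ℝ] ℝ)))) :=
          (𝒢.hasMFDerivAt_unit _).comp l' ((𝒢.hasMFDerivAt_r l'.1).comp l' (hasMFDerivAt_proj l'))
        have h3 : (D' l' v).1 = 𝒢.dU (𝒢.r l'.1) (𝒢.dR l'.1 v.1) :=
          congrArg (fun L : (E × (E →L[ℝ] ℝ)) →L[ℝ] E => L v) (hasMFDerivAt_unique h1 h2)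
        rw [h3, zero_mul]
        exact (𝒢.rΓ_dU l' _).trans (zero_add (0 : ℝ)).symm) v w
    rw [zero_mul, hasMFDerivAt_unique (hD' l) hD, hv, hw] at h
    exact h
  refine ⟨fun hv w hw => hiso v w hv hw, fun h => ?_⟩
  -- vertical tangent vectors
  have hvert : ∀ β : E →L[ℝ] ℝ, D ((0 : E), β.comp (𝒢.algebroidProj x)) =
      ((0 : E), β.comp (𝒢.algebroidProj x)) := by
    intro β
    have h1 := hasVelocity_vertical (I := I) l.1 l.2 (β.comp (𝒢.algebroidProj x))
    refine (h1.comp_of_eq hD ?_).unique (h1.congr (Eventually.of_forall fun t => ?_))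
    · exact congrArg (fun ξ : E →L[ℝ] ℝ => (⟨l.1, ξ⟩ : CotangentBundle I G))
        (by rw [zero_smul, add_zero] :
          fib l + (0 : ℝ) • (β.comp (𝒢.algebroidProj x)) = fib l)
    · refine 𝒢.rΓ_of_mem ?_
      let ζ : E →L[ℝ] ℝ := fib l + t • (β.comp (𝒢.algebroidProj x))
      have h2 : ∀ y, ζ (𝒢.dU x y) = 0 := by
        intro y
        change fib l (𝒢.dU x y) + t * β (𝒢.algebroidProj x (𝒢.dU x y)) = 0
        rw [hl0, algebroidProj_dU, map_zero, mul_zero, add_zero]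
      exact ⟨x, ζ, covector_ext hx.symm fun w => rfl, h2⟩
  -- Orthogonality to the vertical tangent vectors forces the base component of `v` to be tangent to
  -- the units.
  have h1 : 𝒢.algebroidProj x v.1 = 0 := by
    refine SeparatingDual.eq_zero_of_forall_dual_eq_zero (R := ℝ) fun β => ?_
    have h2 := h _ (hvert β)
    simpa [stdSymplectic] using h2
  have h2 : v.1 = 𝒢.dU x (𝒢.dS (𝒢.unit x) v.1) := by
    rw [algebroidProj_apply] at h1
    exact sub_eq_zero.1 h1
  obtain ⟨w, hw, hw1⟩ := exists_velocity_rΓ_over hl hD (𝒢.dS (𝒢.unit x) v.1)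
  -- Subtracting a tangent vector `w` with the same base component leaves a vertical vector. Testing
  -- it against lifts of `TM` shows that `δ` kills `TM`, so it is tangent to `A*G`.
  let δ : E →L[ℝ] ℝ := v.2 - w.2
  have h3 : v = w + ((0 : E), δ) := by
    refine Prod.ext ?_ ?_
    · change v.1 = w.1 + 0
      rw [hw1, add_zero]
      exact h2
    · change v.2 = w.2 + (v.2 - w.2)
      abel
  have h4 : ∀ z, δ (𝒢.dU x z) = 0 := by
    intro z
    obtain ⟨w', hw', hw'1⟩ := exists_velocity_rΓ_over hl hD z
    have h5 := h w' hw'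
    have h6 := hiso w w' hw hw'
    have h7 : w'.1 = 𝒢.dU x z := hw'1
    have h8 : v.1 = w.1 := h2.trans hw1.symm
    change w'.2 v.1 - v.2 w'.1 = 0 at h5
    change w'.2 w.1 - w.2 w'.1 = 0 at h6
    change v.2 (𝒢.dU x z) - w.2 (𝒢.dU x z) = 0
    rw [← h7]
    rw [h8] at h5
    linarith
  have h5 : δ = δ.comp (𝒢.algebroidProj x) := by
    ext z
    change δ z = δ (𝒢.algebroidProj x z)
    rw [algebroidProj_apply, map_sub, h4, sub_zero]
  rw [h3, map_add, hw, h5, hvert]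

end LieGroupoid

/-! ### The cotangent bundle of a product with the line -/

section Product

variable {E H : Type*} [NormedAddCommGroup E] [NormedSpace ℝ E] [TopologicalSpace H]
  {I : ModelWithCorners ℝ E H} 
  {X : Type*} [TopologicalSpace X] [ChartedSpace H X] 

/-- The component in `T*X` of a covector of `ℝ × X`. -/
def restrictCovector (l : CotangentBundle (𝓘(ℝ, ℝ).prod I) (ℝ × X)) : CotangentBundle I X :=
  ⟨l.1.2, ((fib l).comp (ContinuousLinearMap.inr ℝ ℝ E) : E →L[ℝ] ℝ)⟩

/-- The tangent vector `(a, b, v)` of `T*(ℝ × X) = T*ℝ × T*X`. -/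
def prodTangent (a b : ℝ) (v : E × (E →L[ℝ] ℝ)) : (ℝ × E) × (ℝ × E →L[ℝ] ℝ) :=
  ((a, v.1), b • ContinuousLinearMap.fst ℝ ℝ E + v.2.comp (ContinuousLinearMap.snd ℝ ℝ E))

theorem fib_prodCovector (t τ : ℝ) (l : CotangentBundle I X) (w : ℝ × E) :
    fib (prodCovector I t τ l) w = τ * w.1 + fib l w.2 := rfl

theorem restrictCovector_prodCovector (t τ : ℝ) (l : CotangentBundle I X) :
    restrictCovector (prodCovector I t τ l) = l :=
  covector_ext rfl fun w => by
    change τ * 0 + fib l w = fib l w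
    rw [mul_zero, zero_add]

theorem prodCovector_restrictCovector (l : CotangentBundle (𝓘(ℝ, ℝ).prod I) (ℝ × X)) :
    prodCovector I l.1.1 (fib l (1, 0)) (restrictCovector l) = l :=
  covector_ext rfl fun w => by
    change fib l (1, 0) * w.1 + fib l (0, w.2) = fib l w
    have h : w = w.1 • ((1 : ℝ), (0 : E)) + ((0 : ℝ), w.2) := by
      refine Prod.ext ?_ ?_ <;> simp
    conv_rhs => rw [h, map_add, map_smul, smul_eq_mul, mul_comm]

theorem dilate_prodCovector (a t τ : ℝ) (l : CotangentBundle I X) :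
    dilate a (prodCovector I t τ l) = prodCovector I t (a * τ) (dilate a l) :=
  covector_ext rfl fun w => by
    change a * (τ * w.1 + fib l w.2) = a * τ * w.1 + a * fib l w.2
    ring

theorem prodCovector_ne_zero {t τ : ℝ} (hτ : τ ≠ 0) (l : CotangentBundle I X) :
    (prodCovector I t τ l).2 ≠ 0 := by
  intro h
  have h1 : fib (prodCovector I t τ l) (1, 0) = 0 :=
    congrArg (fun ξ : ℝ × E →L[ℝ] ℝ => ξ (1, 0)) h
  rw [fib_prodCovector, map_zero, mul_one, add_zero] at h1
  exact hτ h1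

theorem prodCovector_zero_ne_zero_iff {t : ℝ} {l : CotangentBundle I X} :
    (prodCovector I t 0 l).2 ≠ 0 ↔ l.2 ≠ 0 := by
  refine not_congr ⟨fun h => ContinuousLinearMap.ext fun w => ?_,
    fun h => ContinuousLinearMap.ext fun w => ?_⟩
  · have h1 : fib (prodCovector I t 0 l) (0, w) = 0 :=
      congrArg (fun ξ : ℝ × E →L[ℝ] ℝ => ξ (0, w)) h
    rw [fib_prodCovector, mul_zero, zero_add] at h1
    exact h1
  · have h1 : fib l w.2 = 0 := congrArg (fun ξ : E →L[ℝ] ℝ => ξ w.2) h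
    change 0 * w.1 + fib l w.2 = 0
    rw [h1, zero_mul, zero_add]

theorem prodTangent_eq (v : (ℝ × E) × (ℝ × E →L[ℝ] ℝ)) :
    prodTangent v.1.1 (v.2 (1, 0)) (v.1.2, v.2.comp (ContinuousLinearMap.inr ℝ ℝ E)) = v := by
  refine Prod.ext rfl (ContinuousLinearMap.ext fun w => ?_)
  change v.2 (1, 0) * w.1 + v.2 (0, w.2) = v.2 w
  have h : w = w.1 • ((1 : ℝ), (0 : E)) + ((0 : ℝ), w.2) := by
    refine Prod.ext ?_ ?_ <;> simp
  conv_rhs => rw [h, map_add, map_smul, smul_eq_mul, mul_comm]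

/-- The form splits as `dt ∧ dτ` plus the form on `T*X`; this is where the `τ`-component of `Λ`
enters the Lagrangian computation. -/
theorem stdSymplectic_prodTangent (a b a' b' : ℝ) (v v' : E × (E →L[ℝ] ℝ)) :
    stdSymplectic (prodTangent a b v) (prodTangent a' b' v') =
      a * b' - b * a' + stdSymplectic v v' := by
  change (b' * a + v'.2 v.1) - (b * a' + v.2 v'.1) = a * b' - b * a' + (v'.2 v.1 - v.2 v'.1)
  ring

variable [I.Boundaryless] [IsManifold I ∞ X]

theorem mem_coordAt_prod {t₀ t : ℝ} {x₀ x : X} :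
    (t, x) ∈ (coordAt (𝓘(ℝ, ℝ).prod I) (t₀, x₀)).source ↔ x ∈ (coordAt I x₀).source := by
  simp only [coordAt_source]
  simp only [mfld_simps, prodChartedSpace_chartAt, chartAt_self_eq]

theorem mfderiv_coordAt_prod {t₀ t : ℝ} {x₀ x : X} (hx : x ∈ (coordAt I x₀).source) (a : ℝ)
    (w : E) : mfderiv (𝓘(ℝ, ℝ).prod I) 𝓘(ℝ, ℝ × E) (coordAt (𝓘(ℝ, ℝ).prod I) (t₀, x₀)) (t, x) (a, w) =
      (a, (mfderiv I 𝓘(ℝ, E) (coordAt I x₀) x w : E)) := by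
  obtain ⟨c, hc0, hc, -⟩ := exists_curve (I := I) x w
  have h1 := (hc.comp_of_eq ((isCoord_coordAt (I := I) x₀).hasMFDerivAt hx) hc0)
  have h2 : HasVelocity 𝓘(ℝ, ℝ) (fun u : ℝ => t + u * a) 0 a := by
    simpa using hasVelocity_line t a
  have h3 := (h2.prodMk hc).comp_of_eq ((isCoord_coordAt (I := 𝓘(ℝ, ℝ).prod I) (t₀, x₀)).hasMFDerivAt
    ((mem_coordAt_prod (t := t)).2 hx)) (by simp [hc0])
  rw [hasVelocity_iff_hasDerivAt] at h1 h2 h3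
  exact h3.unique (h2.prodMk h1)

theorem cotCoord_prodCovector {t₀ : ℝ} {x₀ : X} (t τ : ℝ) {l : CotangentBundle I X}
    (hl : l.1 ∈ (coordAt I x₀).source) :
    cotCoord (𝓘(ℝ, ℝ).prod I) (t₀, x₀) (prodCovector I t τ l) =
      ((t, (cotCoord I x₀ l).1), τ • ContinuousLinearMap.fst ℝ ℝ E +
        (cotCoord I x₀ l).2.comp (ContinuousLinearMap.snd ℝ ℝ E)) := by
  refine Prod.ext rfl (cotCoord_snd_eq (l := prodCovector I t τ l) (mem_coordAt_prod.2 hl)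
    fun w => ?_)
  have h1 := mfderiv_coordAt_prod (t₀ := t₀) (t := t) hl w.1 w.2
  have h2 := cotCoord_snd_apply hl w.2
  refine (congrArg _ h1).trans ?_
  exact congrArg (τ * w.1 + ·) h2

theorem cotCoord_restrictCovector {t₀ : ℝ} {x₀ : X}
    {l : CotangentBundle (𝓘(ℝ, ℝ).prod I) (ℝ × X)} (hl : l.1.2 ∈ (coordAt I x₀).source) :
    (cotCoord I x₀ (restrictCovector l)).2 = (cotCoord (𝓘(ℝ, ℝ).prod I) (t₀, x₀) l).2.comp
        (ContinuousLinearMap.inr ℝ ℝ E) := by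
  have h := cotCoord_prodCovector (t₀ := t₀) l.1.1 (fib l (1, 0)) (l := restrictCovector l) hl
  rw [prodCovector_restrictCovector] at h
  rw [h]
  ext w
  simp

theorem contMDiff_prodCovector : ContMDiff (𝓘(ℝ, ℝ).prod (𝓘(ℝ, ℝ).prod (cotangentModel I)))
    (cotangentModel (𝓘(ℝ, ℝ).prod I)) ∞
    (fun q : ℝ × ℝ × CotangentBundle I X => prodCovector I q.1 q.2.1 q.2.2) := by
  intro q
  have hκ : IsCoord (cotangentModel I) (cotCoord I q.2.2.1) := isCoord_cotCoord _
  have hq : q.2.2 ∈ (cotCoord I q.2.2.1).source := mem_cotCoord_source.2 (mem_coordAt_source _)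
  have h1 : ContMDiffAt (𝓘(ℝ, ℝ).prod (𝓘(ℝ, ℝ).prod (cotangentModel I))) 𝓘(ℝ, E × (E →L[ℝ] ℝ)) ∞
      (fun q' : ℝ × ℝ × CotangentBundle I X => cotCoord I q.2.2.1 q'.2.2) q :=
    ContMDiffAt.comp q (f := fun q' : ℝ × ℝ × CotangentBundle I X => q'.2.2) (hκ.contMDiffAt hq)
      (contMDiff_snd.comp contMDiff_snd).contMDiffAt
  have h2 : ContDiff ℝ ∞ fun z : ℝ × (E →L[ℝ] ℝ) => z.1 • ContinuousLinearMap.fst ℝ ℝ E +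
      z.2.comp (ContinuousLinearMap.snd ℝ ℝ E) := by fun_prop
  refine contMDiffAt_cotangent
    (η := fun q' : ℝ × ℝ × CotangentBundle I X => q'.2.1 • ContinuousLinearMap.fst ℝ ℝ E +
      (cotCoord I q.2.2.1 q'.2.2).2.comp (ContinuousLinearMap.snd ℝ ℝ E)) ?_ ?_ ?_
  · exact contMDiffAt_fst.prodMk (contMDiff_proj.comp (contMDiff_snd.comp contMDiff_snd)).contMDiffAt
  · refine ContMDiffAt.comp q (f := fun q' : ℝ × ℝ × CotangentBundle I X =>
      (q'.2.1, (cotCoord I q.2.2.1 q'.2.2).2)) h2.contMDiff.contMDiffAt ?_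
    exact (contMDiff_fst.comp contMDiff_snd).contMDiffAt.prodMk_space
      (contDiff_snd.contMDiff.contMDiffAt.comp q h1)
  · have h3 : ∀ᶠ q' : ℝ × ℝ × CotangentBundle I X in 𝓝 q, q'.2.2 ∈ (cotCoord I q.2.2.1).source :=
      ((continuous_snd.comp continuous_snd).tendsto q).eventually
        ((cotCoord I q.2.2.1).open_source.mem_nhds hq)
    filter_upwards [h3] with q' hq' w
    have h4 := mem_cotCoord_source.1 hq'
    have h5 := cotCoord_prodCovector (t₀ := q.1) q'.1 q'.2.1 h4
    have h6 := cotCoord_snd_apply (x₀ := (q.1, q.2.2.1)) (l := prodCovector I q'.1 q'.2.1 q'.2.2)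
      (mem_coordAt_prod.2 h4) w
    rw [h5] at h6
    exact h6

theorem contMDiff_restrictCovector : ContMDiff (cotangentModel (𝓘(ℝ, ℝ).prod I)) (cotangentModel I) ∞
    (restrictCovector (I := I) (X := X)) := by
  intro l
  have hκ := isCoord_cotCoord (I := 𝓘(ℝ, ℝ).prod I) l.1
  have hl : l ∈ (cotCoord (𝓘(ℝ, ℝ).prod I) l.1).source :=
    mem_cotCoord_source.2 (mem_coordAt_source _)
  have h1 := hκ.contMDiffAt hl
  have h2 : ContDiff ℝ ∞ fun z : (ℝ × E) × (ℝ × E →L[ℝ] ℝ) =>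
      z.2.comp (ContinuousLinearMap.inr ℝ ℝ E) := by fun_prop
  refine contMDiffAt_cotangent (η := fun l' => (cotCoord (𝓘(ℝ, ℝ).prod I) l.1 l').2.comp
    (ContinuousLinearMap.inr ℝ ℝ E)) ?_ ?_ ?_
  · exact (contMDiff_snd.comp contMDiff_proj).contMDiffAt
  · exact h2.contMDiff.contMDiffAt.comp l h1
  · filter_upwards [(cotCoord (𝓘(ℝ, ℝ).prod I) l.1).open_source.mem_nhds hl] with l' hl' w
    have h4 : l'.1.2 ∈ (coordAt I l.1.2).source := mem_coordAt_prod.1 (mem_cotCoord_source.1 hl')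
    have h5 := cotCoord_snd_apply (l := restrictCovector l') h4 w
    rw [cotCoord_restrictCovector (t₀ := l.1.1) h4] at h5
    exact h5

theorem HasVelocity.hasDerivAt_cotCoord {c : ℝ → CotangentBundle I X} {t : ℝ}
    {v : E × (E →L[ℝ] ℝ)} (hc : HasVelocity (cotangentModel I) c t v) :
    HasDerivAt (fun u => cotCoord I (c t).1 (c u)) v t :=
  hasVelocity_iff_hasDerivAt.1
    (hc.comp_of_eq (hasMFDerivAt_coordAt_self (I := cotangentModel I) (c t)) rfl)

/-- Preferred charts of `ℝ × X` are products, so in canonical coordinates the identification of `T*ℝ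
× T*X` with `T*(ℝ × X)` is linear in the covectors and differentiates componentwise. -/
theorem HasVelocity.prodCovector {θ τ : ℝ → ℝ} {c : ℝ → CotangentBundle I X} {t a b : ℝ}
    {v : E × (E →L[ℝ] ℝ)} (hθ : HasVelocity 𝓘(ℝ, ℝ) θ t a) (hτ : HasVelocity 𝓘(ℝ, ℝ) τ t b)
    (hc : HasVelocity (cotangentModel I) c t v) :
    HasVelocity (cotangentModel (𝓘(ℝ, ℝ).prod I)) (fun u => prodCovector I (θ u) (τ u) (c u)) t
      (prodTangent a b v) := by
  have h1 := (hθ.prodMk (hτ.prodMk hc)).comp_of_eq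
    ((contMDiff_prodCovector.mdifferentiable (by simp) (θ t, τ t, c t)).hasMFDerivAt) rfl
  have h2 := h1.hasDerivAt_cotCoord
  have h3 := hc.hasDerivAt_cotCoord
  rw [hasVelocity_iff_hasDerivAt] at hθ hτ
  have h4 : HasDerivAt (fun u => (((θ u, (cotCoord I (c t).1 (c u)).1),
      τ u • ContinuousLinearMap.fst ℝ ℝ E + (cotCoord I (c t).1 (c u)).2.comp
        (ContinuousLinearMap.snd ℝ ℝ E)) : (ℝ × E) × (ℝ × E →L[ℝ] ℝ))) (prodTangent a b v) t :=
    (hθ.prodMk h3.fst).prodMk ((hτ.smul_const _).add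
      (((ContinuousLinearMap.compL ℝ (ℝ × E) E ℝ).flip
        (ContinuousLinearMap.snd ℝ ℝ E)).hasFDerivAt.comp_hasDerivAt t h3.snd))
  have h5 : (fun u => cotCoord (𝓘(ℝ, ℝ).prod I) (θ t, (c t).1)
      (GroupoidRelation.prodCovector I (θ u) (τ u) (c u))) =ᶠ[𝓝 t] fun u =>
        ((θ u, (cotCoord I (c t).1 (c u)).1), τ u • ContinuousLinearMap.fst ℝ ℝ E +
          (cotCoord I (c t).1 (c u)).2.comp (ContinuousLinearMap.snd ℝ ℝ E)) := by
    filter_upwards [hc.continuousAt.eventually_mem ((cotCoord I (c t).1).open_source.mem_nhds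
      (mem_cotCoord_source.2 (mem_coordAt_source _)))] with u hu
    exact cotCoord_prodCovector _ _ (mem_cotCoord_source.1 hu)
  have h6 := h2.unique (h4.congr_of_eventuallyEq h5)
  rw [← h6]
  exact h1

end Product

/-! ### The cotangent groupoids of the products with the line -/

namespace LieGroupoid

variable {E H F N : Type*} [NormedAddCommGroup E] [NormedSpace ℝ E] [FiniteDimensional ℝ E]
  [TopologicalSpace H] [NormedAddCommGroup F] [NormedSpace ℝ F] [FiniteDimensional ℝ F]
  [TopologicalSpace N]
  {I : ModelWithCorners ℝ E H} [I.Boundaryless] {G : Type*} [TopologicalSpace G] [ChartedSpace H G]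
  {J : ModelWithCorners ℝ F N} [J.Boundaryless] {M : Type*} [TopologicalSpace M] [ChartedSpace N M]
  [IsManifold I ∞ G] [IsManifold J ∞ M] (𝒢 : LieGroupoid I G J M)

theorem dU_constFamily (t a : ℝ) (x : M) (y : F) :
    𝒢.constFamily.dU (t, x) (a, y) = (a, 𝒢.dU x y) := by
  obtain ⟨d, hd0, hd, -⟩ := exists_curve (I := J) x y
  have h2 : HasVelocity 𝓘(ℝ, ℝ) (fun u : ℝ => t + u * a) 0 a := by
    simpa using hasVelocity_line t a
  have h3 := (h2.prodMk hd).comp_of_eq (𝒢.constFamily.hasMFDerivAt_unit (t, x)) (by simp [hd0])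
  exact h3.unique (h2.prodMk (hd.comp_of_eq (𝒢.hasMFDerivAt_unit x) hd0))

/-- A covector at a unit of the constant family that vanishes on vectors tangent to the units. -/
theorem eq_prodCovector_of_constFamily {t : ℝ} {x : M}
    {l : CotangentBundle (𝓘(ℝ, ℝ).prod I) (ℝ × G)} {l' : CotangentBundle I G}
    (hl : l.1 = (t, 𝒢.unit x)) (hl' : l'.1 = 𝒢.unit x)
    (h0 : ∀ y, fib l (𝒢.constFamily.dU (t, x) y) = 0) (h0' : ∀ y, fib l' (𝒢.dU x y) = 0)
    (h : ∀ z, 𝒢.dS (𝒢.unit x) z = 0 → fib l (0, z) = fib l' z) : l = prodCovector I t 0 l' := by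
  refine covector_ext (hl.trans (Prod.ext rfl hl'.symm)) fun w => ?_
  change fib l w = 0 * w.1 + fib l' w.2
  have h1 : w = 𝒢.constFamily.dU (t, x) (w.1, 𝒢.dS (𝒢.unit x) w.2) +
      ((0 : ℝ), 𝒢.algebroidProj x w.2) := by
    rw [dU_constFamily, algebroidProj_apply]
    refine Prod.ext ?_ ?_ <;> simp
  conv_lhs => rw [h1]
  rw [map_add, h0, h _ (𝒢.dS_algebroidProj x w.2), algebroidProj_apply, map_sub, h0', zero_mul,
    sub_zero]

/-- The source fibers of the constant family have constant time, so `r_Γ` does not see `τ`, and its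
values vanish in the time direction tangent to the units. -/
theorem constFamily_rΓ (t τ : ℝ) (l : CotangentBundle I G) :
    𝒢.constFamily.rΓ (prodCovector I t τ l) = prodCovector I t 0 (𝒢.rΓ l) := by
  refine 𝒢.eq_prodCovector_of_constFamily (x := 𝒢.r l.1) rfl rfl
    (fun y => 𝒢.constFamily.rΓ_dU (prodCovector I t τ l) y) (fun y => 𝒢.rΓ_dU l y) fun z hz => ?_
  obtain ⟨c, hc0, hcs, hc, -⟩ := 𝒢.exists_fiber_curve hz
  rw [𝒢.s_unit] at hcs
  obtain ⟨v, hv, -⟩ := 𝒢.exists_velocity_mul_right hc hc0 hcs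
  have h1 := 𝒢.constFamily.rΓ_hasVelocity (l := prodCovector I t τ l)
    ((hasVelocity_const t 0).prodMk hc) (Prod.ext rfl hc0)
    (hcs.mono fun u hu => Prod.ext rfl hu) ((hasVelocity_const t 0).prodMk hv)
  have h2 : fib (prodCovector I t τ l) ((0 : ℝ), v) = fib l v := by
    rw [fib_prodCovector, mul_zero, zero_add]
  exact h1.trans (h2.trans (𝒢.rΓ_hasVelocity hc hc0 hcs hv).symm)

theorem constFamily_sΓ (t τ : ℝ) (l : CotangentBundle I G) :
    𝒢.constFamily.sΓ (prodCovector I t τ l) = prodCovector I t 0 (𝒢.sΓ l) := by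
  refine 𝒢.eq_prodCovector_of_constFamily (x := 𝒢.s l.1) rfl rfl
    (fun y => 𝒢.constFamily.sΓ_dU (prodCovector I t τ l) y) (fun y => 𝒢.sΓ_dU l y) fun z hz => ?_
  obtain ⟨c, hc0, hcs, hc, -⟩ := 𝒢.exists_fiber_curve hz
  rw [𝒢.s_unit] at hcs
  have hv := 𝒢.isFiberMap_left.hasVelocity hc hc0 hcs
  have h1 := 𝒢.constFamily.sΓ_hasVelocity (l := prodCovector I t τ l)
    ((hasVelocity_const t 0).prodMk hc) (Prod.ext rfl hc0)
    (hcs.mono fun u hu => Prod.ext rfl hu) ((hasVelocity_const t 0).prodMk hv)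
  rw [fib_prodCovector, mul_zero, zero_add] at h1
  exact h1.trans (𝒢.sΓ_hasVelocity hc hc0 hcs hv).symm

/-- Here the Lie algebroid has an additional `ℝ` summand. Testing only on the summand `AG` recovers
`r_Γ` of `G`, which is enough for nonvanishing. -/
theorem prodReal_rΓ_apply (t τ : ℝ) (l : CotangentBundle I G) {z : E}
    (hz : 𝒢.dS (𝒢.unit (𝒢.r l.1)) z = 0) :
    fib (𝒢.prodReal.rΓ (prodCovector I t τ l)) (0, z) = fib (𝒢.rΓ l) z := by
  obtain ⟨c, hc0, hcs, hc, -⟩ := 𝒢.exists_fiber_curve hz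
  rw [𝒢.s_unit] at hcs
  obtain ⟨v, hv, -⟩ := 𝒢.exists_velocity_mul_right hc hc0 hcs
  have h1 := 𝒢.prodReal.rΓ_hasVelocity (l := prodCovector I t τ l)
    ((hasVelocity_const (0 : ℝ) 0).prodMk hc) (Prod.ext rfl hc0) hcs
    (((hasVelocity_const t 0).prodMk hv).congr
      (Eventually.of_forall fun u => Prod.ext (zero_add t) rfl))
  have h2 : fib (prodCovector I t τ l) ((0 : ℝ), v) = fib l v := by
    rw [fib_prodCovector, mul_zero, zero_add]
  exact h1.trans (h2.trans (𝒢.rΓ_hasVelocity hc hc0 hcs hv).symm)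

theorem prodReal_sΓ_apply (t τ : ℝ) (l : CotangentBundle I G) {z : E}
    (hz : 𝒢.dS (𝒢.unit (𝒢.s l.1)) z = 0) :
    fib (𝒢.prodReal.sΓ (prodCovector I t τ l)) (0, z) = fib (𝒢.sΓ l) z := by
  obtain ⟨c, hc0, hcs, hc, -⟩ := 𝒢.exists_fiber_curve hz
  rw [𝒢.s_unit] at hcs
  have hv := 𝒢.isFiberMap_left.hasVelocity hc hc0 hcs
  have h1 := 𝒢.prodReal.sΓ_hasVelocity (l := prodCovector I t τ l)
    ((hasVelocity_const (0 : ℝ) 0).prodMk hc) (Prod.ext rfl hc0) hcs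
    (((hasVelocity_const t 0).prodMk hv).congr
      (Eventually.of_forall fun u => Prod.ext (by
        change t + -0 = t
        rw [neg_zero, add_zero]) rfl))
  rw [fib_prodCovector, mul_zero, zero_add] at h1
  exact h1.trans (𝒢.sΓ_hasVelocity hc hc0 hcs hv).symm

variable {𝒢}

theorem prodCovector_mem_biregular_constFamily {l : CotangentBundle I G} (hl : l ∈ 𝒢.biregular)
    (t τ : ℝ) : prodCovector I t τ l ∈ 𝒢.constFamily.biregular := by
  refine ⟨?_, ?_⟩
  · rw [constFamily_rΓ]
    exact prodCovector_zero_ne_zero_iff.2 hl.1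
  · rw [constFamily_sΓ]
    exact prodCovector_zero_ne_zero_iff.2 hl.2

theorem prodCovector_mem_biregular_prodReal {l : CotangentBundle I G} (hl : l ∈ 𝒢.biregular)
    (t τ : ℝ) : prodCovector I t τ l ∈ 𝒢.prodReal.biregular := by
  refine ⟨fun h => hl.1 (ContinuousLinearMap.ext fun w => ?_),
    fun h => hl.2 (ContinuousLinearMap.ext fun w => ?_)⟩
  · have h1 := 𝒢.prodReal_rΓ_apply t τ l (𝒢.dS_algebroidProj (𝒢.r l.1) w)
    have h2 : fib (𝒢.prodReal.rΓ (prodCovector I t τ l)) (0, 𝒢.algebroidProj (𝒢.r l.1) w) = 0 :=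
      congrArg (fun ξ : ℝ × E →L[ℝ] ℝ => ξ (0, 𝒢.algebroidProj (𝒢.r l.1) w)) h
    exact (𝒢.rΓ_algebroidProj l w).symm.trans (h1.symm.trans h2)
  · have h1 := 𝒢.prodReal_sΓ_apply t τ l (𝒢.dS_algebroidProj (𝒢.s l.1) w)
    have h2 : fib (𝒢.prodReal.sΓ (prodCovector I t τ l)) (0, 𝒢.algebroidProj (𝒢.s l.1) w) = 0 :=
      congrArg (fun ξ : ℝ × E →L[ℝ] ℝ => ξ (0, 𝒢.algebroidProj (𝒢.s l.1) w)) h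
    exact (𝒢.sΓ_algebroidProj l w).symm.trans (h1.symm.trans h2)

end LieGroupoid

/-! ### The flow out of the dual algebroid -/

namespace LieGroupoid

variable {E H F N : Type*} [NormedAddCommGroup E] [NormedSpace ℝ E] [FiniteDimensional ℝ E]
  [TopologicalSpace H] [NormedAddCommGroup F] [NormedSpace ℝ F] [FiniteDimensional ℝ F]
  [TopologicalSpace N]
  {I : ModelWithCorners ℝ E H} [I.Boundaryless] {G : Type*} [TopologicalSpace G] [ChartedSpace H G]
  {J : ModelWithCorners ℝ F N} [J.Boundaryless] {M : Type*} [TopologicalSpace M] [ChartedSpace N M]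
  [IsManifold I ∞ G] [IsManifold J ∞ M] {𝒢 : LieGroupoid I G J M} [T2Space G]
  {p₀ : CotangentBundle I G → ℝ} {χ : ℝ → 𝒢.rRegular → 𝒢.rRegular}

/-- The covector `(t, -p l, χ_t l)` of `ℝ × G`. -/
def flowCovector (𝒢 : LieGroupoid I G J M) (p₀ : CotangentBundle I G → ℝ)
    (χ : ℝ → 𝒢.rRegular → 𝒢.rRegular) (q : ℝ × CotangentBundle I G) :
    CotangentBundle (𝓘(ℝ, ℝ).prod I) (ℝ × G) :=
  prodCovector I q.1 (-(p₀ (𝒢.rΓ q.2))) (flowMap χ q)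

/-- The element of the dual algebroid whose flow line passes through the component of a covector of
`ℝ × G` in `T*G` (if that component lies on the flow out of the dual algebroid). -/
def flowOrigin (𝒢 : LieGroupoid I G J M) (χ : ℝ → 𝒢.rRegular → 𝒢.rRegular)
    (l : CotangentBundle (𝓘(ℝ, ℝ).prod I) (ℝ × G)) : CotangentBundle I G :=
  𝒢.rΓ (flowMap χ (-l.1.1, restrictCovector l))

/-- The covectors of `ℝ × G` whose component in `T*G` is not in `ker r_Γ`. -/
def rRegularProd (𝒢 : LieGroupoid I G J M) : Set (CotangentBundle (𝓘(ℝ, ℝ).prod I) (ℝ × G)) :=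
  {l | restrictCovector l ∈ 𝒢.rRegular}

theorem isOpen_rRegularProd : IsOpen 𝒢.rRegularProd :=
  𝒢.isOpen_rRegular.preimage contMDiff_restrictCovector.continuous

theorem rRegularProd_eq : 𝒢.rRegularProd =
    {l | ∃ t τ : ℝ, ∃ l' ∈ 𝒢.rRegular, l = prodCovector I t τ l'} := by
  ext l
  constructor
  · exact fun h => ⟨_, _, _, h, (prodCovector_restrictCovector l).symm⟩
  · rintro ⟨t, τ, l', h, rfl⟩
    change restrictCovector (prodCovector I t τ l') ∈ 𝒢.rRegular
    rwa [restrictCovector_prodCovector]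

theorem restrictCovector_flowCovector (q : ℝ × CotangentBundle I G) :
    restrictCovector (flowCovector 𝒢 p₀ χ q) = flowMap χ q := restrictCovector_prodCovector _ _ _

theorem flowCovector_mem {q : ℝ × CotangentBundle I G} (hq : q.2 ∈ 𝒢.rRegular) :
    flowCovector 𝒢 p₀ χ q ∈ 𝒢.rRegularProd := by
  change restrictCovector (flowCovector 𝒢 p₀ χ q) ∈ 𝒢.rRegular
  rw [restrictCovector_flowCovector]
  exact flowMap_mem χ hq

theorem flowOrigin_mem {l : CotangentBundle (𝓘(ℝ, ℝ).prod I) (ℝ × G)} (hl : l ∈ 𝒢.rRegularProd) :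
    flowOrigin 𝒢 χ l ∈ 𝒢.dualAlgebroidNonzero :=
  𝒢.rΓ_mem_dualAlgebroidNonzero (flowMap_mem χ hl)

theorem contMDiffAt_flowCovector
    (hp₀ : 𝒢.IsEllipticSymbol p₀) (hχ : IsHamiltonianFlow I (p₀ ∘ 𝒢.rΓ) 𝒢.rRegular χ)
    {q : ℝ × CotangentBundle I G} (hq : q.2 ∈ 𝒢.rRegular) :
    ContMDiffAt (𝓘(ℝ, ℝ).prod (cotangentModel I)) (cotangentModel (𝓘(ℝ, ℝ).prod I)) ∞
      (flowCovector 𝒢 p₀ χ) q := by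
  have h1 : ContMDiffAt (𝓘(ℝ, ℝ).prod (cotangentModel I)) 𝓘(ℝ, ℝ) ∞
      (fun q : ℝ × CotangentBundle I G => -((p₀ ∘ 𝒢.rΓ) q.2)) q :=
    (ContMDiffAt.comp q (f := Prod.snd) (hp₀.contMDiffOn.contMDiffAt
      (𝒢.isOpen_rRegular.mem_nhds hq)) contMDiffAt_snd).neg
  exact ContMDiffAt.comp q (f := fun q : ℝ × CotangentBundle I G =>
    (q.1, -((p₀ ∘ 𝒢.rΓ) q.2), flowMap χ q)) contMDiff_prodCovector.contMDiffAt
    (contMDiffAt_fst.prodMk (h1.prodMk (hχ.contMDiffAt 𝒢.isOpen_rRegular hp₀.contMDiffOn hq)))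

theorem contMDiffAt_flowOrigin
    (hp₀ : 𝒢.IsEllipticSymbol p₀) (hχ : IsHamiltonianFlow I (p₀ ∘ 𝒢.rΓ) 𝒢.rRegular χ)
    {l : CotangentBundle (𝓘(ℝ, ℝ).prod I) (ℝ × G)}
    (hl : l ∈ 𝒢.rRegularProd) :
    ContMDiffAt (cotangentModel (𝓘(ℝ, ℝ).prod I)) (cotangentModel I) ∞ (flowOrigin 𝒢 χ) l := by
  have h1 : ContMDiffAt (cotangentModel (𝓘(ℝ, ℝ).prod I)) 𝓘(ℝ, ℝ) ∞
      (fun l : CotangentBundle (𝓘(ℝ, ℝ).prod I) (ℝ × G) => -l.1.1) l :=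
    (contMDiff_fst.comp contMDiff_proj).contMDiffAt.neg
  exact 𝒢.contMDiff_rΓ.contMDiffAt.comp l (ContMDiffAt.comp l (g := flowMap χ)
    (f := fun l => (-l.1.1, restrictCovector l))
    (hχ.contMDiffAt 𝒢.isOpen_rRegular hp₀.contMDiffOn (q := (-l.1.1, restrictCovector l)) hl)
    (h1.prodMk contMDiff_restrictCovector.contMDiffAt))

theorem flowOrigin_flowCovector
    (hp₀ : 𝒢.IsEllipticSymbol p₀) (hχ : IsHamiltonianFlow I (p₀ ∘ 𝒢.rΓ) 𝒢.rRegular χ)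
    (t : ℝ) {l : CotangentBundle I G}
    (hl : l ∈ 𝒢.dualAlgebroidNonzero) : flowOrigin 𝒢 χ (flowCovector 𝒢 p₀ χ (t, l)) = l := by
  change 𝒢.rΓ (flowMap χ (-t, restrictCovector (flowCovector 𝒢 p₀ χ (t, l)))) = l
  rw [restrictCovector_flowCovector, hχ.flowMap_neg' 𝒢.isOpen_rRegular hp₀.contMDiffOn _
    (𝒢.dualAlgebroidNonzero_subset hl), 𝒢.rΓ_of_mem hl.1]

/-- Conservation of `p` replaces the value at `χ_t l` by the one at `l`, giving a parametrization
defined and smooth wherever the flow is. -/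
theorem gluedFlowOut_eq_image
    (hp₀ : 𝒢.IsEllipticSymbol p₀) (hχ : IsHamiltonianFlow I (p₀ ∘ 𝒢.rΓ) 𝒢.rRegular χ) :
    𝒢.gluedFlowOut (p₀ ∘ 𝒢.rΓ) χ =
    flowCovector 𝒢 p₀ χ '' (univ ×ˢ 𝒢.dualAlgebroidNonzero) := by
  have key : ∀ (t : ℝ) (l : CotangentBundle I G) (hl : l ∈ 𝒢.rRegular),
      prodCovector I t (-(p₀ ∘ 𝒢.rΓ) (χ t ⟨l, hl⟩)) (χ t ⟨l, hl⟩) =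
        flowCovector 𝒢 p₀ χ (t, l) := by
    intro t l hl
    rw [← flowMap_of_mem χ hl, hχ.hamiltonian_flowMap 𝒢.isOpen_rRegular hp₀.contMDiffOn t hl]
    rfl
  ext L
  constructor
  · rintro ⟨t, l, hl, rfl⟩
    exact ⟨(t, l), ⟨mem_univ _, hl⟩, (key t l.1 l.2).symm⟩
  · rintro ⟨⟨t, l⟩, ⟨-, hl⟩, rfl⟩
    exact ⟨t, ⟨l, 𝒢.dualAlgebroidNonzero_subset hl⟩, hl, (key t l _).symm⟩

/-- Recovering the origin and flowing out again is a retraction onto `Λ`; it also corrects the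
`τ`-component, so no separate equation for `τ` is needed. -/
theorem gluedFlowOut_eq_fixedPoints
    (hp₀ : 𝒢.IsEllipticSymbol p₀) (hχ : IsHamiltonianFlow I (p₀ ∘ 𝒢.rΓ) 𝒢.rRegular χ) :
    𝒢.gluedFlowOut (p₀ ∘ 𝒢.rΓ) χ =
    {l ∈ 𝒢.rRegularProd | flowCovector 𝒢 p₀ χ (l.1.1, flowOrigin 𝒢 χ l) = l} := by
  rw [gluedFlowOut_eq_image hp₀ hχ]
  ext L
  constructor
  · rintro ⟨⟨t, l⟩, ⟨-, hl⟩, rfl⟩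
    refine ⟨flowCovector_mem (𝒢.dualAlgebroidNonzero_subset hl), ?_⟩
    rw [flowOrigin_flowCovector hp₀ hχ t hl]
    rfl
  · rintro ⟨h1, h2⟩
    exact ⟨_, ⟨mem_univ _, flowOrigin_mem h1⟩, h2⟩

theorem contMDiffAt_flowRetraction
    (hp₀ : 𝒢.IsEllipticSymbol p₀) (hχ : IsHamiltonianFlow I (p₀ ∘ 𝒢.rΓ) 𝒢.rRegular χ)
    {l : CotangentBundle (𝓘(ℝ, ℝ).prod I) (ℝ × G)}
    (hl : l ∈ 𝒢.rRegularProd) :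
    ContMDiffAt (cotangentModel (𝓘(ℝ, ℝ).prod I)) (cotangentModel (𝓘(ℝ, ℝ).prod I)) ∞
      (fun l => flowCovector 𝒢 p₀ χ (l.1.1, flowOrigin 𝒢 χ l)) l :=
  ContMDiffAt.comp l (f := fun l => (l.1.1, flowOrigin 𝒢 χ l))
    (contMDiffAt_flowCovector hp₀ hχ (𝒢.dualAlgebroidNonzero_subset (flowOrigin_mem hl)))
    ((contMDiff_fst.comp contMDiff_proj).contMDiffAt.prodMk (contMDiffAt_flowOrigin hp₀ hχ hl))

theorem isEmbeddedSubmanifold_gluedFlowOut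
    (hp₀ : 𝒢.IsEllipticSymbol p₀) (hχ : IsHamiltonianFlow I (p₀ ∘ 𝒢.rΓ) 𝒢.rRegular χ) :
    IsEmbeddedSubmanifold (cotangentModel (𝓘(ℝ, ℝ).prod I))
      (𝒢.gluedFlowOut (p₀ ∘ 𝒢.rΓ) χ) := by
  rw [gluedFlowOut_eq_fixedPoints hp₀ hχ]
  refine isEmbeddedSubmanifold_fixedPoints isOpen_rRegularProd
    (fun l hl => (contMDiffAt_flowRetraction hp₀ hχ hl).contMDiffWithinAt) fun l hl => ?_
  rw [flowOrigin_flowCovector hp₀ hχ _ (flowOrigin_mem hl)]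
  rfl

/-- A fixed point set of a continuous map into a Hausdorff space is closed in the domain, here the
open set where the `T*G` component is `r_Γ`-regular. -/
theorem exists_isClosed_gluedFlowOut
    (hp₀ : 𝒢.IsEllipticSymbol p₀) (hχ : IsHamiltonianFlow I (p₀ ∘ 𝒢.rΓ) 𝒢.rRegular χ) :
    ∃ C : Set (CotangentBundle (𝓘(ℝ, ℝ).prod I) (ℝ × G)), IsClosed C ∧
      𝒢.gluedFlowOut (p₀ ∘ 𝒢.rΓ) χ = C ∩ 𝒢.rRegularProd := by
  have h1 : ContinuousOn (fun l => flowCovector 𝒢 p₀ χ (l.1.1, flowOrigin 𝒢 χ l)) 𝒢.rRegularProd :=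
    fun l hl => (contMDiffAt_flowRetraction hp₀ hχ hl).continuousAt.continuousWithinAt
  have h2 : IsClosed {l : 𝒢.rRegularProd |
      flowCovector 𝒢 p₀ χ (l.1.1.1, flowOrigin 𝒢 χ l.1) = l.1} :=
    isClosed_eq (continuousOn_iff_continuous_domRestrict.1 h1) continuous_subtype_val
  obtain ⟨C, hC, h3⟩ := isClosed_induced_iff.1 h2
  refine ⟨C, hC, ?_⟩
  rw [gluedFlowOut_eq_fixedPoints hp₀ hχ]
  ext l
  constructor
  · rintro ⟨h4, h5⟩
    have h6 : (⟨l, h4⟩ : 𝒢.rRegularProd) ∈ Subtype.val ⁻¹' C := by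
      rw [h3]
      exact h5
    exact ⟨h6, h4⟩
  · rintro ⟨h4, h5⟩
    have h6 : (⟨l, h5⟩ : 𝒢.rRegularProd) ∈ Subtype.val ⁻¹' C := h4
    rw [h3] at h6
    exact ⟨h5, h6⟩

theorem dilate_flowCovector
    (hp₀ : 𝒢.IsEllipticSymbol p₀) (hχ : IsHamiltonianFlow I (p₀ ∘ 𝒢.rΓ) 𝒢.rRegular χ)
    (t : ℝ) {l : CotangentBundle I G} (hl : l ∈ 𝒢.rRegular) {a : ℝ}
    (ha : 0 < a) :
    dilate a (flowCovector 𝒢 p₀ χ (t, l)) = flowCovector 𝒢 p₀ χ (t, dilate a l) := by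
  have h1 : p₀ (𝒢.rΓ (dilate a l)) = a * p₀ (𝒢.rΓ l) := hp₀.isHomogeneousOn.eq l hl a ha
  have h2 := hχ.flowMap_dilate 𝒢.isOpen_rRegular hp₀.contMDiffOn hp₀.isHomogeneousOn t hl ha
  change dilate a (prodCovector I t (-(p₀ (𝒢.rΓ l))) (flowMap χ (t, l))) =
    prodCovector I t (-(p₀ (𝒢.rΓ (dilate a l)))) (flowMap χ (t, dilate a l))
  rw [dilate_prodCovector, h1, h2, mul_neg]

theorem hasVelocity_flowMap
    (hp₀ : 𝒢.IsEllipticSymbol p₀) (hχ : IsHamiltonianFlow I (p₀ ∘ 𝒢.rΓ) 𝒢.rRegular χ)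
    {θ : ℝ → ℝ} {c : ℝ → CotangentBundle I G} {t a : ℝ}
    {l : CotangentBundle I G} (hl : l ∈ 𝒢.rRegular) {w v : E × (E →L[ℝ] ℝ)}
    {A : (E × (E →L[ℝ] ℝ)) →L[ℝ] E × (E →L[ℝ] ℝ)}
    (hA : HasMFDerivAt (cotangentModel I) (cotangentModel I) (fun l => flowMap χ (t, l)) l A)
    (hv : HasVelocity (cotangentModel I) (fun u => flowMap χ (u, l)) t v)
    (hθ : HasVelocity 𝓘(ℝ, ℝ) θ 0 a) (hθ0 : θ 0 = t)
    (hc : HasVelocity (cotangentModel I) c 0 w) (hc0 : c 0 = l) :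
    HasVelocity (cotangentModel I) (fun u => flowMap χ (θ u, c u)) 0 (a • v + A w) := by
  let D : ℝ × (E × (E →L[ℝ] ℝ)) →L[ℝ] E × (E →L[ℝ] ℝ) :=
    mfderiv (𝓘(ℝ, ℝ).prod (cotangentModel I)) (cotangentModel I) (flowMap χ) (t, l)
  have hD : HasMFDerivAt (𝓘(ℝ, ℝ).prod (cotangentModel I)) (cotangentModel I) (flowMap χ) (t, l) D :=
    ((hχ.contMDiffAt 𝒢.isOpen_rRegular hp₀.contMDiffOn (q := (t, l)) hl).mdifferentiableAt
      (by simp)).hasMFDerivAt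
  have h1 : D ((1 : ℝ), (0 : E × (E →L[ℝ] ℝ))) = v := by
    have h2 : HasVelocity 𝓘(ℝ, ℝ) (fun u : ℝ => u) t (1 : ℝ) := by
      rw [hasVelocity_iff_hasDerivAt]
      exact hasDerivAt_id t
    exact ((h2.prodMk (hasVelocity_const l t)).comp_of_eq hD rfl).unique hv
  have h2 : D ((0 : ℝ), w) = A w :=
    (((hasVelocity_const t 0).prodMk hc).comp_of_eq hD (by rw [hc0])).unique (hc.comp_of_eq hA hc0)
  have h3 : a • v + A w = D (a, w) := by
    rw [← h1, ← h2, ← map_smul, ← map_add]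
    congr 1
    refine Prod.ext ?_ ?_ <;> simp
  rw [h3]
  exact (hθ.prodMk hc).comp_of_eq hD (by rw [hθ0, hc0])

theorem hasVelocity_flowCovector
    (hp₀ : 𝒢.IsEllipticSymbol p₀) (hχ : IsHamiltonianFlow I (p₀ ∘ 𝒢.rΓ) 𝒢.rRegular χ)
    {θ : ℝ → ℝ} {c : ℝ → CotangentBundle I G} {t a : ℝ}
    {l : CotangentBundle I G} (hl : l ∈ 𝒢.rRegular) {w v : E × (E →L[ℝ] ℝ)}
    {A : (E × (E →L[ℝ] ℝ)) →L[ℝ] E × (E →L[ℝ] ℝ)} {P : (E × (E →L[ℝ] ℝ)) →L[ℝ] ℝ}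
    (hA : HasMFDerivAt (cotangentModel I) (cotangentModel I) (fun l => flowMap χ (t, l)) l A)
    (hP : HasMFDerivAt (cotangentModel I) 𝓘(ℝ, ℝ) (p₀ ∘ 𝒢.rΓ) l P)
    (hv : HasVelocity (cotangentModel I) (fun u => flowMap χ (u, l)) t v)
    (hθ : HasVelocity 𝓘(ℝ, ℝ) θ 0 a) (hθ0 : θ 0 = t)
    (hc : HasVelocity (cotangentModel I) c 0 w) (hc0 : c 0 = l) :
    HasVelocity (cotangentModel (𝓘(ℝ, ℝ).prod I)) (fun u => flowCovector 𝒢 p₀ χ (θ u, c u)) 0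
      (prodTangent a (-(P w)) (a • v + A w)) := by
  have h1 := hc.comp_of_eq hP hc0
  rw [hasVelocity_iff_hasDerivAt] at h1
  exact HasVelocity.prodCovector hθ (hasVelocity_iff_hasDerivAt.2 h1.neg)
    (hasVelocity_flowMap hp₀ hχ hl hA hv hθ hθ0 hc hc0)

/-- Curves in `Λ` are reparametrized by their time and their origin in `A*G`, and the chain rule for
the parametrization applies. Conversely, a curve with velocity `w` is first projected into `A*G` by
`r_Γ`. -/
theorem mem_tangentVectors_gluedFlowOut
    (hp₀ : 𝒢.IsEllipticSymbol p₀) (hχ : IsHamiltonianFlow I (p₀ ∘ 𝒢.rΓ) 𝒢.rRegular χ)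
    {t : ℝ} {l : CotangentBundle I G}
    (hl : l ∈ 𝒢.dualAlgebroidNonzero) {v : E × (E →L[ℝ] ℝ)}
    {A D : (E × (E →L[ℝ] ℝ)) →L[ℝ] E × (E →L[ℝ] ℝ)} {P : (E × (E →L[ℝ] ℝ)) →L[ℝ] ℝ}
    (hA : HasMFDerivAt (cotangentModel I) (cotangentModel I) (fun l => flowMap χ (t, l)) l A)
    (hD : HasMFDerivAt (cotangentModel I) (cotangentModel I) 𝒢.rΓ l D)
    (hP : HasMFDerivAt (cotangentModel I) 𝓘(ℝ, ℝ) (p₀ ∘ 𝒢.rΓ) l P)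
    (hv : HasVelocity (cotangentModel I) (fun u => flowMap χ (u, l)) t v)
    (V : (ℝ × E) × (ℝ × E →L[ℝ] ℝ)) :
    V ∈ tangentVectors (cotangentModel (𝓘(ℝ, ℝ).prod I)) (𝒢.gluedFlowOut (p₀ ∘ 𝒢.rΓ) χ)
      (flowCovector 𝒢 p₀ χ (t, l)) ↔
      ∃ (a : ℝ) (w : E × (E →L[ℝ] ℝ)), D w = w ∧ V = prodTangent a (-(P w)) (a • v + A w) := by
  have hlU := 𝒢.dualAlgebroidNonzero_subset hl
  have hlr := 𝒢.rΓ_of_mem hl.1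
  constructor
  · rintro ⟨L, hL0, hL, hV⟩
    have hV : HasVelocity (cotangentModel (𝓘(ℝ, ℝ).prod I)) L 0 V := hV
    have h1 : HasVelocity 𝓘(ℝ, ℝ) (fun u => (L u).1.1) 0 V.1.1 := by
      have := hV.proj.comp (hasMFDerivAt_fst (L 0).1)
      exact this
    have hO : L 0 ∈ 𝒢.rRegularProd := by
      rw [hL0]
      exact flowCovector_mem hlU
    have h2 := hV.comp_of_eq ((contMDiffAt_flowOrigin hp₀ hχ hO).mdifferentiableAt
      (by simp)).hasMFDerivAt rfl
    obtain ⟨w, hw⟩ : ∃ w : E × (E →L[ℝ] ℝ),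
      HasVelocity (cotangentModel I) (fun u => flowOrigin 𝒢 χ (L u)) 0 w := ⟨_, h2⟩
    have h3 : flowOrigin 𝒢 χ (L 0) = l := by
      rw [hL0, flowOrigin_flowCovector hp₀ hχ t hl]
    refine ⟨V.1.1, w, ?_, ?_⟩
    · exact (hw.comp_of_eq hD h3).unique
        (hw.congr (Eventually.of_forall fun u => 𝒢.rΓ_rΓ _))
    · refine hV.unique ((hasVelocity_flowCovector hp₀ hχ hlU hA hP hv h1 (by rw [hL0]; rfl)
        hw h3).congr ?_)
      filter_upwards [hL] with u hu
      rw [gluedFlowOut_eq_fixedPoints hp₀ hχ] at hu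
      exact hu.2.symm
  · rintro ⟨a, w, hw, rfl⟩
    obtain ⟨c, hc0, hc, -⟩ := exists_curve (I := cotangentModel I) l w
    have h1 := hc.comp_of_eq hD hc0
    rw [hw] at h1
    have h2 : HasVelocity 𝓘(ℝ, ℝ) (fun u : ℝ => t + u * a) 0 a := by
      simpa using hasVelocity_line t a
    have h3 : 𝒢.rΓ (c 0) = l := by rw [hc0, hlr]
    refine ⟨fun u => flowCovector 𝒢 p₀ χ (t + u * a, 𝒢.rΓ (c u)), ?_, ?_,
      hasVelocity_flowCovector hp₀ hχ hlU hA hP hv h2 (by simp) h1 h3⟩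
    · change flowCovector 𝒢 p₀ χ (t + 0 * a, 𝒢.rΓ (c 0)) = _
      rw [h3, zero_mul, add_zero]
    · filter_upwards [hc.continuousAt.eventually_mem (𝒢.isOpen_rRegular.mem_nhds
        (by rw [hc0]; exact hlU))] with u hu
      rw [gluedFlowOut_eq_image hp₀ hχ]
      exact ⟨_, ⟨mem_univ _, 𝒢.rΓ_mem_dualAlgebroidNonzero hu⟩, rfl⟩

/-- The products with time directions cancel against the `dt ∧ dτ` terms, leaving the symplectic
form of the two vectors tangent to `A*G`. The converse peels off the components by testing against
suitable vectors. -/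
theorem lagrangian_gluedFlowOut
    (hp₀ : 𝒢.IsEllipticSymbol p₀) (hχ : IsHamiltonianFlow I (p₀ ∘ 𝒢.rΓ) 𝒢.rRegular χ)
    {t : ℝ} {l : CotangentBundle I G}
    (hl : l ∈ 𝒢.dualAlgebroidNonzero) (V : (ℝ × E) × (ℝ × E →L[ℝ] ℝ)) :
    V ∈ tangentVectors (cotangentModel (𝓘(ℝ, ℝ).prod I)) (𝒢.gluedFlowOut (p₀ ∘ 𝒢.rΓ) χ)
      (flowCovector 𝒢 p₀ χ (t, l)) ↔
      ∀ W : (ℝ × E) × (ℝ × E →L[ℝ] ℝ), W ∈ tangentVectors (cotangentModel (𝓘(ℝ, ℝ).prod I))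
        (𝒢.gluedFlowOut (p₀ ∘ 𝒢.rΓ) χ) (flowCovector 𝒢 p₀ χ (t, l)) → stdSymplectic V W = 0 := by
  have hU := 𝒢.isOpen_rRegular
  have hp := hp₀.contMDiffOn
  have hom := hp₀.isHomogeneousOn
  have hlU := 𝒢.dualAlgebroidNonzero_subset hl
  let A : (E × (E →L[ℝ] ℝ)) →L[ℝ] E × (E →L[ℝ] ℝ) :=
    mfderiv (cotangentModel I) (cotangentModel I) (fun l => flowMap χ (t, l)) l
  have hA : HasMFDerivAt (cotangentModel I) (cotangentModel I) (fun l => flowMap χ (t, l)) l A :=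
    ((hχ.contMDiffAt_time hU hp t hlU).mdifferentiableAt (by simp)).hasMFDerivAt
  let D : (E × (E →L[ℝ] ℝ)) →L[ℝ] E × (E →L[ℝ] ℝ) :=
    mfderiv (cotangentModel I) (cotangentModel I) 𝒢.rΓ l
  have hD : HasMFDerivAt (cotangentModel I) (cotangentModel I) 𝒢.rΓ l D :=
    (𝒢.contMDiff_rΓ.mdifferentiable (by simp) l).hasMFDerivAt
  let P : (E × (E →L[ℝ] ℝ)) →L[ℝ] ℝ := mfderiv (cotangentModel I) 𝓘(ℝ, ℝ) (p₀ ∘ 𝒢.rΓ) l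
  have hP : HasMFDerivAt (cotangentModel I) 𝓘(ℝ, ℝ) (p₀ ∘ 𝒢.rΓ) l P :=
    ContMDiffOn.hasMFDerivAt_of_isOpen hp hU hlU
  obtain ⟨v, hv, hvw⟩ := hχ.isHamiltonAt_flowMap t hlU
  have hmem := fun V => mem_tangentVectors_gluedFlowOut hp₀ hχ hl hA hD hP hv V
  have hsymp : ∀ w w', stdSymplectic (A w) (A w') = stdSymplectic w w' := fun w w' =>
    hχ.symplecticForm_eq hU hp hom t hlU hA w w'
  -- Hamilton's equation at time `t` gives `dp(A w)`, which equals `dp(w)` at time zero because the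
  -- flow preserves `p`.
  have hvA : ∀ w, stdSymplectic v (A w) = P w := by
    intro w
    refine (hvw (A w)).trans ?_
    let P' : (E × (E →L[ℝ] ℝ)) →L[ℝ] ℝ :=
      mfderiv (cotangentModel I) 𝓘(ℝ, ℝ) (p₀ ∘ 𝒢.rΓ) (flowMap χ (t, l))
    have hP' : HasMFDerivAt (cotangentModel I) 𝓘(ℝ, ℝ) (p₀ ∘ 𝒢.rΓ) (flowMap χ (t, l)) P' :=
      ContMDiffOn.hasMFDerivAt_of_isOpen hp hU (flowMap_mem χ hlU)
    have h1 : HasMFDerivAt (cotangentModel I) 𝓘(ℝ, ℝ) (p₀ ∘ 𝒢.rΓ) l (P'.comp A) := by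
      refine (HasMFDerivAt.comp l hP' hA).congr_of_eventuallyEq ?_
      filter_upwards [hU.mem_nhds hlU] with l' hl'
      exact (hχ.hamiltonian_flowMap hU hp t hl').symm
    exact congrArg (fun L : (E × (E →L[ℝ] ℝ)) →L[ℝ] ℝ => L w) (hasMFDerivAt_unique h1 hP)
  have hanti : ∀ w w' : E × (E →L[ℝ] ℝ), stdSymplectic w w' = -stdSymplectic w' w := fun w w' => by
    simp [stdSymplectic]
  have hadd : ∀ w w' z : E × (E →L[ℝ] ℝ),
      stdSymplectic (w + w') z = stdSymplectic w z + stdSymplectic w' z := fun w w' z => by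
    simp only [stdSymplectic, Prod.fst_add, Prod.snd_add, map_add, add_apply]
    ring
  have hsmul : ∀ (a : ℝ) (w z : E × (E →L[ℝ] ℝ)),
      stdSymplectic (a • w) z = a * stdSymplectic w z := fun a w z => by
    simp only [stdSymplectic, Prod.smul_fst, Prod.smul_snd, map_smul,
      smul_apply, smul_eq_mul]
    ring
  have hself : ∀ w : E × (E →L[ℝ] ℝ), stdSymplectic w w = 0 := fun w => by
    simp [stdSymplectic]
  have hlag := lagrangian_dualAlgebroid hl.1 hD
  constructor
  · intro hV W hW
    obtain ⟨a, w, hw, rfl⟩ := (hmem V).1 hV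
    obtain ⟨a', w', hw', rfl⟩ := (hmem W).1 hW
    rw [stdSymplectic_prodTangent, hadd, hsmul, hanti v, hanti (A w), hadd, hadd, hsmul, hsmul,
      hself, hanti (A w') (A w), hsymp, (hlag w).1 hw w' hw', hanti (A w') v, hvA, hvA]
    ring
  · intro h
    rw [hmem]
    set a := V.1.1
    set b := V.2 (1, 0)
    set z : E × (E →L[ℝ] ℝ) := (V.1.2, V.2.comp (ContinuousLinearMap.inr ℝ ℝ E)) with hz
    have hV : V = prodTangent a b z := (prodTangent_eq V).symm
    have hinj : Function.Injective A := by
      intro w w' hww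
      refine sub_eq_zero.1 (stdSymplectic_nondegenerate fun z => ?_)
      rw [← hsymp, map_sub, hww, sub_self]
      simp [stdSymplectic]
    obtain ⟨w, hw⟩ := LinearMap.surjective_of_injective
      (f := (A : (E × (E →L[ℝ] ℝ)) →ₗ[ℝ] E × (E →L[ℝ] ℝ))) hinj (z - a • v)
    have hw : z = a • v + A w := by
      rw [show A w = z - a • v from hw]
      abel
    -- Pairing with the pure time direction determines the `τ`-component: `b = -P w`.
    have h1 := h _ ((hmem _).2 ⟨1, 0, map_zero D, rfl⟩)
    rw [hV, stdSymplectic_prodTangent, map_zero, map_zero, one_smul, add_zero, neg_zero, mul_zero,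
      mul_one, zero_sub, hw, hadd, hsmul, hself, mul_zero, zero_add, hanti, hvA] at h1
    have hDw : D w = w := by
      rw [hlag]
      intro w' hw'
      -- With `b` known, the remaining pairings say that `w` is orthogonal to the tangent space of
      -- `A*G`, hence belongs to it.
      have h2 := h _ ((hmem _).2 ⟨0, w', hw', rfl⟩)
      rw [hV, stdSymplectic_prodTangent, zero_smul, zero_add, mul_zero, sub_zero, hw, hadd, hsmul,
        hvA, hsymp] at h2
      linarith
    refine ⟨a, w, hDw, ?_⟩
    rw [hV, hw]
    congr 1
    linarith

end LieGroupoid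

/-! ### Relations given by the flow -/

namespace LieGroupoid

variable {E H F N : Type*} [NormedAddCommGroup E] [NormedSpace ℝ E] [FiniteDimensional ℝ E]
  [TopologicalSpace H] [NormedAddCommGroup F] [NormedSpace ℝ F] [FiniteDimensional ℝ F]
  [TopologicalSpace N]
  {I : ModelWithCorners ℝ E H} [I.Boundaryless] {G : Type*} [TopologicalSpace G] [ChartedSpace H G]
  {J : ModelWithCorners ℝ F N} [J.Boundaryless] {M : Type*} [TopologicalSpace M] [ChartedSpace N M]
  [IsManifold I ∞ G] [IsManifold J ∞ M] {𝒢 : LieGroupoid I G J M} [T2Space G]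
  {p₀ : CotangentBundle I G → ℝ} {χ : ℝ → 𝒢.rRegular → 𝒢.rRegular}

theorem mem_gluedFlowOut
    (hp₀ : 𝒢.IsEllipticSymbol p₀) (hχ : IsHamiltonianFlow I (p₀ ∘ 𝒢.rΓ) 𝒢.rRegular χ)
    {L : CotangentBundle (𝓘(ℝ, ℝ).prod I) (ℝ × G)} (hL : L ∈ 𝒢.gluedFlowOut (p₀ ∘ 𝒢.rΓ) χ) :
    ∃ t, ∃ l ∈ 𝒢.dualAlgebroidNonzero, flowCovector 𝒢 p₀ χ (t, l) = L := by
  rw [gluedFlowOut_eq_image hp₀ hχ] at hL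
  obtain ⟨⟨t, l⟩, ⟨-, hl⟩, rfl⟩ := hL
  exact ⟨t, l, hl, rfl⟩

theorem flowCovector_mem_gluedFlowOut
    (hp₀ : 𝒢.IsEllipticSymbol p₀) (hχ : IsHamiltonianFlow I (p₀ ∘ 𝒢.rΓ) 𝒢.rRegular χ)
    (t : ℝ) {l : CotangentBundle I G} (hl : l ∈ 𝒢.dualAlgebroidNonzero) :
    flowCovector 𝒢 p₀ χ (t, l) ∈ 𝒢.gluedFlowOut (p₀ ∘ 𝒢.rΓ) χ := by
  rw [gluedFlowOut_eq_image hp₀ hχ]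
  exact ⟨_, ⟨mem_univ _, hl⟩, rfl⟩

theorem IsEllipticSymbol.rΓ_ne_zero (hp₀ : 𝒢.IsEllipticSymbol p₀) {l : CotangentBundle I G}
    (hl : l ∈ 𝒢.dualAlgebroidNonzero) : -(p₀ (𝒢.rΓ l)) ≠ 0 :=
  neg_ne_zero.2 (hp₀.ne_zero _ (𝒢.rΓ_mem_dualAlgebroidNonzero (𝒢.dualAlgebroidNonzero_subset hl)))

theorem flowMap_mem_biregular
    (hp₀ : 𝒢.IsEllipticSymbol p₀) (hχ : IsHamiltonianFlow I (p₀ ∘ 𝒢.rΓ) 𝒢.rRegular χ)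
    (t : ℝ) {l : CotangentBundle I G} (hl : l ∈ 𝒢.dualAlgebroidNonzero) :
    flowMap χ (t, l) ∈ 𝒢.biregular := by
  refine ⟨flowMap_mem χ (𝒢.dualAlgebroidNonzero_subset hl), ?_⟩
  rw [hp₀.sΓ_flow hχ t hl]
  exact hl.2

theorem isConicLagrangian_gluedFlowOut
    (hp₀ : 𝒢.IsEllipticSymbol p₀) (hχ : IsHamiltonianFlow I (p₀ ∘ 𝒢.rΓ) 𝒢.rRegular χ) :
    IsConicLagrangian (𝓘(ℝ, ℝ).prod I) (𝒢.gluedFlowOut (p₀ ∘ 𝒢.rΓ) χ) where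
  submanifold := isEmbeddedSubmanifold_gluedFlowOut hp₀ hχ
  conic L hL a ha := by
    obtain ⟨t, l, hl, rfl⟩ := mem_gluedFlowOut hp₀ hχ hL
    change dilate a (flowCovector 𝒢 p₀ χ (t, l)) ∈ _
    rw [dilate_flowCovector hp₀ hχ t (𝒢.dualAlgebroidNonzero_subset hl) ha]
    exact flowCovector_mem_gluedFlowOut hp₀ hχ t (dilate_mem_dualAlgebroidNonzero hl ha.ne')
  lagrangian L hL V := by
    obtain ⟨t, l, hl, rfl⟩ := mem_gluedFlowOut hp₀ hχ hL
    exact lagrangian_gluedFlowOut hp₀ hχ hl V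

/-- The differential of `γ ↦ (t, γ)` is the inclusion of the second factor, so pulling back forgets
`τ` and keeps the component in `T*G`. -/
theorem pullback_gluedFlowOut
    (hp₀ : 𝒢.IsEllipticSymbol p₀) (hχ : IsHamiltonianFlow I (p₀ ∘ 𝒢.rΓ) 𝒢.rRegular χ) (t : ℝ) :
    pullback I (𝓘(ℝ, ℝ).prod I) (fun γ : G => (t, γ)) (𝒢.gluedFlowOut (p₀ ∘ 𝒢.rΓ) χ) =
      𝒢.flowOut χ t := by
  have hd : ∀ γ : G, mfderiv I (𝓘(ℝ, ℝ).prod I) (fun γ : G => (t, γ)) γ =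
      ContinuousLinearMap.inr ℝ ℝ E := fun γ =>
    HasMFDerivAt.mfderiv ((hasMFDerivAt_const t γ).prodMk (hasMFDerivAt_id γ))
  ext l
  constructor
  · rintro ⟨η, hη, hl⟩
    obtain ⟨t', l', hl', h⟩ := mem_gluedFlowOut hp₀ hχ hη
    have h1 : t' = t := congrArg (fun L => L.1.1) h
    subst h1
    refine ⟨⟨l', 𝒢.dualAlgebroidNonzero_subset hl'⟩, hl', ?_⟩
    rw [← flowMap_of_mem χ, ← restrictCovector_flowCovector (p₀ := p₀), h]
    refine covector_ext rfl fun w => ?_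
    rw [hl, hd]
    rfl
  · rintro ⟨l', hl', rfl⟩
    have h1 := flowCovector_mem_gluedFlowOut hp₀ hχ t hl'
    have h2 : flowMap χ (t, l'.1) = χ t l' := flowMap_of_mem χ l'.2
    rw [← h2]
    refine ⟨(flowCovector 𝒢 p₀ χ (t, l'.1)).2, h1, ?_⟩
    rw [hd]
    have h3 := restrictCovector_flowCovector (𝒢 := 𝒢) (p₀ := p₀) (χ := χ) (t, l'.1)
    refine ContinuousLinearMap.ext fun w => ?_
    change fib (flowMap χ (t, l'.1)) w =
      fib (restrictCovector (flowCovector 𝒢 p₀ χ (t, l'.1))) w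
    rw [h3]

theorem ne_zero_of_mem_gluedFlowOut
    (hp₀ : 𝒢.IsEllipticSymbol p₀) (hχ : IsHamiltonianFlow I (p₀ ∘ 𝒢.rΓ) 𝒢.rRegular χ)
    {L : CotangentBundle (𝓘(ℝ, ℝ).prod I) (ℝ × G)} (hL : L ∈ 𝒢.gluedFlowOut (p₀ ∘ 𝒢.rΓ) χ) :
    L.2 ≠ 0 := by
  obtain ⟨t, l, hl, rfl⟩ := mem_gluedFlowOut hp₀ hχ hL
  exact prodCovector_ne_zero (hp₀.rΓ_ne_zero hl) _

/-- By translation invariance, flowing `r_Γ (χ_t l)` back by `-t` and applying `r_Γ` gives the same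
as for `χ_t l` itself, namely `l`. So `r_Γ` can be inverted on `Λ`. -/
theorem constFamily_rΓ_flowCovector
    (hp₀ : 𝒢.IsEllipticSymbol p₀) (hχ : IsHamiltonianFlow I (p₀ ∘ 𝒢.rΓ) 𝒢.rRegular χ)
    (t : ℝ) {l : CotangentBundle I G} (hl : l ∈ 𝒢.dualAlgebroidNonzero) :
    𝒢.constFamily.rΓ (flowCovector 𝒢 p₀ χ (t, l)) ∈ 𝒢.rRegularProd ∧
      flowOrigin 𝒢 χ (𝒢.constFamily.rΓ (flowCovector 𝒢 p₀ χ (t, l))) = l := by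
  have hU := 𝒢.isOpen_rRegular
  have hp := hp₀.contMDiffOn
  have hμ := flowMap_mem χ (t := t) (𝒢.dualAlgebroidNonzero_subset hl)
  have h1 : 𝒢.constFamily.rΓ (flowCovector 𝒢 p₀ χ (t, l)) =
    prodCovector I t 0 (𝒢.rΓ (flowMap χ (t, l))) := 𝒢.constFamily_rΓ _ _ _
  rw [h1]
  refine ⟨?_, ?_⟩
  · change restrictCovector (prodCovector I t 0 (𝒢.rΓ (flowMap χ (t, l)))) ∈ 𝒢.rRegular
    rw [restrictCovector_prodCovector]
    exact 𝒢.mem_rRegular_rΓ hμ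
  · change 𝒢.rΓ (flowMap χ (-t, restrictCovector (prodCovector I t 0 _))) = l
    rw [restrictCovector_prodCovector, ← (hp₀.flow_translate hχ (-t) hμ).2,
      hχ.flowMap_neg' hU hp t (𝒢.dualAlgebroidNonzero_subset hl), 𝒢.rΓ_of_mem hl.1]

theorem constFamily_sΓ_flowCovector
    (hp₀ : 𝒢.IsEllipticSymbol p₀) (hχ : IsHamiltonianFlow I (p₀ ∘ 𝒢.rΓ) 𝒢.rRegular χ)
    (t : ℝ) {l : CotangentBundle I G} (hl : l ∈ 𝒢.dualAlgebroidNonzero) :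
    𝒢.constFamily.sΓ (flowCovector 𝒢 p₀ χ (t, l)) = prodCovector I t 0 l := by
  have h1 : 𝒢.constFamily.sΓ (flowCovector 𝒢 p₀ χ (t, l)) =
    prodCovector I t 0 (𝒢.sΓ (flowMap χ (t, l))) := 𝒢.constFamily_sΓ _ _ _
  rw [h1, hp₀.sΓ_flow hχ t hl]

/-- A unit covector of the constant family is fixed by its `r_Γ`, which erases `τ` and projects the
other component to `A*G`. -/
theorem exists_eq_of_mem_dualAlgebroid_constFamily
    {L : CotangentBundle (𝓘(ℝ, ℝ).prod I) (ℝ × G)} (hL : L ∈ 𝒢.constFamily.dualAlgebroid)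
    (hL0 : L.2 ≠ 0) : ∃ t, ∃ l ∈ 𝒢.dualAlgebroidNonzero, L = prodCovector I t 0 l := by
  have h1 := 𝒢.constFamily.rΓ_of_mem hL
  rw [← prodCovector_restrictCovector L, constFamily_rΓ, prodCovector_restrictCovector] at h1
  rw [← h1] at hL0
  exact ⟨_, _, ⟨𝒢.rΓ_mem_dualAlgebroid _, prodCovector_zero_ne_zero_iff.1 hL0⟩, h1.symm⟩

theorem isInvertibleRelation_gluedFlowOut
    (hp₀ : 𝒢.IsEllipticSymbol p₀) (hχ : IsHamiltonianFlow I (p₀ ∘ 𝒢.rΓ) 𝒢.rRegular χ) :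
    𝒢.constFamily.IsInvertibleRelation (𝒢.gluedFlowOut (p₀ ∘ 𝒢.rΓ) χ) where
  isRelation :=
    { conicLagrangian := isConicLagrangian_gluedFlowOut hp₀ hχ
      nonzero := fun L hL => ne_zero_of_mem_gluedFlowOut hp₀ hχ hL
      subset_biregular := fun L hL => by
        obtain ⟨t, l, hl, rfl⟩ := mem_gluedFlowOut hp₀ hχ hL
        exact prodCovector_mem_biregular_constFamily (flowMap_mem_biregular hp₀ hχ t hl) _ _ }
  diffeo_r := by
    -- The inverse of `r_Γ` is the restriction of the retraction onto `Λ`: origin first, then the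
    -- flow-out.
    refine ⟨𝒢.constFamily.contMDiff_rΓ.contMDiffOn,
      fun L => flowCovector 𝒢 p₀ χ (L.1.1, flowOrigin 𝒢 χ L), ?_, ?_⟩
    · rintro _ ⟨L, hL, rfl⟩
      obtain ⟨t, l, hl, rfl⟩ := mem_gluedFlowOut hp₀ hχ hL
      exact (contMDiffAt_flowRetraction hp₀ hχ
        (constFamily_rΓ_flowCovector hp₀ hχ t hl).1).contMDiffWithinAt
    · intro L hL
      obtain ⟨t, l, hl, rfl⟩ := mem_gluedFlowOut hp₀ hχ hL
      change flowCovector 𝒢 p₀ χ (t, flowOrigin 𝒢 χ _) = _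
      rw [(constFamily_rΓ_flowCovector hp₀ hχ t hl).2]
  diffeo_s := by
    -- As `s_Γ` returns the parameters `(t, l)` of the point, its inverse is the parametrization
    -- itself.
    refine ⟨𝒢.constFamily.contMDiff_sΓ.contMDiffOn,
      fun L => flowCovector 𝒢 p₀ χ (L.1.1, restrictCovector L), ?_, ?_⟩
    · rintro _ ⟨L, hL, rfl⟩
      obtain ⟨t, l, hl, rfl⟩ := mem_gluedFlowOut hp₀ hχ hL
      rw [constFamily_sΓ_flowCovector hp₀ hχ t hl]
      refine (ContMDiffAt.comp (prodCovector I t 0 l) (f := fun L => (L.1.1, restrictCovector L))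
        (contMDiffAt_flowCovector hp₀ hχ ?_) ((contMDiff_fst.comp contMDiff_proj).contMDiffAt.prodMk
          contMDiff_restrictCovector.contMDiffAt)).contMDiffWithinAt
      change restrictCovector (prodCovector I t 0 l) ∈ _
      rw [restrictCovector_prodCovector]
      exact 𝒢.dualAlgebroidNonzero_subset hl
    · intro L hL
      obtain ⟨t, l, hl, rfl⟩ := mem_gluedFlowOut hp₀ hχ hL
      change flowCovector 𝒢 p₀ χ (_, restrictCovector _) = _
      rw [constFamily_sΓ_flowCovector hp₀ hχ t hl, restrictCovector_prodCovector]
      rfl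
  open_r := by
    refine ⟨{L | L.2 ≠ 0}, isOpen_ne_zero, Subset.antisymm ?_ ?_⟩
    · rintro _ ⟨L, hL, rfl⟩
      obtain ⟨t, l, hl, rfl⟩ := mem_gluedFlowOut hp₀ hχ hL
      refine ⟨?_, 𝒢.constFamily.rΓ_mem_dualAlgebroid _⟩
      change (𝒢.constFamily.rΓ (prodCovector I _ _ _)).2 ≠ 0
      rw [constFamily_rΓ, prodCovector_zero_ne_zero_iff]
      exact flowMap_mem χ (𝒢.dualAlgebroidNonzero_subset hl)
    · rintro L ⟨hL0, hL⟩
      obtain ⟨t, l, hl, rfl⟩ := exists_eq_of_mem_dualAlgebroid_constFamily hL hL0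
      have hlU := 𝒢.dualAlgebroidNonzero_subset hl
      have hμ := flowMap_mem χ (t := -t) hlU
      -- The preimage of `(t, l)` has origin `r_Γ (χ_{-t} l)`: flowing it out for time `t` has, by
      -- translation invariance, the same `r_Γ` as `l`.
      refine ⟨_, flowCovector_mem_gluedFlowOut hp₀ hχ t (𝒢.rΓ_mem_dualAlgebroidNonzero hμ), ?_⟩
      change 𝒢.constFamily.rΓ (prodCovector I t _ _) = _
      rw [constFamily_rΓ, ← (hp₀.flow_translate hχ t hμ).2,
        hχ.flowMap_neg 𝒢.isOpen_rRegular hp₀.contMDiffOn t hlU, 𝒢.rΓ_of_mem hl.1]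
  open_s := by
    refine ⟨{L | L.2 ≠ 0}, isOpen_ne_zero, Subset.antisymm ?_ ?_⟩
    · rintro _ ⟨L, hL, rfl⟩
      obtain ⟨t, l, hl, rfl⟩ := mem_gluedFlowOut hp₀ hχ hL
      refine ⟨?_, 𝒢.constFamily.sΓ_mem_dualAlgebroid _⟩
      rw [constFamily_sΓ_flowCovector hp₀ hχ t hl]
      exact prodCovector_zero_ne_zero_iff.2 hl.2
    · rintro L ⟨hL0, hL⟩
      obtain ⟨t, l, hl, rfl⟩ := exists_eq_of_mem_dualAlgebroid_constFamily hL hL0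
      exact ⟨_, flowCovector_mem_gluedFlowOut hp₀ hχ t hl, constFamily_sΓ_flowCovector hp₀ hχ t hl⟩

theorem isFamilyRelation_gluedFlowOut
    (hp₀ : 𝒢.IsEllipticSymbol p₀) (hχ : IsHamiltonianFlow I (p₀ ∘ 𝒢.rΓ) 𝒢.rRegular χ) :
    𝒢.prodReal.IsFamilyRelation (𝒢.gluedFlowOut (p₀ ∘ 𝒢.rΓ) χ) where
  isRelation :=
    { conicLagrangian := isConicLagrangian_gluedFlowOut hp₀ hχ
      nonzero := fun L hL => ne_zero_of_mem_gluedFlowOut hp₀ hχ hL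
      subset_biregular := fun L hL => by
        obtain ⟨t, l, hl, rfl⟩ := mem_gluedFlowOut hp₀ hχ hL
        exact prodCovector_mem_biregular_prodReal (flowMap_mem_biregular hp₀ hχ t hl) _ _ }
  submersion L hL y := by
    obtain ⟨t, l, hl, rfl⟩ := mem_gluedFlowOut hp₀ hχ hL
    have hlU := 𝒢.dualAlgebroidNonzero_subset hl
    have hlr := 𝒢.rΓ_of_mem hl.1
    let D : (E × (E →L[ℝ] ℝ)) →L[ℝ] E × (E →L[ℝ] ℝ) :=
      mfderiv (cotangentModel I) (cotangentModel I) 𝒢.rΓ l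
    have hD : HasMFDerivAt (cotangentModel I) (cotangentModel I) 𝒢.rΓ l D :=
      (𝒢.contMDiff_rΓ.mdifferentiable (by simp) l).hasMFDerivAt
    -- A tangent vector of `A*G` over `y` is carried by the flow at fixed time `t`. Since the flow
    -- conserves `s`, its image still projects to `y`.
    obtain ⟨w, hw, hwy⟩ := exists_velocity_rΓ_over hl.1 hD y
    obtain ⟨c, hc0, hc, -⟩ := exists_curve (I := cotangentModel I) l w
    have h1 := hc.comp_of_eq hD hc0
    rw [hw] at h1
    have h3 : 𝒢.rΓ (c 0) = l := by rw [hc0, hlr]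
    have hcU : ∀ᶠ u in 𝓝 0, c u ∈ 𝒢.rRegular :=
      hc.continuousAt.eventually_mem (𝒢.isOpen_rRegular.mem_nhds (by rw [hc0]; exact hlU))
    have h4 := ((hasVelocity_const t 0).prodMk h1).comp_of_eq
      ((contMDiffAt_flowCovector hp₀ hχ (q := (t, l)) hlU).mdifferentiableAt
        (by simp)).hasMFDerivAt (by rw [h3])
    obtain ⟨V, hV⟩ : ∃ V : (ℝ × E) × (ℝ × E →L[ℝ] ℝ),
      HasVelocity (cotangentModel (𝓘(ℝ, ℝ).prod I))
        (fun u => flowCovector 𝒢 p₀ χ (t, 𝒢.rΓ (c u))) 0 V := ⟨_, h4⟩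
    refine ⟨V, ⟨fun u => flowCovector 𝒢 p₀ χ (t, 𝒢.rΓ (c u)),
      congrArg (fun l => flowCovector 𝒢 p₀ χ (t, l)) h3, ?_, hV⟩, ?_⟩
    · filter_upwards [hcU] with u hu
      exact flowCovector_mem_gluedFlowOut hp₀ hχ t (𝒢.rΓ_mem_dualAlgebroidNonzero hu)
    · have hsm : ContMDiff (cotangentModel (𝓘(ℝ, ℝ).prod I)) J ∞
          (fun L : CotangentBundle (𝓘(ℝ, ℝ).prod I) (ℝ × G) => 𝒢.prodReal.s L.1) :=
        𝒢.prodReal.smooth_s.comp contMDiff_proj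
      have h5 := hV.comp_of_eq
        (hsm.mdifferentiable (by simp) (flowCovector 𝒢 p₀ χ (t, l))).hasMFDerivAt (by rw [h3])
      have h6 := h1.proj.comp_of_eq (𝒢.hasMFDerivAt_s l.1) (congrArg Bundle.TotalSpace.proj h3)
      have h7 : 𝒢.dS l.1 w.1 = y := by
        have h8 : 𝒢.unit (𝒢.r l.1) = l.1 := (eq_of_mem_dualAlgebroid hl.1).1
        rw [hwy, ← h8, 𝒢.r_unit]
        exact 𝒢.dS_dU _ _
      rw [h7] at h6
      refine h5.unique (h6.congr ?_)
      filter_upwards [hcU] with u hu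
      exact hp₀.s_flow hχ t (𝒢.mem_rRegular_rΓ hu)

/-- The flow commutes with dilations and these fix base points, so only origins in the compact set
`K` are needed. -/
theorem isRealProper_support_gluedFlowOut [CompactSpace M]
    (hp₀ : 𝒢.IsEllipticSymbol p₀) (hχ : IsHamiltonianFlow I (p₀ ∘ 𝒢.rΓ) 𝒢.rRegular χ) :
    IsRealProper (support (𝓘(ℝ, ℝ).prod I) (𝒢.gluedFlowOut (p₀ ∘ 𝒢.rΓ) χ)) := by
  intro a b
  obtain ⟨K, hK, hKA, hcone⟩ := 𝒢.exists_compact_cosphere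
  have h : support (𝓘(ℝ, ℝ).prod I) (𝒢.gluedFlowOut (p₀ ∘ 𝒢.rΓ) χ) ∩ Icc a b ×ˢ univ =
      (fun q => (flowCovector 𝒢 p₀ χ q).1) '' (Icc a b ×ˢ K) := by
    ext ⟨t, γ⟩
    constructor
    · rintro ⟨⟨L, hL, hLt⟩, ht, -⟩
      obtain ⟨t', l, hl, rfl⟩ := mem_gluedFlowOut hp₀ hχ hL
      obtain rfl : t' = t := congrArg Prod.fst hLt
      obtain ⟨c, hc, hcK⟩ := hcone l hl
      refine ⟨(t', dilate c l), ⟨ht, hcK⟩, ?_⟩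
      change (flowCovector 𝒢 p₀ χ (t', dilate c l)).1 = _
      rw [← dilate_flowCovector hp₀ hχ t' (𝒢.dualAlgebroidNonzero_subset hl) hc]
      exact hLt
    · rintro ⟨⟨t', l⟩, ⟨ht, hl⟩, h⟩
      obtain rfl : t' = t := congrArg Prod.fst h
      exact ⟨⟨_, flowCovector_mem_gluedFlowOut hp₀ hχ t' (hKA hl), h⟩, ht, mem_univ _⟩
  rw [h]
  refine (isCompact_Icc.prod hK).image_of_continuousOn fun q hq => ?_
  exact (continuous_proj.continuousAt.comp (contMDiffAt_flowCovector hp₀ hχ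
    (𝒢.dualAlgebroidNonzero_subset (hKA hq.2))).continuousAt).continuousWithinAt

end LieGroupoid

end GroupoidRelation

end

/-! ### Assembly of the theorem -/

theorem mainTheorem11
    {E H : Type*} [NormedAddCommGroup E] [NormedSpace ℝ E] [FiniteDimensional ℝ E]
    [TopologicalSpace H] {I : ModelWithCorners ℝ E H} [I.Boundaryless]
    {F N : Type*} [NormedAddCommGroup F] [NormedSpace ℝ F] [FiniteDimensional ℝ F]
    [TopologicalSpace N] {J : ModelWithCorners ℝ F N} [J.Boundaryless]
    {G : Type*} [TopologicalSpace G] [T2Space G] [ChartedSpace H G] [IsManifold I ∞ G]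
    {M : Type*} [TopologicalSpace M] [T2Space M] [CompactSpace M] [ChartedSpace N M]
    [IsManifold J ∞ M]
    (𝒢 : LieGroupoid I G J M) (p₀ : CotangentBundle I G → ℝ) (hp₀ : 𝒢.IsEllipticSymbol p₀) :
    𝒢.dualAlgebroidNonzero ⊆ 𝒢.rRegular ∧
    (∃! χ : ℝ → 𝒢.rRegular → 𝒢.rRegular,
      IsHamiltonianFlow I (p₀ ∘ 𝒢.rΓ) 𝒢.rRegular χ) ∧
    ∀ χ : ℝ → 𝒢.rRegular → 𝒢.rRegular,
      IsHamiltonianFlow I (p₀ ∘ 𝒢.rΓ) 𝒢.rRegular χ →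
    ∀ Λ : Set (CotangentBundle (𝓘(ℝ, ℝ).prod I) (ℝ × G)),
      Λ = 𝒢.gluedFlowOut (p₀ ∘ 𝒢.rΓ) χ →
      IsConicLagrangian (𝓘(ℝ, ℝ).prod I) Λ ∧
      (∀ t : ℝ, pullback I (𝓘(ℝ, ℝ).prod I) (fun γ : G => (t, γ)) Λ = 𝒢.flowOut χ t) ∧
      Λ ⊆ {l | ∃ t τ : ℝ, τ ≠ 0 ∧ ∃ l' ∈ 𝒢.biregular, l = prodCovector I t τ l'} ∧
      (∃ C : Set (CotangentBundle (𝓘(ℝ, ℝ).prod I) (ℝ × G)), IsClosed C ∧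
        Λ = C ∩ {l | ∃ t τ : ℝ, ∃ l' ∈ 𝒢.rRegular, l = prodCovector I t τ l'}) ∧
      𝒢.constFamily.IsInvertibleRelation Λ ∧
      𝒢.prodReal.IsFamilyRelation Λ ∧
      IsRealProper (support (𝓘(ℝ, ℝ).prod I) Λ) := by
  refine ⟨𝒢.dualAlgebroidNonzero_subset, hp₀.existsUnique_flow, fun χ hχ Λ hΛ => ?_⟩
  subst hΛ
  refine ⟨LieGroupoid.isConicLagrangian_gluedFlowOut hp₀ hχ,
    LieGroupoid.pullback_gluedFlowOut hp₀ hχ, fun L hL => ?_, ?_,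
    LieGroupoid.isInvertibleRelation_gluedFlowOut hp₀ hχ,
    LieGroupoid.isFamilyRelation_gluedFlowOut hp₀ hχ,
    LieGroupoid.isRealProper_support_gluedFlowOut hp₀ hχ⟩
  · obtain ⟨t, l, hl, rfl⟩ := LieGroupoid.mem_gluedFlowOut hp₀ hχ hL
    exact ⟨t, _, hp₀.rΓ_ne_zero hl, _, LieGroupoid.flowMap_mem_biregular hp₀ hχ t hl, rfl⟩
  · rw [← LieGroupoid.rRegularProd_eq]
    exact LieGroupoid.exists_isClosed_gluedFlowOut hp₀ hχ
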